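/- Let $k$ be an algebraically closed field of characteristic $p>0$, $X$ a smooth $k$-scheme and $\mathcal L$ a line bundle on $X$. **Notation.** $D$ denotes crystalline differential operators (the universal enveloping algebra of the Lie algebroid of vector fields), filtered by order. Let $\pi:\tilde X\to X$ be the principal $\mathbb G_m$-bundle of $\mathcal L$ (the total space of $\mathcal L$ minus the zero section), $\mathrm{Eu}$ its Euler vector field, and $D_\hbar(\tilde X)=\bigoplus_{n\ge0}D^{\le n}(\tilde X)$, with $\hbar=1\in D^{\le1}$ and with $\hat\xi\in D^{\le 1}$ the element of degree one given by a vector field $\xi$. Put $$D_{c,\hbar,\mathcal L}=(\pi_*D_\hbar(\tilde X))^{\mathbb G_m},\qquad c=\widehat{\mathrm{Eu}},$$ a sheaf on $X$ of graded $k[c,\hbar]$-algebras with $\deg c=\deg\hbar=1$; for $c_0,\hbar_0\in k$ let $D_{c,\hbar,\mathcal L}[c_0,\hbar_0]$ be its specialization $c\mapsto c_0$, $\hbar\mapsto\hbar_0$. The action of $\mathbb G_m$ given by the grading induces isomorphisms $D_{c,\hbar,\mathcal L}[c_0,\hbar_0]\cong D_{c,\hbar,\mathcal L}[\lambda c_0,\lambda\hbar_0]$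 for $\lambda\in k^\times$. For a function $\mu$ on a base, $\mathrm{Conn}_\mu(\mathcal L^{(1)})$ is the affine bundle whose sections are the $\mu$-connections on the Frobenius twist $\mathcal L^{(1)}$ over $X^{(1)}$, i.e. maps $\nabla$ with $\nabla(fs)=f\nabla s+\mu\,df\otimes s$. Let $Z=\mathrm{Conn}_{c^p-c\hbar^{p-1}}(\mathcal L^{(1)})$, a scheme over $X^{(1)}\times\mathrm{Spec}\,k[c,\hbar]$, and let $Z_{c_0,\hbar_0}$ be its fibre over $(c_0,\hbar_0)$. We identify the topological spaces of $X$ and $X^{(1)}$ and write $\mathcal O_Z$, $\mathcal O_{Z_{c_0,\hbar_0}}$ also for the direct images on $X$. For $c\in k$, $D_{\mathcal L^c}$ is the sheaf of algebras glued from the algebras $D(U)$, one for each local trivialization $\varphi:\mathcal L|_U\cong\mathcal O_U$, by the isomorphisms $f\mapsto f$, $\xi\mapsto\xi+c\,\xi(h)/h$ from the copy of $\varphi$ to that of $\varphi'$, where $h=\varphi'\circ\varphi^{-1}$. **Theorem.** 1. The center of $D_{c,\hbar,\mathcal L}$ is canonically isomorphic to $\mathcal O_Z$ as a sheaf of $k[c,\hbar]$-algebras.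 The isomorphism $\mathcal O_Z\to Z(D_{c,\hbar,\mathcal L})$ sends $f^{(1)}$ to $f^p$ for a function $f$ on $X$. If $\xi$ is a vector field on $X$ and $a$ is a $\mathbb G_m$-invariant vector field on $\tilde X$ lifting $\xi$, then for local sections $\ell$ of $\mathcal L$ and $\nu$ of $\mathcal L^\vee$ it sends the function $\nabla\mapsto\langle\xi^{(1)}\otimes\nu^{(1)},\nabla\ell^{(1)}\rangle$ on $Z$ to $$\nu(\ell)^p\bigl(\hat a^p-\hbar^{p-1}\widehat{a^{[p]}}\bigr)+(c^p-c\hbar^{p-1})\,(\nu\cdot a(\ell))^p .$$ Here $\nu$ is regarded as the fibrewise linear function on $\tilde X$, and $\ell$ as the function $v\mapsto\ell/v$ of degree $-1$. 2. For all $c_0,\hbar_0\in k$ the specialization $c\mapsto c_0$, $\hbar\mapsto\hbar_0$ induces a map $\mathcal O_{Z_{c_0,\hbar_0}}\to Z(D_{c,\hbar,\mathcal L}[c_0,\hbar_0])$. If $\hbar_0\ne0$, this map is an isomorphism and $D_{c,\hbar,\mathcal L}[c_0,\hbar_0]$ is (the direct image of) an Azumaya algebra over $Z_{c_0,\hbar_0}$.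 If $\dim X>0$, the map is an isomorphism only if $\hbar_0\ne0$. 3. The isomorphism of part 1 and the induced maps of part 2 are compatible with the $\mathbb G_m$-action on $D_{c,\hbar,\mathcal L}$ given by the grading, respectively with the isomorphisms $D_{c,\hbar,\mathcal L}[c_0,\hbar_0]\cong D_{c,\hbar,\mathcal L}[\lambda c_0,\lambda\hbar_0]$, and with the action of $\lambda\in\mathbb G_m$ on $Z$ by $(c,\hbar,\nabla)\mapsto(\lambda c,\lambda\hbar,\lambda^p\nabla)$. 4. In particular, for every $c\in k$ the center of $D_{\mathcal L^c}$ is canonically isomorphic to the direct image of the structure sheaf of $\mathrm{Conn}_{c^p-c}(\mathcal L^{(1)})$, and $D_{\mathcal L^c}$ is the direct image of an Azumaya algebra on $\mathrm{Conn}_{c^p-c}(\mathcal L^{(1)})$. In a trivialization of $\mathcal L$ with frame $s$ the isomorphism sends $f^{(1)}$ to $f^p$ and $\langle\xi^{(1)}\otimes\nu^{(1)},\nabla s^{(1)}\rangle$ to $\nu(s)^p(\xi^p-\xi^{[p]})$. -/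

import Mathlib

open CategoryTheory AlgebraicGeometry TensorProduct

universe u

noncomputable section

namespace TDO

/-! ## Derivations in characteristic `p` -/

section Derivations

variable {k : Type u} [Field k] {R : Type u} [CommRing R] [Algebra k R]

/-- Conjugation of a vector field by an automorphism. -/
def conjDer (σ : R ≃ₐ[k] R) (ξ : Derivation k R R) : Derivation k R R :=
  Derivation.mk' (σ.toLinearMap ∘ₗ (ξ : R →ₗ[k] R) ∘ₗ σ.symm.toLinearMap) (by
    intro a b
    simp [Derivation.leibniz])

@[simp] lemma conjDer_apply (σ : R ≃ₐ[k] R) (ξ : Derivation k R R) (f : R) :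
    conjDer σ ξ f = σ (ξ (σ.symm f)) := rfl

/-- The restricted power `ξ^{[p]}` of a vector field `ξ` in characteristic `p`: the derivation
`f ↦ ξ(ξ(⋯ξ(f)))` (`p` times). -/
def pPow (p : ℕ) [Fact p.Prime] [CharP k p] (ξ : Derivation k R R) : Derivation k R R :=
  Derivation.mk' ((ξ : R →ₗ[k] R) ^ p) (by
    intro a b
    let D : Module.End k R := (ξ : R →ₗ[k] R)
    let E₁ : Module.End k (R ⊗[k] R) := LinearMap.rTensor R D
    let E₂ : Module.End k (R ⊗[k] R) := LinearMap.lTensor R D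
    have hD : ∀ f, D f = ξ f := fun _ => rfl
    have hcomm : Commute E₁ E₂ := by
      refine TensorProduct.ext' fun x y => ?_
      simp [E₁, E₂, Module.End.mul_apply]
    have hmul : LinearMap.mul' k R ∘ₗ (E₁ + E₂) = D ∘ₗ LinearMap.mul' k R := by
      refine TensorProduct.ext' fun x y => ?_
      simp only [LinearMap.comp_apply, LinearMap.add_apply, map_add, E₁, E₂,
        LinearMap.rTensor_tmul, LinearMap.lTensor_tmul, LinearMap.mul'_apply, hD,
        Derivation.leibniz, smul_eq_mul]
      ring
    have hpow : ∀ n : ℕ, LinearMap.mul' k R ∘ₗ ((E₁ + E₂) ^ n) = (D ^ n) ∘ₗ LinearMap.mul' k R := by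
      intro n
      induction n with
      | zero => ext; simp
      | succ n ih =>
        rw [pow_succ, pow_succ, Module.End.mul_eq_comp, Module.End.mul_eq_comp,
          ← LinearMap.comp_assoc, ih, LinearMap.comp_assoc, hmul, LinearMap.comp_assoc]
    have : CharP (Module.End k (R ⊗[k] R)) p ∨ Subsingleton (R ⊗[k] R) := by
      rcases subsingleton_or_nontrivial (R ⊗[k] R) with h | h
      · exact Or.inr h
      · exact Or.inl (charP_of_injective_algebraMap
          (algebraMap k (Module.End k (R ⊗[k] R))).injective p)
    have hadd : (E₁ + E₂) ^ p = E₁ ^ p + E₂ ^ p := by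
      rcases this with h | h
      · exact add_pow_char_of_commute p hcomm
      · exact LinearMap.ext fun x => Subsingleton.elim _ _
    have h1 : ∀ n : ℕ, (E₁ ^ n) (a ⊗ₜ[k] b) = ((D ^ n) a) ⊗ₜ b := by
      intro n
      rw [show E₁ ^ n = LinearMap.rTensor R (D ^ n) from by simp [E₁]]
      simp
    have h2 : ∀ n : ℕ, (E₂ ^ n) (a ⊗ₜ[k] b) = a ⊗ₜ ((D ^ n) b) := by
      intro n
      rw [show E₂ ^ n = LinearMap.lTensor R (D ^ n) from by simp [E₂]]
      simp
    have key := LinearMap.congr_fun (hpow p) (a ⊗ₜ[k] b)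
    rw [hadd] at key
    simp only [LinearMap.comp_apply, LinearMap.add_apply, h1, h2, map_add,
      LinearMap.mul'_apply] at key
    simp only [smul_eq_mul]
    change (D ^ p) (a * b) = a * (D ^ p) b + b * (D ^ p) a
    rw [← key]; ring)

lemma pPow_apply (p : ℕ) [Fact p.Prime] [CharP k p] (ξ : Derivation k R R) (f : R) :
    pPow p ξ f = (⇑ξ)^[p] f := by
  change ((ξ : R →ₗ[k] R) ^ p) f = _
  rw [Module.End.pow_apply]
  rfl

end Derivations

/-! ## Crystalline differential operators -/

section Crystalline

variable (k : Type u) [Field k] (R : Type u) [CommRing R] [Algebra k R]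

/-- The relations of the universal enveloping algebra of the Lie algebroid of vector fields. -/
inductive CrysRel : FreeAlgebra k (R ⊕ Derivation k R R) →
    FreeAlgebra k (R ⊕ Derivation k R R) → Prop
  | fn_add (f g : R) : CrysRel (FreeAlgebra.ι k (Sum.inl (f + g)))
      (FreeAlgebra.ι k (Sum.inl f) + FreeAlgebra.ι k (Sum.inl g))
  | fn_mul (f g : R) : CrysRel (FreeAlgebra.ι k (Sum.inl (f * g)))
      (FreeAlgebra.ι k (Sum.inl f) * FreeAlgebra.ι k (Sum.inl g))
  | fn_const (a : k) : CrysRel (FreeAlgebra.ι k (Sum.inl (algebraMap k R a)))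
      (algebraMap k (FreeAlgebra k (R ⊕ Derivation k R R)) a)
  | vf_add (ξ η : Derivation k R R) : CrysRel (FreeAlgebra.ι k (Sum.inr (ξ + η)))
      (FreeAlgebra.ι k (Sum.inr ξ) + FreeAlgebra.ι k (Sum.inr η))
  | vf_smul (f : R) (ξ : Derivation k R R) : CrysRel (FreeAlgebra.ι k (Sum.inr (f • ξ)))
      (FreeAlgebra.ι k (Sum.inl f) * FreeAlgebra.ι k (Sum.inr ξ))
  | vf_fn (ξ : Derivation k R R) (f : R) :
      CrysRel (FreeAlgebra.ι k (Sum.inr ξ) * FreeAlgebra.ι k (Sum.inl f))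
        (FreeAlgebra.ι k (Sum.inl f) * FreeAlgebra.ι k (Sum.inr ξ)
          + FreeAlgebra.ι k (Sum.inl (ξ f)))
  | vf_vf (ξ η : Derivation k R R) :
      CrysRel (FreeAlgebra.ι k (Sum.inr ξ) * FreeAlgebra.ι k (Sum.inr η))
        (FreeAlgebra.ι k (Sum.inr η) * FreeAlgebra.ι k (Sum.inr ξ)
          + FreeAlgebra.ι k (Sum.inr ⁅ξ, η⁆))

/-- The algebra `D(Spec R)` of crystalline differential operators (without divided powers): the
universal enveloping algebra of the Lie algebroid of `k`-derivations of `R`. -/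
def CrysDiff : Type u := RingQuot (CrysRel k R)

instance : Ring (CrysDiff k R) := inferInstanceAs (Ring (RingQuot (CrysRel k R)))
instance : Algebra k (CrysDiff k R) := inferInstanceAs (Algebra k (RingQuot (CrysRel k R)))

namespace CrysDiff

/-- The quotient map from the free algebra. -/
def mk : FreeAlgebra k (R ⊕ Derivation k R R) →ₐ[k] CrysDiff k R :=
  RingQuot.mkAlgHom k (CrysRel k R)

variable {k R} in
lemma mk_rel {x y : FreeAlgebra k (R ⊕ Derivation k R R)} (h : CrysRel k R x y) :
    mk k R x = mk k R y := RingQuot.mkAlgHom_rel k h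

/-- A function as a differential operator of order `0`. -/
def fn : R →ₐ[k] CrysDiff k R where
  toFun f := mk k R (FreeAlgebra.ι k (Sum.inl f))
  map_one' := by
    have := mk_rel (CrysRel.fn_const (R := R) (1 : k))
    rwa [map_one, map_one, map_one] at this
  map_mul' f g := by
    have := mk_rel (CrysRel.fn_mul (k := k) f g)
    rwa [map_mul] at this
  map_zero' := by
    have := mk_rel (CrysRel.fn_const (R := R) (0 : k))
    rwa [map_zero, map_zero, map_zero] at this
  map_add' f g := by
    have := mk_rel (CrysRel.fn_add (k := k) f g)
    rwa [map_add] at this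
  commutes' a := by
    have := mk_rel (CrysRel.fn_const (R := R) a)
    rwa [AlgHom.commutes] at this

/-- A vector field as a differential operator of order `1`. -/
def vf : Derivation k R R →ₗ[k] CrysDiff k R where
  toFun ξ := mk k R (FreeAlgebra.ι k (Sum.inr ξ))
  map_add' ξ η := by
    have := mk_rel (CrysRel.vf_add ξ η)
    rwa [map_add] at this
  map_smul' a ξ := by
    have := mk_rel (CrysRel.vf_smul (algebraMap k R a) ξ)
    rw [map_mul, mk_rel (CrysRel.fn_const (R := R) a), AlgHom.commutes,
      algebraMap_smul] at this
    rw [RingHom.id_apply, Algebra.smul_def]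
    exact this

lemma vf_smul (f : R) (ξ : Derivation k R R) : vf k R (f • ξ) = fn k R f * vf k R ξ := by
  have := mk_rel (CrysRel.vf_smul f ξ)
  rwa [map_mul] at this

lemma vf_mul_fn (ξ : Derivation k R R) (f : R) :
    vf k R ξ * fn k R f = fn k R f * vf k R ξ + fn k R (ξ f) := by
  have := mk_rel (CrysRel.vf_fn ξ f)
  rwa [map_add, map_mul, map_mul] at this

lemma vf_mul_vf (ξ η : Derivation k R R) :
    vf k R ξ * vf k R η = vf k R η * vf k R ξ + vf k R ⁅ξ, η⁆ := by
  have := mk_rel (CrysRel.vf_vf ξ η)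
  rwa [map_add, map_mul, map_mul] at this

variable {k R} in
/-- The universal property of the enveloping algebra. -/
def lift {A : Type u} [Ring A] [Algebra k A] (F : R →ₐ[k] A) (G : Derivation k R R →+ A)
    (h₁ : ∀ f ξ, G (f • ξ) = F f * G ξ) (h₂ : ∀ ξ f, G ξ * F f = F f * G ξ + F (ξ f))
    (h₃ : ∀ ξ η, G ξ * G η = G η * G ξ + G ⁅ξ, η⁆) : CrysDiff k R →ₐ[k] A :=
  RingQuot.liftAlgHom k ⟨FreeAlgebra.lift k (Sum.elim F G), by
    intro x y h
    cases h with
    | fn_add f g => simp only [FreeAlgebra.lift_ι_apply, Sum.elim_inl, map_add]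
    | fn_mul f g => simp only [FreeAlgebra.lift_ι_apply, Sum.elim_inl, map_mul]
    | fn_const a => simp only [FreeAlgebra.lift_ι_apply, Sum.elim_inl, AlgHom.commutes]
    | vf_add ξ η => simp only [FreeAlgebra.lift_ι_apply, Sum.elim_inr, map_add]
    | vf_smul f ξ => simp only [FreeAlgebra.lift_ι_apply, Sum.elim_inr, Sum.elim_inl, map_mul, h₁]
    | vf_fn ξ f =>
      simp only [FreeAlgebra.lift_ι_apply, Sum.elim_inr, Sum.elim_inl, map_mul, map_add, h₂]
    | vf_vf ξ η =>
      simp only [FreeAlgebra.lift_ι_apply, Sum.elim_inr, map_mul, map_add]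
      exact h₃ ξ η⟩

variable {k R} in
@[simp] lemma lift_fn {A : Type u} [Ring A] [Algebra k A] (F : R →ₐ[k] A)
    (G : Derivation k R R →+ A) (h₁ h₂ h₃) (f : R) :
    lift F G h₁ h₂ h₃ (fn k R f) = F f := by
  refine (RingQuot.liftAlgHom_mkAlgHom_apply k _ _ _).trans ?_
  simp only [FreeAlgebra.lift_ι_apply, Sum.elim_inl]

variable {k R} in
@[simp] lemma lift_vf {A : Type u} [Ring A] [Algebra k A] (F : R →ₐ[k] A)
    (G : Derivation k R R →+ A) (h₁ h₂ h₃) (ξ : Derivation k R R) :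
    lift F G h₁ h₂ h₃ (vf k R ξ) = G ξ := by
  refine (RingQuot.liftAlgHom_mkAlgHom_apply k _ _ _).trans ?_
  simp only [FreeAlgebra.lift_ι_apply, Sum.elim_inr]

/-- The operators of order at most `n`: combinations of products of functions and at most `n`
vector fields. -/
def order (n : ℕ) : Submodule k (CrysDiff k R) :=
  LinearMap.range (fn k R).toLinearMap *
    (LinearMap.range (fn k R).toLinearMap ⊔ LinearMap.range (vf k R)) ^ n

variable {k R} in
/-- An automorphism of `Spec R` acts on differential operators: functions and vector fields are
transported. -/
def map (σ : R ≃ₐ[k] R) : CrysDiff k R →ₐ[k] CrysDiff k R :=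
  lift ((fn k R).comp (σ : R →ₐ[k] R))
    { toFun := fun ξ => vf k R (conjDer σ ξ)
      map_zero' := by
        rw [show conjDer σ (0 : Derivation k R R) = 0 by ext; simp, map_zero]
      map_add' := fun ξ η => by
        rw [show conjDer σ (ξ + η) = conjDer σ ξ + conjDer σ η by ext; simp, map_add] }
    (fun f ξ => by
      have : conjDer σ (f • ξ) = σ f • conjDer σ ξ := by ext; simp
      simp [this, vf_smul])
    (fun ξ f => by
      have := vf_mul_fn k R (conjDer σ ξ) (σ f)
      simpa using this)
    (fun ξ η => by
      have : conjDer σ ⁅ξ, η⁆ = ⁅conjDer σ ξ, conjDer σ η⁆ := by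
        ext; simp [Derivation.commutator_apply]
      simpa [this] using vf_mul_vf k R (conjDer σ ξ) (conjDer σ η))

variable {k R} in
@[simp] lemma map_fn (σ : R ≃ₐ[k] R) (f : R) : map σ (fn k R f) = fn k R (σ f) :=
  lift_fn _ _ _ _ _ f

variable {k R} in
@[simp] lemma map_vf (σ : R ≃ₐ[k] R) (ξ : Derivation k R R) :
    map σ (vf k R ξ) = vf k R (conjDer σ ξ) :=
  lift_vf _ _ _ _ _ ξ

lemma one_mem_fn : (1 : CrysDiff k R) ∈ LinearMap.range (fn k R).toLinearMap :=
  ⟨1, by simp⟩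

lemma pow_mul_fn_le (n : ℕ) :
    (LinearMap.range (fn k R).toLinearMap ⊔ LinearMap.range (vf k R)) ^ n *
      LinearMap.range (fn k R).toLinearMap ≤ order k R n := by
  set F := LinearMap.range (fn k R).toLinearMap with hF
  set M := F ⊔ LinearMap.range (vf k R) with hM
  have hFF : F * F ≤ F := by
    rw [Submodule.mul_le]
    rintro _ ⟨a, rfl⟩ _ ⟨b, rfl⟩
    exact ⟨a * b, by simp⟩
  have hMF : M * F ≤ F * M := by
    rw [hM, Submodule.sup_mul, sup_le_iff]
    constructor
    · exact mul_le_mul' le_rfl le_sup_left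
    · rw [Submodule.mul_le]
      rintro _ ⟨ξ, rfl⟩ _ ⟨f, rfl⟩
      change vf k R ξ * fn k R f ∈ _
      rw [vf_mul_fn]
      refine add_mem ?_ ?_
      · exact Submodule.mul_mem_mul ⟨f, rfl⟩ (Submodule.mem_sup_right ⟨ξ, rfl⟩)
      · rw [← mul_one (fn k R (ξ f))]
        exact Submodule.mul_mem_mul ⟨ξ f, rfl⟩ (Submodule.mem_sup_left (one_mem_fn k R))
  change M ^ n * F ≤ F * M ^ n
  induction n with
  | zero => simp
  | succ n ih =>
    calc M ^ (n + 1) * F = M ^ n * (M * F) := by rw [pow_succ, mul_assoc]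
      _ ≤ M ^ n * (F * M) := mul_le_mul' le_rfl hMF
      _ = (M ^ n * F) * M := by rw [mul_assoc]
      _ ≤ (F * M ^ n) * M := mul_le_mul' ih le_rfl
      _ = F * M ^ (n + 1) := by rw [pow_succ, mul_assoc]

lemma order_mul_le (m n : ℕ) : order k R m * order k R n ≤ order k R (m + n) := by
  have h := pow_mul_fn_le k R m
  unfold order at *
  set F := LinearMap.range (fn k R).toLinearMap with hF
  set M := F ⊔ LinearMap.range (vf k R) with hM
  have hFF : F * F ≤ F := by
    rw [Submodule.mul_le]
    rintro _ ⟨a, rfl⟩ _ ⟨b, rfl⟩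
    exact ⟨a * b, by simp⟩
  calc F * M ^ m * (F * M ^ n) = F * (M ^ m * F) * M ^ n := by simp only [mul_assoc]
    _ ≤ F * (F * M ^ m) * M ^ n := mul_le_mul' (mul_le_mul' le_rfl h) le_rfl
    _ = (F * F) * M ^ (m + n) := by rw [pow_add]; simp only [mul_assoc]
    _ ≤ F * M ^ (m + n) := mul_le_mul' hFF le_rfl

lemma order_mono_one : (1 : CrysDiff k R) ∈ order k R 0 := by
  unfold order
  rw [pow_zero, mul_one]
  exact one_mem_fn k R

lemma one_mem_order (n : ℕ) : (1 : CrysDiff k R) ∈ order k R n := by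
  unfold order
  rw [show (1 : CrysDiff k R) = 1 * 1 ^ n by simp]
  exact Submodule.mul_mem_mul (one_mem_fn k R)
    (Submodule.pow_mem_pow _ (Submodule.mem_sup_left (one_mem_fn k R)) n)

lemma fn_mem_order (f : R) : fn k R f ∈ order k R 0 := by
  unfold order
  rw [pow_zero, mul_one]
  exact ⟨f, rfl⟩

lemma vf_mem_order (ξ : Derivation k R R) : vf k R ξ ∈ order k R 1 := by
  unfold order
  rw [pow_one, ← one_mul (vf k R ξ)]
  exact Submodule.mul_mem_mul (one_mem_fn k R) (Submodule.mem_sup_right ⟨ξ, rfl⟩)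

/-- The algebra `D_ℏ = ⨁ₙ D^{≤n}` of differential operators with parameter, realized as the
subalgebra of `D[ℏ]` of polynomials whose coefficient of `ℏⁿ` lies in `D^{≤n}`; the variable `ℏ`
is `1 ∈ D^{≤1}` in degree one. -/
def rees : Subalgebra k (Polynomial (CrysDiff k R)) where
  carrier := {q | ∀ n, q.coeff n ∈ order k R n}
  mul_mem' {a b} ha hb n := by
    rw [Polynomial.coeff_mul]
    refine Submodule.sum_mem _ fun x hx => ?_
    rw [← Finset.HasAntidiagonal.mem_antidiagonal.mp hx]
    exact order_mul_le k R _ _ (Submodule.mul_mem_mul (ha _) (hb _))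
  add_mem' {a b} ha hb n := by
    rw [Polynomial.coeff_add]
    exact add_mem (ha n) (hb n)
  algebraMap_mem' r n := by
    rw [Polynomial.algebraMap_apply, Polynomial.coeff_C]
    split_ifs with h
    · subst h
      rw [Algebra.algebraMap_eq_smul_one]
      exact Submodule.smul_mem _ _ (order_mono_one k R)
    · exact zero_mem _

end CrysDiff

end Crystalline

/-! ## The principal bundle of a line bundle over an affine base -/

section Torsor

variable (R : Type u) [CommRing R] (L : Type u) [AddCommGroup L] [Module R L]

/-- The relations `ℓ · ν = ν(ℓ)` between `ℓ ∈ L` and `ν` in the dual of `L`. -/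
def torsorIdeal : Ideal (SymmetricAlgebra R (L × Module.Dual R L)) :=
  Ideal.span {x | ∃ (l : L) (ν : Module.Dual R L),
    x = SymmetricAlgebra.ι R _ (l, 0) * SymmetricAlgebra.ι R _ (0, ν)
      - algebraMap R _ (ν l)}

/-- The ring of functions on the principal `𝔾ₘ`-bundle `X̃` of an invertible module `L` over
`X = Spec R`, i.e. on the total space of `L` minus its zero section.  An element `ν` of the dual
module is a function linear on the fibres; an element `ℓ` of `L` gives the function
`v ↦ ℓ / v`, homogeneous of degree `-1`. -/
def TorsorRing : Type u := SymmetricAlgebra R (L × Module.Dual R L) ⧸ torsorIdeal R L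

namespace TorsorRing

instance : CommRing (TorsorRing R L) :=
  inferInstanceAs (CommRing (SymmetricAlgebra R (L × Module.Dual R L) ⧸ torsorIdeal R L))
instance : Algebra R (TorsorRing R L) :=
  inferInstanceAs (Algebra R (SymmetricAlgebra R (L × Module.Dual R L) ⧸ torsorIdeal R L))

/-- The function `v ↦ ℓ / v`. -/
def sec : L →ₗ[R] TorsorRing R L :=
  (Ideal.Quotient.mkₐ R (torsorIdeal R L)).toLinearMap ∘ₗ SymmetricAlgebra.ι R _ ∘ₗ
    LinearMap.inl R L (Module.Dual R L)

/-- The function `v ↦ ν(v)`. -/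
def cosec : Module.Dual R L →ₗ[R] TorsorRing R L :=
  (Ideal.Quotient.mkₐ R (torsorIdeal R L)).toLinearMap ∘ₗ SymmetricAlgebra.ι R _ ∘ₗ
    LinearMap.inr R L (Module.Dual R L)

lemma sec_mul_cosec (l : L) (ν : Module.Dual R L) :
    sec R L l * cosec R L ν = algebraMap R _ (ν l) := by
  have : (Ideal.Quotient.mk (torsorIdeal R L))
      (SymmetricAlgebra.ι R _ (l, 0) * SymmetricAlgebra.ι R _ (0, ν)) =
      (Ideal.Quotient.mk (torsorIdeal R L)) (algebraMap R _ (ν l)) :=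
    Ideal.Quotient.eq.mpr (Ideal.subset_span ⟨l, ν, rfl⟩)
  exact this

variable {R L}

/-- The universal property of the ring of functions on the principal bundle. -/
def lift {T : Type u} [CommRing T] [Algebra R T] (a : L →ₗ[R] T) (b : Module.Dual R L →ₗ[R] T)
    (h : ∀ l ν, a l * b ν = algebraMap R T (ν l)) : TorsorRing R L →ₐ[R] T :=
  Ideal.Quotient.liftₐ (torsorIdeal R L) (SymmetricAlgebra.lift (LinearMap.coprod a b)) (by
    intro x hx
    have : torsorIdeal R L ≤ RingHom.ker (SymmetricAlgebra.lift (LinearMap.coprod a b)) := by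
      refine Ideal.span_le.mpr ?_
      rintro _ ⟨l, ν, rfl⟩
      simp [RingHom.mem_ker, h]
    exact this hx)

section
variable {T : Type u} [CommRing T] [Algebra R T]

@[simp] lemma lift_sec (a : L →ₗ[R] T) (b : Module.Dual R L →ₗ[R] T) (h) (l : L) :
    lift a b h (sec R L l) = a l := by
  have : lift a b h (Ideal.Quotient.mk _ (SymmetricAlgebra.ι R _ (l, 0))) = a l := by
    unfold lift
    erw [Ideal.Quotient.lift_mk]
    simp
  exact this

@[simp] lemma lift_cosec (a : L →ₗ[R] T) (b : Module.Dual R L →ₗ[R] T) (h)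
    (ν : Module.Dual R L) : lift a b h (cosec R L ν) = b ν := by
  have : lift a b h (Ideal.Quotient.mk _ (SymmetricAlgebra.ι R _ (0, ν))) = b ν := by
    unfold lift
    erw [Ideal.Quotient.lift_mk]
    simp
  exact this

lemma algHom_ext {f g : TorsorRing R L →ₐ[R] T} (h₁ : ∀ l, f (sec R L l) = g (sec R L l))
    (h₂ : ∀ ν, f (cosec R L ν) = g (cosec R L ν)) : f = g := by
  have : f.comp (Ideal.Quotient.mkₐ R (torsorIdeal R L)) =
      g.comp (Ideal.Quotient.mkₐ R (torsorIdeal R L)) := by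
    apply SymmetricAlgebra.algHom_ext
    refine LinearMap.prod_ext (LinearMap.ext fun l => h₁ l) (LinearMap.ext fun ν => h₂ ν)
  refine AlgHom.ext fun x => ?_
  obtain ⟨y, rfl⟩ := Ideal.Quotient.mk_surjective x
  exact AlgHom.congr_fun this y

end

/-- The action of `𝔾ₘ` on functions on the principal bundle: the pullback under `v ↦ t v`
multiplies fibrewise linear functions by `t`. -/
def twist (t : Rˣ) : TorsorRing R L →ₐ[R] TorsorRing R L :=
  lift ((↑t⁻¹ : R) • sec R L) ((t : R) • cosec R L) (by
    intro l ν
    simp only [LinearMap.smul_apply, smul_mul_smul_comm, sec_mul_cosec]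
    simp)

lemma twist_mul (t s : Rˣ) : (twist t).comp (twist s) = twist (L := L) (t * s) := by
  apply algHom_ext <;> intro x <;> simp [twist, smul_smul, mul_comm]

lemma twist_one : twist (1 : Rˣ) = AlgHom.id R (TorsorRing R L) := by
  apply algHom_ext <;> intro x <;> simp [twist]

/-- First-order part of the action of `1 + ε`. -/
def twistEps : TorsorRing R L →ₐ[R] TrivSqZeroExt (TorsorRing R L) (TorsorRing R L) :=
  lift ((TrivSqZeroExt.inlAlgHom R (TorsorRing R L) (TorsorRing R L)).toLinearMap ∘ₗ sec R L
        - (TrivSqZeroExt.inrHom (TorsorRing R L) (TorsorRing R L)).restrictScalars R ∘ₗ sec R L)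
    ((TrivSqZeroExt.inlAlgHom R (TorsorRing R L) (TorsorRing R L)).toLinearMap ∘ₗ cosec R L
        + (TrivSqZeroExt.inrHom (TorsorRing R L) (TorsorRing R L)).restrictScalars R ∘ₗ
          cosec R L) (by
    intro l ν
    have h := sec_mul_cosec R L l ν
    ext
    · simpa [TrivSqZeroExt.algebraMap_eq_inl'] using h
    · simp [TrivSqZeroExt.algebraMap_eq_inl', mul_comm])

lemma fst_twistEps (f : TorsorRing R L) : (twistEps f).fst = f := by
  have : (TrivSqZeroExt.fstHom R (TorsorRing R L) (TorsorRing R L)).comp twistEps =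
      AlgHom.id R (TorsorRing R L) := by
    apply algHom_ext <;> intro x <;> simp [twistEps]
  exact AlgHom.congr_fun this f

variable {k : Type u} [Field k] [Algebra k R]

instance : Algebra k (TorsorRing R L) := ((algebraMap R (TorsorRing R L)).comp (algebraMap k R)).toAlgebra

instance : IsScalarTower k R (TorsorRing R L) := IsScalarTower.of_algebraMap_eq fun _ => rfl

variable (k)

/-- The automorphism of the principal bundle given by a point `t` of `𝔾ₘ`. -/
def act (t : kˣ) : TorsorRing R L ≃ₐ[k] TorsorRing R L :=
  AlgEquiv.ofAlgHom ((twist (Units.map (algebraMap k R).toMonoidHom t)).restrictScalars k)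
    ((twist (Units.map (algebraMap k R).toMonoidHom t⁻¹)).restrictScalars k)
    (by
      ext x
      change ((twist _).comp (twist _)) x = x
      rw [twist_mul, ← map_mul, mul_inv_cancel, map_one, twist_one]; rfl)
    (by
      ext x
      change ((twist _).comp (twist _)) x = x
      rw [twist_mul, ← map_mul, inv_mul_cancel, map_one, twist_one]; rfl)

variable (R L)

/-- The Euler vector field on the principal bundle: the differential of the `𝔾ₘ`-action. -/
def euler : Derivation k (TorsorRing R L) (TorsorRing R L) :=
  Derivation.mk'
    { toFun := fun f => (twistEps f).snd
      map_add' := by simp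
      map_smul' := fun a f => by
        have : a • f = (algebraMap k R a) • f := (algebraMap_smul R a f).symm
        rw [this, map_smul, TrivSqZeroExt.snd_smul, algebraMap_smul]; rfl }
    (fun a b => by simp [fst_twistEps, mul_comm])

@[simp] lemma euler_sec (l : L) : euler R L k (sec R L l) = - sec R L l := by
  change (twistEps (sec R L l)).snd = _
  simp [twistEps]

@[simp] lemma euler_cosec (ν : Module.Dual R L) : euler R L k (cosec R L ν) = cosec R L ν := by
  change (twistEps (cosec R L ν)).snd = _
  simp [twistEps]

@[simp] lemma euler_algebraMap (r : R) : euler R L k (algebraMap R _ r) = 0 := by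
  change (twistEps (algebraMap R _ r)).snd = _
  rw [AlgHom.commutes]
  simp [TrivSqZeroExt.algebraMap_eq_inl']

lemma induction {motive : TorsorRing R L → Prop} (base : ∀ r, motive (algebraMap R _ r))
    (sec' : ∀ l, motive (sec R L l)) (cosec' : ∀ ν, motive (cosec R L ν))
    (mul : ∀ a b, motive a → motive b → motive (a * b))
    (add : ∀ a b, motive a → motive b → motive (a + b)) (a : TorsorRing R L) : motive a := by
  obtain ⟨y, rfl⟩ := Ideal.Quotient.mk_surjective a
  induction y using SymmetricAlgebra.induction with
  | algebraMap r => exact base r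
  | ι x =>
    have : SymmetricAlgebra.ι R (L × Module.Dual R L) x =
        SymmetricAlgebra.ι R _ (x.1, 0) + SymmetricAlgebra.ι R _ (0, x.2) := by
      rw [← map_add]; simp
    rw [this, map_add]
    exact add _ _ (sec' x.1) (cosec' x.2)
  | mul a b ha hb => rw [map_mul]; exact mul _ _ ha hb
  | add a b ha hb => rw [map_add]; exact add _ _ ha hb

variable {R L k} in
/-- Invariance of a vector field on the principal bundle under `𝔾ₘ`. -/
def IsInvariant (a : Derivation k (TorsorRing R L) (TorsorRing R L)) : Prop :=
  ∀ t : kˣ, conjDer (act k t) a = a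

variable {R L k} in
lemma act_symm_sec (t : kˣ) (l : L) : (act k t).symm (sec R L l) = (t : k) • sec R L l := by
  change twist _ (sec R L l) = _
  rw [map_inv]
  simp [twist]

variable {R L k} in
lemma act_symm_cosec (t : kˣ) (ν : Module.Dual R L) :
    (act k t).symm (cosec R L ν) = ((t⁻¹ : kˣ) : k) • cosec R L ν := by
  change twist _ (cosec R L ν) = _
  simp [twist]

variable {R L k} in
lemma act_symm_algebraMap (t : kˣ) (r : R) :
    (act k t).symm (algebraMap R (TorsorRing R L) r) = algebraMap R _ r :=
  AlgHom.commutes _ r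

lemma euler_isInvariant : IsInvariant (euler R L k) := by
  intro t
  have key : ∀ f, euler R L k ((act k t).symm f) = (act k t).symm (euler R L k f) := by
    intro f
    induction f using induction with
    | base r => simp [act_symm_algebraMap]
    | sec' l => simp [act_symm_sec]
    | cosec' ν => simp [act_symm_cosec]
    | mul a b ha hb => simp [Derivation.leibniz, ha, hb]
    | add a b ha hb => simp [ha, hb]
  ext f
  simp [key]

end TorsorRing

end Torsor

/-! ## The algebra `D_{c,ℏ,L}` -/

section TDOAlgebra

open Polynomial

variable (k : Type u) [Field k] (R : Type u) [CommRing R] [Algebra k R]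
  (L : Type u) [AddCommGroup L] [Module R L]

/-- The algebra `D_{c,ℏ,L}` over `Spec R`: the `𝔾ₘ`-invariants in the algebra
`D_ℏ(X̃) = ⨁ₙ D^{≤n}(X̃)` of the principal bundle `X̃` of `L`.  (Invariance is tested on the
`k`-points of `𝔾ₘ`, which are dense when `k` is infinite.) -/
def TDOAlg : Subalgebra k (CrysDiff k (TorsorRing R L))[X] where
  carrier := {q | q ∈ CrysDiff.rees k (TorsorRing R L) ∧
    ∀ t : kˣ, Polynomial.mapAlgHom (CrysDiff.map (TorsorRing.act k t)) q = q}
  mul_mem' ha hb := ⟨mul_mem ha.1 hb.1, fun t => by rw [map_mul, ha.2, hb.2]⟩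
  add_mem' ha hb := ⟨add_mem ha.1 hb.1, fun t => by rw [map_add, ha.2, hb.2]⟩
  algebraMap_mem' r := ⟨Subalgebra.algebraMap_mem _ r, fun t => AlgHom.commutes _ r⟩

variable {k R L} in
/-- The element `ξ̂` of degree one of `D_ℏ(X̃)` given by a vector field `ξ` on `X̃`. -/
def hat (ξ : Derivation k (TorsorRing R L) (TorsorRing R L)) :
    (CrysDiff k (TorsorRing R L))[X] :=
  C (CrysDiff.vf k _ ξ) * X

variable {k R L} in
/-- The element of degree zero of `D_ℏ(X̃)` given by a function on `X̃`. -/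
def fnT (f : TorsorRing R L) : (CrysDiff k (TorsorRing R L))[X] := C (CrysDiff.fn k _ f)

variable {k R L} in
lemma hat_mem {ξ : Derivation k (TorsorRing R L) (TorsorRing R L)}
    (hξ : TorsorRing.IsInvariant ξ) : hat ξ ∈ TDOAlg k R L := by
  refine ⟨fun n => ?_, fun t => ?_⟩
  · rw [hat, coeff_C_mul, coeff_X]
    split_ifs with h
    · subst h; simpa using CrysDiff.vf_mem_order k _ ξ
    · simp
  · simp only [hat, coe_mapAlgHom, Polynomial.map_mul, Polynomial.map_C, Polynomial.map_X]
    have := CrysDiff.map_vf (TorsorRing.act k t) ξ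
    rw [hξ t] at this
    exact congrArg (fun z => C z * X) this

/-- The central parameter `ℏ`. -/
def TDOAlg.hbar : TDOAlg k R L :=
  ⟨X, fun n => by
    rw [coeff_X]
    split_ifs with h
    · exact CrysDiff.one_mem_order _ _ _
    · exact zero_mem _, fun t => by simp⟩

/-- The central parameter `c`: the element given by the Euler vector field. -/
def TDOAlg.c : TDOAlg k R L :=
  ⟨hat (TorsorRing.euler R L k), hat_mem (TorsorRing.euler_isInvariant R L k)⟩

variable {k} in
/-- Rescaling of the parameter: multiplication by `lam ^ n` in degree `n`. -/
def scaleHom {A : Type u} [Ring A] [Algebra k A] (lam : k) : A[X] →ₐ[k] A[X] :=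
  Polynomial.eval₂AlgHom CAlgHom (algebraMap k A[X] lam * X) (fun a => by
    have h₁ : Commute (C a) (algebraMap k A[X] lam) := (Algebra.commutes lam (C a)).symm
    exact h₁.mul_right (Polynomial.commute_X (C a)).symm)

lemma coeff_scaleHom {k : Type u} [Field k] {A : Type u} [Ring A] [Algebra k A] (lam : k) (q : A[X])
    (n : ℕ) : (scaleHom lam q).coeff n = lam ^ n • q.coeff n := by
  have hX : ∀ m, (algebraMap k A[X] lam * X) ^ m = C (algebraMap k A (lam ^ m)) * X ^ m := by
    intro m
    have hc : Commute (algebraMap k A[X] lam) X := Algebra.commutes lam X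
    rw [hc.mul_pow, Polynomial.algebraMap_apply, map_pow, C_pow]
  induction q using Polynomial.induction_on' with
  | add p q hp hq => rw [map_add, coeff_add, coeff_add, hp, hq, smul_add]
  | monomial m a =>
    have : scaleHom lam (monomial m a) = C (a * algebraMap k A (lam ^ m)) * X ^ m := by
      change eval₂ _ _ _ = _
      rw [eval₂_monomial, hX, ← mul_assoc, C_mul]
      rfl
    rw [this, coeff_C_mul_X_pow, coeff_monomial]
    by_cases h : n = m
    · subst h; rw [if_pos rfl, if_pos rfl, Algebra.smul_def, Algebra.commutes]
    · rw [if_neg h, if_neg (Ne.symm h), smul_zero]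

/-- The action of `lam ∈ 𝔾ₘ` on `D_{c,ℏ,L}` defined by the grading (multiplication by
`lam ^ n` in degree `n`). -/
def TDOAlg.scale (lam : k) : TDOAlg k R L →ₐ[k] TDOAlg k R L :=
  ((scaleHom lam).comp (TDOAlg k R L).val).codRestrict _ (by
    rintro ⟨q, hq₁, hq₂⟩
    refine ⟨fun n => ?_, fun t => ?_⟩
    · change (scaleHom lam q).coeff n ∈ _
      rw [coeff_scaleHom]
      exact Submodule.smul_mem _ _ (hq₁ n)
    · ext n
      have h := congrArg (fun r => r.coeff n) (hq₂ t)
      simp only [coe_mapAlgHom, coeff_map] at h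
      change ((scaleHom lam q).map _).coeff n = (scaleHom lam q).coeff n
      rw [coeff_map, coeff_scaleHom]
      change CrysDiff.map (TorsorRing.act k t) _ = _
      rw [map_smul]
      exact congrArg _ h)

/-- The relations `c = c₀`, `ℏ = ℏ₀`. -/
inductive SpecRel (c₀ h₀ : k) : TDOAlg k R L → TDOAlg k R L → Prop
  | c : SpecRel c₀ h₀ (TDOAlg.c k R L) (algebraMap k _ c₀)
  | hbar : SpecRel c₀ h₀ (TDOAlg.hbar k R L) (algebraMap k _ h₀)

/-- The specialization `D_{c,ℏ,L}[c₀,ℏ₀]`. -/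
def TDOSpec (c₀ h₀ : k) : Type u := RingQuot (SpecRel k R L c₀ h₀)

instance (c₀ h₀ : k) : Ring (TDOSpec k R L c₀ h₀) :=
  inferInstanceAs (Ring (RingQuot (SpecRel k R L c₀ h₀)))
instance (c₀ h₀ : k) : Algebra k (TDOSpec k R L c₀ h₀) :=
  inferInstanceAs (Algebra k (RingQuot (SpecRel k R L c₀ h₀)))

/-- The specialization map. -/
def TDOSpec.mk (c₀ h₀ : k) : TDOAlg k R L →ₐ[k] TDOSpec k R L c₀ h₀ :=
  RingQuot.mkAlgHom k (SpecRel k R L c₀ h₀)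

end TDOAlgebra

/-! ## `λ`-connections and the scheme `Conn_λ(L)` -/

section Connections

variable (k : Type u) [Field k] (R : Type u) [CommRing R] [Algebra k R]
  (L : Type u) [AddCommGroup L] [Module R L]

/-- A `λ`-connection on `L` with coefficients in an `R`-algebra `S`, where `λ ∈ S`: an additive map
`∇ : L → S ⊗ Ω¹ ⊗ L` with `∇(f s) = f ∇s + λ df ⊗ s`.  For `S = R` this is a `λ`-connection on `L`;
in general it is an `S`-point of the torsor of `λ`-connections on `L`. -/
structure LambdaConnection (S : Type u) [CommRing S] [Algebra R S] (lam : S) where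
  /-- the underlying map -/
  toFun : L →+ S ⊗[R] (Ω[R⁄k] ⊗[R] L)
  leibniz : ∀ (f : R) (s : L),
    toFun (f • s) = f • toFun s + lam ⊗ₜ (KaehlerDifferential.D k R f ⊗ₜ s)

variable (B : Type u) [CommRing B] [Algebra R B] (lam : B)

/-- The relations between the coordinates `⟨μ, ∇ℓ⟩` of a `λ`-connection. -/
def connIdeal : Ideal (MvPolynomial (Module.Dual R (Ω[R⁄k] ⊗[R] L) × L) B) :=
  Ideal.span (
    {x | ∃ μ μ' l, x = MvPolynomial.X (μ + μ', l) - MvPolynomial.X (μ, l)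
        - MvPolynomial.X (μ', l)} ∪
    {x | ∃ (f : R) (μ : Module.Dual R (Ω[R⁄k] ⊗[R] L)) (l : L), x = MvPolynomial.X (f • μ, l)
        - MvPolynomial.C (algebraMap R B f) * MvPolynomial.X (μ, l)} ∪
    {x | ∃ μ l l', x = MvPolynomial.X (μ, l + l') - MvPolynomial.X (μ, l)
        - MvPolynomial.X (μ, l')} ∪
    {x | ∃ (f : R) (μ : Module.Dual R (Ω[R⁄k] ⊗[R] L)) (l : L), x = MvPolynomial.X (μ, f • l)
        - MvPolynomial.C (algebraMap R B f) * MvPolynomial.X (μ, l)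
        - MvPolynomial.C (lam * algebraMap R B (μ (KaehlerDifferential.D k R f ⊗ₜ l)))})

/-- The ring of functions on the affine scheme `Conn_λ(L)` over `Spec B`, where `Spec B` is a scheme
over `Spec R` and `λ` a function on it.  It is generated over `B` by the coordinates `⟨μ, ∇ℓ⟩` of
the universal `λ`-connection `∇`, for `ℓ ∈ L` and `μ` in the dual of `Ω¹ ⊗ L`.  See
`ConnAlg.points_bijective` for its functor of points. -/
def ConnAlg : Type u :=
  MvPolynomial (Module.Dual R (Ω[R⁄k] ⊗[R] L) × L) B ⧸ connIdeal k R L B lam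

namespace ConnAlg

instance : CommRing (ConnAlg k R L B lam) :=
  inferInstanceAs (CommRing (_ ⧸ connIdeal k R L B lam))

instance {k' : Type u} [CommRing k'] [Algebra k' B] : Algebra k' (ConnAlg k R L B lam) :=
  inferInstanceAs (Algebra k' (_ ⧸ connIdeal k R L B lam))

instance {k' k'' : Type u} [CommRing k'] [CommRing k''] [Algebra k' k''] [Algebra k' B]
    [Algebra k'' B] [IsScalarTower k' k'' B] : IsScalarTower k' k'' (ConnAlg k R L B lam) :=
  inferInstanceAs (IsScalarTower k' k'' (_ ⧸ connIdeal k R L B lam))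

/-- The coordinate `⟨μ, ∇ℓ⟩`. -/
def coord (μ : Module.Dual R (Ω[R⁄k] ⊗[R] L)) (l : L) : ConnAlg k R L B lam :=
  Ideal.Quotient.mk (connIdeal k R L B lam) (MvPolynomial.X (μ, l))

/-- Functions on the base. -/
def ofBase : B →+* ConnAlg k R L B lam :=
  (Ideal.Quotient.mk (connIdeal k R L B lam)).comp MvPolynomial.C

lemma algebraMap_eq : algebraMap B (ConnAlg k R L B lam) = ofBase k R L B lam := rfl

lemma coord_add_left (μ μ' : Module.Dual R (Ω[R⁄k] ⊗[R] L)) (l : L) :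
    coord k R L B lam (μ + μ') l = coord k R L B lam μ l + coord k R L B lam μ' l := by
  have : MvPolynomial.X (μ + μ', l) - MvPolynomial.X (μ, l) - MvPolynomial.X (μ', l) ∈
      connIdeal k R L B lam :=
    Ideal.subset_span (Or.inl (Or.inl (Or.inl ⟨μ, μ', l, rfl⟩)))
  have := Ideal.Quotient.eq_zero_iff_mem.mpr this
  rw [map_sub, map_sub, sub_sub, sub_eq_zero] at this
  exact this

lemma coord_smul_left (f : R) (μ : Module.Dual R (Ω[R⁄k] ⊗[R] L)) (l : L) :
    coord k R L B lam (f • μ) l = ofBase k R L B lam (algebraMap R B f) * coord k R L B lam μ l := by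
  have : MvPolynomial.X (f • μ, l) - MvPolynomial.C (algebraMap R B f) * MvPolynomial.X (μ, l) ∈
      connIdeal k R L B lam :=
    Ideal.subset_span (Or.inl (Or.inl (Or.inr ⟨f, μ, l, rfl⟩)))
  have := Ideal.Quotient.eq_zero_iff_mem.mpr this
  rw [map_sub, sub_eq_zero, map_mul] at this
  exact this

lemma coord_add_right (μ : Module.Dual R (Ω[R⁄k] ⊗[R] L)) (l l' : L) :
    coord k R L B lam μ (l + l') = coord k R L B lam μ l + coord k R L B lam μ l' := by
  have : MvPolynomial.X (μ, l + l') - MvPolynomial.X (μ, l) - MvPolynomial.X (μ, l') ∈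
      connIdeal k R L B lam :=
    Ideal.subset_span (Or.inl (Or.inr ⟨μ, l, l', rfl⟩))
  have := Ideal.Quotient.eq_zero_iff_mem.mpr this
  rw [map_sub, map_sub, sub_sub, sub_eq_zero] at this
  exact this

lemma coord_smul_right (f : R) (μ : Module.Dual R (Ω[R⁄k] ⊗[R] L)) (l : L) :
    coord k R L B lam μ (f • l) = ofBase k R L B lam (algebraMap R B f) * coord k R L B lam μ l
      + ofBase k R L B lam (lam * algebraMap R B (μ (KaehlerDifferential.D k R f ⊗ₜ l))) := by
  have : MvPolynomial.X (μ, f • l) - MvPolynomial.C (algebraMap R B f) * MvPolynomial.X (μ, l)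
        - MvPolynomial.C (lam * algebraMap R B (μ (KaehlerDifferential.D k R f ⊗ₜ l))) ∈
      connIdeal k R L B lam :=
    Ideal.subset_span (Or.inr ⟨f, μ, l, rfl⟩)
  have := Ideal.Quotient.eq_zero_iff_mem.mpr this
  rw [map_sub, map_sub, sub_sub, sub_eq_zero, map_mul] at this
  exact this

variable {k R L B lam}

/-- A ring homomorphism out of the ring of functions on `Conn_λ(L)` is given by its values on the
base and on the coordinates. -/
def lift {S : Type u} [CommRing S] (g : B →+* S) (v : Module.Dual R (Ω[R⁄k] ⊗[R] L) → L → S)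
    (h₁ : ∀ μ μ' l, v (μ + μ') l = v μ l + v μ' l)
    (h₂ : ∀ (f : R) μ l, v (f • μ) l = g (algebraMap R B f) * v μ l)
    (h₃ : ∀ μ l l', v μ (l + l') = v μ l + v μ l')
    (h₄ : ∀ (f : R) μ l, v μ (f • l) = g (algebraMap R B f) * v μ l
      + g (lam * algebraMap R B (μ (KaehlerDifferential.D k R f ⊗ₜ l)))) :
    ConnAlg k R L B lam →+* S :=
  Ideal.Quotient.lift (connIdeal k R L B lam) (MvPolynomial.eval₂Hom g (fun x => v x.1 x.2)) (by
    intro x hx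
    have : connIdeal k R L B lam ≤
        RingHom.ker (MvPolynomial.eval₂Hom g (fun x => v x.1 x.2)) := by
      refine Ideal.span_le.mpr ?_
      rintro x (((⟨μ, μ', l, rfl⟩ | ⟨f, μ, l, rfl⟩) | ⟨μ, l, l', rfl⟩) | ⟨f, μ, l, rfl⟩)
      · simp [RingHom.mem_ker, h₁]
      · simp [RingHom.mem_ker, h₂]
      · simp [RingHom.mem_ker, h₃]
      · simp only [SetLike.mem_coe, RingHom.mem_ker, map_sub, MvPolynomial.eval₂Hom_X', h₄,
          map_mul, MvPolynomial.eval₂Hom_C]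
        ring
    exact this hx)

section
variable {S : Type u} [CommRing S] (g : B →+* S) (v : Module.Dual R (Ω[R⁄k] ⊗[R] L) → L → S)
  (h₁ h₂ h₃ h₄)

@[simp] lemma lift_coord (μ : Module.Dual R (Ω[R⁄k] ⊗[R] L)) (l : L) :
    lift (lam := lam) g v h₁ h₂ h₃ h₄ (coord k R L B lam μ l) = v μ l :=
  (Ideal.Quotient.lift_mk _ _ _).trans (MvPolynomial.eval₂Hom_X' _ _ _)

@[simp] lemma lift_ofBase (b : B) :
    lift (lam := lam) g v h₁ h₂ h₃ h₄ (ofBase k R L B lam b) = g b :=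
  (Ideal.Quotient.lift_mk _ _ _).trans (MvPolynomial.eval₂Hom_C _ _ _)

end

lemma ringHom_ext {S : Type u} [CommRing S] {g g' : ConnAlg k R L B lam →+* S}
    (h₁ : ∀ b, g (ofBase k R L B lam b) = g' (ofBase k R L B lam b))
    (h₂ : ∀ μ l, g (coord k R L B lam μ l) = g' (coord k R L B lam μ l)) : g = g' := by
  refine Ideal.Quotient.ringHom_ext (MvPolynomial.ringHom_ext h₁ fun x => h₂ x.1 x.2)

/-- The pairing of `S ⊗ M` with an element of the dual of `M`. -/
def pair (S : Type u) [CommRing S] [Algebra R S] {M : Type u} [AddCommGroup M] [Module R M]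
    (μ : Module.Dual R M) : S ⊗[R] M →ₗ[R] S :=
  (TensorProduct.rid R S).toLinearMap ∘ₗ LinearMap.lTensor S μ

lemma pair_tmul (S : Type u) [CommRing S] [Algebra R S] {M : Type u} [AddCommGroup M] [Module R M]
    (μ : Module.Dual R M) (s : S) (m : M) : pair S μ (s ⊗ₜ m) = s * algebraMap R S (μ m) := by
  simp [pair, Algebra.smul_def, mul_comm]

/-- The ring homomorphism underlying `pointOf`. -/
def pointHom {S : Type u} [CommRing S] [Algebra R S] [Algebra B S] [IsScalarTower R B S]
    (D : LambdaConnection k R L S (algebraMap B S lam)) : ConnAlg k R L B lam →+* S :=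
  lift (algebraMap B S) (fun μ l => pair S μ (D.toFun l))
    (fun μ μ' l => by
      have : pair S (μ + μ') = pair S μ + pair S μ' := by
        refine TensorProduct.ext' fun s m => ?_
        simp [pair_tmul, mul_add]
      simp [this])
    (fun f μ l => by
      have : pair S (f • μ) = f • pair S μ := by
        refine TensorProduct.ext' fun s m => ?_
        simp [pair_tmul, Algebra.smul_def, mul_left_comm]
      simp [this, Algebra.smul_def, ← IsScalarTower.algebraMap_apply])
    (fun μ l l' => by simp)
    (fun f μ l => by
      rw [D.leibniz, map_add, map_smul, pair_tmul, map_mul]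
      simp [Algebra.smul_def, ← IsScalarTower.algebraMap_apply])

lemma pointHom_coord {S : Type u} [CommRing S] [Algebra R S] [Algebra B S]
    [IsScalarTower R B S] (D : LambdaConnection k R L S (algebraMap B S lam))
    (μ : Module.Dual R (Ω[R⁄k] ⊗[R] L)) (l : L) :
    pointHom D (coord k R L B lam μ l) = pair S μ (D.toFun l) := by
  unfold pointHom
  rw [lift_coord]

lemma pointHom_ofBase {S : Type u} [CommRing S] [Algebra R S] [Algebra B S]
    [IsScalarTower R B S] (D : LambdaConnection k R L S (algebraMap B S lam)) (b : B) :
    pointHom D (ofBase k R L B lam b) = algebraMap B S b := by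
  unfold pointHom
  rw [lift_ofBase]

/-- The point of `Conn_λ(L)` given by a `λ`-connection `∇` with coefficients in a `B`-algebra `S`:
the coordinate of index `(μ, ℓ)` takes the value `⟨μ, ∇ℓ⟩`. -/
def pointOf {S : Type u} [CommRing S] [Algebra R S] [Algebra B S] [IsScalarTower R B S]
    (D : LambdaConnection k R L S (algebraMap B S lam)) : ConnAlg k R L B lam →ₐ[B] S :=
  { pointHom D with commutes' := pointHom_ofBase D }

lemma pointOf_coord {S : Type u} [CommRing S] [Algebra R S] [Algebra B S]
    [IsScalarTower R B S] (D : LambdaConnection k R L S (algebraMap B S lam))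
    (μ : Module.Dual R (Ω[R⁄k] ⊗[R] L)) (l : L) :
    pointOf D (coord k R L B lam μ l) = pair S μ (D.toFun l) :=
  pointHom_coord D μ l

/-- The functor of points of `Conn_λ(L)`: if `Ω¹ ⊗ L` is finite projective, then the `S`-points of
`Conn_λ(L)` over `Spec B` are the `λ`-connections on `L` with coefficients in `S`. -/
theorem points_bijective [Module.Finite R (Ω[R⁄k] ⊗[R] L)] [Module.Projective R (Ω[R⁄k] ⊗[R] L)]
    (S : Type u) [CommRing S] [Algebra R S] [Algebra B S] [IsScalarTower R B S] :
    Function.Bijective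
      (pointOf : LambdaConnection k R L S (algebraMap B S lam) → (ConnAlg k R L B lam →ₐ[B] S)) := by
  obtain ⟨n, q, i, -, -, hqi⟩ :=
    Module.Finite.exists_comp_eq_id_of_projective R (Ω[R⁄k] ⊗[R] L)
  let e : Fin n → (Ω[R⁄k] ⊗[R] L) := fun j => q (Pi.single j 1)
  let δ : Fin n → Module.Dual R (Ω[R⁄k] ⊗[R] L) := fun j => LinearMap.proj j ∘ₗ i
  have hm : ∀ m, m = ∑ j, δ j m • e j := by
    intro m
    conv_lhs => rw [← LinearMap.id_apply (R := R) m, ← hqi, LinearMap.comp_apply,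
      ← Finset.univ_sum_single (i m), map_sum]
    refine Finset.sum_congr rfl fun j _ => ?_
    rw [← map_smul, ← Pi.single_smul]
    simp [δ]
  have hS : ∀ z : S ⊗[R] (Ω[R⁄k] ⊗[R] L), z = ∑ j, pair S (δ j) z ⊗ₜ e j := by
    intro z
    induction z using TensorProduct.induction_on with
    | zero => simp
    | add x y hx hy =>
      conv_lhs => rw [hx, hy]
      rw [← Finset.sum_add_distrib]
      refine Finset.sum_congr rfl fun j _ => ?_
      rw [map_add, TensorProduct.add_tmul]
    | tmul s m =>
      conv_lhs => rw [hm m]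
      rw [TensorProduct.tmul_sum]
      refine Finset.sum_congr rfl fun j _ => ?_
      rw [pair_tmul, TensorProduct.tmul_smul, TensorProduct.smul_tmul', Algebra.smul_def, mul_comm]
  constructor
  · rintro ⟨D, hD⟩ ⟨D', hD'⟩ h
    have : D = D' := by
      ext l
      rw [hS (D l), hS (D' l)]
      refine Finset.sum_congr rfl fun j _ => ?_
      have := AlgHom.congr_fun h (coord k R L B lam (δ j) l)
      rw [pointOf_coord, pointOf_coord] at this
      rw [this]
    subst this; rfl
  · intro g
    have hg : ∀ b, g (ofBase k R L B lam b) = algebraMap B S b := fun b => g.commutes b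
    refine ⟨⟨⟨⟨fun l => ∑ j, g (coord k R L B lam (δ j) l) ⊗ₜ e j, ?_⟩, ?_⟩, ?_⟩, ?_⟩
    · have : ∀ μ, coord k R L B lam μ 0 = 0 := by
        intro μ
        have := coord_add_right k R L B lam μ 0 0
        rwa [add_zero, left_eq_add] at this
      simp [this]
    · intro l l'
      simp only [coord_add_right, map_add, TensorProduct.add_tmul, Finset.sum_add_distrib]
    · intro f l
      change ∑ j, g (coord k R L B lam (δ j) (f • l)) ⊗ₜ e j = f • ∑ j, g (coord k R L B lam (δ j) l) ⊗ₜ e j + _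
      conv_rhs => rw [hm (KaehlerDifferential.D k R f ⊗ₜ[R] l)]
      simp only [coord_smul_right, map_add, map_mul, hg, TensorProduct.add_tmul,
        Finset.sum_add_distrib, Finset.smul_sum, TensorProduct.tmul_sum, TensorProduct.tmul_smul,
        TensorProduct.smul_tmul', Algebra.smul_def, ← IsScalarTower.algebraMap_apply, mul_comm]
    · refine AlgHom.coe_ringHom_injective (ringHom_ext (fun b => ?_) fun μ l => ?_)
      · exact ((pointOf _).commutes b).trans (g.commutes b).symm
      · refine (pointOf_coord _ μ l).trans ?_
        change pair S μ (∑ j, g (coord k R L B lam (δ j) l) ⊗ₜ e j) = g (coord k R L B lam μ l)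
        have hμ : μ = ∑ j, μ (e j) • δ j := by
          refine LinearMap.ext fun m => ?_
          conv_lhs => rw [hm m]
          simp [mul_comm]
        let cl : Module.Dual R (Ω[R⁄k] ⊗[R] L) →+ ConnAlg k R L B lam :=
          AddMonoidHom.mk' (fun μ => coord k R L B lam μ l)
            (fun μ μ' => coord_add_left k R L B lam μ μ' l)
        have : coord k R L B lam μ l = ∑ j, coord k R L B lam (μ (e j) • δ j) l := by
          conv_lhs => rw [hμ]
          exact map_sum cl _ _
        rw [this]
        simp only [map_sum, pair_tmul, coord_smul_left, map_mul, hg,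
          ← IsScalarTower.algebraMap_apply, mul_comm]

end ConnAlg

end Connections

/-! ## Frobenius twist

The ground field is perfect, so the Frobenius twist `X⁽¹⁾` of a `k`-scheme `X` is `X` itself as a
scheme, with the `k`-structure twisted by the inverse of the Frobenius automorphism of `k`. -/

section Frobenius

variable {k : Type u} [Field k] (p : ℕ) [ExpChar k p] [PerfectRing k p]
  (R : Type u) [CommRing R] [Algebra k R] (L : Type u) [AddCommGroup L] [Module R L]

/-- The ring of functions `R⁽¹⁾` on the Frobenius twist of `Spec R`. -/
def FrobTwist (_p : ℕ) (R : Type u) : Type u := R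

/-- The inverse image `L⁽¹⁾` of `L` on the Frobenius twist of `Spec R`. -/
def FrobTwistMod (_p : ℕ) (L : Type u) : Type u := L

instance : CommRing (FrobTwist p R) := inferInstanceAs (CommRing R)

/-- The element `f⁽¹⁾` of `R⁽¹⁾`. -/
def FrobTwist.of : R ≃+* FrobTwist p R := RingEquiv.refl R

instance : Algebra k (FrobTwist p R) :=
  ((FrobTwist.of p R).toRingHom.comp
    ((algebraMap k R).comp (frobeniusEquiv k p).symm.toRingHom)).toAlgebra

lemma FrobTwist.algebraMap_eq (a : k) : algebraMap k (FrobTwist p R) a =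
    FrobTwist.of p R (algebraMap k R ((frobeniusEquiv k p).symm a)) := rfl

instance : AddCommGroup (FrobTwistMod p L) := inferInstanceAs (AddCommGroup L)

instance : Module (FrobTwist p R) (FrobTwistMod p L) := inferInstanceAs (Module R L)

/-- The element `ℓ⁽¹⁾` of `L⁽¹⁾`. -/
def FrobTwistMod.of : L ≃+ FrobTwistMod p L := AddEquiv.refl L

variable {R L}

/-- The vector field `ξ⁽¹⁾` on the Frobenius twist: `ξ⁽¹⁾(f⁽¹⁾) = (ξ f)⁽¹⁾`. -/
def twistDer (ξ : Derivation k R R) : Derivation k (FrobTwist p R) (FrobTwist p R) :=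
  Derivation.mk'
    { toFun := fun f => FrobTwist.of p R (ξ ((FrobTwist.of p R).symm f))
      map_add' := by simp
      map_smul' := fun a f => by
        rw [Algebra.smul_def, RingHom.id_apply, Algebra.smul_def, FrobTwist.algebraMap_eq]
        simp [Derivation.leibniz] }
    (fun a b => by simp [Derivation.leibniz])

/-- The element `ν⁽¹⁾` of the dual of `L⁽¹⁾`: `ν⁽¹⁾(ℓ⁽¹⁾) = ν(ℓ)⁽¹⁾`. -/
def twistDual (ν : Module.Dual R L) : Module.Dual (FrobTwist p R) (FrobTwistMod p L) where
  toFun l := FrobTwist.of p R (ν ((FrobTwistMod.of p L).symm l))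
  map_add' := by simp
  map_smul' f l := by
    change FrobTwist.of p R (ν ((FrobTwist.of p R).symm f • (FrobTwistMod.of p L).symm l)) = _
    rw [map_smul, smul_eq_mul, map_mul]
    simp

end Frobenius

/-! ## The schemes of connections on `L⁽¹⁾` and the center -/

section Center

variable {k : Type u} [Field k]

section
variable {R : Type u} [CommRing R] [Algebra k R] {L : Type u} [AddCommGroup L] [Module R L]

/-- The functional `ω ⊗ ℓ ↦ ⟨ξ, ω⟩ ν(ℓ)` on `Ω¹ ⊗ L`. -/
def contract (ξ : Derivation k R R) (ν : Module.Dual R L) : Module.Dual R (Ω[R⁄k] ⊗[R] L) :=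
  LinearMap.mul' R R ∘ₗ TensorProduct.map ξ.liftKaehlerDifferential ν

end

variable (p : ℕ) [ExpChar k p] [PerfectRing k p]
variable (R : Type u) [CommRing R] [Algebra k R] (L : Type u) [AddCommGroup L] [Module R L]

variable (k) in
/-- The ring of functions on `Conn_λ(L⁽¹⁾)` over `X = Spec R`, for a constant `λ ∈ k`. -/
abbrev ConnTwist (lam : k) : Type u :=
  ConnAlg k (FrobTwist p R) (FrobTwistMod p L) (FrobTwist p R) (algebraMap k (FrobTwist p R) lam)

variable (k) in
/-- The ring of functions on `Z = Conn_{c^p - c ℏ^{p-1}}(L⁽¹⁾)` over `X = Spec R`; here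
`c, ℏ` are the coordinates (with indices `0`, `1`) on the second factor of `X⁽¹⁾ × 𝔸²`. -/
abbrev ZAlg : Type u :=
  ConnAlg k (FrobTwist p R) (FrobTwistMod p L) (MvPolynomial (Fin 2) (FrobTwist p R))
    (MvPolynomial.X 0 ^ p - MvPolynomial.X 0 * MvPolynomial.X 1 ^ (p - 1))

variable (k) in
/-- The function `c` on `Z`. -/
def ZAlg.c : ZAlg k p R L := ConnAlg.ofBase _ _ _ _ _ (MvPolynomial.X 0)

variable (k) in
/-- The function `ℏ` on `Z`. -/
def ZAlg.hbar : ZAlg k p R L := ConnAlg.ofBase _ _ _ _ _ (MvPolynomial.X 1)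

variable (k) {R} in
/-- The pullback to `Z` of the function `f⁽¹⁾` on `X⁽¹⁾`. -/
def ZAlg.fn (f : R) : ZAlg k p R L :=
  ConnAlg.ofBase _ _ _ _ _ (MvPolynomial.C (FrobTwist.of p R f))

variable {R L} in
/-- The function `⟨ξ⁽¹⁾ ⊗ ν⁽¹⁾, ∇ ℓ⁽¹⁾⟩` of a point `∇` of `Z`. -/
def ZAlg.coord (ξ : Derivation k R R) (ν : Module.Dual R L) (l : L) : ZAlg k p R L :=
  ConnAlg.coord _ _ _ _ _ (contract (twistDer p ξ) (twistDual p ν)) (FrobTwistMod.of p L l)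

/-- The action of `lam ∈ 𝔾ₘ` on functions on `Z`: the pullback under the map
`(c, ℏ, ∇) ↦ (lam c, lam ℏ, lam ^ p ∇)`. -/
def ZAlg.scale [Fact p.Prime] (lam : k) : ZAlg k p R L →ₐ[k] ZAlg k p R L :=
  { ConnAlg.lift
      (MvPolynomial.aeval (R := FrobTwist p R)
        ![algebraMap k (ZAlg k p R L) lam * ZAlg.c k p R L,
          algebraMap k (ZAlg k p R L) lam * ZAlg.hbar k p R L]).toRingHom
      (fun μ l => algebraMap k (ZAlg k p R L) lam ^ p * ConnAlg.coord _ _ _ _ _ μ l)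
      (fun μ μ' l => by rw [ConnAlg.coord_add_left, mul_add])
      (fun f μ l => by
        rw [ConnAlg.coord_smul_left, MvPolynomial.algebraMap_eq, mul_left_comm]
        congr 1
        simp
        rfl)
      (fun μ l l' => by rw [ConnAlg.coord_add_right, mul_add])
      (fun f μ l => by
        have hp : p - 1 + 1 = p := Nat.sub_add_cancel (Fact.out : p.Prime).one_le
        have hC : ∀ b : FrobTwist p R, algebraMap (FrobTwist p R) (ZAlg k p R L) b =
            ConnAlg.ofBase _ _ _ _ _ (MvPolynomial.C b) := fun _ => rfl
        have hlam : algebraMap k (ZAlg k p R L) lam ^ p =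
            algebraMap k (ZAlg k p R L) lam * algebraMap k (ZAlg k p R L) lam ^ (p - 1) := by
          rw [← pow_succ', hp]
        rw [ConnAlg.coord_smul_right, MvPolynomial.algebraMap_eq]
        simp only [AlgHom.toRingHom_eq_coe, RingHom.coe_coe, map_mul, map_sub, map_pow,
          MvPolynomial.aeval_X, MvPolynomial.aeval_C, Matrix.cons_val_zero, Matrix.cons_val_one,
          hC, mul_pow]
        change _ * (_ + ((ZAlg.c k p R L) ^ p - ZAlg.c k p R L * ZAlg.hbar k p R L ^ (p - 1)) * _) = _
        rw [hlam]
        ring) with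
    commutes' := fun a => by
      have h : algebraMap k (ZAlg k p R L) a = ConnAlg.ofBase _ _ _ _ _
          (MvPolynomial.C (algebraMap k (FrobTwist p R) a)) := rfl
      change ConnAlg.lift _ _ _ _ _ _ _ = _
      rw [h, ConnAlg.lift_ofBase]
      simp only [AlgHom.toRingHom_eq_coe, RingHom.coe_coe, MvPolynomial.aeval_C]
      rfl }

/-- The ideal of the fibre of `Z` over `(c₀, ℏ₀)`. -/
def ZAlg.fibreIdeal (c₀ h₀ : k) : Ideal (ZAlg k p R L) :=
  Ideal.span {ZAlg.c k p R L - algebraMap k _ c₀, ZAlg.hbar k p R L - algebraMap k _ h₀}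

variable (k) in
/-- The ring of functions on the fibre `Z_{c₀,ℏ₀}`. -/
abbrev ZSpec (c₀ h₀ : k) : Type u := ZAlg k p R L ⧸ ZAlg.fibreIdeal p R L c₀ h₀

end Center

/-- `φ` is an isomorphism onto the center of its target. -/
def IsIsoOntoCenter {k A D : Type u} [Field k] [CommRing A] [Ring D] [Algebra k A] [Algebra k D]
    (φ : A →ₐ[k] D) : Prop :=
  Function.Injective φ ∧ φ.range = Subalgebra.center k D

/-- `D` is an Azumaya algebra over `A` via `φ`. -/
def IsAzumayaVia {k A D : Type u} [Field k] [CommRing A] [Ring D] [Algebra k A] [Algebra k D]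
    (φ : A →ₐ[k] D) : Prop :=
  ∃ h : ∀ a x, φ a * x = x * φ a,
    letI : Algebra A D := φ.toRingHom.toAlgebra' h
    IsAzumaya A D

/-- The canonical map from functions on `Z` to `D_{c,ℏ,L}`, over `X = Spec R`: it maps `c`, `ℏ` to
`c`, `ℏ`, it is the Frobenius `f⁽¹⁾ ↦ f^p` on functions on `X⁽¹⁾`, and for a vector field `ξ` on `X`
and any `𝔾ₘ`-invariant lift `a` of `ξ` to the principal bundle `X̃` of `L` it satisfies
`⟨ξ⁽¹⁾ ⊗ ν⁽¹⁾, ∇ ℓ⁽¹⁾⟩ ↦ ν(ℓ)^p (â^p - ℏ^{p-1} (a^{[p]})^) + (c^p - c ℏ^{p-1}) (ν · a(ℓ))^p`. -/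
def IsCanonicalMap {k : Type u} [Field k] (p : ℕ) [Fact p.Prime] [CharP k p] [PerfectRing k p]
    {R : Type u} [CommRing R] [Algebra k R] {L : Type u} [AddCommGroup L] [Module R L]
    (Φ : ZAlg k p R L →ₐ[k] TDOAlg k R L) : Prop :=
  Φ (ZAlg.c k p R L) = TDOAlg.c k R L ∧
  Φ (ZAlg.hbar k p R L) = TDOAlg.hbar k R L ∧
  (∀ f : R, (Φ (ZAlg.fn k p L f) : Polynomial (CrysDiff k (TorsorRing R L))) =
    fnT (algebraMap R _ f) ^ p) ∧
  ∀ (ξ : Derivation k R R) (a : Derivation k (TorsorRing R L) (TorsorRing R L)),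
    TorsorRing.IsInvariant a →
    (∀ f : R, a (algebraMap R _ f) = algebraMap R _ (ξ f)) →
    ∀ (ν : Module.Dual R L) (l : L),
      (Φ (ZAlg.coord p ξ ν l) : Polynomial (CrysDiff k (TorsorRing R L))) =
        fnT (algebraMap R _ (ν l)) ^ p * (hat a ^ p - Polynomial.X ^ (p - 1) * hat (pPow p a))
        + (hat (TorsorRing.euler R L k) ^ p
            - hat (TorsorRing.euler R L k) * Polynomial.X ^ (p - 1))
          * fnT (TorsorRing.cosec R L ν * a (TorsorRing.sec R L l)) ^ p

/-! ## Restriction to a smaller affine open subset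

For `V = Spec R' ⊆ U = Spec R` open, restriction of sections from `U` to `V` is described by its
graph, the subalgebra generated by the pairs of corresponding generators. -/

section Restriction

variable {k : Type u} [Field k] {R R' : Type u} [CommRing R] [Algebra k R] [CommRing R']
  [Algebra k R'] {L L' : Type u} [AddCommGroup L] [Module R L] [AddCommGroup L'] [Module R' L']
  (ρ : R →ₐ[k] R') (σ : L →+ L')

/-- Graph of restriction for functions on the principal bundle. -/
def TorsorRing.resGraph : Subalgebra k (TorsorRing R L × TorsorRing R' L') :=
  Algebra.adjoin k (
    {x | ∃ f : R, x = (algebraMap R _ f, algebraMap R' _ (ρ f))} ∪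
    {x | ∃ l : L, x = (TorsorRing.sec R L l, TorsorRing.sec R' L' (σ l))} ∪
    {x | ∃ (ν : Module.Dual R L) (ν' : Module.Dual R' L'), (∀ l, ν' (σ l) = ρ (ν l)) ∧
      x = (TorsorRing.cosec R L ν, TorsorRing.cosec R' L' ν')})

/-- Graph of restriction for `D_{c,ℏ,L}`. -/
def TDOAlg.resGraph : Subalgebra k (TDOAlg k R L × TDOAlg k R' L') :=
  (Algebra.adjoin k (
    {x | ∃ y ∈ TorsorRing.resGraph ρ σ, x = (fnT y.1, fnT y.2)} ∪
    {x | ∃ (ξ : Derivation k (TorsorRing R L) (TorsorRing R L))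
        (ξ' : Derivation k (TorsorRing R' L') (TorsorRing R' L')),
        (∀ y ∈ TorsorRing.resGraph ρ σ, (ξ y.1, ξ' y.2) ∈ TorsorRing.resGraph ρ σ) ∧
        x = (hat ξ, hat ξ')} ∪
    {(Polynomial.X, Polynomial.X)})).comap
    ((TDOAlg k R L).val.prodMap (TDOAlg k R' L').val)

/-- Graph of restriction for functions on schemes of connections.  The map `β` is restriction of
functions on the base. -/
def ConnAlg.resGraph {B B' : Type u} [CommRing B] [Algebra R B] [CommRing B'] [Algebra R' B']
    [Algebra k B] [Algebra k B'] (lam : B) (lam' : B') (ρ : R →+* R') (σ : L →+ L')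
    (β : B →+* B') :
    Subalgebra k (ConnAlg k R L B lam × ConnAlg k R' L' B' lam') :=
  Algebra.adjoin k (
    {x | ∃ b : B, x = (ConnAlg.ofBase _ _ _ _ _ b, ConnAlg.ofBase _ _ _ _ _ (β b))} ∪
    {x | ∃ (μ : Module.Dual R (Ω[R⁄k] ⊗[R] L)) (μ' : Module.Dual R' (Ω[R'⁄k] ⊗[R'] L')) (l : L),
      (∀ f s, μ' (KaehlerDifferential.D k R' (ρ f) ⊗ₜ σ s)
        = ρ (μ (KaehlerDifferential.D k R f ⊗ₜ s))) ∧
      x = (ConnAlg.coord _ _ _ _ _ μ l, ConnAlg.coord _ _ _ _ _ μ' (σ l))})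

section
variable (p : ℕ) [ExpChar k p] [PerfectRing k p]

/-- Restriction of functions on the Frobenius twist. -/
def FrobTwist.map : FrobTwist p R →+* FrobTwist p R' :=
  (FrobTwist.of p R').toRingHom.comp (ρ.toRingHom.comp (FrobTwist.of p R).symm.toRingHom)

/-- Restriction of sections of `L⁽¹⁾`. -/
def FrobTwistMod.map : FrobTwistMod p L →+ FrobTwistMod p L' :=
  (FrobTwistMod.of p L').toAddMonoidHom.comp (σ.comp (FrobTwistMod.of p L).symm.toAddMonoidHom)

/-- Graph of restriction for functions on `Z`. -/
def ZAlg.resGraph : Subalgebra k (ZAlg k p R L × ZAlg k p R' L') :=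
  ConnAlg.resGraph _ _ (FrobTwist.map ρ p) (FrobTwistMod.map σ p)
    (MvPolynomial.map (FrobTwist.map ρ p))

/-- Graph of restriction for functions on `Conn_λ(L⁽¹⁾)`. -/
def ConnTwist.resGraph (lam : k) :
    Subalgebra k (ConnTwist k p R L lam × ConnTwist k p R' L' lam) :=
  ConnAlg.resGraph _ _ (FrobTwist.map ρ p) (FrobTwistMod.map σ p) (FrobTwist.map ρ p)

end

/-- Graph of the composition of restriction of differential operators from `U` to `V` with the
automorphism `f ↦ f`, `ξ ↦ ξ + c ξ(h) / h` of `D(V)`. -/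
def CrysDiff.gluingGraph (c : k) (h : R'ˣ) : Subalgebra k (CrysDiff k R × CrysDiff k R') :=
  Algebra.adjoin k (
    {x | ∃ f : R, x = (CrysDiff.fn k R f, CrysDiff.fn k R' (ρ f))} ∪
    {x | ∃ (ξ : Derivation k R R) (ξ' : Derivation k R' R'), (∀ f, ξ' (ρ f) = ρ (ξ f)) ∧
      x = (CrysDiff.vf k R ξ,
        CrysDiff.vf k R' ξ' + CrysDiff.fn k R' (c • (ξ' (h : R') * ((h⁻¹ : R'ˣ) : R'))))})

end Restriction

/-! ## Schemes -/

section Schemes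

variable {k : Type u} [Field k] {X : Scheme.{u}} [X.Over (Spec (.of k))]

/-- Functions on an open subset of a `k`-scheme form a `k`-algebra. -/
instance sectionsAlgebra (U : X.Opens) : Algebra k Γ(X, U) :=
  ((X.presheaf.map (homOfLE le_top : U ⟶ ⊤).op).hom.comp
    ((X ↘ Spec (.of k)).appTop.hom.comp (Scheme.ΓSpecIso (.of k)).inv.hom)).toAlgebra

/-- Restriction of functions. -/
def res {U V : X.Opens} (h : V ≤ U) : Γ(X, U) →ₐ[k] Γ(X, V) :=
  { (X.presheaf.map (homOfLE h).op).hom with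
    commutes' := fun a => by
      change (X.presheaf.map (homOfLE h).op).hom ((X.presheaf.map (homOfLE le_top).op).hom _) =
        (X.presheaf.map (homOfLE le_top).op).hom _
      rw [← CommRingCat.comp_apply, ← Functor.map_comp]
      rfl }

variable (L : X.Modules)

/-- Restriction of sections of an `𝒪`-module. -/
def resMod {U V : X.Opens} (h : V ≤ U) : Γ(L, U) →+ Γ(L, V) :=
  (L.presheaf.map (homOfLE h).op).hom

/-- `s` is a frame (a nowhere vanishing section) of `L` over `U`: it trivializes `L` over `U`. -/
def IsFrame {U : X.Opens} (s : Γ(L, U)) : Prop :=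
  ∀ (V : X.Opens) (h : V ≤ U), Function.Bijective fun f : Γ(X, V) => f • resMod L h s

/-- `L` is a line bundle: locally it has a frame. -/
def IsLineBundle : Prop :=
  ∀ x : X, ∃ (U : X.Opens) (_ : x ∈ U) (s : Γ(L, U)), IsFrame L s

/-- An affine open subset contained in `U` together with a frame of `L` over it, i.e. a
trivialization `φ` of `L` with `φ(s) = 1`. -/
structure Framing (U : X.Opens) where
  /-- the affine open subset -/
  V : X.affineOpens
  le : V.1 ≤ U
  /-- the frame -/
  s : Γ(L, V.1)
  isFrame : IsFrame L s

variable {L} in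
/-- A framing on a subset of a smaller open subset. -/
def Framing.of {U U' : X.Opens} (h : U' ≤ U) (i : Framing L U') : Framing L U :=
  ⟨i.V, i.le.trans h, i.s, i.isFrame⟩

variable (k) in
/-- The sections over `U` of the sheaf `D_{L^c}` of twisted differential operators, glued from the
algebras `D(V)` for all trivializations `φ` of `L` over affine open `V ⊆ U`: the gluing isomorphism
from `φ` to `φ'` is `f ↦ f`, `ξ ↦ ξ + c ξ(h) / h`, where `h = φ' ∘ φ⁻¹`, i.e. `s = h s'` for the
corresponding frames. -/
def TDOSheaf (c : k) (U : X.Opens) :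
    Subalgebra k (∀ i : Framing L U, CrysDiff k Γ(X, i.V.1)) where
  carrier := {d | ∀ (i j : Framing L U) (hij : j.V.1 ≤ i.V.1) (h : Γ(X, j.V.1)ˣ),
    resMod L hij i.s = (h : Γ(X, j.V.1)) • j.s →
      (d i, d j) ∈ CrysDiff.gluingGraph (res hij) c h}
  mul_mem' ha hb _ _ hij h e := mul_mem (ha _ _ hij h e) (hb _ _ hij h e)
  add_mem' ha hb _ _ hij h e := add_mem (ha _ _ hij h e) (hb _ _ hij h e)
  algebraMap_mem' r _ _ hij h _ :=
    Subalgebra.algebraMap_mem (CrysDiff.gluingGraph (res hij) c h) r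

end Schemes

end TDO

end

open TDO

noncomputable section

namespace TDO

set_option linter.unusedSectionVars false

variable {k : Type u} [Field k]
open LinearMap (mulLeft mulRight mulLeft_apply)
open Module (Dual)
open Derivation (leibniz commutator_apply)
open Finset (sum_congr mul_sum sum_add_distrib sum_mul)
open _root_.Algebra (FiniteType smul_def subset_adjoin adjoin)
open AlgHom (commutes)
open Subalgebra (mem_center_iff)
open Function (Bijective)
open Set (range)
open TopologicalSpace.Opens (mem_iSup)
open Submonoid (powers)
open FreeAlgebra (lift_ι_apply)
open Polynomial (mapAlgHom)
open Sum (inl inr)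
open KaehlerDifferential (D)

/-- Vector fields on an affine scheme. -/
abbrev Der (k A : Type*) [CommSemiring k] [CommSemiring A] [Algebra k A] := Derivation k A A

section FrobeniusGeneration

variable (p : ℕ) [Fact p.Prime] [CharP k p]
variable {R : Type u} [CommRing R] [Algebra k R]

variable (k R) in
lemma natCast_p_eq_zero {A : Type*} [Ring A] [Algebra k A] : (p : A) = 0 := by
  rw [← map_natCast (algebraMap k A), CharP.cast_eq_zero, map_zero]

variable (k) in
lemma expChar_or_subsingleton (A : Type*) [Ring A] [Algebra k A] : ExpChar A p ∨ Subsingleton A := by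
  rcases subsingleton_or_nontrivial A with h | h
  · exact Or.inr h
  · have := charP_of_injective_algebraMap (algebraMap k A).injective p
    exact Or.inl inferInstance

variable (k) in
lemma add_pow_p {A : Type*} [CommRing A] [Algebra k A] (a b : A) : (a + b) ^ p = a ^ p + b ^ p := by
  rcases expChar_or_subsingleton k p A with h | h
  · exact add_pow_expChar ..
  · exact Subsingleton.elim _ _

variable (k) in
lemma sub_pow_p {A : Type*} [CommRing A] [Algebra k A] (a b : A) : (a - b) ^ p = a ^ p - b ^ p := by
  rw [eq_sub_iff_add_eq, ← add_pow_p k p, sub_add_cancel]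

variable (k) in
lemma sum_pow_p {A : Type*} [CommRing A] [Algebra k A] {ι : Type*} (s : Finset ι) (f : ι → A) :
    (∑ i ∈ s, f i) ^ p = ∑ i ∈ s, f i ^ p := by
  classical
  induction s using Finset.induction_on with
  | empty => simp [(Fact.out : p.Prime).ne_zero]
  | insert a s ha ih => rw [Finset.sum_insert ha, Finset.sum_insert ha, add_pow_p k p, ih]

variable (k R) in
/-- The subalgebra of `p`-th powers. -/
def pthPowers [PerfectRing k p] : Subalgebra k R where
  carrier := range fun r : R => r ^ p
  mul_mem' := by rintro _ _ ⟨a, rfl⟩ ⟨b, rfl⟩; exact ⟨a * b, mul_pow ..⟩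
  add_mem' := by rintro _ _ ⟨a, rfl⟩ ⟨b, rfl⟩; exact ⟨a + b, add_pow_p k p _ _⟩
  algebraMap_mem' a := ⟨algebraMap k R ((frobeniusEquiv k p).symm a), by
    change _ ^ p = _
    rw [← map_pow, frobeniusEquiv_symm_pow_p]⟩

variable (k) in
/-- If the differentials of the `x i` generate the Kähler differentials, then `R` is generated by
the `x i` over the `p`-th powers. -/
theorem adjoin_pthPowers_eq_top [PerfectRing k p] [FiniteType k R] {ι : Type*} (x : ι → R)
    (hx : Submodule.span R (range fun i => D k R (x i)) = ⊤) :
    adjoin k ((pthPowers k p R : Set R) ∪ range x) = ⊤ := by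
  set A := adjoin k ((pthPowers k p R : Set R) ∪ range x) with hA
  have hpow : ∀ r : R, r ^ p ∈ A := fun r => subset_adjoin (Or.inl ⟨r, rfl⟩)
  have hunr : Subsingleton Ω[R⁄A] := by
    have hs := KaehlerDifferential.map_surjective k A R
    have h0 : ∀ ω, KaehlerDifferential.map k A R R ω = 0 := by
      intro ω
      have : ω ∈ Submodule.span R (range fun i => D k R (x i)) := hx ▸ trivial
      induction this using Submodule.span_induction with
      | mem ω h =>
        obtain ⟨i, rfl⟩ := h
        rw [KaehlerDifferential.map_D]
        exact Derivation.map_algebraMap _ (⟨x i, subset_adjoin (Or.inr ⟨i, rfl⟩)⟩ : A)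
      | zero => simp
      | add a b _ _ ha hb => rw [map_add, ha, hb, add_zero]
      | smul r a _ ha => rw [map_smul, ha, smul_zero]
    exact subsingleton_of_forall_eq 0 fun y => by obtain ⟨ω, rfl⟩ := hs y; exact h0 ω
  have : FiniteType A R := FiniteType.of_restrictScalars_finiteType k A R
  have hidem : IsIdempotentElem (KaehlerDifferential.ideal A R) :=
    (Ideal.cotangent_subsingleton_iff _).mp hunr
  have hnil : KaehlerDifferential.ideal A R ≤ nilradical (R ⊗[A] R) := by
    rw [← KaehlerDifferential.span_range_eq_ideal, Ideal.span_le]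
    rintro _ ⟨s, rfl⟩
    refine ⟨p, ?_⟩
    change (1 ⊗ₜ[A] s - s ⊗ₜ[A] 1) ^ p = 0
    rw [sub_pow_p k, Algebra.TensorProduct.tmul_pow, Algebra.TensorProduct.tmul_pow, one_pow,
      show s ^ p = (⟨s ^ p, hpow s⟩ : A) • (1 : R) by rw [smul_def, mul_one]; rfl,
      TensorProduct.smul_tmul, sub_self]
  have hbot : KaehlerDifferential.ideal A R = ⊥ := by
    obtain ⟨n, hn⟩ := (Ideal.FG.isNilpotent_iff_le_nilradical
      (KaehlerDifferential.ideal_fg A R)).mpr hnil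
    rcases Nat.eq_zero_or_pos n with h | h
    · subst h
      rw [pow_zero] at hn
      exact le_bot_iff.mp (le_top.trans (Ideal.one_eq_top.symm.trans hn).le)
    · rw [← hidem.pow_eq h.ne']; exact hn
  have hepi : Algebra.IsEpi A R := by
    rw [Algebra.isEpi_iff_forall_one_tmul_eq]
    intro a
    have := KaehlerDifferential.one_smul_sub_smul_one_mem_ideal A a
    rw [hbot] at this
    exact sub_eq_zero.mp this
  have : Algebra.IsIntegral A R := ⟨fun r => ⟨Polynomial.X ^ p - Polynomial.C ⟨r ^ p, hpow r⟩,
    Polynomial.monic_X_pow_sub_C _ (Fact.out : p.Prime).ne_zero, by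
      simp only [Polynomial.eval₂_sub, Polynomial.eval₂_pow, Polynomial.eval₂_X,
        Polynomial.eval₂_C]
      exact sub_self _⟩⟩
  have : Module.Finite A R := Algebra.IsIntegral.finite
  have hsurj := (Algebra.isEpi_iff_surjective_algebraMap_of_finite (R := A) (A := R)).mp hepi
  rw [eq_top_iff]
  intro r _
  obtain ⟨a, rfl⟩ := hsurj r
  exact a.2

lemma eq_C_of_derivative_eq_zero {B : Type*} [CommRing B] [Algebra k B] {q : Polynomial B}
    (hq : q.natDegree < p) (h : q.derivative = 0) : q = Polynomial.C (q.coeff 0) := by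
  ext n
  rcases n with _ | n
  · simp
  · rw [Polynomial.coeff_C_succ]
    rcases lt_or_ge (n + 1) p with hn | hn
    · have := congrArg (fun q => q.coeff n) h
      simp only [Polynomial.coeff_derivative, Polynomial.coeff_zero] at this
      have hu : ((n + 1 : ℕ) : k) ≠ 0 := by
        rw [Ne, CharP.cast_eq_zero_iff k p]
        exact Nat.not_dvd_of_pos_of_lt n.succ_pos hn
      have h2 : ((n + 1 : ℕ) : k) • q.coeff (n + 1) = 0 := by
        rw [smul_def, map_natCast, mul_comm]; push_cast; exact this
      exact (smul_eq_zero_iff_right hu).mp h2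
    · exact Polynomial.coeff_eq_zero_of_natDegree_lt (by omega)

/-- Let `d` be a derivation vanishing on `B` with `d x = 1`. A constant of `d` in `B[x]`, where
`x ^ p ∈ B`, lies in `B`. -/
lemma mem_of_derivation_eq_zero (B : Subalgebra k R) (d : Der k R) (x : R)
    (hx : x ^ p ∈ B) (hdB : ∀ b ∈ B, d b = 0) (hdx : d x = 1) {f : R}
    (hf : f ∈ adjoin B {x}) (hdf : d f = 0) : f ∈ B := by
  have hd : ∀ q : Polynomial B, d (Polynomial.aeval x q) = Polynomial.aeval x q.derivative := by
    intro q
    induction q using Polynomial.induction_on' with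
    | add p q hp hq => simp [hp, hq]
    | monomial n a =>
      rw [Polynomial.aeval_monomial, leibniz, show d (algebraMap B R a) = 0 from hdB _ a.2,
        Derivation.leibniz_pow, hdx, Polynomial.derivative_monomial, Polynomial.aeval_monomial]
      simp
      ring
  have hinj : ∀ n, ∀ q : Polynomial B, q.natDegree ≤ n → n < p → Polynomial.aeval x q = 0 → q = 0 := by
    intro n
    induction n with
    | zero =>
      intro q hq _ h
      rw [Polynomial.eq_C_of_natDegree_le_zero hq] at h ⊢
      rw [Polynomial.aeval_C] at h
      rw [show q.coeff 0 = 0 from Subtype.ext h, map_zero]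
    | succ n ih =>
      intro q hq hn h
      have h1 : q.derivative = 0 := ih _ ((Polynomial.natDegree_derivative_le q).trans (by omega))
        (by omega) (by rw [← hd, h, map_zero])
      have h2 := eq_C_of_derivative_eq_zero p (k := k) (lt_of_le_of_lt hq hn) h1
      rw [h2] at h ⊢
      rw [Polynomial.aeval_C] at h
      rw [show q.coeff 0 = 0 from Subtype.ext h, map_zero]
  obtain ⟨q, rfl⟩ := (Algebra.adjoin_singleton_eq_range_aeval B x ▸ hf : f ∈ (Polynomial.aeval x).range)
  have hp : p ≠ 0 := (Fact.out : p.Prime).ne_zero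
  rcases subsingleton_or_nontrivial R with hR | hR
  · have h0 : ∀ r : R, r ∈ B := fun r => by rw [Subsingleton.elim r 0]; exact zero_mem B
    exact h0 _
  have hm := Polynomial.monic_X_pow_sub_C (⟨x ^ p, hx⟩ : B) hp
  set q' := q %ₘ (Polynomial.X ^ p - Polynomial.C ⟨x ^ p, hx⟩) with hq'
  have hdeg : q'.natDegree < p := by
    have := Polynomial.natDegree_modByMonic_lt q hm (by
      intro h
      have := congrArg Polynomial.natDegree h
      rw [Polynomial.natDegree_X_pow_sub_C, Polynomial.natDegree_one] at this
      exact hp this)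
    rwa [Polynomial.natDegree_X_pow_sub_C] at this
  have heq : Polynomial.aeval x q = Polynomial.aeval x q' := by
    conv_lhs => rw [← Polynomial.modByMonic_add_div q (Polynomial.X ^ p - Polynomial.C ⟨x ^ p, hx⟩)]
    have h0 : x ^ p - algebraMap B R ⟨x ^ p, hx⟩ = 0 := sub_self _
    rw [map_add, map_mul, map_sub, map_pow, Polynomial.aeval_X, Polynomial.aeval_C, h0, zero_mul,
      add_zero]
  change Polynomial.aeval x q ∈ B
  change d (Polynomial.aeval x q) = 0 at hdf
  rw [heq] at hdf ⊢
  have h1 : q'.derivative = 0 := hinj (p - 1) _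
    ((Polynomial.natDegree_derivative_le q').trans (by omega)) (by omega) (by rw [← hd, hdf])
  rw [eq_C_of_derivative_eq_zero p (k := k) hdeg h1, Polynomial.aeval_C]
  exact (q'.coeff 0).2

lemma derivation_pow_p (d : Der k R) (r : R) : d (r ^ p) = 0 := by
  rw [Derivation.leibniz_pow, ← Nat.cast_smul_eq_nsmul R, natCast_p_eq_zero k p (A := R), zero_smul]

variable (k) in
/-- The common constants of the coordinate derivations are the `p`-th powers. -/
theorem exists_pow_eq_of_constant [PerfectRing k p] [FiniteType k R] {ι : Type*} [Finite ι] (x : ι → R)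
    (hx : Submodule.span R (range fun i => D k R (x i)) = ⊤)
    (d : ι → Der k R) (hd : ∀ i, d i (x i) = 1) (hd' : ∀ i j, i ≠ j → d i (x j) = 0)
    (f : R) (hf : ∀ i, d i f = 0) : ∃ g, g ^ p = f := by
  classical
  have := Fintype.ofFinite ι
  have key : ∀ s : Finset ι, f ∈ adjoin k ((pthPowers k p R : Set R) ∪ x '' s) →
      f ∈ adjoin k ((pthPowers k p R : Set R)) := by
    intro s
    induction s using Finset.induction_on with
    | empty => simp
    | insert i s hi ih =>
      intro h
      refine ih ?_
      refine mem_of_derivation_eq_zero p _ (d i) (x i) (subset_adjoin (Or.inl ⟨_, rfl⟩)) ?_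
        (hd i) ?_ (hf i)
      · intro b hb
        induction hb using Algebra.adjoin_induction with
        | mem b hb =>
          rcases hb with ⟨r, rfl⟩ | ⟨j, hj, rfl⟩
          · exact derivation_pow_p p _ _
          · exact hd' i j (by rintro rfl; exact hi hj)
        | algebraMap a => simp
        | add a b _ _ ha hb => simp [ha, hb]
        | mul a b _ _ ha hb => simp [ha, hb]
      · rw [Finset.coe_insert, Set.image_insert_eq, Set.union_insert, ← Set.singleton_union,
          Set.union_comm, Algebra.adjoin_union_eq_adjoin_adjoin] at h
        exact h
  have h := key Finset.univ (by
    rw [Finset.coe_univ, Set.image_univ, adjoin_pthPowers_eq_top k p x hx]; trivial)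
  rw [Algebra.adjoin_eq] at h
  exact h

end FrobeniusGeneration

section Jacobson

variable (p : ℕ) [Fact p.Prime] [CharP k p]
variable {S : Type u} [CommRing S] [Algebra k S]

open Polynomial in
/-- The `p`-th power of the sum of a derivation and a multiplication operator. -/
theorem derivation_add_mul_pow (d : Der k S) (m : S) :
    ((d : S →ₗ[k] S) + mulLeft k m) ^ p =
      (d : S →ₗ[k] S) ^ p + mulLeft k ((⇑d)^[p - 1] m + m ^ p) := by
  set A : Module.End k S := (d : S →ₗ[k] S) with hA
  let M : S → Module.End k S := fun s => mulLeft k s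
  have hAM : ∀ s, A * M s = M s * A + M (d s) := by
    intro s
    ext t
    simp [A, M, Module.End.mul_apply, leibniz]
    ring
  have hMM : ∀ n, M m ^ n = M (m ^ n) := fun n => LinearMap.pow_mulLeft ..
  have hMcomm : ∀ s t, M s * M t = M t * M s := by
    intro s t; ext u; simp [M, Module.End.mul_apply]; ring
  let Y : (Module.End k S)[X] := C A + C (M m) * X
  have hYM : ∀ s, Y * C (M s) = C (M s) * Y + C (M (d s)) := by
    intro s
    simp only [Y, add_mul, mul_add, mul_assoc, X_mul_C]
    rw [← C_mul, ← C_mul, hAM, C_add, ← mul_assoc, ← mul_assoc, ← C_mul, ← C_mul, hMcomm]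
    abel
  have hder : ∀ n, derivative (Y ^ n) = ∑ j ∈ Finset.range n,
      (n.choose (j + 1)) • (C (M ((⇑d)^[j] m)) * Y ^ (n - 1 - j)) := by
    intro n
    induction n with
    | zero => simp
    | succ n ih =>
      have hY' : derivative Y = C (M m) := by simp [Y]
      rw [pow_succ', derivative_mul, ih, hY', mul_sum, Finset.sum_range_succ']
      have h1 : ∀ j ∈ Finset.range n, Y * n.choose (j + 1) • (C (M ((⇑d)^[j] m)) * Y ^ (n - 1 - j))
          = n.choose (j + 1) • (C (M ((⇑d)^[j] m)) * Y ^ (n - j))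
            + n.choose (j + 1) • (C (M ((⇑d)^[j + 1] m)) * Y ^ (n - 1 - j)) := by
        intro j hj
        rw [Finset.mem_range] at hj
        rw [mul_smul_comm, ← mul_assoc, hYM, add_mul, mul_assoc, ← pow_succ',
          show n - 1 - j + 1 = n - j by omega, smul_add, Function.iterate_succ_apply']
      rw [sum_congr rfl h1, sum_add_distrib]
      have h2 : ∑ j ∈ Finset.range n, n.choose (j + 1) • (C (M ((⇑d)^[j] m)) * Y ^ (n - j)) + C (M m) * Y ^ n
          = ∑ j ∈ Finset.range n, n.choose (j + 2) • (C (M ((⇑d)^[j + 1] m)) * Y ^ (n - 1 - j))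
            + (n + 1).choose 1 • (C (M m) * Y ^ n) := by
        have h3 := Finset.sum_range_succ' (fun j => n.choose (j + 1) • (C (M ((⇑d)^[j] m)) * Y ^ (n - j))) n
        rw [Finset.sum_range_succ, Nat.choose_succ_self, zero_smul, add_zero] at h3
        rw [h3, add_assoc]
        congr 1
        · refine sum_congr rfl fun j _ => ?_
          rw [show n - (j + 1) = n - 1 - j by omega]
        · simp [add_smul]
      rw [← add_assoc, add_comm (C (M m) * Y ^ n), h2]
      have h4 : ∀ j ∈ Finset.range n, (n + 1).choose (j + 1 + 1) • (C (M ((⇑d)^[j + 1] m)) * Y ^ (n + 1 - 1 - (j + 1)))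
          = n.choose (j + 2) • (C (M ((⇑d)^[j + 1] m)) * Y ^ (n - 1 - j)) + n.choose (j + 1) • (C (M ((⇑d)^[j + 1] m)) * Y ^ (n - 1 - j)) := by
        intro j _
        rw [← add_smul, show n + 1 - 1 - (j + 1) = n - 1 - j by omega, Nat.choose_succ_succ n (j + 1),
          add_comm (n.choose _)]
      rw [sum_congr rfl h4, sum_add_distrib]
      simp only [Nat.choose_one_right, zero_add, Function.iterate_zero, id, Nat.add_sub_cancel,
        Nat.sub_zero]
      abel
  have hp : p.Prime := Fact.out
  have hcast : ((p : ℕ) : (Module.End k S)[X]) = 0 := by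
    rw [← map_natCast C, natCast_p_eq_zero k p (A := Module.End k S), map_zero]
  have hderp : derivative (Y ^ p) = C (M ((⇑d)^[p - 1] m)) := by
    rw [hder, Finset.sum_eq_single_of_mem (p - 1) (Finset.mem_range.mpr (Nat.sub_lt hp.pos one_pos))]
    · rw [Nat.sub_add_cancel hp.one_le]; simp
    · intro j hj hne
      rw [Finset.mem_range] at hj
      obtain ⟨c, hc⟩ := hp.dvd_choose_self (Nat.succ_ne_zero j) (by omega)
      rw [hc, nsmul_eq_mul, Nat.cast_mul, hcast, zero_mul, zero_mul]
  have hY1 : Y.natDegree ≤ 1 := (natDegree_add_le _ _).trans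
    (max_le (by simp) ((natDegree_C_mul_le _ _).trans natDegree_X_le))
  have hdeg : (Y ^ p).natDegree ≤ p := natDegree_pow_le.trans (by nlinarith)
  have hc0 : (Y ^ p).coeff 0 = A ^ p := by
    rw [← constantCoeff_apply, map_pow]; simp [Y]
  have hcp : (Y ^ p).coeff p = M (m ^ p) := by
    have : (Y ^ p).coeff (p * 1) = (Y.coeff 1) ^ p := coeff_pow_of_natDegree_le hY1
    rw [mul_one] at this
    rw [this, ← hMM]; simp [Y, coeff_C]
  have hcj : ∀ j, j + 1 < p → (Y ^ p).coeff (j + 1) = if j = 0 then M ((⇑d)^[p - 1] m) else 0 := by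
    intro j hj
    have h1 := congrArg (fun q => q.coeff j) hderp
    simp only [coeff_derivative, coeff_C] at h1
    split_ifs at h1 ⊢ with h
    · subst h; simpa using h1
    · have hu : ((j + 1 : ℕ) : k) ≠ 0 := by
        rw [Ne, CharP.cast_eq_zero_iff k p]
        exact Nat.not_dvd_of_pos_of_lt j.succ_pos hj
      refine (smul_eq_zero_iff_right hu).mp ?_
      rw [smul_def, Algebra.commutes, map_natCast]; push_cast; exact h1
  let ev : (Module.End k S)[X] →+* Module.End k S :=
    eval₂RingHom' (RingHom.id _) 1 fun a => Commute.one_right a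
  have hev : ev (Y ^ p) = (A + M m) ^ p := by
    rw [map_pow]; congr 1
    change eval₂ _ _ _ = _
    simp [Y]
  change (A + M m) ^ p = A ^ p + M _
  rw [show A + mulLeft k m = A + M m from rfl, ← hev]
  change eval₂ (RingHom.id _) 1 (Y ^ p) = _
  rw [eval₂_eq_sum_range' _ (Nat.lt_succ_of_le hdeg), Finset.sum_range_succ]
  simp only [RingHom.id_apply, one_pow, mul_one]
  obtain ⟨q, hq⟩ : ∃ q, p = q + 2 := ⟨p - 2, by have := hp.two_le; omega⟩
  have hsum : ∑ j ∈ Finset.range p, (Y ^ p).coeff j = A ^ p + M ((⇑d)^[p - 1] m) := by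
    rw [show Finset.range p = Finset.range (q + 1 + 1) by rw [hq], Finset.sum_range_succ',
      hc0, add_comm, sum_congr rfl (g := fun j => if j = 0 then M ((⇑d)^[p - 1] m) else 0)
      (fun j hj => hcj j (by rw [Finset.mem_range] at hj; omega)), Finset.sum_ite_eq']
    simp
  rw [hsum, hcp, add_assoc]
  congr 1
  ext t; simp [M, add_mul]

end Jacobson

/-! ## A criterion for Azumaya algebras -/

section AzumayaCriterion

variable (A : Type u) [Ring A]

/-- The ring of operators generated by the left and right multiplications. -/
def multSubring : Subring (Module.End ℤ A) :=
  Subring.closure (range (fun a : A => (mulLeft ℤ a : Module.End ℤ A)) ∪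
    range (fun a : A => (mulRight ℤ a : Module.End ℤ A)))

variable {A}

lemma mulLeft_mem (a : A) : (mulLeft ℤ a : Module.End ℤ A) ∈ multSubring A :=
  Subring.subset_closure (Or.inl ⟨a, rfl⟩)

lemma mulRight_mem (a : A) : (mulRight ℤ a : Module.End ℤ A) ∈ multSubring A :=
  Subring.subset_closure (Or.inr ⟨a, rfl⟩)

lemma neg_list_sum {ι : Type*} (l : List ι) (f : ι → A) :
    -(l.map f).sum = (l.map fun u => -f u).sum := by
  induction l with
  | nil => simp
  | cons u l ih => rw [List.map_cons, List.sum_cons, neg_add, ih, List.map_cons, List.sum_cons]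

/-- Operators `x ↦ ∑ aᵢ x bᵢ`. -/
def listOp (l : List (A × A)) (x : A) : A := (l.map fun u => u.1 * x * u.2).sum

lemma listOp_mem (l : List (A × A)) : ∃ T ∈ multSubring A, ∀ x, T x = listOp l x := by
  induction l with
  | nil => exact ⟨0, zero_mem _, fun x => rfl⟩
  | cons u l ih =>
    obtain ⟨T, hT, h⟩ := ih
    refine ⟨mulRight ℤ u.2 * mulLeft ℤ u.1 + T,
      add_mem (mul_mem (mulRight_mem _) (mulLeft_mem _)) hT, fun x => ?_⟩
    rw [LinearMap.add_apply, h]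
    simp [listOp]

lemma exists_listOp {T : Module.End ℤ A} (hT : T ∈ multSubring A) :
    ∃ l : List (A × A), ∀ x, T x = listOp l x := by
  induction hT using Subring.closure_induction with
  | mem T h =>
    rcases h with ⟨a, rfl⟩ | ⟨a, rfl⟩
    · exact ⟨[(a, 1)], fun x => by simp [listOp]⟩
    · exact ⟨[(1, a)], fun x => by simp [listOp]⟩
  | zero => exact ⟨[], fun x => rfl⟩
  | one => exact ⟨[(1, 1)], fun x => by simp [listOp]⟩
  | add S T _ _ hS hT =>
    obtain ⟨l, hl⟩ := hS
    obtain ⟨l', hl'⟩ := hT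
    exact ⟨l ++ l', fun x => by rw [LinearMap.add_apply, hl, hl']; simp [listOp]⟩
  | neg T _ hT =>
    obtain ⟨l, hl⟩ := hT
    refine ⟨l.map fun u => (-u.1, u.2), fun x => ?_⟩
    rw [LinearMap.neg_apply, hl]
    simp only [listOp, List.map_map, neg_list_sum, Function.comp_def, neg_mul]
  | mul S T _ _ hS hT =>
    obtain ⟨l, hl⟩ := hS
    obtain ⟨l', hl'⟩ := hT
    refine ⟨l.flatMap fun u => l'.map fun v => (u.1 * v.1, v.2 * u.2), fun x => ?_⟩
    rw [Module.End.mul_apply, hl', hl]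
    simp only [listOp]
    clear hl hl'
    induction l with
    | nil => simp
    | cons u l ih =>
      rw [List.map_cons, List.sum_cons, ih, List.flatMap_cons, List.map_append, List.sum_append]
      congr 1
      rw [← List.sum_map_mul_left, ← List.sum_map_mul_right, List.map_map]
      simp [Function.comp_def, mul_assoc]

variable (A) in
/-- The operators generated by `b · τ(x)`, where `τ` is a sum of two-sided multiplications with
central values. -/
def centralOps : AddSubgroup (Module.End ℤ A) :=
  AddSubgroup.closure {T | ∃ (b : A) (τ : Module.End ℤ A), τ ∈ multSubring A ∧
    (∀ a, τ a ∈ Subring.center A) ∧ T = (mulLeft ℤ b : Module.End ℤ A) * τ}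

lemma mulLeft_mul_mem_centralOps (b : A) {τ : Module.End ℤ A} (h : τ ∈ multSubring A)
    (h' : ∀ a, τ a ∈ Subring.center A) :
    (mulLeft ℤ b : Module.End ℤ A) * τ ∈ centralOps A :=
  AddSubgroup.subset_closure ⟨b, τ, h, h', rfl⟩

lemma centralOps_mul_right {T S : Module.End ℤ A} (hT : T ∈ centralOps A) (hS : S ∈ multSubring A) :
    T * S ∈ centralOps A := by
  induction hT using AddSubgroup.closure_induction with
  | mem T h =>
    obtain ⟨b, τ, h1, h2, rfl⟩ := h
    rw [mul_assoc]
    exact mulLeft_mul_mem_centralOps _ (mul_mem h1 hS) fun a => h2 _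
  | zero => rw [zero_mul]; exact zero_mem _
  | add x y _ _ hx hy => rw [add_mul]; exact add_mem hx hy
  | neg x _ hx => rw [neg_mul]; exact neg_mem hx

lemma centralOps_mul_left {T S : Module.End ℤ A} (hT : T ∈ centralOps A) (hS : S ∈ multSubring A) :
    S * T ∈ centralOps A := by
  induction hS using Subring.closure_induction generalizing T with
  | mem S h =>
    induction hT using AddSubgroup.closure_induction with
    | mem T h' =>
      obtain ⟨b, τ, h1, h2, rfl⟩ := h'
      rcases h with ⟨a, rfl⟩ | ⟨a, rfl⟩
      · have : (mulLeft ℤ a : Module.End ℤ A) *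
            ((mulLeft ℤ b : Module.End ℤ A) * τ) =
            (mulLeft ℤ (a * b) : Module.End ℤ A) * τ := by
          ext x; simp
        rw [this]
        exact mulLeft_mul_mem_centralOps _ h1 h2
      · have : (mulRight ℤ a : Module.End ℤ A) *
            ((mulLeft ℤ b : Module.End ℤ A) * τ) =
            (mulLeft ℤ (b * a) : Module.End ℤ A) * τ := by
          ext x
          have := Subring.mem_center_iff.mp (h2 x) a
          simp [mul_assoc, this]
        rw [this]
        exact mulLeft_mul_mem_centralOps _ h1 h2
    | zero => rw [mul_zero]; exact zero_mem _
    | add x y _ _ hx hy => rw [mul_add]; exact add_mem hx hy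
    | neg x _ hx => rw [mul_neg]; exact neg_mem hx
  | zero => rw [zero_mul]; exact zero_mem _
  | one => rwa [one_mul]
  | add x y _ _ hx hy => rw [add_mul]; exact add_mem (hx hT) (hy hT)
  | neg x _ hx => rw [neg_mul]; exact neg_mem (hx hT)
  | mul x y _ _ hx hy => rw [mul_assoc]; exact hx (hy hT)

lemma exists_list_of_mem_centralOps {T : Module.End ℤ A} (hT : T ∈ centralOps A) :
    ∃ l : List (A × List (A × A)), (∀ u ∈ l, ∀ a, listOp u.2 a ∈ Subring.center A) ∧
      ∀ a, T a = (l.map fun u => u.1 * listOp u.2 a).sum := by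
  induction hT using AddSubgroup.closure_induction with
  | mem T h =>
    obtain ⟨b, τ, h1, h2, rfl⟩ := h
    obtain ⟨l, hl⟩ := exists_listOp h1
    refine ⟨[(b, l)], ?_, fun a => ?_⟩
    · simpa [← hl] using h2
    · simp [← hl]
  | zero => exact ⟨[], by simp, fun a => rfl⟩
  | add x y _ _ hx hy =>
    obtain ⟨l, h, h'⟩ := hx
    obtain ⟨m, g, g'⟩ := hy
    refine ⟨l ++ m, ?_, fun a => ?_⟩
    · intro u hu
      rcases List.mem_append.mp hu with hu | hu
      exacts [h u hu, g u hu]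
    · rw [LinearMap.add_apply, h', g']; simp
  | neg x _ hx =>
    obtain ⟨l, h, h'⟩ := hx
    refine ⟨l.map fun u => (-u.1, u.2), ?_, fun a => ?_⟩
    · intro u hu
      obtain ⟨v, hv, rfl⟩ := List.mem_map.mp hu
      exact h v hv
    · rw [LinearMap.neg_apply, h']
      simp only [List.map_map, neg_list_sum, Function.comp_def, neg_mul]

lemma list_mem_centralOps (l : List (A × List (A × A)))
    (h : ∀ u ∈ l, ∀ a, listOp u.2 a ∈ Subring.center A) :
    ∃ T ∈ centralOps A, ∀ a, T a = (l.map fun u => u.1 * listOp u.2 a).sum := by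
  induction l with
  | nil => exact ⟨0, zero_mem _, fun a => rfl⟩
  | cons u l ih =>
    obtain ⟨T, hT, h'⟩ := ih fun v hv => h v (List.mem_cons_of_mem _ hv)
    obtain ⟨τ, hτ, hτ'⟩ := listOp_mem u.2
    refine ⟨_, add_mem (mulLeft_mul_mem_centralOps u.1 hτ fun a => ?_) hT, fun a => ?_⟩
    · rw [hτ']; exact h u (by simp) a
    · rw [LinearMap.add_apply, h']; simp [hτ']

/-- A certificate for `A` being Azumaya over its center: the identity is a sum of maps `b · τ(x)`
with `τ` a sum of two-sided multiplications with central values. -/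
def HasAzumayaCert (A : Type u) [Ring A] : Prop := (1 : Module.End ℤ A) ∈ centralOps A

lemma hasAzumayaCert_iff : HasAzumayaCert A ↔ ∃ l : List (A × List (A × A)),
    (∀ u ∈ l, ∀ a, listOp u.2 a ∈ Subring.center A) ∧
      ∀ a, a = (l.map fun u => u.1 * listOp u.2 a).sum := by
  constructor
  · exact fun h => exists_list_of_mem_centralOps h
  · rintro ⟨l, h, h'⟩
    obtain ⟨T, hT, hT'⟩ := list_mem_centralOps l h
    have : T = 1 := by ext a; rw [hT', ← h' a]; rfl
    rwa [this] at hT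

lemma HasAzumayaCert.ofEquiv {B : Type u} [Ring B] (e : A ≃+* B) (h : HasAzumayaCert A) :
    HasAzumayaCert B := by
  have hop : ∀ (l : List (A × A)) (b : B),
      listOp (l.map fun v => (e v.1, e v.2)) b = e (listOp l (e.symm b)) := by
    intro l b
    simp only [listOp, List.map_map, map_list_sum, Function.comp_def, map_mul,
      RingEquiv.apply_symm_apply]
  rw [hasAzumayaCert_iff] at h ⊢
  obtain ⟨l, h1, h2⟩ := h
  refine ⟨l.map fun u => (e u.1, u.2.map fun v => (e v.1, e v.2)), ?_, fun b => ?_⟩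
  · intro u hu b
    obtain ⟨v, hv, rfl⟩ := List.mem_map.mp hu
    rw [hop, Subring.mem_center_iff]
    intro g
    have := Subring.mem_center_iff.mp (h1 v hv (e.symm b)) (e.symm g)
    have := congrArg e this
    simpa using this
  · conv_lhs => rw [← e.apply_symm_apply b, h2 (e.symm b), map_list_sum]
    simp only [List.map_map, Function.comp_def, hop, map_mul]

theorem isAzumayaVia_of_cert {k Z D : Type u} [Field k] [CommRing Z] [Ring D] [Algebra k Z]
    [Algebra k D] (φ : Z →ₐ[k] D) (hφ : IsIsoOntoCenter φ) (hD : HasAzumayaCert D) :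
    IsAzumayaVia φ := by
  obtain ⟨hinj, hrange⟩ := hφ
  have hcen : ∀ a x, φ a * x = x * φ a := fun a x => by
    have : φ a ∈ Subalgebra.center k D := hrange ▸ ⟨a, rfl⟩
    exact (mem_center_iff.mp this x).symm
  refine ⟨hcen, ?_⟩
  let : Algebra Z D := φ.toRingHom.toAlgebra' hcen
  have hsm : ∀ (z : Z) (d : D), z • d = φ z * d := fun z d => smul_def z d
  obtain ⟨l, h1, h2⟩ := hasAzumayaCert_iff.mp hD
  have hval : ∀ (i : Fin l.length) (a : D), ∃ z, φ z = listOp (l.get i).2 a := by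
    intro i a
    have := h1 (l.get i) (List.get_mem _ _) a
    have : listOp (l.get i).2 a ∈ Subalgebra.center k D := this
    rw [← hrange] at this
    exact this
  choose t ht using hval
  have hop_add : ∀ (m : List (D × D)) (a b : D), listOp m (a + b) = listOp m a + listOp m b := by
    intro m a b
    obtain ⟨T, -, hT⟩ := listOp_mem m
    rw [← hT, ← hT, ← hT, map_add]
  have hop_smul : ∀ (m : List (D × D)) (z : Z) (a : D), listOp m (φ z * a) = φ z * listOp m a := by
    intro m z a
    simp only [listOp]
    rw [← List.sum_map_mul_left]
    congr 1
    refine List.map_congr_left fun u _ => ?_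
    rw [← mul_assoc, ← hcen, mul_assoc, mul_assoc, mul_assoc]
  let τ : Fin l.length → D →ₗ[Z] Z := fun i =>
    { toFun := t i
      map_add' := fun a b => hinj (by rw [map_add, ht, ht, ht, hop_add])
      map_smul' := fun z a => hinj (by
        rw [RingHom.id_apply, smul_eq_mul, map_mul, ht, ht, hsm, hop_smul]) }
  let b : Fin l.length → D := fun i => (l.get i).1
  have hid : ∀ a, a = ∑ i, b i * φ (τ i a) := by
    intro a
    conv_lhs => rw [h2 a]
    rw [← List.sum_ofFn]
    congr 1
    refine List.ext_get (by simp) fun n h h' => ?_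
    simp [b, τ, ht]
  let s : (Fin l.length → Z) →ₗ[Z] D := Fintype.linearCombination Z b
  have hs : s ∘ₗ LinearMap.pi τ = LinearMap.id := by
    ext a
    simp only [s, LinearMap.comp_apply, Fintype.linearCombination_apply, LinearMap.pi_apply,
      LinearMap.id_apply]
    conv_rhs => rw [hid a]
    exact sum_congr rfl fun i _ => by rw [hsm, hcen]
  have hproj : Module.Projective Z D := Module.Projective.of_split (LinearMap.pi τ) s hs
  have hfin : Module.Finite Z D := Module.Finite.of_surjective s fun a =>
    ⟨LinearMap.pi τ a, LinearMap.congr_fun hs a⟩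
  have hmem : ∀ m : List (D × D), ∃ e : D ⊗[Z] Dᵐᵒᵖ, ∀ a, AlgHom.mulLeftRight Z D e a = listOp m a := by
    intro m
    induction m with
    | nil => exact ⟨0, fun a => by simp [listOp]⟩
    | cons u m ih =>
      obtain ⟨e, he⟩ := ih
      exact ⟨u.1 ⊗ₜ MulOpposite.op u.2 + e, fun a => by
        rw [map_add, LinearMap.add_apply, he]; simp [listOp]⟩
  refine { hproj, hfin with
    eq_of_smul_eq_smul := fun {z z'} h => hinj (by simpa [hsm] using h 1)
    bij := ⟨?_, ?_⟩ }
  · rw [injective_iff_map_eq_zero]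
    intro x hx
    let g : List (D × D) → Module.End Z D → D := fun m T => (m.map fun u => T u.1 * u.2).sum
    have hg : ∀ m T T', g m (T + T') = g m T + g m T' := by
      intro m T T'
      simp only [g, LinearMap.add_apply, add_mul, List.sum_map_add]
    have key : x = ∑ i : Fin l.length,
        g (l.get i).2 (AlgHom.mulLeftRight Z D x) ⊗ₜ[Z] MulOpposite.op (b i) := by
      clear hx
      induction x using TensorProduct.induction_on with
      | zero => simp [g]
      | add x y hx hy =>
        simp only [map_add, hg, TensorProduct.add_tmul, sum_add_distrib]
        rw [← hx, ← hy]
      | tmul u v =>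
        have hv : v = ∑ i, τ i v.unop • MulOpposite.op (b i) := by
          apply MulOpposite.unop_injective
          conv_lhs => rw [hid v.unop]
          refine Eq.trans ?_ (map_sum (MulOpposite.opAddEquiv (α := D)).symm _ _).symm
          exact sum_congr rfl fun i _ => by
            change _ = τ i v.unop • b i
            rw [hsm, hcen]
        conv_lhs => rw [hv, TensorProduct.tmul_sum]
        refine sum_congr rfl fun i _ => ?_
        rw [← TensorProduct.smul_tmul, hsm, hcen]
        congr 1
        simp only [τ, LinearMap.coe_mk, AddHom.coe_mk, ht, g, listOp, AlgHom.mulLeftRight_apply]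
        rw [← List.sum_map_mul_left]
        simp [mul_assoc]
    rw [key, hx]
    simp [g]
  · intro T
    choose e he using fun i : Fin l.length => hmem (l.get i).2
    refine ⟨∑ i, (T (b i) ⊗ₜ 1) * e i, ?_⟩
    ext a
    rw [map_sum, LinearMap.sum_apply]
    conv_rhs => rw [hid a, map_sum]
    refine sum_congr rfl fun i _ => ?_
    rw [← hcen, ← hsm, map_smul, hsm, hcen, map_mul, Module.End.mul_apply, he]
    simp [τ, ht]

section Weyl

variable {A : Type u} [Ring A]

lemma centralOps_of_nsmul (k : Type u) [Field k] (p : ℕ) [Fact p.Prime] [CharP k p] [Algebra k A]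
    {T : Module.End ℤ A} {j : ℕ} (hj : 0 < j) (hjp : j < p)
    (h : (j : Module.End ℤ A) * T ∈ centralOps A) : T ∈ centralOps A := by
  have hp : p.Prime := Fact.out
  have hcop : Nat.Coprime j p := (Nat.coprime_of_lt_prime hj.ne' hjp hp).symm
  have hpT : (p : ℤ) • T = 0 := by
    ext a
    change (p : ℤ) • (T a) = 0
    rw [natCast_zsmul, nsmul_eq_mul, natCast_p_eq_zero k p, zero_mul]
  have hb := Nat.gcd_eq_gcd_ab j p
  rw [hcop] at hb
  have : T = (Nat.gcdA j p) • ((j : Module.End ℤ A) * T) := by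
    conv_lhs => rw [← one_smul ℤ T, show (1 : ℤ) = ((1 : ℕ) : ℤ) from rfl, hb, add_smul, mul_comm (p : ℤ),
      mul_smul _ (p : ℤ), hpT, smul_zero, add_zero, mul_comm, mul_smul]
    rw [natCast_zsmul, nsmul_eq_mul]
  rw [this]
  exact zsmul_mem h _

lemma centralOps_step (k : Type u) [Field k] (p : ℕ) [Fact p.Prime] [CharP k p] [Algebra k A]
    {d y G : Module.End ℤ A} (hd : d ∈ multSubring A) (hy : y ∈ multSubring A)
    (hdy : d * y = y * d + 1) (hdG : d * G = G * d) (hyG : y * G = G * y)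
    (h : d ^ (p - 1) * y ^ (p - 1) * G ∈ centralOps A) : G ∈ centralOps A := by
  have hp : p.Prime := Fact.out
  have hdj : ∀ j : ℕ, d ^ (j + 1) * y = y * d ^ (j + 1) + ((j + 1 : ℕ) : Module.End ℤ A) * d ^ j := by
    intro j
    induction j with
    | zero => simp [hdy]
    | succ j ih =>
      rw [pow_succ', mul_assoc, ih, mul_add, ← mul_assoc, hdy, add_mul, one_mul, mul_assoc,
        ← pow_succ', ← mul_assoc d, ← Nat.cast_comm, mul_assoc _ d, ← pow_succ']
      rw [Nat.cast_succ (j + 1), add_mul _ (1 : Module.End ℤ A), one_mul]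
      abel
  have hyj : ∀ j : ℕ, d * y ^ (j + 1) = y ^ (j + 1) * d + ((j + 1 : ℕ) : Module.End ℤ A) * y ^ j := by
    intro j
    induction j with
    | zero => simp [hdy]
    | succ j ih =>
      rw [pow_succ, ← mul_assoc, ih, add_mul, mul_assoc, hdy, mul_add, mul_one, ← mul_assoc,
        ← pow_succ, mul_assoc _ _ y, ← pow_succ]
      rw [Nat.cast_succ (j + 1), add_mul _ (1 : Module.End ℤ A), one_mul]
      abel
  have hdesc : ∀ F : ℕ → Module.End ℤ A, F (p - 1) ∈ centralOps A →
      (∀ j, F (j + 1) ∈ centralOps A → ((j + 1 : ℕ) : Module.End ℤ A) * F j ∈ centralOps A) →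
      F 0 ∈ centralOps A := by
    intro F h0 hF
    have : ∀ i, i ≤ p - 1 → F (p - 1 - i) ∈ centralOps A := by
      intro i
      induction i with
      | zero => exact fun _ => h0
      | succ i ih =>
        intro hi
        refine centralOps_of_nsmul k p (j := p - 1 - i) (by omega) (by omega) ?_
        rw [show p - 1 - i = p - 1 - (i + 1) + 1 by omega] at ih ⊢
        exact hF _ (ih (by omega))
    simpa using this (p - 1) le_rfl
  have h1 := hdesc (fun j => d ^ j * y ^ (p - 1) * G) h fun j h0 => by
    convert sub_mem (centralOps_mul_right h0 hy) (centralOps_mul_left h0 hy) using 1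
    rw [mul_assoc (d ^ (j + 1) * y ^ (p - 1)) G y, ← hyG, mul_assoc (d ^ (j + 1)),
      ← mul_assoc (y ^ (p - 1)) y, ← pow_succ, pow_succ' y (p - 1), mul_assoc y (y ^ (p - 1)) G,
      ← mul_assoc (d ^ (j + 1)) y, hdj, add_mul]
    simp only [mul_assoc]
    abel
  have h2 := hdesc (fun j => y ^ j * G) (by simpa using h1) fun j h0 => by
    convert sub_mem (centralOps_mul_left h0 hd) (centralOps_mul_right h0 hd) using 1
    rw [← mul_assoc d, hyj, add_mul, mul_assoc (y ^ (j + 1)) G d, ← hdG]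
    simp only [mul_assoc]
    abel
  simpa using h2

/-- A ring with commuting Weyl pairs of two-sided multiplication operators `d i`, `y i`, with
`d i ^ p = 0` and common kernel of the `d i` central, has an Azumaya certificate. -/
theorem hasAzumayaCert_of_weyl (k : Type u) [Field k] (p : ℕ) [Fact p.Prime] [CharP k p] [Algebra k A]
    {ι : Type*} [Finite ι] (d y : ι → Module.End ℤ A)
    (hd : ∀ i, d i ∈ multSubring A) (hy : ∀ i, y i ∈ multSubring A)
    (hdy : ∀ i, d i * y i = y i * d i + 1) (hdd : ∀ i j, Commute (d i) (d j))
    (hyy : ∀ i j, Commute (y i) (y j)) (hdy' : ∀ i j, i ≠ j → Commute (d i) (y j))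
    (hdp : ∀ i, d i ^ p = 0) (hker : ∀ a, (∀ i, d i a = 0) → a ∈ Subring.center A) :
    HasAzumayaCert A := by
  classical
  have := Fintype.ofFinite ι
  have hp : p.Prime := Fact.out
  let P : ι → Module.End ℤ A := fun i => d i ^ (p - 1) * y i ^ (p - 1)
  have hPm : ∀ i, P i ∈ multSubring A := fun i => mul_mem (pow_mem (hd i) _) (pow_mem (hy i) _)
  have hdP : ∀ i j, i ≠ j → Commute (d i) (P j) := fun i j h =>
    ((hdd i j).pow_right _).mul_right ((hdy' i j h).pow_right _)
  have hyP : ∀ i j, i ≠ j → Commute (y i) (P j) := fun i j h =>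
    ((hdy' j i h.symm).symm.pow_right _).mul_right ((hyy i j).pow_right _)
  have hdPi : ∀ i, d i * P i = 0 := fun i => by
    change d i * (d i ^ (p - 1) * _) = 0
    rw [← mul_assoc, ← pow_succ', Nat.sub_add_cancel hp.one_le, hdp, zero_mul]
  have hstep : ∀ l : List ι, l.Nodup → (l.map P).prod ∈ centralOps A → (1 : Module.End ℤ A) ∈ centralOps A := by
    intro l
    induction l with
    | nil => intro _ h; simpa using h
    | cons i l ih =>
      intro hnd h
      rw [List.nodup_cons] at hnd
      refine ih hnd.2 (centralOps_step k p (hd i) (hy i) (hdy i) ?_ ?_ ?_)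
      · exact Commute.list_prod_right _ _ fun T hT => by
          obtain ⟨j, hj, rfl⟩ := List.mem_map.mp hT
          exact hdP i j (by rintro rfl; exact hnd.1 hj)
      · exact Commute.list_prod_right _ _ fun T hT => by
          obtain ⟨j, hj, rfl⟩ := List.mem_map.mp hT
          exact hyP i j (by rintro rfl; exact hnd.1 hj)
      · rwa [List.map_cons, List.prod_cons] at h
  have hkill : ∀ l : List ι, l.Nodup → ∀ i ∈ l, d i * (l.map P).prod = 0 := by
    intro l
    induction l with
    | nil => intro _ i hi; simp at hi
    | cons j l ih =>
      intro hnd i hi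
      rw [List.nodup_cons] at hnd
      rw [List.map_cons, List.prod_cons, ← mul_assoc]
      by_cases h : i = j
      · subst h; rw [hdPi, zero_mul]
      · rw [(hdP i j h).eq, mul_assoc, ih hnd.2 i (by simpa [h] using hi), mul_zero]
  refine hstep Finset.univ.toList (Finset.nodup_toList _) ?_
  have hG : ((Finset.univ.toList : List ι).map P).prod ∈ multSubring A :=
    list_prod_mem fun T hT => by
      obtain ⟨j, hj, rfl⟩ := List.mem_map.mp hT
      exact hPm j
  have h1 : (mulLeft ℤ (1 : A) : Module.End ℤ A) = 1 := by ext; simp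
  rw [← one_mul (List.prod _), ← h1]
  refine mulLeft_mul_mem_centralOps _ hG fun a => hker _ fun i => ?_
  exact DFunLike.congr_fun (hkill _ (Finset.nodup_toList _) i (by simp)) a

end Weyl

end AzumayaCriterion

open TDO.CrysDiff (vf vf_smul)

/-! ## Derivations acting on coefficients -/

section CoefDer

variable {R : Type u} [CommRing R] [Algebra k R] {J : Type*}

open MvPolynomial

variable (k R) in
/-- A polynomial over `R` is a sum of products of elements of `R` and polynomials over `k`. -/
lemma mv_induction {motive : MvPolynomial J R → Prop}
    (mul : ∀ (r : R) (g : MvPolynomial J k), motive (C r * map (algebraMap k R) g))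
    (add : ∀ a b, motive a → motive b → motive (a + b)) (q : MvPolynomial J R) : motive q := by
  induction q using MvPolynomial.induction_on' with
  | monomial α r =>
    have := mul r (monomial α 1)
    rwa [map_monomial, map_one, C_mul_monomial, mul_one] at this
  | add a b ha hb => exact add _ _ ha hb

/-- The action of a linear endomorphism on the coefficients of a polynomial. -/
def coefMap (d : R →ₗ[k] R) : MvPolynomial J R →ₗ[k] MvPolynomial J R :=
  ((algebraTensorAlgEquiv k R (σ := J)).restrictScalars k).toLinearMap ∘ₗ
    LinearMap.rTensor (MvPolynomial J k) d ∘ₗ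
    ((algebraTensorAlgEquiv k R (σ := J)).restrictScalars k).symm.toLinearMap

lemma algebraTensor_symm_C_mul_map (r : R) (g : MvPolynomial J k) :
    (algebraTensorAlgEquiv k R (σ := J)).symm (C r * map (algebraMap k R) g) = r ⊗ₜ g := by
  rw [AlgEquiv.symm_apply_eq, algebraTensorAlgEquiv_tmul, smul_eq_C_mul]

lemma coefMap_C_mul_map (d : R →ₗ[k] R) (r : R) (g : MvPolynomial J k) :
    coefMap d (C r * map (algebraMap k R) g) = C (d r) * map (algebraMap k R) g := by
  change algebraTensorAlgEquiv k R (LinearMap.rTensor (MvPolynomial J k) d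
    ((algebraTensorAlgEquiv k R).symm _)) = _
  rw [algebraTensor_symm_C_mul_map, LinearMap.rTensor_tmul, algebraTensorAlgEquiv_tmul,
    smul_eq_C_mul]

lemma coeff_coefMap (d : R →ₗ[k] R) (q : MvPolynomial J R) (α : J →₀ ℕ) :
    coeff α (coefMap d q) = d (coeff α q) := by
  induction q using mv_induction k R with
  | mul r g =>
    rw [coefMap_C_mul_map, coeff_C_mul, coeff_C_mul, coeff_map, mul_comm, mul_comm r,
      ← smul_def, ← smul_def, map_smul]
  | add a b ha hb => rw [map_add, coeff_add, coeff_add, map_add, ha, hb]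

/-- The derivation of a polynomial ring given by a derivation of the coefficients. -/
def coefDer (d : Der k R) : Derivation k (MvPolynomial J R) (MvPolynomial J R) :=
  Derivation.mk' (coefMap (d : R →ₗ[k] R)) fun a b => by
    induction a using mv_induction k R with
    | add a a' ha ha' => simp only [add_mul, map_add, ha, ha', add_smul, smul_add]; ring
    | mul r g =>
      induction b using mv_induction k R with
      | add a a' ha ha' => simp only [mul_add, map_add, ha, ha', add_smul, smul_add]; ring
      | mul s g' =>
        rw [show C r * map (algebraMap k R) g * (C s * map (algebraMap k R) g') =
          C (r * s) * map (algebraMap k R) (g * g') by rw [C_mul, map_mul]; ring,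
          coefMap_C_mul_map, coefMap_C_mul_map, coefMap_C_mul_map]
        simp only [smul_eq_mul, Derivation.coeFn_coe, leibniz, map_add, map_mul]
        ring

lemma coefDer_C_mul_map (d : Der k R) (r : R) (g : MvPolynomial J k) :
    coefDer d (C r * map (algebraMap k R) g) = C (d r) * map (algebraMap k R) g :=
  coefMap_C_mul_map _ r g

lemma coeff_coefDer (d : Der k R) (q : MvPolynomial J R) (α : J →₀ ℕ) :
    coeff α (coefDer d q) = d (coeff α q) := coeff_coefMap _ q α

@[simp] lemma coefDer_C (d : Der k R) (r : R) : coefDer d (C r : MvPolynomial J R) = C (d r) := by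
  simpa using coefDer_C_mul_map d r (1 : MvPolynomial J k)

@[simp] lemma coefDer_X (d : Der k R) (j : J) : coefDer d (X j : MvPolynomial J R) = 0 := by
  have := coefDer_C_mul_map d 1 (X j : MvPolynomial J k)
  simpa using this

end CoefDer

/-! ## Rings of operators with polynomial symbols -/

/-- A ring `A` of operators over `R`, with commuting generators `D_j` satisfying
`[D_j, r] = ∂_j(r) h`. -/
structure OreData (k R A : Type u) [Field k] [CommRing R] [Algebra k R] [Ring A] [Algebra k A]
    (J : Type*) where
  /-- functions -/
  ι : R →ₐ[k] A
  /-- polynomials in the `D_j` -/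
  m : MvPolynomial J k →ₐ[k] A
  /-- the derivations -/
  der : J → Der k R
  /-- the parameter -/
  h : MvPolynomial J k
  rel : ∀ j r, m (MvPolynomial.X j) * ι r = ι r * m (MvPolynomial.X j) + ι (der j r) * m h

namespace OreData

open MvPolynomial

variable {k R A : Type u} [Field k] [CommRing R] [Algebra k R] [Ring A] [Algebra k A]
  {J : Type*} (O : OreData k R A J)

/-- The operator with a given (left normally ordered) symbol. -/
def op : MvPolynomial J R →ₗ[k] A :=
  TensorProduct.lift ((LinearMap.mul k A).compl₁₂ O.ι.toLinearMap O.m.toLinearMap) ∘ₗ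
    ((algebraTensorAlgEquiv k R (σ := J)).restrictScalars k).symm.toLinearMap

lemma op_C_mul_map (r : R) (g : MvPolynomial J k) :
    O.op (C r * map (algebraMap k R) g) = O.ι r * O.m g := by
  change TensorProduct.lift _ ((algebraTensorAlgEquiv k R).symm _) = _
  rw [algebraTensor_symm_C_mul_map]
  rfl

@[simp] lemma op_C (r : R) : O.op (C r) = O.ι r := by
  simpa using O.op_C_mul_map r 1

@[simp] lemma op_map (g : MvPolynomial J k) : O.op (map (algebraMap k R) g) = O.m g := by
  simpa using O.op_C_mul_map 1 g

@[simp] lemma op_X (j : J) : O.op (X j) = O.m (X j) := by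
  simpa using O.op_map (X j)

lemma op_C_mul (r : R) (q : MvPolynomial J R) : O.op (C r * q) = O.ι r * O.op q := by
  induction q using mv_induction k R with
  | mul s g => rw [← mul_assoc, ← C_mul, op_C_mul_map, op_C_mul_map, map_mul, mul_assoc]
  | add a b ha hb => rw [mul_add, map_add, map_add, ha, hb, mul_add]

lemma op_mul_map (q : MvPolynomial J R) (g : MvPolynomial J k) :
    O.op (q * map (algebraMap k R) g) = O.op q * O.m g := by
  induction q using mv_induction k R with
  | mul s g => rw [mul_assoc, ← map_mul, op_C_mul_map, op_C_mul_map, map_mul, mul_assoc]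
  | add a b ha hb => rw [add_mul, map_add, map_add, ha, hb, add_mul]

lemma X_mul_op (j : J) (q : MvPolynomial J R) :
    O.m (X j) * O.op q = O.op (q * X j + coefDer (O.der j) q * MvPolynomial.map (algebraMap k R) O.h) := by
  induction q using mv_induction k R with
  | mul s g =>
    have e1 : O.op (C s * MvPolynomial.map (algebraMap k R) g * X j) = O.ι s * O.m g * O.m (X j) := by
      rw [← map_X (algebraMap k R), op_mul_map, op_C_mul_map]
    have e2 : O.op (C (O.der j s) * MvPolynomial.map (algebraMap k R) g *
        MvPolynomial.map (algebraMap k R) O.h) = O.ι (O.der j s) * O.m g * O.m O.h := by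
      rw [op_mul_map, op_C_mul_map]
    rw [coefDer_C_mul_map, op_C_mul_map, ← mul_assoc, O.rel, map_add, e1, e2, add_mul]
    simp only [mul_assoc, ← map_mul O.m]
    rw [mul_comm (X j), mul_comm O.h]
  | add a b ha hb =>
    rw [map_add, mul_add, ha, hb, ← map_add, map_add (coefDer _)]
    congr 1
    ring

lemma m_mul_coord [DecidableEq J] {x : R} {i : J} (hx : ∀ j, O.der j x = if j = i then 1 else 0)
    (g : MvPolynomial J k) : O.m g * O.ι x = O.ι x * O.m g + O.m (pderiv i g * O.h) := by
  induction g using MvPolynomial.induction_on with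
  | C a => rw [pderiv_C, zero_mul, map_zero, add_zero, ← algebraMap_eq, commutes,
      Algebra.commutes]
  | add a b ha hb => rw [map_add, add_mul, ha, hb, map_add (pderiv i), add_mul, map_add, mul_add]; abel
  | mul_X g j hg =>
    rw [map_mul, mul_assoc, O.rel, mul_add, ← mul_assoc, hg, hx, add_mul, pderiv_mul, pderiv_X]
    simp only [Pi.single_apply]
    have hm : ∀ a b : MvPolynomial J k, O.m a * O.m b = O.m (a * b) := fun a b => (map_mul O.m a b).symm
    have h0 : ∀ b : MvPolynomial J k, O.ι 0 * O.m b = 0 := fun b => by rw [map_zero, zero_mul]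
    split_ifs with h
    · rw [map_one, one_mul, mul_assoc, hm, hm, hm, add_assoc, ← map_add]
      congr 2
      ring
    · rw [mul_assoc, hm, hm, h0, mul_zero, add_zero]
      congr 2
      ring

lemma op_mul_coord [DecidableEq J] {x : R} {i : J} (hx : ∀ j, O.der j x = if j = i then 1 else 0)
    (q : MvPolynomial J R) :
    O.op q * O.ι x = O.ι x * O.op q + O.op (pderiv i q * map (algebraMap k R) O.h) := by
  induction q using mv_induction k R with
  | mul s g =>
    rw [op_C_mul_map, mul_assoc, O.m_mul_coord hx, pderiv_C_mul, pderiv_map, mul_assoc, ← map_mul,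
      op_C_mul_map, mul_add, ← mul_assoc, ← mul_assoc, ← map_mul, ← map_mul, mul_comm s]
  | add a b ha hb => simp only [map_add, add_mul, ha, hb, mul_add]; abel



/-- An operator commuting with the coordinates and with the `D_j` is a combination of products of
`p`-th powers of functions, `p`-th powers of the `D_j`, and those `D_j` that do not correspond to
coordinates. -/
theorem mem_of_commute (p : ℕ) [Fact p.Prime] [CharP k p] {I : Type*} [DecidableEq J] (e : I → J)
    (x : I → R) (hx : ∀ i j, O.der j (x i) = if j = e i then 1 else 0)
    (hconst : ∀ r, (∀ j, O.der j r = 0) → ∃ s, s ^ p = r)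
    (hh : ∀ q : MvPolynomial J R, q * map (algebraMap k R) O.h = 0 → q = 0)
    (hinj : Function.Injective O.op)
    (S : Subalgebra k A) (h1 : ∀ r, O.ι r ^ p ∈ S)
    (h2 : ∀ i, O.m (X (e i)) ^ p ∈ S) (h3 : ∀ j, j ∉ range e → O.m (X j) ∈ S)
    (q : MvPolynomial J R) (hq : ∀ j, O.m (X j) * O.op q = O.op q * O.m (X j))
    (hq' : ∀ i, O.op q * O.ι (x i) = O.ι (x i) * O.op q) : O.op q ∈ S := by
  have hc : ∀ j, coefDer (O.der j) q = 0 := fun j => by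
    have := hq j
    rw [X_mul_op, ← op_mul_map, map_X] at this
    exact hh _ (by simpa using hinj this)
  have hd : ∀ i, pderiv (e i) q = 0 := fun i => by
    have := hq' i
    rw [O.op_mul_coord (hx i), add_eq_left] at this
    exact hh _ (hinj (by rw [this, map_zero]))
  have hcoef : ∀ α, ∃ s, s ^ p = coeff α q := fun α => hconst _ fun j => by
    rw [← coeff_coefDer, hc, coeff_zero]
  have hexp : ∀ α ∈ q.support, ∀ i, p ∣ α (e i) := by
    intro α hα i
    rw [mem_support_iff] at hα
    by_contra hdvd
    obtain ⟨n, hn⟩ : ∃ n, α (e i) = n + 1 := ⟨α (e i) - 1, by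
      have : α (e i) ≠ 0 := by rintro h; simp [h] at hdvd
      omega⟩
    have hle : Finsupp.single (e i) 1 ≤ α := by
      rw [Finsupp.single_le_iff]; omega
    have := coeff_pderiv q (i := e i) (α - Finsupp.single (e i) 1)
    rw [hd, coeff_zero, tsub_add_cancel_of_le hle] at this
    have hcast : ((α (e i) : ℕ) : R) = algebraMap k R ((α (e i) : ℕ) : k) := by simp
    have hne : ((α (e i) : ℕ) : k) ≠ 0 := by
      rwa [Ne, CharP.cast_eq_zero_iff k p]
    have h0 : coeff α q * ((α (e i) : ℕ) : R) = 0 := by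
      rw [this]
      simp [hn]
    rw [hcast] at h0
    exact hα (((IsUnit.mk0 _ hne).map (algebraMap k R)).mul_left_eq_zero.mp h0)
  have hmon : ∀ α : J →₀ ℕ, (∀ i, p ∣ α (e i)) → O.m (monomial α 1) ∈ S := by
    intro α hα
    change monomial α 1 ∈ S.comap O.m
    rw [monomial_eq, C_1, one_mul, Finsupp.prod]
    refine prod_mem fun j _ => ?_
    by_cases hj : j ∈ range e
    · obtain ⟨i, rfl⟩ := hj
      obtain ⟨n, hn⟩ := hα i
      rw [hn, pow_mul]
      exact pow_mem (Subalgebra.mem_comap S O.m _ |>.mpr (by rw [map_pow]; exact h2 i)) n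
    · exact pow_mem (Subalgebra.mem_comap S O.m _ |>.mpr (h3 j hj)) _
  rw [← MvPolynomial.support_sum_monomial_coeff q, map_sum]
  refine sum_mem fun α hα => ?_
  obtain ⟨s, hs⟩ := hcoef α
  have := O.op_C_mul_map (coeff α q) (monomial α 1)
  rw [map_monomial, map_one, C_mul_monomial, mul_one] at this
  rw [this, ← hs, map_pow]
  exact mul_mem (h1 s) (hmon α (hexp α hα))


/-- The Frobenius-type homomorphism to a ring of operators, with values in the center, is
injective. -/
theorem eq_zero_of_frobenius (p : ℕ) [Fact p.Prime] {I : Type*} (e : I → J)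
    (hred : ∀ r : R, r ^ p = 0 → r = 0) (hinj : Function.Injective O.op)
    (F : MvPolynomial J R →+* A) (hC : ∀ r, F (C r) = O.ι r ^ p)
    (hX : ∀ i, F (X (e i)) = O.m (X (e i)) ^ p) (hX' : ∀ j, j ∉ range e → F (X j) = O.m (X j))
    (P : MvPolynomial J R) (hP : F P = 0) : P = 0 := by
  classical
  have hp : p.Prime := Fact.out
  let s : (J →₀ ℕ) → (J →₀ ℕ) := fun α => α + Finsupp.filter (· ∈ range e) ((p - 1) • α)
  have hs : ∀ α j, s α j = if j ∈ range e then p * α j else α j := by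
    intro α j
    obtain ⟨n, rfl⟩ : ∃ n, p = n + 1 := ⟨p - 1, by have := hp.pos; omega⟩
    simp only [s, Finsupp.add_apply, Finsupp.filter_apply]
    split_ifs
    · simp; ring
    · rw [add_zero]
  have hsinj : Function.Injective s := by
    intro α β h
    ext j
    have := DFunLike.congr_fun h j
    rw [hs, hs] at this
    split_ifs at this
    · exact Nat.eq_of_mul_eq_mul_left hp.pos this
    · exact this
  have hmon : ∀ α : J →₀ ℕ, F (monomial α 1) = O.m (monomial (s α) 1) := by
    intro α
    induction α using Finsupp.induction_linear with
    | zero =>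
      have : s 0 = 0 := by ext j; rw [hs]; simp
      rw [this]; simp [monomial_zero']
    | add α β hα hβ =>
      have : s (α + β) = s α + s β := by
        ext j
        rw [hs, Finsupp.add_apply, Finsupp.add_apply, hs, hs]
        split_ifs <;> ring
      rw [this, show monomial (α + β) (1 : R) = monomial α 1 * monomial β 1 by
        rw [monomial_mul, one_mul], show monomial (s α + s β) (1 : k) =
        monomial (s α) 1 * monomial (s β) 1 by rw [monomial_mul, one_mul], map_mul, map_mul, hα, hβ]
    | single j n =>
      by_cases hj : j ∈ range e
      · have : s (Finsupp.single j n) = Finsupp.single j (p * n) := by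
          ext j'
          rw [hs, Finsupp.single_apply, Finsupp.single_apply]
          split_ifs with h1 h2 h2 <;> simp_all
        obtain ⟨i, rfl⟩ := hj
        rw [this, ← X_pow_eq_monomial, ← X_pow_eq_monomial, map_pow, map_pow, hX, pow_mul]
      · have : s (Finsupp.single j n) = Finsupp.single j n := by
          ext j'
          rw [hs, Finsupp.single_apply]
          split_ifs with h1 h2 h2 <;> simp_all
        rw [this, ← X_pow_eq_monomial, ← X_pow_eq_monomial, map_pow, map_pow, hX' j hj]
  have hop : ∀ α r, F (monomial α r) = O.op (monomial (s α) (r ^ p)) := by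
    intro α r
    have h := O.op_C_mul_map (r ^ p) (monomial (s α) 1)
    rw [map_monomial, map_one, C_mul_monomial, mul_one] at h
    rw [h, ← hmon, map_pow, ← hC, ← map_mul, C_mul_monomial, mul_one]
  have hsum : F P = O.op (∑ α ∈ P.support, monomial (s α) (coeff α P ^ p)) := by
    conv_lhs => rw [← MvPolynomial.support_sum_monomial_coeff P]
    rw [map_sum, map_sum]
    exact sum_congr rfl fun α _ => hop _ _
  rw [hsum] at hP
  have h0 := hinj (hP.trans (map_zero O.op).symm)
  ext β
  rw [coeff_zero]
  by_contra hβ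
  have := congrArg (coeff (s β)) h0
  rw [coeff_sum, Finset.sum_eq_single β, coeff_monomial, if_pos rfl, coeff_zero] at this
  · exact hβ (hred _ this)
  · intro α _ hα
    rw [coeff_monomial, if_neg (fun h => hα (hsinj h))]
  · intro h
    rw [notMem_support_iff.mp h, zero_pow hp.ne_zero, monomial_zero, coeff_zero]

end OreData

section AdPow

variable {A : Type u} [Ring A]

lemma ad_pow (k : Type u) [Field k] (p : ℕ) [Fact p.Prime] [CharP k p] [Algebra k A] (a : A) :
    (mulLeft ℤ a - mulRight ℤ a : Module.End ℤ A) ^ p =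
      mulLeft ℤ (a ^ p) - mulRight ℤ (a ^ p) := by
  have hc : Commute (mulLeft ℤ a : Module.End ℤ A) (mulRight ℤ a) := by
    ext x; simp [mul_assoc]
  have h1 : (mulLeft ℤ a : Module.End ℤ A) ^ p = mulLeft ℤ (a ^ p) :=
    LinearMap.pow_mulLeft ..
  have h2 : (mulRight ℤ a : Module.End ℤ A) ^ p = mulRight ℤ (a ^ p) :=
    LinearMap.pow_mulRight ..
  rw [← h1, ← h2]
  have h : ExpChar (Module.End ℤ A) p ∨ Subsingleton (Module.End ℤ A) := by
    rcases subsingleton_or_nontrivial (Module.End ℤ A) with h | h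
    · exact Or.inr h
    · have : CharP (Module.End ℤ A) p := by
        refine (CharP.charP_iff_prime_eq_zero Fact.out).mpr (LinearMap.ext fun x => ?_)
        rw [← nsmul_one, LinearMap.smul_apply, Module.End.one_apply, nsmul_eq_mul,
          natCast_p_eq_zero k p, zero_mul, LinearMap.zero_apply]
      exact Or.inl inferInstance
  rcases h with h | h
  · exact sub_pow_expChar_of_commute p hc
  · exact Subsingleton.elim _ _

lemma ad_commute {a b : A} (h : ∀ z, (a * b - b * a) * z = z * (a * b - b * a)) :
    Commute (mulLeft ℤ a - mulRight ℤ a : Module.End ℤ A)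
      (mulLeft ℤ b - mulRight ℤ b) := by
  ext z
  have := h z
  simp only [Module.End.mul_apply, LinearMap.sub_apply, mulLeft_apply,
    LinearMap.mulRight_apply, sub_mul, mul_sub, mul_assoc] at this ⊢
  rw [← sub_eq_zero] at this ⊢
  rw [← this]
  abel

lemma mulLeft_commute {a b : A} (h : a * b = b * a) :
    Commute (mulLeft ℤ a : Module.End ℤ A) (mulLeft ℤ b) := by
  ext z; simp [← mul_assoc, h]

lemma mulRight_commute {a b : A} (h : a * b = b * a) :
    Commute (mulRight ℤ a : Module.End ℤ A) (mulRight ℤ b) := by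
  ext z; simp [mul_assoc, h]

lemma mulLeft_commute_mulRight (a b : A) :
    Commute (mulLeft ℤ a : Module.End ℤ A) (mulRight ℤ b) := by
  ext z; simp [mul_assoc]

lemma mulLeft_commute_of_mem {u : A} (hu : ∀ a, u * a = a * u) {T : Module.End ℤ A}
    (hT : T ∈ multSubring A) : Commute (mulLeft ℤ u : Module.End ℤ A) T := by
  have : multSubring A ≤ Subring.centralizer {(mulLeft ℤ u : Module.End ℤ A)} := by
    refine Subring.closure_le.mpr ?_
    rintro _ (⟨a, rfl⟩ | ⟨a, rfl⟩) _ rfl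
    · exact mulLeft_commute (hu a)
    · exact mulLeft_commute_mulRight u a
  exact this hT _ rfl

lemma ad_mem (a : A) : (mulLeft ℤ a - mulRight ℤ a : Module.End ℤ A) ∈ multSubring A :=
  sub_mem (mulLeft_mem a) (mulRight_mem a)

end AdPow

namespace OreData

open MvPolynomial

variable {k R A : Type u} [Field k] [CommRing R] [Algebra k R] [Ring A] [Algebra k A]
  {J : Type*} (O : OreData k R A J)

lemma X_pow_mul_ι (p : ℕ) [Fact p.Prime] [CharP k p] (j : J) (r : R) :
    O.m (X j) ^ p * O.ι r = O.ι r * O.m (X j) ^ p + O.ι ((O.der j)^[p] r) * O.m O.h ^ p := by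
  have key : ∀ n, ((mulLeft ℤ (O.m (X j)) - mulRight ℤ (O.m (X j)) :
      Module.End ℤ A) ^ n) (O.ι r) = O.ι ((O.der j)^[n] r) * O.m O.h ^ n := by
    intro n
    induction n with
    | zero => simp
    | succ n ih =>
      have hc : O.m (X j) * O.m O.h ^ n = O.m O.h ^ n * O.m (X j) := by
        rw [← map_pow, ← map_mul, mul_comm, map_mul]
      rw [pow_succ', Module.End.mul_apply, ih, Function.iterate_succ_apply']
      simp only [LinearMap.sub_apply, mulLeft_apply, LinearMap.mulRight_apply]
      rw [← mul_assoc, O.rel, add_mul, mul_assoc _ _ (O.m (X j)), ← hc, ← mul_assoc,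
        add_sub_cancel_left, mul_assoc, ← pow_succ']
  have := key p
  rw [ad_pow k p] at this
  simp only [LinearMap.sub_apply, mulLeft_apply, LinearMap.mulRight_apply] at this
  rw [← this]
  abel

/-- A ring of operators with invertible parameter is Azumaya. -/
theorem hasAzumayaCert (p : ℕ) [Fact p.Prime] [CharP k p] [Finite J] [DecidableEq J] (x : J → R)
    (hx : ∀ i j, O.der j (x i) = if j = i then 1 else 0)
    (hconst : ∀ r, (∀ j, O.der j r = 0) → ∃ s, s ^ p = r)
    (hder : ∀ j r, (O.der j)^[p] r = 0) (h₀ : k) (hh₀ : h₀ ≠ 0) (hh : O.h = C h₀)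
    (hbij : Bijective O.op) : HasAzumayaCert A := by
  have hmh : O.m O.h = algebraMap k A h₀ := by rw [hh, ← algebraMap_eq, commutes]
  have hDp : ∀ j a, O.m (X j) ^ p * a = a * O.m (X j) ^ p := by
    intro j a
    obtain ⟨q, rfl⟩ := hbij.2 a
    induction q using mv_induction k R with
    | mul r g =>
      rw [op_C_mul_map, ← mul_assoc, O.X_pow_mul_ι p, hder, map_zero, zero_mul, add_zero, mul_assoc,
        mul_assoc, ← map_pow, ← map_mul, mul_comm, map_mul]
    | add a b ha hb => rw [map_add, mul_add, add_mul, ha, hb]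
  have hmX : ∀ i j, O.m (X i) * O.m (X j) = O.m (X j) * O.m (X i) := fun i j => by
    rw [← map_mul, mul_comm, map_mul]
  have hxX : ∀ (r : R) (q : A), (∀ j, O.der j r = 0) → O.ι r * q = q * O.ι r := by
    intro r q hr
    obtain ⟨q, rfl⟩ := hbij.2 q
    induction q using MvPolynomial.induction_on with
    | C s => rw [op_C, ← map_mul, mul_comm, map_mul]
    | add a b ha hb => rw [map_add, mul_add, add_mul, ha, hb]
    | mul_X q j hq =>
      rw [← map_X (algebraMap k R), op_mul_map, ← mul_assoc, hq, mul_assoc, mul_assoc, O.rel, hr,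
        map_zero, zero_mul, add_zero]
  have hxp : ∀ (r : R) (q : A), O.ι r ^ p * q = q * O.ι r ^ p := by
    intro r q
    rw [← map_pow]
    exact hxX _ _ fun j => derivation_pow_p p _ _
  have hιι : ∀ r s, O.ι r * O.ι s = O.ι s * O.ι r := fun r s => by rw [← map_mul, mul_comm, map_mul]
  have hrel : ∀ i j, O.m (X j) * O.ι (x i) = O.ι (x i) * O.m (X j) +
      if j = i then algebraMap k A h₀ else 0 := by
    intro i j
    rw [O.rel, hx, hmh]
    split_ifs <;> simp
  let u : A := algebraMap k A h₀⁻¹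
  have hu : ∀ a, u * a = a * u := fun a => Algebra.commutes _ _
  have hu1 : u * algebraMap k A h₀ = 1 := by rw [← map_mul, inv_mul_cancel₀ hh₀, map_one]
  let d : J ⊕ J → Module.End ℤ A := Sum.elim
    (fun j => mulLeft ℤ u * (mulLeft ℤ (O.m (X j)) - mulRight ℤ (O.m (X j))))
    (fun j => mulLeft ℤ u * -(mulLeft ℤ (O.ι (x j)) - mulRight ℤ (O.ι (x j))))
  let y : J ⊕ J → Module.End ℤ A := Sum.elim
    (fun j => mulLeft ℤ (O.ι (x j))) (fun j => mulRight ℤ (O.m (X j)))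
  have hdl : ∀ j a, d (inl j) a = u * (O.m (X j) * a - a * O.m (X j)) := fun j a => rfl
  have hdr : ∀ j a, d (inr j) a = u * (a * O.ι (x j) - O.ι (x j) * a) := fun j a => by
    change u * -(O.ι (x j) * a - a * O.ι (x j)) = _
    rw [neg_sub]
  have hyl : ∀ j a, y (inl j) a = O.ι (x j) * a := fun j a => rfl
  have hyr : ∀ j a, y (inr j) a = a * O.m (X j) := fun j a => rfl
  have hunit : ∀ a b, u * a = u * b → a = b := fun a b h => by
    have := congrArg (algebraMap k A h₀ * ·) h
    simp only [← mul_assoc, ← hu (algebraMap k A h₀), hu1, one_mul] at this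
    exact this
  refine hasAzumayaCert_of_weyl k p d y ?_ ?_ ?_ ?_ ?_ ?_ ?_ ?_
  · rintro (j | j)
    · exact mul_mem (mulLeft_mem _) (ad_mem _)
    · exact mul_mem (mulLeft_mem _) (neg_mem (ad_mem _))
  · rintro (j | j)
    · exact mulLeft_mem _
    · exact mulRight_mem _
  · rintro (j | j) <;> ext a
    · change d (inl j) (y (inl j) a) = y (inl j) (d (inl j) a) + a
      simp only [hdl, hyl]
      rw [← mul_assoc (O.m (X j)), hrel, if_pos rfl, add_mul, mul_sub, mul_add, ← mul_assoc u
        (algebraMap k A h₀), hu1, one_mul, ← mul_assoc (O.ι (x j)) u, ← hu, mul_assoc u (O.ι (x j)),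
        mul_sub (O.ι (x j)), mul_sub u]
      simp only [mul_assoc]
      abel
    · change d (inr j) (y (inr j) a) = y (inr j) (d (inr j) a) + a
      simp only [hdr, hyr]
      rw [mul_assoc a, hrel, if_pos rfl, mul_add]
      have : u * (a * algebraMap k A h₀) = a * (u * algebraMap k A h₀) := by
        rw [← mul_assoc, hu, mul_assoc]
      rw [mul_sub, mul_add, this, hu1, mul_one, mul_sub, sub_mul]
      simp only [mul_assoc]
      abel
  · have key : ∀ S ∈ multSubring A, ∀ T ∈ multSubring A, Commute S T →
        Commute (mulLeft ℤ u * S) (mulLeft ℤ u * T) := fun S hS T hT h =>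
      ((Commute.refl _).mul_right (mulLeft_commute_of_mem hu hT)).mul_left
        ((mulLeft_commute_of_mem hu hS).symm.mul_right h)
    rintro (i | i) (j | j)
    · exact key _ (ad_mem _) _ (ad_mem _) (ad_commute fun z => by rw [hmX i j, sub_self, zero_mul, mul_zero])
    · refine key _ (ad_mem _) _ (neg_mem (ad_mem _)) (ad_commute fun z => ?_).neg_right
      rw [hrel, add_sub_cancel_left]
      split_ifs
      · exact Algebra.commutes _ _
      · rw [zero_mul, mul_zero]
    · refine key _ (neg_mem (ad_mem _)) _ (ad_mem _) (ad_commute fun z => ?_).symm.neg_left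
      rw [hrel, add_sub_cancel_left]
      split_ifs
      · exact Algebra.commutes _ _
      · rw [zero_mul, mul_zero]
    · have hxx : Commute (mulLeft ℤ (O.ι (x i)) - mulRight ℤ (O.ι (x i)) :
          Module.End ℤ A) (mulLeft ℤ (O.ι (x j)) - mulRight ℤ (O.ι (x j))) :=
        ad_commute fun z => by rw [hιι, sub_self, zero_mul, mul_zero]
      exact key _ (neg_mem (ad_mem _)) _ (neg_mem (ad_mem _)) hxx.neg_left.neg_right
  · rintro (i | i) (j | j)
    · exact mulLeft_commute (hιι _ _)
    · exact mulLeft_commute_mulRight _ _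
    · exact (mulLeft_commute_mulRight _ _).symm
    · exact mulRight_commute (hmX _ _)
  · have key : ∀ S T : Module.End ℤ A, T ∈ multSubring A → Commute S T →
        Commute (mulLeft ℤ u * S) T := fun S T hT h =>
      (mulLeft_commute_of_mem hu hT).mul_left h
    rintro (i | i) (j | j) hij
    · refine key _ _ (mulLeft_mem _) (Commute.sub_left (mulLeft_commute ?_)
        (mulLeft_commute_mulRight _ _).symm)
      rw [hrel, if_neg (fun h => hij (by rw [h])), add_zero]
    · exact key _ _ (mulRight_mem _) (Commute.sub_left (mulLeft_commute_mulRight _ _)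
        (mulRight_commute (hmX _ _)))
    · exact key _ _ (mulLeft_mem _) (Commute.sub_left (mulLeft_commute (hιι _ _))
        (mulLeft_commute_mulRight _ _).symm).neg_left
    · refine key _ _ (mulRight_mem _) (Commute.sub_left (mulLeft_commute_mulRight _ _)
        (mulRight_commute ?_)).neg_left
      rw [hrel, if_neg (fun h => hij (by rw [h])), add_zero]
  · have key : ∀ a : A, (∀ b, a ^ p * b = b * a ^ p) →
        (mulLeft ℤ a - mulRight ℤ a : Module.End ℤ A) ^ p = 0 := fun a ha => by
      rw [ad_pow k p]
      ext b
      simp [ha]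
    rintro (j | j)
    · change (mulLeft ℤ u * _) ^ p = 0
      rw [(mulLeft_commute_of_mem hu (ad_mem _)).mul_pow, key _ (hDp j), mul_zero]
    · change (mulLeft ℤ u * _) ^ p = 0
      rw [(mulLeft_commute_of_mem hu (neg_mem (ad_mem _))).mul_pow, neg_pow, key _ (hxp _), mul_zero,
        mul_zero]
  · intro a ha
    obtain ⟨q, rfl⟩ := hbij.2 a
    have := O.mem_of_commute p id x hx hconst (fun q hq => ?_) hbij.1 (Subalgebra.center k A) ?_ ?_
      (fun j hj => absurd ⟨j, rfl⟩ hj) q ?_ ?_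
    · exact this
    · rw [hh, map_C] at hq
      have hw : (C (algebraMap k R h₀) : MvPolynomial J R) * C (algebraMap k R h₀⁻¹) = 1 := by
        rw [← C_mul, ← map_mul, mul_inv_cancel₀ hh₀, map_one, C_1]
      rw [← mul_one q, ← hw, ← mul_assoc, hq, zero_mul]
    · exact fun r => mem_center_iff.mpr fun b => (hxp r b).symm
    · exact fun j => mem_center_iff.mpr fun b => (hDp j b).symm
    · intro j
      have := ha (inl j)
      rw [hdl, ← mul_zero u] at this
      exact sub_eq_zero.mp (hunit _ _ this)
    · intro j
      have := ha (inr j)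
      rw [hdr, ← mul_zero u] at this
      exact sub_eq_zero.mp (hunit _ _ this)

end OreData

/-! ## Polynomials in commuting elements -/

section CommAeval

variable {A : Type u} [Ring A] [Algebra k A] {J : Type*}

/-- Evaluation of polynomials at commuting elements of a ring. -/
def commAeval (D : J → A) (hD : ∀ i j, D i * D j = D j * D i) : MvPolynomial J k →ₐ[k] A :=
  letI : CommRing (adjoin k (range D)) :=
    { (inferInstance : Ring (adjoin k (range D))) with
      mul_comm := (Algebra.isMulCommutative_adjoin k (s := range D) (by
        rintro _ ⟨i, rfl⟩ _ ⟨j, rfl⟩; exact hD i j)).is_comm.comm }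
  (adjoin k (range D)).val.comp
    (MvPolynomial.aeval fun j => (⟨D j, subset_adjoin ⟨j, rfl⟩⟩ : adjoin k (range D)))

@[simp] lemma commAeval_X (D : J → A) (hD : ∀ i j, D i * D j = D j * D i) (j : J) :
    commAeval (k := k) D hD (MvPolynomial.X j) = D j := by
  simp [commAeval]

end CommAeval

/-! ## Generation of `D(Spec A)` -/

section CrysGen

variable {A : Type u} [CommRing A] [Algebra k A]

lemma CrysDiff.adjoin_eq_top :
    adjoin k (range (CrysDiff.fn k A) ∪ range (vf k A)) = ⊤ := by
  rw [eq_top_iff]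
  rintro x -
  obtain ⟨y, rfl⟩ := RingQuot.mkAlgHom_surjective k (CrysRel k A) x
  induction y using FreeAlgebra.induction with
  | grade0 r => rw [commutes]; exact Subalgebra.algebraMap_mem _ r
  | grade1 x =>
    rcases x with f | ξ
    · exact subset_adjoin (Or.inl ⟨f, rfl⟩)
    · exact subset_adjoin (Or.inr ⟨ξ, rfl⟩)
  | mul a b ha hb => rw [map_mul]; exact mul_mem ha hb
  | add a b ha hb => rw [map_add]; exact add_mem ha hb

lemma CrysDiff.mem_of_generators (S : Subalgebra k (CrysDiff k A)) (h1 : ∀ f, CrysDiff.fn k A f ∈ S)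
    (h2 : ∀ ξ, vf k A ξ ∈ S) (x : CrysDiff k A) : x ∈ S := by
  have : adjoin k (range (CrysDiff.fn k A) ∪ range (vf k A)) ≤ S :=
    Algebra.adjoin_le (by rintro _ (⟨f, rfl⟩ | ⟨ξ, rfl⟩); exacts [h1 f, h2 ξ])
  rw [CrysDiff.adjoin_eq_top] at this
  exact this Algebra.mem_top

lemma CrysDiff.algHom_ext {B : Type u} [Ring B] [Algebra k B] {φ ψ : CrysDiff k A →ₐ[k] B}
    (h1 : ∀ f, φ (CrysDiff.fn k A f) = ψ (CrysDiff.fn k A f))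
    (h2 : ∀ ξ, φ (vf k A ξ) = ψ (vf k A ξ)) : φ = ψ := by
  refine AlgHom.ext fun x => ?_
  have : x ∈ AlgHom.equalizer φ ψ := CrysDiff.mem_of_generators _ h1 h2 x
  exact this

lemma CrysDiff.fn_pow_central (p : ℕ) [Fact p.Prime] [CharP k p] (f : A) (x : CrysDiff k A) :
    CrysDiff.fn k A (f ^ p) * x = x * CrysDiff.fn k A (f ^ p) := by
  refine CrysDiff.mem_of_generators (Subalgebra.centralizer k {CrysDiff.fn k A (f ^ p)}) ?_ ?_ x _ rfl
  · rintro g _ rfl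
    rw [← map_mul, mul_comm, map_mul]
  · rintro ξ _ rfl
    rw [CrysDiff.vf_mul_fn, derivation_pow_p p, map_zero, add_zero]

end CrysGen

/-! ## Coordinate systems and the Poincaré–Birkhoff–Witt theorem -/

lemma derivation_sum_apply {k A : Type*} [CommRing k] [CommRing A] [Algebra k A] {ι : Type*}
    (s : Finset ι) (d : ι → Der k A) (a : A) : (∑ i ∈ s, d i) a = ∑ i ∈ s, d i a :=
  map_sum (AddMonoidHom.mk' (fun d : Der k A => d a) fun _ _ => rfl) d s

/-- A basis of the vector fields on `Spec A` consisting of commuting vector fields. -/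
structure CommFrame (k A : Type u) [Field k] [CommRing A] [Algebra k A] (I : Type) where
  /-- the vector fields -/
  der : I → Der k A
  /-- the coefficients of a vector field -/
  coef : Der k A →ₗ[A] I → A
  der_comm : ∀ i j, ⁅der i, der j⁆ = 0
  coef_self : ∀ i, coef (der i) i = 1
  coef_ne : ∀ i j, i ≠ j → coef (der i) j = 0
  coef_inj : ∀ ξ, coef ξ = 0 → ξ = 0

namespace CommFrame

variable {k A : Type u} [Field k] [CommRing A] [Algebra k A] {I : Type} (X : CommFrame k A I)

open MvPolynomial

lemma coef_der [DecidableEq I] (i j : I) : X.coef (X.der i) j = if i = j then 1 else 0 := by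
  split_ifs with h
  · subst h; exact X.coef_self i
  · exact X.coef_ne i j h

lemma eq_sum [Fintype I] (ξ : Der k A) : ξ = ∑ i, X.coef ξ i • X.der i := by
  classical
  rw [← sub_eq_zero]
  refine X.coef_inj _ (funext fun j => ?_)
  rw [map_sub, map_sum]
  simp [X.coef_der]

lemma coef_bracket [Finite I] (ξ η : Der k A) (i : I) :
    X.coef ⁅ξ, η⁆ i = ξ (X.coef η i) - η (X.coef ξ i) := by
  classical
  have := Fintype.ofFinite I
  have : ⁅ξ, η⁆ = ∑ j, (ξ (X.coef η j) - η (X.coef ξ j)) • X.der j := by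
    ext f
    have h1 : ∀ ζ : Der k A, ∀ g, ζ g = ∑ j, X.coef ζ j * X.der j g := by
      intro ζ g
      conv_lhs => rw [X.eq_sum ζ]
      rw [derivation_sum_apply]
      rfl
    have hc : ∀ i j, X.der i (X.der j f) = X.der j (X.der i f) := fun i j => by
      have := DFunLike.congr_fun (X.der_comm i j) f
      rw [commutator_apply] at this
      exact sub_eq_zero.mp this
    rw [commutator_apply, derivation_sum_apply, h1 η f, h1 ξ f, map_sum, map_sum]
    simp only [leibniz, Derivation.smul_apply, smul_eq_mul, sub_mul,
      sum_add_distrib, Finset.sum_sub_distrib]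
    have h2 : ∑ j, X.coef η j * ξ (X.der j f) = ∑ j, X.coef ξ j * η (X.der j f) := by
      simp_rw [h1 ξ (X.der _ f), h1 η (X.der _ f), mul_sum]
      rw [Finset.sum_comm]
      refine sum_congr rfl fun i _ => sum_congr rfl fun j _ => ?_
      rw [hc i j]; ring
    rw [h2]
    simp only [mul_comm (ξ _), mul_comm (η _)]
    ring
  rw [this, map_sum]
  simp [X.coef_der]

/-- The operators over `A` in terms of the basis. -/
def ore : OreData k A (CrysDiff k A) I where
  ι := CrysDiff.fn k A
  m := commAeval (fun i => vf k A (X.der i)) fun i j => by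
    rw [CrysDiff.vf_mul_vf, X.der_comm, map_zero, add_zero]
  der := X.der
  h := 1
  rel j r := by rw [commAeval_X, CrysDiff.vf_mul_fn, map_one, mul_one]

@[simp] lemma ore_m_X (i : I) : X.ore.m (MvPolynomial.X i) = vf k A (X.der i) :=
  commAeval_X (fun i => vf k A (X.der i))
    (fun i j => by rw [CrysDiff.vf_mul_vf, X.der_comm, map_zero, add_zero]) i

/-- The symbol of a vector field. -/
def symb [Fintype I] (ξ : Der k A) : MvPolynomial I A :=
  ∑ i, C (X.coef ξ i) * MvPolynomial.X i

lemma coefDer_symb [Fintype I] (ξ η : Der k A) :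
    coefDer ξ (X.symb η) = ∑ i, C (ξ (X.coef η i)) * MvPolynomial.X i := by
  simp [symb, leibniz, mul_comm]

/-- The representation of differential operators on polynomials over `A`. -/
def rep [Fintype I] : CrysDiff k A →ₐ[k] Module.End k (MvPolynomial I A) :=
  CrysDiff.lift ((Algebra.lmul k (MvPolynomial I A)).comp (IsScalarTower.toAlgHom k A _))
    { toFun := fun ξ => ((coefDer ξ : Derivation k (MvPolynomial I A) (MvPolynomial I A)) :
      MvPolynomial I A →ₗ[k] MvPolynomial I A)
        + mulLeft k (X.symb ξ)
      map_zero' := by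
        refine LinearMap.ext fun q => ?_
        have : coefDer (0 : Der k A) q = 0 := by
          ext α; rw [coeff_coefDer]; simp
        simp [symb, this]
      map_add' := fun ξ η => by
        refine LinearMap.ext fun q => ?_
        have : coefDer (ξ + η) q = coefDer ξ q + coefDer η q := by
          ext α; rw [coeff_add, coeff_coefDer, coeff_coefDer, coeff_coefDer]; simp
        simp [symb, this, add_mul, sum_add_distrib]
        abel }
    (fun f ξ => by
      refine LinearMap.ext fun q => ?_
      have : coefDer (f • ξ) q = C f * coefDer ξ q := by
        ext α; rw [coeff_C_mul, coeff_coefDer, coeff_coefDer]; simp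
      have h2 : X.symb (f • ξ) = C f * X.symb ξ := by
        simp [symb, mul_sum, mul_assoc]
      simp [this, h2, mul_add, algebraMap_eq])
    (fun ξ f => by
      refine LinearMap.ext fun q => ?_
      simp [algebraMap_eq, leibniz, Module.End.mul_apply]
      ring)
    (fun ξ η => by
      refine LinearMap.ext fun q => ?_
      have h1 : coefDer ξ (coefDer η q) = coefDer η (coefDer ξ q) + coefDer ⁅ξ, η⁆ q := by
        ext α
        simp only [coeff_add, coeff_coefDer, commutator_apply]
        ring
      have h2 : coefDer ξ (X.symb η) = coefDer η (X.symb ξ) + X.symb ⁅ξ, η⁆ := by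
        rw [coefDer_symb, coefDer_symb, symb, ← sum_add_distrib]
        refine sum_congr rfl fun i _ => ?_
        rw [← add_mul, ← C_add, X.coef_bracket]
        congr 2
        ring
      simp only [AddMonoidHom.coe_mk, ZeroHom.coe_mk, Module.End.mul_apply, LinearMap.add_apply,
        mulLeft_apply, Derivation.coeFn_coe, map_add, leibniz, smul_eq_mul, h1,
        h2]
      ring)

lemma rep_fn [Fintype I] (f : A) (q : MvPolynomial I A) :
    X.rep (CrysDiff.fn k A f) q = C f * q := by
  rw [rep, CrysDiff.lift_fn]; rfl

lemma rep_vf [Fintype I] (ξ : Der k A) : X.rep (vf k A ξ) =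
    ((coefDer ξ : Derivation k (MvPolynomial I A) (MvPolynomial I A)) :
      MvPolynomial I A →ₗ[k] MvPolynomial I A) + mulLeft k (X.symb ξ) := by
  rw [rep, CrysDiff.lift_vf]; rfl

lemma symb_der [Fintype I] (i : I) : X.symb (X.der i) = MvPolynomial.X i := by
  classical
  simp [symb, X.coef_der]

lemma rep_op_one [Fintype I] (q : MvPolynomial I A) : X.rep (X.ore.op q) 1 = q := by
  have h : ∀ g : MvPolynomial I k, X.rep (X.ore.m g) 1 = MvPolynomial.map (algebraMap k A) g := by
    intro g
    induction g using MvPolynomial.induction_on with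
    | C a =>
      rw [← algebraMap_eq, commutes, commutes, algebraMap_eq, map_C,
        Module.algebraMap_end_apply, smul_def, mul_one]; rfl
    | add a b ha hb => simp only [map_add, LinearMap.add_apply, ha, hb]
    | mul_X g i hg =>
      have := coefDer_C_mul_map (X.der i) 1 g
      rw [C_1, one_mul, Derivation.map_one_eq_zero, C_0, zero_mul] at this
      rw [mul_comm, map_mul, map_mul, Module.End.mul_apply, hg, ore_m_X, rep_vf, symb_der]
      simp [this]
  induction q using mv_induction k A with
  | mul r g =>
    rw [X.ore.op_C_mul_map, map_mul, Module.End.mul_apply, h]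
    exact X.rep_fn _ _
  | add a b ha hb => rw [map_add, map_add, LinearMap.add_apply, ha, hb]

lemma op_injective [Finite I] : Function.Injective X.ore.op := by
  have := Fintype.ofFinite I
  exact Function.LeftInverse.injective (g := fun a => X.rep a 1) X.rep_op_one

lemma vf_eq_sum [Fintype I] (ξ : Der k A) :
    vf k A ξ = ∑ i, CrysDiff.fn k A (X.coef ξ i) * vf k A (X.der i) := by
  conv_lhs => rw [X.eq_sum ξ]
  simp [vf_smul]

lemma op_surjective [Finite I] : Function.Surjective X.ore.op := by
  have := Fintype.ofFinite I
  have h : ∀ a : CrysDiff k A, ∀ q, ∃ q', X.ore.op q' = a * X.ore.op q := by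
    intro a
    let S : Subalgebra k (CrysDiff k A) :=
      { carrier := {a | ∀ q, ∃ q', X.ore.op q' = a * X.ore.op q}
        mul_mem' := by
          intro a b ha hb q
          obtain ⟨q', h⟩ := hb q
          obtain ⟨q'', h'⟩ := ha q'
          exact ⟨q'', by rw [h', h, mul_assoc]⟩
        add_mem' := by
          intro a b ha hb q
          obtain ⟨q', h⟩ := hb q
          obtain ⟨q'', h'⟩ := ha q
          exact ⟨q'' + q', by rw [map_add, h', h, add_mul]⟩
        algebraMap_mem' := fun r q => ⟨r • q, by rw [map_smul, smul_def]⟩ }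
    have hfn : ∀ f, CrysDiff.fn k A f ∈ S := fun f q => ⟨C f * q, X.ore.op_C_mul f q⟩
    refine CrysDiff.mem_of_generators S hfn (fun ξ => ?_) a
    rw [X.vf_eq_sum ξ]
    refine sum_mem fun i _ => mul_mem (hfn _) fun q =>
      ⟨q * MvPolynomial.X i + coefDer (X.der i) q * MvPolynomial.map (algebraMap k A) 1, ?_⟩
    rw [← ore_m_X, X.ore.X_mul_op]
    rfl
  intro a
  obtain ⟨q, hq⟩ := h a 1
  exact ⟨q, by rw [hq, ← C_1, X.ore.op_C, map_one, mul_one]⟩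

lemma op_bijective [Finite I] : Bijective X.ore.op := ⟨X.op_injective, X.op_surjective⟩

/-- Operators of order at most `n` have symbols of degree at most `n`. -/
lemma exists_op_of_order [Finite I] {n : ℕ} {a : CrysDiff k A} (ha : a ∈ CrysDiff.order k A n) :
    ∃ q : MvPolynomial I A, q.totalDegree ≤ n ∧ X.ore.op q = a := by
  have := Fintype.ofFinite I
  let G : ℕ → Submodule k (CrysDiff k A) := fun n =>
    ((restrictTotalDegree I A n).restrictScalars k).map X.ore.op
  have hG : ∀ n a, a ∈ G n ↔ ∃ q : MvPolynomial I A, q.totalDegree ≤ n ∧ X.ore.op q = a := by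
    intro n a
    simp [G, Submodule.mem_map, mem_restrictTotalDegree]
  have hF : ∀ n, LinearMap.range (CrysDiff.fn k A).toLinearMap * G n ≤ G n := by
    intro n
    rw [Submodule.mul_le]
    rintro _ ⟨f, rfl⟩ b hb
    obtain ⟨q, hq, rfl⟩ := (hG _ _).mp hb
    refine (hG _ _).mpr ⟨C f * q, (totalDegree_mul _ _).trans ?_, X.ore.op_C_mul f q⟩
    simpa using hq
  have hV : ∀ n, LinearMap.range (vf k A) * G n ≤ G (n + 1) := by
    intro n
    rw [Submodule.mul_le]
    rintro _ ⟨ξ, rfl⟩ b hb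
    obtain ⟨q, hq, rfl⟩ := (hG _ _).mp hb
    rw [X.vf_eq_sum ξ, sum_mul]
    refine sum_mem fun i _ => ?_
    rw [mul_assoc]
    refine hF _ (Submodule.mul_mem_mul ⟨_, rfl⟩ ?_)
    rw [← ore_m_X, X.ore.X_mul_op]
    refine (hG _ _).mpr ⟨_, ?_, rfl⟩
    refine (totalDegree_add _ _).trans (max_le ?_ ?_)
    · refine (totalDegree_mul _ _).trans ?_
      have := totalDegree_monomial_le (Finsupp.single i 1) (1 : A)
      rw [Finsupp.sum_single_index rfl, id] at this
      change _ + (monomial (Finsupp.single i 1) (1 : A)).totalDegree ≤ _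
      omega
    · change (coefDer (X.der i) q * MvPolynomial.map (algebraMap k A) 1).totalDegree ≤ _
      rw [map_one, mul_one]
      refine le_trans ?_ (hq.trans (Nat.le_succ n))
      refine totalDegree_le_of_support_subset fun α hα => ?_
      rw [mem_support_iff] at hα ⊢
      intro h
      rw [coeff_coefDer, h, map_zero] at hα
      exact hα rfl
  have hmono : ∀ n, G n ≤ G (n + 1) := fun n a ha => by
    obtain ⟨q, hq, h⟩ := (hG _ _).mp ha
    exact (hG _ _).mpr ⟨q, hq.trans (Nat.le_succ n), h⟩
  have hM : ∀ n, (LinearMap.range (CrysDiff.fn k A).toLinearMap ⊔ LinearMap.range (vf k A)) ^ n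
      ≤ G n := by
    intro n
    induction n with
    | zero =>
      rw [pow_zero, Submodule.one_le]
      exact (hG _ _).mpr ⟨1, by simp, by rw [← C_1, X.ore.op_C, map_one]⟩
    | succ n ih =>
      rw [pow_succ']
      refine (mul_le_mul' le_rfl ih).trans ?_
      rw [Submodule.sup_mul]
      exact sup_le ((hF n).trans (hmono n)) (hV n)
  refine (hG _ _).mp ?_
  exact hF n ((mul_le_mul' le_rfl (hM n)) ha)

end CommFrame

/-- A coordinate system on `Spec A`: functions `x i` and vector fields `∂ i` with `∂ i (x j) = δ i j`
such that a vector field is determined by its values on the `x i`. -/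
structure Coords (k A : Type u) [Field k] [CommRing A] [Algebra k A] (I : Type) where
  /-- the coordinates -/
  x : I → A
  /-- the partial derivatives -/
  der : I → Der k A
  der_self : ∀ i, der i (x i) = 1
  der_ne : ∀ i j, i ≠ j → der i (x j) = 0
  ext_zero : ∀ ξ : Der k A, (∀ i, ξ (x i) = 0) → ξ = 0

namespace Coords

variable {k A : Type u} [Field k] [CommRing A] [Algebra k A] {I : Type} (X : Coords k A I)

open MvPolynomial

lemma ext {ξ η : Der k A} (h : ∀ i, ξ (X.x i) = η (X.x i)) : ξ = η :=
  sub_eq_zero.mp (X.ext_zero _ fun i => by simp [h])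

lemma der_x [DecidableEq I] (i j : I) : X.der i (X.x j) = if i = j then 1 else 0 := by
  split_ifs with h
  · subst h; exact X.der_self i
  · exact X.der_ne i j h

lemma eq_sum [Fintype I] (ξ : Der k A) : ξ = ∑ i, ξ (X.x i) • X.der i := by
  classical
  refine X.ext fun j => ?_
  rw [derivation_sum_apply]
  simp [X.der_x]

lemma der_comm (i j : I) : ⁅X.der i, X.der j⁆ = 0 := by
  classical
  refine X.ext_zero _ fun l => ?_
  rw [commutator_apply, X.der_x, X.der_x]
  split_ifs <;> simp

lemma der_iterate (p : ℕ) (hp : 2 ≤ p) [Fact p.Prime] [CharP k p] (i : I) (r : A) :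
    (X.der i)^[p] r = 0 := by
  classical
  rw [← pPow_apply]
  have : pPow p (X.der i) = 0 := X.ext_zero _ fun l => by
    obtain ⟨q, rfl⟩ : ∃ q, p = q + 2 := ⟨p - 2, by omega⟩
    rw [pPow_apply, Function.iterate_add_apply, Function.iterate_succ_apply', Function.iterate_one,
      X.der_x]
    have : X.der i (if i = l then 1 else 0) = 0 := by split_ifs <;> simp
    rw [this, iterate_map_zero]
  rw [this]; rfl

lemma pPow_der (p : ℕ) [Fact p.Prime] [CharP k p] (i : I) : pPow p (X.der i) = 0 := by
  ext r
  rw [pPow_apply, X.der_iterate p (Fact.out : p.Prime).two_le]; rfl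

/-- The basis of partial derivatives. -/
def frame : CommFrame k A I where
  der := X.der
  coef :=
    { toFun := fun ξ i => ξ (X.x i)
      map_add' := fun _ _ => rfl
      map_smul' := fun _ _ => rfl }
  der_comm := X.der_comm
  coef_self := X.der_self
  coef_ne := X.der_ne
  coef_inj ξ h := X.ext_zero ξ fun i => congrFun h i

end Coords

/-! ## The `p`-curvature elements -/

section PCurv

variable (p : ℕ) [Fact p.Prime] [CharP k p] {A : Type u} [CommRing A]
  [Algebra k A]

/-- The element `ξ^p - ξ^{[p]}`. -/
def pcurv (ξ : Der k A) : CrysDiff k A :=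
  vf k A ξ ^ p - vf k A (pPow p ξ)

open MvPolynomial in
lemma Coords.pcurv_eq {I : Type} [Fintype I] (X : Coords k A I) (ξ : Der k A) :
    pcurv p ξ = ∑ i, CrysDiff.fn k A (ξ (X.x i) ^ p) * vf k A (X.der i) ^ p := by
  have hp : p.Prime := Fact.out
  have hone : ∀ a b : CrysDiff k A, X.frame.rep a 1 = X.frame.rep b 1 → a = b := by
    intro a b h
    obtain ⟨q, rfl⟩ := X.frame.op_surjective a
    obtain ⟨q', rfl⟩ := X.frame.op_surjective b
    rw [X.frame.rep_op_one, X.frame.rep_op_one] at h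
    rw [h]
  have hpow : ∀ η : Der k A, X.frame.rep (vf k A η ^ p) 1 =
      (coefDer η)^[p - 1] (X.frame.symb η) + X.frame.symb η ^ p := by
    intro η
    rw [map_pow, X.frame.rep_vf, derivation_add_mul_pow p, LinearMap.add_apply, mulLeft_apply,
      mul_one, Module.End.pow_apply, add_eq_right]
    obtain ⟨q, rfl⟩ : ∃ q, p = q + 1 := ⟨p - 1, by have := hp.pos; omega⟩
    rw [Function.iterate_succ_apply]
    change (⇑(coefDer η))^[q] (coefDer η 1) = 0
    rw [Derivation.map_one_eq_zero, iterate_map_zero]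
  have hsd : ∀ i, X.frame.symb (X.der i) = MvPolynomial.X i := X.frame.symb_der
  have hit : ∀ n, (coefDer ξ)^[n] (X.frame.symb ξ) = ∑ i, C (ξ^[n + 1] (X.x i)) * MvPolynomial.X i := by
    intro n
    induction n with
    | zero => rfl
    | succ n ih =>
      rw [Function.iterate_succ_apply', ih, map_sum]
      refine sum_congr rfl fun i _ => ?_
      rw [leibniz, coefDer_X, coefDer_C, smul_zero, zero_add, smul_eq_mul, mul_comm,
        Function.iterate_succ_apply' ξ (n + 1)]
  refine hone _ _ ?_
  rw [pcurv, map_sub, LinearMap.sub_apply, hpow, X.frame.rep_vf, map_sum, LinearMap.sum_apply]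
  have h1 : ∀ i, X.frame.rep (CrysDiff.fn k A (ξ (X.x i) ^ p) * vf k A (X.der i) ^ p) 1 =
      C (ξ (X.x i) ^ p) * MvPolynomial.X i ^ p := by
    intro i
    rw [map_mul, Module.End.mul_apply, hpow, X.frame.rep_fn, hsd i]
    obtain ⟨q, hq⟩ : ∃ q, p - 1 = q + 1 := ⟨p - 2, by have := hp.two_le; omega⟩
    rw [hq, Function.iterate_succ_apply, coefDer_X, iterate_map_zero, zero_add]
  rw [sum_congr rfl fun i _ => h1 i, hit, Nat.sub_add_cancel hp.one_le]
  simp only [LinearMap.add_apply, mulLeft_apply, mul_one, Derivation.coeFn_coe,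
    Derivation.map_one_eq_zero, zero_add]
  have h2 : X.frame.symb ξ ^ p = ∑ i, C (ξ (X.x i) ^ p) * MvPolynomial.X i ^ p := by
    rw [CommFrame.symb, sum_pow_p k p]
    exact sum_congr rfl fun i _ => by rw [mul_pow, ← C_pow]; rfl
  rw [h2, add_comm, add_sub_assoc, add_eq_left, sub_eq_zero, CommFrame.symb]
  exact sum_congr rfl fun i _ => by rw [← pPow_apply p ξ]; rfl

end PCurv

lemma pred_mul_add (p n : ℕ) [Fact p.Prime] : (p - 1) * n + n = p * n := by
  rw [Nat.sub_mul, one_mul, Nat.sub_add_cancel (Nat.le_mul_of_pos_left n (Fact.out : p.Prime).pos)]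

/-! ## Functoriality of differential operators -/

section DerExt

variable {k A A' : Type u} [Field k] [CommRing A] [Algebra k A] [CommRing A'] [Algebra k A']

/-- Derivations extend uniquely along `ρ`. -/
def DerExt (ρ : A →ₐ[k] A') : Prop :=
  ∀ ξ : Der k A, ∃! ξ' : Der k A', ∀ a, ξ' (ρ a) = ρ (ξ a)

lemma derExt_of_formallyEtale (ρ : A →ₐ[k] A') (h : ρ.toRingHom.FormallyEtale) : DerExt ρ := by
  algebraize [ρ.toRingHom]
  have : IsScalarTower k A A' := IsScalarTower.of_algebraMap_eq fun a => (ρ.commutes a).symm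
  have hρ : ∀ a, algebraMap A A' a = ρ a := fun _ => rfl
  intro ξ
  let g : Ω[A⁄k] →ₗ[A] A' := (Algebra.linearMap A A') ∘ₗ ξ.liftKaehlerDifferential
  let G : A' ⊗[A] Ω[A⁄k] →ₗ[A'] A' := LinearMap.liftBaseChange A' g
  let e := KaehlerDifferential.tensorKaehlerEquivOfFormallyEtale k A A'
  refine ⟨(G ∘ₗ e.symm.toLinearMap).compDer (D k A'), fun a => ?_, fun η hη => ?_⟩
  · change G (e.symm (D k A' (algebraMap A A' a))) = _
    rw [KaehlerDifferential.tensorKaehlerEquivOfFormallyEtale_symm_D_algebraMap]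
    simp [G, g, hρ]
  · have hG : ∀ z : Ω[A'⁄k], η.liftKaehlerDifferential z = G (e.symm z) := by
      intro z
      obtain ⟨w, rfl⟩ := e.surjective z
      rw [e.symm_apply_apply]
      have : η.liftKaehlerDifferential ∘ₗ e.toLinearMap = G := by
        refine TensorProduct.AlgebraTensorModule.curry_injective ?_
        refine LinearMap.ext_ring ?_
        refine LinearMap.ext fun z => ?_
        have hz : z ∈ Submodule.span A (range (D k A)) := by
          rw [KaehlerDifferential.span_range_derivation]; trivial
        induction hz using Submodule.span_induction with
        | mem z hz =>
          obtain ⟨a, rfl⟩ := hz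
          change η.liftKaehlerDifferential (e (1 ⊗ₜ _)) = G (1 ⊗ₜ _)
          rw [← KaehlerDifferential.tensorKaehlerEquivOfFormallyEtale_symm_D_algebraMap]
          change η.liftKaehlerDifferential (e (e.symm _)) = _
          rw [e.apply_symm_apply, KaehlerDifferential.tensorKaehlerEquivOfFormallyEtale_symm_D_algebraMap]
          simp [G, g, hρ, hη]
        | add x y _ _ hx hy => rw [map_add, map_add, hx, hy]
        | smul a x _ hx => rw [map_smul, map_smul, hx]
        | zero => rw [map_zero, map_zero]
      exact LinearMap.congr_fun this w
    ext x
    rw [← Derivation.liftKaehlerDifferential_comp_D η x, hG]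
    rfl

namespace DerExt

variable {ρ : A →ₐ[k] A'} (h : DerExt ρ)

/-- The extension of a derivation. -/
def ext (ξ : Der k A) : Der k A' := (h ξ).choose

lemma ext_apply (ξ : Der k A) (a : A) : h.ext ξ (ρ a) = ρ (ξ a) := (h ξ).choose_spec.1 a

lemma eq_ext {ξ : Der k A} {ξ' : Der k A'} (hξ : ∀ a, ξ' (ρ a) = ρ (ξ a)) :
    ξ' = h.ext ξ := (h ξ).choose_spec.2 ξ' hξ

lemma ext_add (ξ η : Der k A) : h.ext (ξ + η) = h.ext ξ + h.ext η :=
  (h.eq_ext fun a => by simp [ext_apply]).symm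

lemma ext_smul (f : A) (ξ : Der k A) : h.ext (f • ξ) = ρ f • h.ext ξ :=
  (h.eq_ext fun a => by simp [ext_apply]).symm

lemma ext_bracket (ξ η : Der k A) : h.ext ⁅ξ, η⁆ = ⁅h.ext ξ, h.ext η⁆ :=
  (h.eq_ext fun a => by simp [ext_apply, commutator_apply]).symm

lemma ext_pPow (p : ℕ) [Fact p.Prime] [CharP k p] (ξ : Der k A) :
    h.ext (pPow p ξ) = pPow p (h.ext ξ) :=
  (h.eq_ext fun a => by
    have : ∀ n, (h.ext ξ)^[n] (ρ a) = ρ (ξ^[n] a) := by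
      intro n
      induction n with
      | zero => rfl
      | succ n ih => rw [Function.iterate_succ_apply', ih, ext_apply, Function.iterate_succ_apply']
    rw [pPow_apply, pPow_apply, this]).symm

lemma ext_zero : h.ext 0 = 0 := (h.eq_ext fun a => by simp).symm

/-- Restriction of differential operators. -/
def map : CrysDiff k A →ₐ[k] CrysDiff k A' :=
  CrysDiff.lift ((CrysDiff.fn k A').comp ρ)
    { toFun := fun ξ => vf k A' (h.ext ξ)
      map_zero' := by rw [h.ext_zero, map_zero]
      map_add' := fun ξ η => by rw [h.ext_add, map_add] }
    (fun f ξ => by simp [h.ext_smul, vf_smul])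
    (fun ξ f => by
      have := CrysDiff.vf_mul_fn k A' (h.ext ξ) (ρ f)
      rw [h.ext_apply] at this
      exact this)
    (fun ξ η => by
      have := CrysDiff.vf_mul_vf k A' (h.ext ξ) (h.ext η)
      rw [← h.ext_bracket] at this
      exact this)

@[simp] lemma map_fn (f : A) : h.map (CrysDiff.fn k A f) = CrysDiff.fn k A' (ρ f) :=
  CrysDiff.lift_fn _ _ _ _ _ f

@[simp] lemma map_vf (ξ : Der k A) :
    h.map (vf k A ξ) = vf k A' (h.ext ξ) :=
  CrysDiff.lift_vf _ _ _ _ _ ξ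

lemma map_pcurv (p : ℕ) [Fact p.Prime] [CharP k p] (ξ : Der k A) :
    h.map (pcurv p ξ) = pcurv p (h.ext ξ) := by
  rw [pcurv, map_sub, map_pow, map_vf, map_vf, h.ext_pPow]; rfl

lemma map_order {n : ℕ} {d : CrysDiff k A} (hd : d ∈ CrysDiff.order k A n) :
    h.map d ∈ CrysDiff.order k A' n := by
  have : (CrysDiff.order k A n).map h.map.toLinearMap ≤ CrysDiff.order k A' n := by
    unfold CrysDiff.order
    rw [Submodule.map_mul, Submodule.map_pow, Submodule.map_sup]
    have h1 : Submodule.map h.map.toLinearMap (LinearMap.range (CrysDiff.fn k A).toLinearMap) ≤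
        LinearMap.range (CrysDiff.fn k A').toLinearMap := by
      rintro _ ⟨_, ⟨f, rfl⟩, rfl⟩
      exact ⟨ρ f, (h.map_fn f).symm⟩
    have h2 : Submodule.map h.map.toLinearMap (LinearMap.range (vf k A)) ≤
        LinearMap.range (vf k A') := by
      rintro _ ⟨_, ⟨f, rfl⟩, rfl⟩
      exact ⟨h.ext f, (h.map_vf f).symm⟩
    exact mul_le_mul' h1 (pow_le_pow_left' (sup_le_sup h1 h2) n)
  exact this ⟨d, hd, rfl⟩

end DerExt

end DerExt

/-! ## Localization of differential operators -/

section Localization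

variable {k A A' : Type u} [Field k] [CommRing A] [Algebra k A] [CommRing A'] [Algebra k A']

/-- `ρ` is the localization away from `f`. -/
structure IsAway (ρ : A →ₐ[k] A') (f : A) : Prop where
  isUnit : IsUnit (ρ f)
  surj : ∀ a', ∃ (n : ℕ) (a : A), ρ f ^ n * a' = ρ a
  ker : ∀ a, ρ a = 0 → ∃ n : ℕ, f ^ n * a = 0

lemma IsAway.isLocalization {ρ : A →ₐ[k] A'} {f : A} (h : IsAway ρ f) :
    @IsLocalization.Away A _ f A' _ ρ.toRingHom.toAlgebra := by
  algebraize [ρ.toRingHom]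
  refine (isLocalization_iff (powers f) A').mpr ⟨?_, ?_, ?_⟩
  · rintro ⟨_, n, rfl⟩
    change IsUnit (ρ (f ^ n))
    rw [map_pow]
    exact h.isUnit.pow n
  · intro z
    obtain ⟨n, a, ha⟩ := h.surj z
    refine ⟨(a, ⟨f ^ n, n, rfl⟩), ?_⟩
    change z * ρ (f ^ n) = ρ a
    rw [map_pow, mul_comm, ha]
  · intro x y hxy
    obtain ⟨n, hn⟩ := h.ker (x - y) (by rw [map_sub, sub_eq_zero]; exact hxy)
    exact ⟨⟨f ^ n, n, rfl⟩, by rw [← sub_eq_zero, ← mul_sub]; exact hn⟩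

lemma isAway_of_isLocalization [Algebra A A'] [IsScalarTower k A A'] (f : A) [IsLocalization.Away f A'] :
    IsAway (IsScalarTower.toAlgHom k A A') f where
  isUnit := IsLocalization.Away.algebraMap_isUnit f
  surj a' := by
    obtain ⟨n, a, h⟩ := IsLocalization.Away.surj f a'
    exact ⟨n, a, by rw [mul_comm]; exact h⟩
  ker a ha := by
    obtain ⟨⟨_, n, rfl⟩, h⟩ := (IsLocalization.map_eq_zero_iff (powers f) A' a).mp ha
    exact ⟨n, h⟩

lemma IsAway.formallyEtale {ρ : A →ₐ[k] A'} {f : A} (h : IsAway ρ f) :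
    ρ.toRingHom.FormallyEtale := by
  algebraize [ρ.toRingHom]
  have := h.isLocalization
  exact Algebra.FormallyEtale.of_isLocalization (powers f)

lemma IsAway.derExt {ρ : A →ₐ[k] A'} {f : A} (h : IsAway ρ f) : DerExt ρ :=
  derExt_of_formallyEtale ρ h.formallyEtale

lemma IsAway.exists_der {ρ : A →ₐ[k] A'} {f : A} (h : IsAway ρ f) [FiniteType k A]
    (ξ' : Der k A') : ∃ (n : ℕ) (ξ : Der k A), ∀ a, ρ (ξ a) = ρ f ^ n * ξ' (ρ a) := by
  algebraize [ρ.toRingHom]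
  have : IsScalarTower k A A' := IsScalarTower.of_algebraMap_eq fun a => (ρ.commutes a).symm
  have := h.isLocalization
  have : IsNoetherianRing A := FiniteType.isNoetherianRing k A
  have : Module.FinitePresentation A Ω[A⁄k] := Module.finitePresentation_of_finite A _
  have : IsLocalizedModule (powers f) (Algebra.linearMap A A') := inferInstance
  let δ : Derivation k A A' := ξ'.compAlgebraMap A
  obtain ⟨g, ⟨_, n, rfl⟩, hg⟩ := Module.FinitePresentation.exists_lift_of_isLocalizedModule
    (powers f) (Algebra.linearMap A A') δ.liftKaehlerDifferential
  refine ⟨n, g.compDer (D k A), fun a => ?_⟩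
  have := LinearMap.congr_fun hg (D k A a)
  simp only [LinearMap.comp_apply, LinearMap.smul_apply, Derivation.liftKaehlerDifferential_comp_D] at this
  refine this.trans ?_
  change f ^ n • δ a = _
  rw [smul_def, map_pow]
  rfl

lemma IsAway.der_eq_zero {ρ : A →ₐ[k] A'} {f : A} (h : IsAway ρ f) [hA : FiniteType k A]
    (ξ : Der k A) (hξ : ∀ a, ρ (ξ a) = 0) : ∃ n : ℕ, f ^ n • ξ = 0 := by
  obtain ⟨s, hs⟩ := hA.out
  choose n hn using fun a => h.ker (ξ a) (hξ a)
  refine ⟨s.sup n, Derivation.ext_of_adjoin_eq_top (s : Set A) hs fun a ha => ?_⟩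
  have : n a ≤ s.sup n := Finset.le_sup ha
  rw [Derivation.smul_apply, smul_eq_mul, ← Nat.sub_add_cancel this, pow_add, mul_assoc, hn, mul_zero]
  rfl

/-- Inverting a central element of a ring. -/
lemma exists_central_localization {D : Type u} [Ring D] [Algebra k D] (t : D)
    (ht : ∀ d, t * d = d * t) :
    ∃ (B : Type u) (_ : Ring B) (_ : Algebra k B) (j : D →ₐ[k] B) (s : B), s * j t = 1 ∧
      (∀ b, s * b = b * s) ∧ ∀ d, j d = 0 → ∃ n : ℕ, t ^ n * d = 0 := by
  let : Algebra (Polynomial k) D := (Polynomial.aeval (R := k) t).toRingHom.toAlgebra' (by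
    intro q d
    induction q using Polynomial.induction_on' with
    | add q r hq hr => rw [map_add, add_mul, mul_add, hq, hr]
    | monomial n a =>
      change Polynomial.aeval t _ * d = d * Polynomial.aeval t _
      rw [Polynomial.aeval_monomial, mul_assoc, (Commute.pow_left (ht d) n).eq, ← mul_assoc,
        Algebra.commutes, mul_assoc])
  have hX : algebraMap (Polynomial k) D Polynomial.X = t := Polynomial.aeval_X t
  have hC : ∀ a, algebraMap (Polynomial k) D (Polynomial.C a) = algebraMap k D a :=
    fun a => Polynomial.aeval_C t a
  let S := powers (Polynomial.X : Polynomial k)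
  let B := LocalizedModule S D
  let : Algebra k B := Algebra.compHom B (Polynomial.C : k →+* Polynomial k)
  have h1 : (1 : B) = LocalizedModule.mk 1 1 := (map_one LocalizedModule.numeratorRingHom).symm
  let j : D →ₐ[k] B :=
    { (LocalizedModule.numeratorRingHom : D →+* B) with
      commutes' := fun a => by
        change _ = LocalizedModule.mk (algebraMap (Polynomial k) D (Polynomial.C a)) 1
        rw [hC] }
  refine ⟨B, inferInstance, inferInstance, j, LocalizedModule.mk 1 ⟨Polynomial.X, 1, pow_one _⟩, ?_, ?_, ?_⟩
  · change LocalizedModule.mk (1 : D) _ * LocalizedModule.mk t 1 = 1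
    rw [h1, LocalizedModule.mk_mul_mk, one_mul, mul_one, LocalizedModule.mk_eq]
    refine ⟨1, ?_⟩
    rw [one_smul, one_smul, one_smul, Submonoid.smul_def, smul_def, hX, mul_one]
  · intro b
    induction b using LocalizedModule.induction_on with
    | h d s => rw [LocalizedModule.mk_mul_mk, LocalizedModule.mk_mul_mk, one_mul, mul_one, mul_comm]
  · intro d hd
    have : LocalizedModule.mk d (1 : S) = LocalizedModule.mk 0 1 := hd.trans (LocalizedModule.zero_mk _).symm
    obtain ⟨⟨_, n, rfl⟩, hn⟩ := LocalizedModule.mk_eq.mp this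
    refine ⟨n, ?_⟩
    rw [one_smul, one_smul, smul_zero, Submonoid.smul_def, smul_def] at hn
    change algebraMap (Polynomial k) D (Polynomial.X ^ n) * d = 0 at hn
    rwa [map_pow, hX] at hn

variable (p : ℕ) [Fact p.Prime] [CharP k p]

lemma fn_pow_pow_mul_comm (f : A) (n : ℕ) (x : CrysDiff k A) :
    CrysDiff.fn k A (f ^ p) ^ n * x = x * CrysDiff.fn k A (f ^ p) ^ n :=
  (Commute.pow_left (CrysDiff.fn_pow_central p f x) n).eq

theorem IsAway.map_eq_zero {ρ : A →ₐ[k] A'} {f : A} (h : IsAway ρ f) [FiniteType k A]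
    (d : CrysDiff k A) (hd : h.derExt.map d = 0) : ∃ n : ℕ, CrysDiff.fn k A (f ^ p) ^ n * d = 0 := by
  obtain ⟨B, _, _, j, s, hs, hsc, hker⟩ := exists_central_localization (k := k)
    (CrysDiff.fn k A (f ^ p)) (CrysDiff.fn_pow_central p f)
  have hsn : ∀ n, s ^ n * j (CrysDiff.fn k A ((f ^ p) ^ n)) = 1 := by
    intro n
    have hc : Commute s (j (CrysDiff.fn k A (f ^ p))) := hsc _
    rw [map_pow, map_pow, ← hc.mul_pow, hs, one_pow]
  have hscn : ∀ n b, s ^ n * b = b * s ^ n := fun n b => (Commute.pow_left (hsc b) n).eq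
  have hjz : ∀ (n : ℕ) (z : CrysDiff k A), CrysDiff.fn k A ((f ^ p) ^ n) * z = 0 → j z = 0 := by
    intro n z hz
    rw [← one_mul (j z), ← hsn n, mul_assoc, ← map_mul, hz, map_zero, mul_zero]
  have hfp : ∀ (n : ℕ) (z : CrysDiff k A), CrysDiff.fn k A (f ^ n) * z = 0 → j z = 0 := by
    intro n z hz
    refine hjz n z ?_
    rw [← pow_mul, ← pred_mul_add, pow_add, map_mul, mul_assoc, hz, mul_zero]
  have hred : ∀ (n m : ℕ) (z : CrysDiff k A),
      s ^ (n + m) * j (CrysDiff.fn k A ((f ^ p) ^ m) * z) = s ^ n * j z := by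
    intro n m z
    rw [pow_add, map_mul, mul_assoc, ← mul_assoc (s ^ m), hsn, one_mul]
  have huniq : ∀ (n m : ℕ) (z w : CrysDiff k A), j (CrysDiff.fn k A ((f ^ p) ^ m) * z) =
      j (CrysDiff.fn k A ((f ^ p) ^ n) * w) → s ^ n * j z = s ^ m * j w := by
    intro n m z w h
    rw [← hred n m, h, add_comm, hred m n]
  let RF : A' → ℕ → A → Prop := fun a' n a => ρ ((f ^ p) ^ n) * a' = ρ a
  let RG : Der k A' → ℕ → Der k A → Prop :=
    fun ξ' n ξ => ∀ a, ρ (ξ a) = ρ ((f ^ p) ^ n) * ξ' (ρ a)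
  have hRF : ∀ {a' n m a b}, RF a' n a → RF a' m b →
      s ^ n * j (CrysDiff.fn k A a) = s ^ m * j (CrysDiff.fn k A b) := by
    intro a' n m a b ha hb
    refine huniq n m _ _ ?_
    rw [← map_mul, ← map_mul, ← sub_eq_zero, ← map_sub, ← map_sub]
    obtain ⟨l, hl⟩ := h.ker ((f ^ p) ^ m * a - (f ^ p) ^ n * b) (by
      rw [map_sub, map_mul, map_mul, ← ha, ← hb]; ring)
    exact hfp l _ (by rw [← map_mul, hl, map_zero])
  have hRG : ∀ {ξ' n m ξ η}, RG ξ' n ξ → RG ξ' m η →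
      s ^ n * j (vf k A ξ) = s ^ m * j (vf k A η) := by
    intro ξ' n m ξ η hξ hη
    refine huniq n m _ _ ?_
    rw [← vf_smul, ← vf_smul, ← sub_eq_zero, ← map_sub, ← map_sub]
    obtain ⟨l, hl⟩ := h.der_eq_zero ((f ^ p) ^ m • ξ - (f ^ p) ^ n • η) (fun a => by
      rw [Derivation.sub_apply, Derivation.smul_apply, Derivation.smul_apply, smul_eq_mul,
        smul_eq_mul, map_sub, map_mul, map_mul, hξ, hη]
      ring)
    exact hfp l _ (by rw [← vf_smul, hl, map_zero])
  have hpn : ∀ n : ℕ, (f ^ p) ^ n = f ^ ((p - 1) * n) * f ^ n := fun n => by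
    rw [← pow_mul, ← pow_add, pred_mul_add]
  have hexF : ∀ a', ∃ (n : ℕ) (a : A), RF a' n a := by
    intro a'
    obtain ⟨n, a, ha⟩ := h.surj a'
    refine ⟨n, f ^ ((p - 1) * n) * a, ?_⟩
    change ρ ((f ^ p) ^ n) * a' = _
    rw [hpn, map_mul, map_mul, map_pow ρ f n, mul_assoc, ha]
  have hexG : ∀ ξ', ∃ (n : ℕ) (ξ : Der k A), RG ξ' n ξ := by
    intro ξ'
    obtain ⟨n, ξ, hξ⟩ := h.exists_der ξ'
    refine ⟨n, f ^ ((p - 1) * n) • ξ, fun a => ?_⟩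
    rw [Derivation.smul_apply, smul_eq_mul, map_mul, hξ, hpn, map_mul, map_pow ρ f n, mul_assoc]
  choose nF aF hF using hexF
  choose nG dG hG using hexG
  let F : A' → B := fun a' => s ^ nF a' * j (CrysDiff.fn k A (aF a'))
  let G : Der k A' → B := fun ξ' => s ^ nG ξ' * j (vf k A (dG ξ'))
  have eF : ∀ {a' n a}, RF a' n a → F a' = s ^ n * j (CrysDiff.fn k A a) := fun h => hRF (hF _) h
  have eG : ∀ {ξ' n ξ}, RG ξ' n ξ → G ξ' = s ^ n * j (vf k A ξ) := fun h => hRG (hG _) h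
  have hmulF : ∀ (n m : ℕ) (z w : CrysDiff k A), s ^ n * j z * (s ^ m * j w) = s ^ (n + m) * j (z * w) := by
    intro n m z w
    rw [map_mul, pow_add, mul_assoc, mul_assoc, ← mul_assoc (j z), ← hscn, mul_assoc]
  have hF0 : ∀ a, F (ρ a) = j (CrysDiff.fn k A a) := fun a => by
    rw [eF (n := 0) (a := a) (by simp [RF]), pow_zero, one_mul]
  let FF : A' →ₐ[k] B :=
    { toFun := F
      map_one' := by rw [← map_one ρ, hF0, map_one, map_one]
      map_zero' := by rw [← map_zero ρ, hF0, map_zero, map_zero]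
      map_mul' := fun x y => by
        rw [eF (a' := x * y) (n := nF x + nF y) (a := aF x * aF y), map_mul, ← hmulF]
        change _ * _ = _
        rw [map_mul, ← hF x, ← hF y, pow_add, map_mul]; ring
      map_add' := fun x y => by
        rw [eF (a' := x + y) (n := nF x + nF y)
          (a := (f ^ p) ^ nF y * aF x + (f ^ p) ^ nF x * aF y), map_add, map_mul, map_mul, map_add,
          mul_add, hred, add_comm (nF x), hred]
        change _ * _ = _
        rw [map_add, map_mul, map_mul, ← hF x, ← hF y, pow_add, map_mul]; ring
      commutes' := fun a => by
        rw [← ρ.commutes, hF0, commutes, commutes] }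
  let GG : Der k A' →+ B := AddMonoidHom.mk' G fun x y => by
    rw [eG (ξ' := x + y) (n := nG x + nG y)
      (ξ := (f ^ p) ^ nG y • dG x + (f ^ p) ^ nG x • dG y), map_add, vf_smul,
      vf_smul, map_add, mul_add, hred, add_comm (nG x), hred]
    intro a
    rw [Derivation.add_apply, Derivation.smul_apply, Derivation.smul_apply, Derivation.add_apply,
      smul_eq_mul, smul_eq_mul, map_add, map_mul, map_mul, hG x, hG y, pow_add, map_mul]
    ring
  have hkill : ∀ (ξ' : Der k A') (n : ℕ) (a : A'), ξ' (ρ ((f ^ p) ^ n) * a) =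
      ρ ((f ^ p) ^ n) * ξ' a := by
    intro ξ' n a
    rw [← pow_mul, mul_comm p, pow_mul, map_pow, leibniz, derivation_pow_p p, smul_zero,
      add_zero, smul_eq_mul]
  let L : CrysDiff k A' →ₐ[k] B := CrysDiff.lift FF GG
    (fun x ξ => by
      change G (x • ξ) = F x * G ξ
      rw [eG (ξ' := x • ξ) (n := nF x + nG ξ) (ξ := aF x • dG ξ), vf_smul, ← hmulF]
      intro a
      rw [Derivation.smul_apply, Derivation.smul_apply, smul_eq_mul, smul_eq_mul, map_mul, hG ξ,
        ← hF x, pow_add, map_mul]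
      ring)
    (fun ξ x => by
      change G ξ * F x = F x * G ξ + F (ξ x)
      rw [eF (a' := ξ x) (n := nF x + nG ξ) (a := dG ξ (aF x)), hmulF, hmulF, CrysDiff.vf_mul_fn,
        map_add, mul_add, add_comm (nG ξ)]
      change _ * _ = _
      rw [hG ξ, ← hF x, hkill, pow_add, map_mul]
      ring)
    (fun ξ η => by
      change G ξ * G η = G η * G ξ + G ⁅ξ, η⁆
      rw [eG (ξ' := ⁅ξ, η⁆) (n := nG η + nG ξ) (ξ := ⁅dG ξ, dG η⁆), hmulF, hmulF,
        CrysDiff.vf_mul_vf, map_add, mul_add, add_comm (nG ξ)]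
      intro a
      rw [commutator_apply, commutator_apply, map_sub, hG ξ (dG η a),
        hG η a, hG η (dG ξ a), hG ξ a, hkill, hkill, pow_add, map_mul]
      ring)
  have hL : L.comp h.derExt.map = j := by
    refine CrysDiff.algHom_ext (fun f => ?_) fun ξ => ?_
    · rw [AlgHom.comp_apply, DerExt.map_fn, CrysDiff.lift_fn]
      exact hF0 f
    · rw [AlgHom.comp_apply, DerExt.map_vf, CrysDiff.lift_vf]
      change G _ = _
      rw [eG (n := 0) (ξ := ξ) (fun a => by rw [h.derExt.ext_apply]; simp), pow_zero, one_mul]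
  refine hker d ?_
  rw [← hL, AlgHom.comp_apply, hd, map_zero]

theorem IsAway.map_surj {ρ : A →ₐ[k] A'} {f : A} (h : IsAway ρ f) [FiniteType k A]
    (d' : CrysDiff k A') : ∃ (n : ℕ) (d : CrysDiff k A), CrysDiff.fn k A' (ρ f ^ p) ^ n * d' = h.derExt.map d := by
  let c : CrysDiff k A' := CrysDiff.fn k A' (ρ f ^ p)
  have hc : ∀ n x, c ^ n * x = x * c ^ n := fun n x => fn_pow_pow_mul_comm p (ρ f) n x
  have hcm : ∀ n, c ^ n = h.derExt.map (CrysDiff.fn k A ((f ^ p) ^ n)) := fun n => by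
    rw [map_pow, map_pow, DerExt.map_fn, map_pow]
  let S : Subalgebra k (CrysDiff k A') :=
    { carrier := {d' | ∃ (n : ℕ) (d : CrysDiff k A), c ^ n * d' = h.derExt.map d}
      mul_mem' := by
        rintro x y ⟨n, d, hd⟩ ⟨m, e, he⟩
        exact ⟨n + m, d * e, by rw [map_mul, ← hd, ← he, pow_add, mul_assoc, ← mul_assoc _ x,
          hc m x, mul_assoc, mul_assoc]⟩
      add_mem' := by
        rintro x y ⟨n, d, hd⟩ ⟨m, e, he⟩
        refine ⟨n + m, CrysDiff.fn k A ((f ^ p) ^ m) * d + CrysDiff.fn k A ((f ^ p) ^ n) * e, ?_⟩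
        rw [map_add, map_mul, map_mul, ← hd, ← he, ← hcm, ← hcm, mul_add, ← mul_assoc, ← mul_assoc,
          ← pow_add, ← pow_add, add_comm m]
      algebraMap_mem' := fun r => ⟨0, algebraMap k _ r, by rw [pow_zero, one_mul, commutes]⟩ }
  refine CrysDiff.mem_of_generators S (fun a' => ?_) (fun ξ' => ?_) d'
  · obtain ⟨n, a, ha⟩ := h.surj a'
    refine ⟨n, CrysDiff.fn k A (f ^ ((p - 1) * n) * a), ?_⟩
    have := pred_mul_add p n
    rw [DerExt.map_fn, map_mul, map_pow, ← ha, ← map_pow, ← map_mul, ← mul_assoc, ← pow_add, this,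
      pow_mul]
  · obtain ⟨n, ξ, hξ⟩ := h.exists_der ξ'
    refine ⟨n, vf k A (f ^ ((p - 1) * n) • ξ), ?_⟩
    have := pred_mul_add p n
    rw [DerExt.map_vf, ← map_pow, ← vf_smul]
    congr 1
    refine h.derExt.eq_ext fun a => ?_
    rw [Derivation.smul_apply, Derivation.smul_apply, smul_eq_mul, smul_eq_mul, map_mul, hξ,
      ← mul_assoc, map_pow, ← pow_add, this, pow_mul]

end Localization

/-! ## Local arguments -/

section Local

variable {A D : Type u} [CommRing A] [Ring D]

/-- A local principle for subgroups of a ring stable under a commutative ring of multipliers. -/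
lemma mem_of_local (j : A →+* D) (H : AddSubgroup D) (hH : ∀ a, ∀ x ∈ H, j a * x ∈ H) (s : Set A)
    (hs : Ideal.span s = ⊤) (x : D) (h : ∀ f ∈ s, ∃ n : ℕ, j (f ^ n) * x ∈ H) : x ∈ H := by
  let I : Ideal A :=
    { carrier := {a | j a * x ∈ H}
      add_mem' := fun {a b} ha hb => by
        change j (a + b) * x ∈ H
        rw [map_add, add_mul]
        exact add_mem ha hb
      zero_mem' := by
        change j 0 * x ∈ H
        rw [map_zero, zero_mul]; exact zero_mem _
      smul_mem' := fun a b hb => by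
        change j (a * b) * x ∈ H
        rw [map_mul, mul_assoc]
        exact hH _ _ hb }
  have hI : I.radical = ⊤ := by
    rw [← top_le_iff, ← hs]
    refine Ideal.span_le.mpr fun f hf => ?_
    obtain ⟨n, hn⟩ := h f hf
    exact ⟨n, hn⟩
  have : (1 : A) ∈ I := by
    rw [Ideal.radical_eq_top] at hI
    rw [hI]; trivial
  have h1 : j 1 * x ∈ H := this
  rwa [map_one, one_mul] at h1

lemma eq_zero_of_local (j : A →+* D) (s : Set A) (hs : Ideal.span s = ⊤) (x : D)
    (h : ∀ f ∈ s, ∃ n : ℕ, j (f ^ n) * x = 0) : x = 0 :=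
  mem_of_local j ⊥ (fun a x hx => by
    rw [AddSubgroup.mem_bot] at hx ⊢; rw [hx, mul_zero]) s hs x h

end Local

/-! ## Local coordinates and the `p`-curvature -/

section LocCoords

variable (k : Type u) [Field k] (p : ℕ) [Fact p.Prime] [CharP k p]

/-- The Frobenius endomorphism of a commutative `k`-algebra. -/
def frobHom (A : Type*) [CommRing A] [Algebra k A] : A →+* A where
  toFun a := a ^ p
  map_one' := one_pow p
  map_mul' a b := mul_pow a b p
  map_zero' := zero_pow (Fact.out : p.Prime).ne_zero
  map_add' a b := add_pow_p k p a b

lemma frobHom_apply {A : Type*} [CommRing A] [Algebra k A] (a : A) : frobHom k p A a = a ^ p := rfl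

/-- There are coordinate systems locally on `Spec A`. -/
def HasLocCoords (A : Type u) [CommRing A] [Algebra k A] : Prop :=
  ∃ s : Set A, Ideal.span s = ⊤ ∧ ∀ f ∈ s, ∃ (A' : Type u) (_ : CommRing A') (_ : Algebra k A')
    (ρ : A →ₐ[k] A') (I : Type) (_ : Finite I) (_ : Coords k A' I), IsAway ρ f

variable {k} {A : Type u} [CommRing A] [Algebra k A]

lemma Coords.vf_der_pow_central {I : Type} [Finite I] (X : Coords k A I) (i : I) (x : CrysDiff k A) :
    vf k A (X.der i) ^ p * x = x * vf k A (X.der i) ^ p := by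
  have := Fintype.ofFinite I
  have hf : ∀ r, vf k A (X.der i) ^ p * CrysDiff.fn k A r =
      CrysDiff.fn k A r * vf k A (X.der i) ^ p := by
    intro r
    have := X.frame.ore.X_pow_mul_ι p i r
    rw [show X.frame.ore.der i = X.der i from rfl, X.der_iterate p (Fact.out : p.Prime).two_le, map_zero,
      zero_mul, add_zero, X.frame.ore_m_X] at this
    exact this
  refine CrysDiff.mem_of_generators (Subalgebra.centralizer k {vf k A (X.der i) ^ p}) ?_ ?_ x _ rfl
  · rintro r _ rfl
    exact hf r
  · rintro ξ _ rfl
    have hc : ∀ j, vf k A (X.der i) ^ p * vf k A (X.der j) =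
        vf k A (X.der j) * vf k A (X.der i) ^ p := by
      intro j
      refine (Commute.pow_left ?_ p).eq
      have := CrysDiff.vf_mul_vf k A (X.der i) (X.der j)
      rwa [X.der_comm, map_zero, add_zero] at this
    rw [X.frame.vf_eq_sum ξ, mul_sum, sum_mul]
    refine sum_congr rfl fun j _ => ?_
    rw [← mul_assoc, hf, mul_assoc]
    exact (congrArg _ (hc j)).trans (mul_assoc _ _ _).symm

lemma Coords.pcurv_central {I : Type} [Finite I] (X : Coords k A I) (ξ : Der k A)
    (x : CrysDiff k A) : pcurv p ξ * x = x * pcurv p ξ := by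
  have := Fintype.ofFinite I
  rw [X.pcurv_eq p, sum_mul, mul_sum]
  refine sum_congr rfl fun i _ => ?_
  rw [mul_assoc, X.vf_der_pow_central p, ← mul_assoc, CrysDiff.fn_pow_central, mul_assoc]

lemma Coords.pcurv_add {I : Type} [Finite I] (X : Coords k A I) (ξ η : Der k A) :
    pcurv p (ξ + η) = pcurv p ξ + pcurv p η := by
  have := Fintype.ofFinite I
  rw [X.pcurv_eq p, X.pcurv_eq p, X.pcurv_eq p, ← sum_add_distrib]
  refine sum_congr rfl fun i _ => ?_
  rw [Derivation.add_apply, add_pow_p k p, map_add, add_mul]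

lemma Coords.pcurv_smul {I : Type} [Finite I] (X : Coords k A I) (f : A) (ξ : Der k A) :
    pcurv p (f • ξ) = CrysDiff.fn k A (f ^ p) * pcurv p ξ := by
  have := Fintype.ofFinite I
  rw [X.pcurv_eq p, X.pcurv_eq p, mul_sum]
  refine sum_congr rfl fun i _ => ?_
  rw [Derivation.smul_apply, smul_eq_mul, mul_pow, map_mul, mul_assoc]

lemma HasLocCoords.eq_of_local [FiniteType k A] {s : Set A} (hs : Ideal.span s = ⊤)
    {x y : CrysDiff k A} (h : ∀ f ∈ s, ∃ (A' : Type u) (_ : CommRing A') (_ : Algebra k A')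
      (ρ : A →ₐ[k] A') (hρ : IsAway ρ f), hρ.derExt.map x = hρ.derExt.map y)
    (p : ℕ) [Fact p.Prime] [CharP k p] : x = y := by
  rw [← sub_eq_zero]
  refine eq_zero_of_local ((CrysDiff.fn k A).toRingHom.comp (frobHom k p A)) s hs _ fun f hf => ?_
  obtain ⟨A', _, _, ρ, hρ, e⟩ := h f hf
  obtain ⟨n, hn⟩ := hρ.map_eq_zero p (x - y) (by rw [map_sub, e, sub_self])
  refine ⟨n, ?_⟩
  rw [map_pow]
  exact hn

lemma pcurv_central [FiniteType k A] (hA : HasLocCoords k A) (ξ : Der k A)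
    (x : CrysDiff k A) : pcurv p ξ * x = x * pcurv p ξ := by
  obtain ⟨s, hs, h⟩ := hA
  refine HasLocCoords.eq_of_local hs (fun f hf => ?_) p
  obtain ⟨A', _, _, ρ, I, _, X, hρ⟩ := h f hf
  refine ⟨A', _, _, ρ, hρ, ?_⟩
  rw [map_mul, map_mul, DerExt.map_pcurv, X.pcurv_central p]

lemma pcurv_add [FiniteType k A] (hA : HasLocCoords k A) (ξ η : Der k A) :
    pcurv p (ξ + η) = pcurv p ξ + pcurv p η := by
  obtain ⟨s, hs, h⟩ := hA
  refine HasLocCoords.eq_of_local hs (fun f hf => ?_) p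
  obtain ⟨A', _, _, ρ, I, _, X, hρ⟩ := h f hf
  refine ⟨A', _, _, ρ, hρ, ?_⟩
  rw [map_add, DerExt.map_pcurv, DerExt.map_pcurv, DerExt.map_pcurv, DerExt.ext_add, X.pcurv_add p]

lemma pcurv_smul [FiniteType k A] (hA : HasLocCoords k A) (f : A) (ξ : Der k A) :
    pcurv p (f • ξ) = CrysDiff.fn k A (f ^ p) * pcurv p ξ := by
  obtain ⟨s, hs, h⟩ := hA
  refine HasLocCoords.eq_of_local hs (fun f hf => ?_) p
  obtain ⟨A', _, _, ρ, I, _, X, hρ⟩ := h f hf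
  refine ⟨A', _, _, ρ, hρ, ?_⟩
  rw [map_mul, DerExt.map_pcurv, DerExt.map_pcurv, DerExt.map_fn, DerExt.ext_smul, X.pcurv_smul p,
    map_pow ρ]

end LocCoords

open TDO.TorsorRing (act euler)


/-- Vector fields on the principal bundle. -/
abbrev TorsorDer (k R L : Type u) [Field k] [CommRing R] [Algebra k R] [AddCommGroup L] [Module R L] :=
  Derivation k (TorsorRing R L) (TorsorRing R L)

/-- Polynomials in `ℏ` whose coefficients are differential operators on the principal bundle. -/
abbrev TorsorOps (k R L : Type u) [Field k] [CommRing R] [Algebra k R] [AddCommGroup L] [Module R L] :=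
  Polynomial (CrysDiff k (TorsorRing R L))

section InvSys

/-- A presentation of an invertible module by generators and functionals. -/
structure InvSys (R L : Type u) [CommRing R] [AddCommGroup L] [Module R L] where
  /-- the number of generators -/
  n : ℕ
  /-- the generators -/
  l : Fin n → L
  /-- the functionals -/
  ν : Fin n → Dual R L
  sum_smul : ∀ m, ∑ j, ν j m • l j = m
  sum_one : ∑ j, ν j (l j) = 1

variable {R L : Type u} [CommRing R] [AddCommGroup L] [Module R L] (S : InvSys R L)

lemma InvSys.dual_apply (ν : Dual R L) (m : L) : ν m = ∑ j, S.ν j m * ν (S.l j) := by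
  conv_lhs => rw [← S.sum_smul m]
  simp

lemma InvSys.dual_eq (ν : Dual R L) : ν = ∑ j, ν (S.l j) • S.ν j := by
  refine LinearMap.ext fun m => ?_
  rw [S.dual_apply ν m, LinearMap.sum_apply]
  simp [mul_comm]

namespace TorsorRing

/-- A ring homomorphism out of the ring of functions on the principal bundle. -/
def liftHom {T : Type u} [CommRing T] (φ : R →+* T) (a : L →+ T) (b : Dual R L →+ T)
    (ha : ∀ (r : R) l, a (r • l) = φ r * a l) (hb : ∀ (r : R) ν, b (r • ν) = φ r * b ν)
    (h : ∀ l ν, a l * b ν = φ (ν l)) : TorsorRing R L →+* T :=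
  letI := φ.toAlgebra
  (lift { toFun := a, map_add' := a.map_add, map_smul' := ha }
    { toFun := b, map_add' := b.map_add, map_smul' := hb } h).toRingHom

section
variable {T : Type u} [CommRing T] (φ : R →+* T) (a : L →+ T) (b : Dual R L →+ T) (ha hb h)

@[simp] lemma liftHom_sec (l : L) : liftHom φ a b ha hb h (sec R L l) = a l :=
  letI := φ.toAlgebra
  lift_sec { toFun := a, map_add' := a.map_add, map_smul' := ha } _ _ l

@[simp] lemma liftHom_cosec (ν : Dual R L) : liftHom φ a b ha hb h (cosec R L ν) = b ν :=
  letI := φ.toAlgebra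
  lift_cosec _ { toFun := b, map_add' := b.map_add, map_smul' := hb } _ ν

@[simp] lemma liftHom_algebraMap (r : R) : liftHom φ a b ha hb h (algebraMap R _ r) = φ r :=
  letI := φ.toAlgebra
  (lift { toFun := a, map_add' := a.map_add, map_smul' := ha }
    { toFun := b, map_add' := b.map_add, map_smul' := hb } h).commutes r

end

lemma ringHom_ext {T : Type*} [CommRing T] {f g : TorsorRing R L →+* T}
    (h₀ : ∀ r, f (algebraMap R _ r) = g (algebraMap R _ r))
    (h₁ : ∀ l, f (sec R L l) = g (sec R L l)) (h₂ : ∀ ν, f (cosec R L ν) = g (cosec R L ν)) : f = g := by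
  refine RingHom.ext fun x => ?_
  induction x using TorsorRing.induction with
  | base r => exact h₀ r
  | sec' l => exact h₁ l
  | cosec' l => exact h₂ l
  | mul a b ha hb => rw [map_mul, map_mul, ha, hb]
  | add a b ha hb => rw [map_add, map_add, ha, hb]

lemma sec_smul' (r : R) (l : L) : sec R L (r • l) = algebraMap R _ r * sec R L l := by
  rw [map_smul, smul_def]

lemma cosec_smul' (r : R) (ν : Dual R L) :
    cosec R L (r • ν) = algebraMap R _ r * cosec R L ν := by
  rw [map_smul, smul_def]

lemma sec_eq (l : L) : sec R L l = ∑ j, algebraMap R _ (S.ν j l) * sec R L (S.l j) := by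
  conv_lhs => rw [← S.sum_smul l]
  simp only [map_sum, sec_smul']

lemma cosec_eq (ν : Dual R L) :
    cosec R L ν = ∑ j, algebraMap R _ (ν (S.l j)) * cosec R L (S.ν j) := by
  conv_lhs => rw [S.dual_eq ν]
  simp only [map_sum, cosec_smul']

lemma sum_sec_mul_cosec : ∑ j, sec R L (S.l j) * cosec R L (S.ν j) = 1 := by
  simp only [sec_mul_cosec, ← map_sum, S.sum_one, map_one]

variable (k : Type u) [Field k] [Algebra k R]

lemma finiteType (S : InvSys R L) [FiniteType k R] : FiniteType k (TorsorRing R L) := by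
  classical
  have : FiniteType R (TorsorRing R L) := by
    refine ⟨⟨Finset.univ.image (fun j => sec R L (S.l j)) ∪ Finset.univ.image (fun j => cosec R L (S.ν j)), ?_⟩⟩
    rw [eq_top_iff]
    rintro x -
    set T := adjoin R (((Finset.univ.image (fun j => sec R L (S.l j)) ∪
      Finset.univ.image (fun j => cosec R L (S.ν j)) : Finset (TorsorRing R L))) : Set (TorsorRing R L)) with hT
    induction x using TorsorRing.induction with
    | base r => exact Subalgebra.algebraMap_mem _ r
    | sec' l =>
      rw [sec_eq S]
      exact sum_mem fun j _ => mul_mem (Subalgebra.algebraMap_mem _ _) (subset_adjoin (by simp))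
    | cosec' l =>
      rw [cosec_eq S]
      exact sum_mem fun j _ => mul_mem (Subalgebra.algebraMap_mem _ _) (subset_adjoin (by simp))
    | mul a b ha hb => exact mul_mem ha hb
    | add a b ha hb => exact add_mem ha hb
  exact FiniteType.trans (S := R) inferInstance inferInstance

variable {k}

lemma derivation_ext {a b : TorsorDer k R L}
    (h₀ : ∀ r, a (algebraMap R _ r) = b (algebraMap R _ r))
    (h₁ : ∀ l, a (sec R L l) = b (sec R L l)) (h₂ : ∀ ν, a (cosec R L ν) = b (cosec R L ν)) : a = b := by
  ext x
  induction x using TorsorRing.induction with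
  | base r => exact h₀ r
  | sec' l => exact h₁ l
  | cosec' l => exact h₂ l
  | mul x y hx hy => rw [leibniz, leibniz, hx, hy]
  | add x y hx hy => rw [map_add, map_add, hx, hy]

lemma isInvariant_iff {a : TorsorDer k R L} :
    IsInvariant a ↔ ∀ t f, a ((act k t).symm f) = (act k t).symm (a f) := by
  constructor
  · intro h t f
    conv_rhs => rw [← h t, conjDer_apply, AlgEquiv.symm_apply_apply]
  · intro h t
    ext f
    rw [conjDer_apply, h, AlgEquiv.apply_symm_apply]

lemma isInvariant_of {a : TorsorDer k R L}
    (h₀ : ∀ (t : kˣ) r, a (algebraMap R _ r) = (act k t).symm (a (algebraMap R _ r)))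
    (h₁ : ∀ (t : kˣ) l, (t : k) • a (sec R L l) = (act k t).symm (a (sec R L l)))
    (h₂ : ∀ (t : kˣ) ν, ((t⁻¹ : kˣ) : k) • a (cosec R L ν) = (act k t).symm (a (cosec R L ν))) :
    IsInvariant a := by
  rw [isInvariant_iff]
  intro t f
  induction f using TorsorRing.induction with
  | base r => rw [act_symm_algebraMap]; exact h₀ t r
  | sec' l => rw [act_symm_sec, Derivation.map_smul]; exact h₁ t l
  | cosec' ν => rw [act_symm_cosec, Derivation.map_smul]; exact h₂ t ν
  | mul x y hx hy =>
    rw [map_mul, leibniz, leibniz, map_add, smul_eq_mul, smul_eq_mul, smul_eq_mul,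
      smul_eq_mul, map_mul, map_mul, hx, hy]
  | add x y hx hy => rw [map_add, map_add, map_add, map_add, hx, hy]

/-- The dual number `a + b ε`. -/
def dualNum {A : Type*} [CommRing A] (a b : A) : TrivSqZeroExt A A :=
  TrivSqZeroExt.inl a + TrivSqZeroExt.inr b

section
variable {A : Type*} [CommRing A] (a b c d : A)

@[simp] lemma fst_dualNum : (dualNum a b).fst = a := by simp [dualNum]

@[simp] lemma snd_dualNum : (dualNum a b).snd = b := by simp [dualNum]

lemma dualNum_mul : dualNum a b * dualNum c d = dualNum (a * c) (a * d + c * b) := by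
  ext <;> simp [mul_comm]

lemma dualNum_add : dualNum a b + dualNum c d = dualNum (a + c) (b + d) := by ext <;> simp

end

/-- The dual-number homomorphism of `liftDer`. -/
def liftDerHom (ξ : Der k R) : TorsorRing R L →+* TrivSqZeroExt (TorsorRing R L) (TorsorRing R L) :=
  liftHom
    { toFun := fun r => dualNum (algebraMap R _ r) (algebraMap R _ (ξ r))
      map_one' := by ext <;> simp
      map_mul' := fun r s => by simp [dualNum_mul]
      map_zero' := by ext <;> simp
      map_add' := fun r s => by simp [dualNum_add] }
    { toFun := fun l => dualNum (sec R L l) (∑ j, algebraMap R _ (ξ (S.ν j l)) * sec R L (S.l j))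
      map_zero' := by ext <;> simp
      map_add' := fun l l' => by simp [dualNum_add, add_mul, sum_add_distrib] }
    { toFun := fun ν => dualNum (cosec R L ν) (∑ j, algebraMap R _ (ξ (ν (S.l j))) * cosec R L (S.ν j))
      map_zero' := by ext <;> simp
      map_add' := fun l l' => by simp [dualNum_add, add_mul, sum_add_distrib] }
    (fun r l => by
      refine Eq.trans ?_ (dualNum_mul _ _ _ _).symm
      refine congrArg₂ dualNum (sec_smul' r l) ?_
      rw [mul_sum]
      conv_rhs => rw [sec_eq S l, sum_mul, ← sum_add_distrib]
      refine sum_congr rfl fun j _ => ?_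
      rw [map_smul, smul_eq_mul, leibniz, smul_eq_mul, smul_eq_mul, map_add, map_mul, map_mul]
      ring)
    (fun r ν => by
      refine Eq.trans ?_ (dualNum_mul _ _ _ _).symm
      refine congrArg₂ dualNum (cosec_smul' r ν) ?_
      rw [mul_sum]
      conv_rhs => rw [cosec_eq S ν, sum_mul, ← sum_add_distrib]
      refine sum_congr rfl fun j _ => ?_
      rw [LinearMap.smul_apply, smul_eq_mul, leibniz, smul_eq_mul, smul_eq_mul, map_add,
        map_mul, map_mul]
      ring)
    (fun l ν => by
      refine Eq.trans (dualNum_mul _ _ _ _) ?_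
      refine congrArg₂ dualNum (sec_mul_cosec R L l ν) ?_
      rw [S.dual_apply ν l, map_sum, map_sum, mul_sum, mul_sum, ← sum_add_distrib]
      refine sum_congr rfl fun j _ => ?_
      rw [leibniz, smul_eq_mul, smul_eq_mul, map_add, map_mul, map_mul, ← sec_mul_cosec,
        ← sec_mul_cosec]
      ring)

lemma fst_liftDerHom (ξ : Der k R) (f : TorsorRing R L) : (liftDerHom S ξ f).fst = f := by
  have : ((TrivSqZeroExt.fstHom R (TorsorRing R L) (TorsorRing R L)).toRingHom.comp (liftDerHom S ξ)) =
      RingHom.id _ := by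
    apply ringHom_ext <;> intro x <;> simp [liftDerHom]
  exact RingHom.congr_fun this f

/-- The lift of a vector field to an invariant vector field on the principal bundle. -/
def liftDer (ξ : Der k R) : TorsorDer k R L :=
  Derivation.mk'
    { toFun := fun f => (liftDerHom S ξ f).snd
      map_add' := by simp
      map_smul' := fun a f => by
        have h : (liftDerHom S ξ (algebraMap R (TorsorRing R L) (algebraMap k R a))).snd = 0 := by
          rw [liftDerHom, liftHom_algebraMap]; exact (snd_dualNum (A := TorsorRing R L) _ _).trans (by simp)
        have h2 : a • f = algebraMap R (TorsorRing R L) (algebraMap k R a) * f := by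
          rw [← smul_def, algebraMap_smul]
        rw [h2, map_mul, TrivSqZeroExt.snd_mul, h, fst_liftDerHom, fst_liftDerHom, smul_zero, add_zero,
          smul_def]
        rfl }
    (fun a b => by simp [fst_liftDerHom, mul_comm])

@[simp] lemma liftDer_algebraMap (ξ : Der k R) (r : R) :
    liftDer S ξ (algebraMap R _ r) = algebraMap R _ (ξ r) := by
  change (liftDerHom S ξ _).snd = _
  rw [liftDerHom, liftHom_algebraMap]; exact snd_dualNum _ _

@[simp] lemma liftDer_sec (ξ : Der k R) (l : L) :
    liftDer S ξ (sec R L l) = ∑ j, algebraMap R _ (ξ (S.ν j l)) * sec R L (S.l j) := by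
  change (liftDerHom S ξ _).snd = _
  rw [liftDerHom, liftHom_sec]; exact snd_dualNum _ _

@[simp] lemma liftDer_cosec (ξ : Der k R) (ν : Dual R L) :
    liftDer S ξ (cosec R L ν) = ∑ j, algebraMap R _ (ξ (ν (S.l j))) * cosec R L (S.ν j) := by
  change (liftDerHom S ξ _).snd = _
  rw [liftDerHom, liftHom_cosec]; exact snd_dualNum _ _

lemma liftDer_isInvariant (ξ : Der k R) : IsInvariant (liftDer S ξ) := by
  refine isInvariant_of ?_ ?_ ?_
  · intro t r
    rw [liftDer_algebraMap, act_symm_algebraMap]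
  · intro t l
    rw [liftDer_sec, map_sum, Finset.smul_sum]
    refine sum_congr rfl fun j _ => ?_
    rw [map_mul, act_symm_algebraMap, act_symm_sec, mul_smul_comm]
  · intro t l
    rw [liftDer_cosec, map_sum, Finset.smul_sum]
    refine sum_congr rfl fun j _ => ?_
    rw [map_mul, act_symm_algebraMap, act_symm_cosec, mul_smul_comm]

lemma liftDer_add (ξ η : Der k R) : liftDer S (ξ + η) = liftDer S ξ + liftDer S η := by
  apply derivation_ext <;> intro x <;> simp [add_mul, sum_add_distrib]

/-- The coefficient of the Euler vector field in a vertical vector field. -/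
def eulerCoef (a : TorsorDer k R L) : TorsorRing R L :=
  - ∑ j, cosec R L (S.ν j) * a (sec R L (S.l j))

lemma eq_eulerCoef_smul {a : TorsorDer k R L}
    (ha : ∀ r, a (algebraMap R _ r) = 0) : a = eulerCoef S a • euler R L k := by
  refine derivation_ext (fun r => ?_) (fun l => ?_) (fun ν => ?_)
  · rw [ha, Derivation.smul_apply, euler_algebraMap, smul_zero]
  · rw [Derivation.smul_apply, euler_sec, eulerCoef, neg_smul, smul_neg, neg_neg, smul_eq_mul,
      sum_mul]
    conv_lhs => rw [sec_eq S l]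
    rw [map_sum]
    refine sum_congr rfl fun j _ => ?_
    rw [leibniz, ha, smul_zero, add_zero, smul_eq_mul, ← sec_mul_cosec]
    ring
  · rw [Derivation.smul_apply, euler_cosec, eulerCoef, neg_smul, smul_eq_mul, sum_mul]
    conv_lhs => rw [← one_mul (a (cosec R L ν)), ← sum_sec_mul_cosec S, sum_mul]
    rw [← Finset.sum_neg_distrib]
    refine sum_congr rfl fun j _ => ?_
    have h := ha (ν (S.l j))
    rw [← sec_mul_cosec, leibniz, smul_eq_mul, smul_eq_mul, add_eq_zero_iff_eq_neg] at h
    rw [mul_right_comm, h]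
    ring

lemma pPow_euler (p : ℕ) [Fact p.Prime] [CharP k p] : pPow p (euler R L k) = euler R L k := by
  have h1 : ∀ l n, (euler R L k)^[n] (sec R L l) = (-1) ^ n * sec R L l := by
    intro l n
    induction n with
    | zero => simp
    | succ n ih => 
      rw [Function.iterate_succ_apply, euler_sec, iterate_map_neg, ih]; ring
  have h2 : ∀ l n, (euler R L k)^[n] (cosec R L l) = cosec R L l := by
    intro l n
    induction n with
    | zero => simp
    | succ n ih => rw [Function.iterate_succ_apply, euler_cosec, ih]
  have h3 : (-1 : TorsorRing R L) ^ p = -1 := by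
    have : (-1 : k) ^ p = -1 := by exact neg_one_pow_char k p
    simpa using congrArg (algebraMap k (TorsorRing R L)) this
  refine derivation_ext (fun r => ?_) (fun l => ?_) (fun ν => ?_)
  · obtain ⟨q, hq⟩ : ∃ q, p = q + 1 := Nat.exists_eq_add_one.mpr (Fact.out : p.Prime).pos
    rw [pPow_apply, hq, Function.iterate_succ_apply, euler_algebraMap, iterate_map_zero]
  · rw [pPow_apply, h1, h3, euler_sec, neg_one_mul]
  · rw [pPow_apply, h2, euler_cosec]

end TorsorRing

end InvSys

open TDO.TorsorRing (liftDer liftDer_algebraMap liftDer_isInvariant)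


section Restr

variable {R R' : Type u} [CommRing R] [Algebra k R] [CommRing R']
  [Algebra k R'] {L L' : Type u} [AddCommGroup L] [Module R L] [AddCommGroup L'] [Module R' L']

/-- Restriction of functions and of sections of a line bundle to a smaller affine open subset. -/
structure IsRestr (ρ : R →ₐ[k] R') (σ : L →+ L') : Prop where
  smul : ∀ r l, σ (r • l) = ρ r • σ l
  etale : ρ.toRingHom.FormallyEtale
  span : Submodule.span R' (range σ) = ⊤
  dual : ∀ ν : Dual R L, ∃ ν' : Dual R' L', ∀ l, ν' (σ l) = ρ (ν l)

variable {ρ : R →ₐ[k] R'} {σ : L →+ L'}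

namespace IsRestr

lemma hom_ext (H : IsRestr ρ σ) {M : Type*} [AddCommGroup M] [Module R' M] {a b : L' →ₗ[R'] M}
    (h : ∀ l, a (σ l) = b (σ l)) : a = b :=
  LinearMap.ext_on_range H.span h

lemma derExt (H : IsRestr ρ σ) : DerExt ρ := derExt_of_formallyEtale ρ H.etale

/-- The extension of a functional. -/
def dualExt (H : IsRestr ρ σ) : Dual R L →+ Dual R' L' where
  toFun ν := (H.dual ν).choose
  map_zero' := H.hom_ext fun l => by rw [(H.dual 0).choose_spec]; simp
  map_add' ν ν' := H.hom_ext fun l => by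
    rw [LinearMap.add_apply, (H.dual _).choose_spec, (H.dual _).choose_spec, (H.dual _).choose_spec]
    simp

@[simp] lemma dualExt_apply (H : IsRestr ρ σ) (ν : Dual R L) (l : L) :
    H.dualExt ν (σ l) = ρ (ν l) := (H.dual ν).choose_spec l

lemma eq_dualExt (H : IsRestr ρ σ) {ν : Dual R L} {ν' : Dual R' L'}
    (h : ∀ l, ν' (σ l) = ρ (ν l)) : ν' = H.dualExt ν := H.hom_ext fun l => by rw [h, dualExt_apply]

lemma dualExt_smul (H : IsRestr ρ σ) (r : R) (ν : Dual R L) :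
    H.dualExt (r • ν) = ρ r • H.dualExt ν :=
  (H.eq_dualExt fun l => by simp).symm

/-- The presentation induced on the smaller subset. -/
def invSys (H : IsRestr ρ σ) (S : InvSys R L) : InvSys R' L' where
  n := S.n
  l j := σ (S.l j)
  ν j := H.dualExt (S.ν j)
  sum_smul m := by
    have : ∑ j, (H.dualExt (S.ν j)).smulRight (σ (S.l j)) = LinearMap.id := H.hom_ext fun l => by
      rw [LinearMap.sum_apply]
      simp only [LinearMap.smulRight_apply, dualExt_apply, ← H.smul, ← map_sum, S.sum_smul]
      rfl
    have := LinearMap.congr_fun this m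
    rw [LinearMap.sum_apply] at this
    exact this
  sum_one := by simp only [dualExt_apply, ← map_sum, S.sum_one, map_one]

end IsRestr

namespace TorsorRing

open IsRestr

/-- Restriction of functions on the principal bundle, as a ring homomorphism. -/
def mapHom (H : IsRestr ρ σ) : TorsorRing R L →+* TorsorRing R' L' :=
  liftHom ((algebraMap R' (TorsorRing R' L')).comp ρ.toRingHom)
    ((sec R' L').toAddMonoidHom.comp σ) ((cosec R' L').toAddMonoidHom.comp H.dualExt)
    (fun r l => by
      change sec R' L' (σ (r • l)) = _
      rw [H.smul, sec_smul']; rfl)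
    (fun r ν => by
      change cosec R' L' (H.dualExt (r • ν)) = _
      rw [H.dualExt_smul, cosec_smul']; rfl)
    (fun l ν => by
      change sec R' L' (σ l) * cosec R' L' (H.dualExt ν) = _
      rw [sec_mul_cosec, H.dualExt_apply]; rfl)

/-- Restriction of functions on the principal bundle. -/
def map (H : IsRestr ρ σ) : TorsorRing R L →ₐ[k] TorsorRing R' L' :=
  { mapHom H with
    commutes' := fun a => by
      change mapHom H (algebraMap R _ (algebraMap k R a)) = algebraMap R' _ (algebraMap k R' a)
      rw [mapHom, liftHom_algebraMap, ← ρ.commutes a]; rfl }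

variable (H : IsRestr ρ σ)

@[simp] lemma map_algebraMap (r : R) : map H (algebraMap R _ r) = algebraMap R' _ (ρ r) :=
  by change mapHom H _ = _; rw [mapHom, liftHom_algebraMap]; rfl

@[simp] lemma map_sec (l : L) : map H (sec R L l) = sec R' L' (σ l) :=
  by change mapHom H _ = _; rw [mapHom, liftHom_sec]; rfl

@[simp] lemma map_cosec (ν : Dual R L) : map H (cosec R L ν) = cosec R' L' (H.dualExt ν) :=
  by change mapHom H _ = _; rw [mapHom, liftHom_cosec]; rfl

lemma mem_resGraph_iff (x : TorsorRing R L) (y : TorsorRing R' L') :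
    (x, y) ∈ resGraph (k := k) ρ σ ↔ y = map H x := by
  constructor
  · intro h
    have : resGraph (k := k) ρ σ ≤ AlgHom.equalizer (AlgHom.snd k (TorsorRing R L) (TorsorRing R' L'))
        ((map H).comp (AlgHom.fst k (TorsorRing R L) (TorsorRing R' L'))) := by
      refine Algebra.adjoin_le ?_
      rintro _ ((⟨f, rfl⟩ | ⟨l, rfl⟩) | ⟨ν, ν', h, rfl⟩)
      · exact (map_algebraMap H f).symm
      · exact (map_sec H l).symm
      · rw [H.eq_dualExt h]; exact (map_cosec H ν).symm
    exact this h
  · rintro rfl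
    induction x using TorsorRing.induction with
    | base r => exact subset_adjoin (Or.inl (Or.inl ⟨r, by rw [map_algebraMap]⟩))
    | sec' l => exact subset_adjoin (Or.inl (Or.inr ⟨l, by rw [map_sec]⟩))
    | cosec' ν =>
      exact subset_adjoin (Or.inr ⟨ν, H.dualExt ν, H.dualExt_apply ν, by rw [map_cosec]⟩)
    | mul a b ha hb => rw [map_mul]; exact mul_mem ha hb
    | add a b ha hb => rw [map_add]; exact add_mem ha hb

lemma hom_ext_of_restr (S : InvSys R L) {T : Type*} [CommRing T] {f g : TorsorRing R' L' →+* T}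
    (h₀ : ∀ r, f (algebraMap R' _ r) = g (algebraMap R' _ r)) (h₁ : ∀ x, f (map H x) = g (map H x)) :
    f = g := by
  refine ringHom_ext h₀ (fun l => ?_) fun ν => ?_
  · rw [sec_eq (H.invSys S), map_sum, map_sum]
    refine sum_congr rfl fun j _ => ?_
    rw [map_mul, map_mul, h₀]
    congr 1
    have := h₁ (sec R L (S.l j))
    rwa [map_sec] at this
  · rw [cosec_eq (H.invSys S), map_sum, map_sum]
    refine sum_congr rfl fun j _ => ?_
    rw [map_mul, map_mul, h₀]
    congr 1
    have := h₁ (cosec R L (S.ν j))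
    rwa [map_cosec] at this

lemma exists_hom_of_restr (S : InvSys R L) {T : Type u} [CommRing T] (g : TorsorRing R L →+* T)
    (ψ : R' →+* T) (h : ∀ r, ψ (ρ r) = g (algebraMap R _ r)) :
    ∃ G : TorsorRing R' L' →+* T, (∀ r, G (algebraMap R' _ r) = ψ r) ∧ ∀ x, G (map H x) = g x := by
  let S' := H.invSys S
  let G : TorsorRing R' L' →+* T := liftHom ψ
    { toFun := fun l => ∑ j, ψ (H.dualExt (S.ν j) l) * g (sec R L (S.l j))
      map_zero' := by simp
      map_add' := fun l l' => by simp [add_mul, sum_add_distrib] }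
    { toFun := fun ν => ∑ j, ψ (ν (σ (S.l j))) * g (cosec R L (S.ν j))
      map_zero' := by simp
      map_add' := fun l l' => by simp [add_mul, sum_add_distrib] }
    (fun r l => by simp [mul_sum, mul_assoc])
    (fun r ν => by simp [mul_sum, mul_assoc])
    (fun l ν => by
      change (∑ j : Fin S.n, _) * (∑ j : Fin S.n, _) = _
      rw [Finset.sum_mul_sum]
      have h1 : ∀ i j, ψ (H.dualExt (S.ν i) l) * g (sec R L (S.l i)) *
          (ψ (ν (σ (S.l j))) * g (cosec R L (S.ν j))) =
          ψ (H.dualExt (S.ν i) l * (H.dualExt (S.ν j) (σ (S.l i)) * ν (σ (S.l j)))) := by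
        intro i j
        rw [H.dualExt_apply, map_mul, map_mul, h, ← sec_mul_cosec, map_mul]
        ring
      simp only [h1]
      rw [S'.dual_apply ν l, map_sum]
      refine sum_congr rfl fun i _ => ?_
      rw [← map_sum, ← mul_sum]
      congr 2
      exact (S'.dual_apply ν _).symm)
  have hG0 : ∀ r, G (algebraMap R' _ r) = ψ r := liftHom_algebraMap _ _ _ _ _ _
  refine ⟨G, hG0, fun x => ?_⟩
  refine RingHom.congr_fun (f := G.comp (map H).toRingHom) (g := g) (ringHom_ext (fun r => ?_) (fun l => ?_)
    fun ν => ?_) x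
  · change G (map H _) = _
    rw [map_algebraMap, hG0, h]
  · change G (map H _) = _
    rw [map_sec, sec_eq S l, map_sum]
    refine (liftHom_sec _ _ _ _ _ _ _).trans ?_
    change (∑ j : Fin S.n, ψ (H.dualExt (S.ν j) (σ l)) * g (sec R L (S.l j))) = _
    refine sum_congr rfl fun j _ => ?_
    rw [map_mul, H.dualExt_apply, h]
  · change G (map H _) = _
    rw [map_cosec, cosec_eq S ν, map_sum]
    refine (liftHom_cosec _ _ _ _ _ _ _).trans ?_
    change (∑ j : Fin S.n, ψ (H.dualExt ν (σ (S.l j))) * g (cosec R L (S.ν j))) = _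
    refine sum_congr rfl fun j _ => ?_
    rw [map_mul, H.dualExt_apply, h]

lemma map_formallyEtale (S : InvSys R L) : (map H).toRingHom.FormallyEtale := by
  have hE := H.etale
  algebraize [ρ.toRingHom, (map H).toRingHom]
  change Algebra.FormallyEtale (TorsorRing R L) (TorsorRing R' L')
  rw [Algebra.FormallyEtale.iff_comp_bijective]
  intro B _ _ I hI
  let : Algebra R B := ((algebraMap (TorsorRing R L) B).comp (algebraMap R (TorsorRing R L))).toAlgebra
  have hbij := Algebra.FormallyEtale.comp_bijective R R' I hI
  have hα : ∀ r, algebraMap R B r = algebraMap (TorsorRing R L) B (algebraMap R (TorsorRing R L) r) :=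
    fun _ => rfl
  have hρ : ∀ r, algebraMap R R' r = ρ r := fun _ => rfl
  have hm : ∀ r, algebraMap (TorsorRing R L) (TorsorRing R' L') r = map H r := fun _ => rfl
  let toR' : ∀ {C : Type u} [CommRing C] [Algebra R C] [Algebra (TorsorRing R L) C],
      (∀ r, algebraMap R C r = algebraMap (TorsorRing R L) C (algebraMap R _ r)) →
      (TorsorRing R' L' →ₐ[TorsorRing R L] C) → (R' →ₐ[R] C) := fun hC f =>
    { f.toRingHom.comp (algebraMap R' (TorsorRing R' L')) with
      commutes' := fun r => by
        change f (algebraMap R' _ (ρ r)) = _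
        rw [← map_algebraMap H, ← hm, f.commutes, hC] }
  constructor
  · intro f g hfg
    have h0 : toR' hα f = toR' hα g := hbij.1 (AlgHom.ext fun r =>
      AlgHom.congr_fun hfg (algebraMap R' (TorsorRing R' L') r))
    refine AlgHom.coe_ringHom_injective (hom_ext_of_restr H S (fun r => AlgHom.congr_fun h0 r) fun x => ?_)
    change f (map H x) = g (map H x)
    rw [← hm, f.commutes, g.commutes]
  · intro f
    obtain ⟨ψ, hψ⟩ := hbij.2 (toR' (C := B ⧸ I) (fun r => rfl) f)
    obtain ⟨G, hG0, hG1⟩ := exists_hom_of_restr H S (algebraMap (TorsorRing R L) B) ψ.toRingHom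
      (fun r => (ψ.commutes r).trans (hα r))
    refine ⟨{ G with commutes' := hG1 }, AlgHom.coe_ringHom_injective
      (hom_ext_of_restr H S (fun r => ?_) fun x => ?_)⟩
    · change Ideal.Quotient.mk I (G _) = f _
      rw [hG0]
      exact AlgHom.congr_fun hψ r
    · change Ideal.Quotient.mk I (G _) = f _
      rw [hG1, ← hm, f.commutes]
      rfl

lemma map_derExt (S : InvSys R L) : DerExt (map H) := derExt_of_formallyEtale _ (map_formallyEtale H S)

lemma map_isAway (S : InvSys R L) {f : R} (hf : IsAway ρ f) :
    IsAway (map H) (algebraMap R (TorsorRing R L) f) where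
  isUnit := by rw [map_algebraMap]; exact hf.isUnit.map _
  surj a' := by
    rw [map_algebraMap]
    have key : ∀ r', ∃ (n : ℕ) (a : TorsorRing R L),
        algebraMap R' (TorsorRing R' L') (ρ f) ^ n * algebraMap R' _ r' = map H a := by
      intro r'
      obtain ⟨n, a, h⟩ := hf.surj r'
      exact ⟨n, algebraMap R _ a, by rw [map_algebraMap, ← h, map_mul, map_pow]⟩
    have hmap : ∀ n, algebraMap R' (TorsorRing R' L') (ρ f) ^ n = map H (algebraMap R _ f ^ n) := by
      intro n; rw [_root_.map_pow, map_algebraMap]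
    have hmul : ∀ a b : TorsorRing R' L',
        (∃ (n : ℕ) (c : TorsorRing R L), algebraMap R' (TorsorRing R' L') (ρ f) ^ n * a = map H c) →
        (∃ (n : ℕ) (c : TorsorRing R L), algebraMap R' (TorsorRing R' L') (ρ f) ^ n * b = map H c) →
        (∃ (n : ℕ) (c : TorsorRing R L), algebraMap R' (TorsorRing R' L') (ρ f) ^ n * (a * b) = map H c) := by
      rintro a b ⟨n, x, hx⟩ ⟨m, y, hy⟩
      exact ⟨n + m, x * y, by rw [_root_.map_mul, ← hx, ← hy]; ring⟩
    have hadd : ∀ a b : TorsorRing R' L',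
        (∃ (n : ℕ) (c : TorsorRing R L), algebraMap R' (TorsorRing R' L') (ρ f) ^ n * a = map H c) →
        (∃ (n : ℕ) (c : TorsorRing R L), algebraMap R' (TorsorRing R' L') (ρ f) ^ n * b = map H c) →
        (∃ (n : ℕ) (c : TorsorRing R L), algebraMap R' (TorsorRing R' L') (ρ f) ^ n * (a + b) = map H c) := by
      rintro a b ⟨n, x, hx⟩ ⟨m, y, hy⟩
      refine ⟨n + m, algebraMap R _ f ^ m * x + algebraMap R _ f ^ n * y, ?_⟩
      rw [_root_.map_add, _root_.map_mul, _root_.map_mul, ← hx, ← hy, ← hmap, ← hmap]; ring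
    have hsum : ∀ {n : ℕ} (a : Fin n → TorsorRing R' L'), (∀ j,
        (∃ (n : ℕ) (c : TorsorRing R L), algebraMap R' (TorsorRing R' L') (ρ f) ^ n * a j = map H c)) →
        (∃ (n : ℕ) (c : TorsorRing R L), algebraMap R' (TorsorRing R' L') (ρ f) ^ n * ∑ j, a j = map H c) := by
      intro n a ha
      refine Finset.sum_induction (s := Finset.univ) a (fun a => ∃ (n : ℕ) (c : TorsorRing R L),
        algebraMap R' (TorsorRing R' L') (ρ f) ^ n * a = map H c) hadd ⟨0, 0, by simp⟩ fun j _ => ha j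
    induction a' using TorsorRing.induction with
    | base r => exact key r
    | sec' l =>
      rw [sec_eq (H.invSys S)]
      exact hsum _ fun j => hmul _ _ (key _) ⟨0, sec R L (S.l j), by rw [map_sec]; simp; rfl⟩
    | cosec' l =>
      rw [cosec_eq (H.invSys S)]
      exact hsum _ fun j => hmul _ _ (key _) ⟨0, cosec R L (S.ν j), by rw [map_cosec]; simp; rfl⟩
    | mul a b ha hb => exact hmul a b ha hb
    | add a b ha hb => exact hadd a b ha hb
  ker a ha := by
    algebraize [ρ.toRingHom]
    have := hf.isLocalization
    let B := Localization.Away (algebraMap R (TorsorRing R L) f)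
    have hu : IsUnit (((algebraMap (TorsorRing R L) B).comp (algebraMap R (TorsorRing R L))) f) :=
      IsLocalization.Away.algebraMap_isUnit (algebraMap R (TorsorRing R L) f)
    obtain ⟨G, -, hG⟩ := exists_hom_of_restr H S (algebraMap (TorsorRing R L) B)
      (IsLocalization.Away.lift (S := R') f hu) (fun r => IsLocalization.Away.lift_eq f hu r)
    have h0 : algebraMap (TorsorRing R L) B a = 0 := by rw [← hG, ha, _root_.map_zero]
    obtain ⟨⟨_, n, rfl⟩, hn⟩ := (IsLocalization.map_eq_zero_iff
      (powers (algebraMap R (TorsorRing R L) f)) B a).mp h0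
    exact ⟨n, hn⟩

lemma map_act (t : kˣ) (x : TorsorRing R L) : map H ((act k t).symm x) = (act k t).symm (map H x) := by
  induction x using TorsorRing.induction with
  | base r => rw [act_symm_algebraMap, map_algebraMap, act_symm_algebraMap]
  | sec' l => rw [act_symm_sec, _root_.map_smul, map_sec, act_symm_sec]
  | cosec' l => rw [act_symm_cosec, _root_.map_smul, map_cosec, act_symm_cosec]
  | mul a b ha hb => simp only [_root_.map_mul, ha, hb]
  | add a b ha hb => simp only [_root_.map_add, ha, hb]

lemma ext_isInvariant (S : InvSys R L) {a : TorsorDer k R L}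
    (ha : IsInvariant a) : IsInvariant ((map_derExt H S).ext a) := by
  intro t
  refine (map_derExt H S).eq_ext fun x => ?_
  have hs : (act k t).symm (map H x) = map H ((act k t).symm x) := (map_act H t x).symm
  rw [conjDer_apply, hs, (map_derExt H S).ext_apply, isInvariant_iff.mp ha, map_act,
    AlgEquiv.apply_symm_apply]

lemma ext_euler (S : InvSys R L) : (map_derExt H S).ext (euler R L k) = euler R' L' k :=
  ((map_derExt H S).eq_ext fun x => by
    induction x using TorsorRing.induction with
    | base r => simp
    | sec' l => simp
    | cosec' l => simp
    | mul a b ha hb => simp [leibniz, ha, hb]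
    | add a b ha hb => simp [ha, hb]).symm

lemma ext_liftDer (S : InvSys R L) (ξ : Der k R) :
    (map_derExt H S).ext (liftDer S ξ) = liftDer (H.invSys S) (H.derExt.ext ξ) := by
  refine ((map_derExt H S).eq_ext fun x => ?_).symm
  induction x using TorsorRing.induction with
  | base r => simp [H.derExt.ext_apply]
  | sec' l => 
    simp only [liftDer_sec, map_sec, map_sum, map_mul, map_algebraMap]
    refine sum_congr rfl fun j _ => ?_
    rw [← H.derExt.ext_apply, ← H.dualExt_apply]; rfl
  | cosec' l => 
    simp only [liftDer_cosec, map_cosec, map_sum, map_mul, map_algebraMap]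
    refine sum_congr rfl fun j _ => ?_
    rw [← H.derExt.ext_apply, ← H.dualExt_apply]; rfl
  | mul a b ha hb => simp [leibniz, ha, hb]
  | add a b ha hb => simp [ha, hb]

end TorsorRing

end Restr

section LFrame

/-- A frame of a module. -/
structure LFrame (R L : Type u) [CommRing R] [AddCommGroup L] [Module R L] where
  /-- the frame -/
  s : L
  bij : Bijective fun r : R => r • s

namespace LFrame

variable {R L : Type u} [CommRing R] [AddCommGroup L] [Module R L] (F : LFrame R L)

/-- The dual frame. -/
def dual : Dual R L :=
  (LinearEquiv.ofBijective (LinearMap.toSpanSingleton R L F.s) F.bij).symm.toLinearMap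

lemma dual_smul (l : L) : F.dual l • F.s = l :=
  (LinearEquiv.ofBijective (LinearMap.toSpanSingleton R L F.s) F.bij).apply_symm_apply l

lemma dual_s : F.dual F.s = 1 := F.bij.1 (by simp [dual_smul])

/-- The presentation given by a frame. -/
def invSys : InvSys R L where
  n := 1
  l _ := F.s
  ν _ := F.dual
  sum_smul m := by simp [dual_smul]
  sum_one := by simp [dual_s]

open LaurentPolynomial in
/-- Functions on the trivial principal bundle as Laurent polynomials. -/
def laurent : TorsorRing R L →ₐ[R] LaurentPolynomial R :=
  TorsorRing.lift ((LinearMap.toSpanSingleton R _ (T (-1))) ∘ₗ F.dual)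
    ((LinearMap.toSpanSingleton R _ (T 1)) ∘ₗ LinearMap.applyₗ F.s) fun l ν => by
      have : (ν l : R) = F.dual l * ν F.s := by
        conv_lhs => rw [← F.dual_smul l]
        simp
      simp only [LinearMap.comp_apply, LinearMap.toSpanSingleton_apply, LinearMap.applyₗ_apply_apply]
      rw [smul_mul_smul_comm, ← T_add, this, Algebra.algebraMap_eq_smul_one]
      simp

/-- The coordinate on the fibres. -/
def y : TorsorRing R L := TorsorRing.cosec R L F.dual

/-- The inverse of the coordinate on the fibres. -/
def yinv : TorsorRing R L := TorsorRing.sec R L F.s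

lemma yinv_mul_y : F.yinv * F.y = 1 := by
  rw [yinv, y, TorsorRing.sec_mul_cosec, F.dual_s, map_one]

lemma y_mul_yinv : F.y * F.yinv = 1 := by rw [mul_comm, yinv_mul_y]

lemma sec_eq (l : L) : TorsorRing.sec R L l = algebraMap R _ (F.dual l) * F.yinv := by
  conv_lhs => rw [← F.dual_smul l]
  rw [TorsorRing.sec_smul']; rfl

lemma cosec_eq (ν : Dual R L) : TorsorRing.cosec R L ν = algebraMap R _ (ν F.s) * F.y := by
  have := TorsorRing.cosec_eq F.invSys ν
  rw [this]
  exact Fin.sum_univ_one _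

open LaurentPolynomial in
lemma laurent_sec (l : L) : F.laurent (TorsorRing.sec R L l) = F.dual l • T (-1) :=
  TorsorRing.lift_sec _ _ _ l

open LaurentPolynomial in
lemma laurent_cosec (ν : Dual R L) : F.laurent (TorsorRing.cosec R L ν) = ν F.s • T 1 :=
  TorsorRing.lift_cosec _ _ _ ν

open LaurentPolynomial in
lemma laurent_injective : Function.Injective F.laurent := by
  let g : LaurentPolynomial R →+* TorsorRing R L :=
    eval₂ (algebraMap R _) ⟨F.y, F.yinv, F.y_mul_yinv, F.yinv_mul_y⟩
  have hC : ∀ r, g (algebraMap R _ r) = algebraMap R _ r := fun r => by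
    rw [← C_eq_algebraMap]; exact eval₂_C _ _ r
  have h : g.comp F.laurent.toRingHom = RingHom.id _ := by
    refine TorsorRing.ringHom_ext (fun r => ?_) (fun l => ?_) fun ν => ?_
    · change g (F.laurent _) = _
      rw [commutes, hC]; rfl
    · change g (F.laurent _) = TorsorRing.sec R L l
      rw [laurent_sec, smul_def, map_mul, hC, F.sec_eq]
      congr 1
      exact (eval₂_T_neg_n _ _ 1).trans (pow_one _)
    · change g (F.laurent _) = TorsorRing.cosec R L ν
      rw [laurent_cosec, smul_def, map_mul, hC, F.cosec_eq]
      congr 1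
      exact (eval₂_T_n _ _ 1).trans (pow_one _)
  exact Function.LeftInverse.injective (g := g) fun x => RingHom.congr_fun h x

/-- The homogeneous components of a function on the trivial principal bundle. -/
def coef (n : ℤ) : TorsorRing R L →ₗ[R] R where
  toFun x := (F.laurent x).coeff n
  map_add' x y := by simp
  map_smul' r x := by simp

lemma coef_ext {x y : TorsorRing R L} (h : ∀ n, F.coef n x = F.coef n y) : x = y :=
  F.laurent_injective (LaurentPolynomial.ext h)

lemma coef_algebraMap (n : ℤ) (r : R) :
    F.coef n (algebraMap R _ r) = if n = 0 then r else 0 := by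
  change (F.laurent _).coeff n = _
  rw [commutes, ← LaurentPolynomial.C_eq_algebraMap, LaurentPolynomial.C_apply]

lemma coef_algebraMap_mul (n : ℤ) (r : R) (x : TorsorRing R L) :
    F.coef n (algebraMap R _ r * x) = r * F.coef n x := by
  rw [← smul_def, map_smul, smul_eq_mul]

lemma algebraMap_injective (F : LFrame R L) : Function.Injective (algebraMap R (TorsorRing R L)) := fun a b h => by
  simpa [coef_algebraMap] using congrArg (F.coef 0) h

variable [Algebra k R]

open LaurentPolynomial in
variable (R) in
/-- The variable as a unit of the ring of Laurent polynomials, multiplied by a constant. -/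
def unitT (t : kˣ) : (LaurentPolynomial R)ˣ :=
  Units.map ((C : R →+* LaurentPolynomial R).comp (algebraMap k R)).toMonoidHom t *
    ⟨T 1, T (-1), by rw [← T_add, add_neg_cancel, T_zero], by rw [← T_add, neg_add_cancel, T_zero]⟩

open LaurentPolynomial in
lemma unitT_zpow (t : kˣ) (m : ℤ) : ((unitT R t ^ m : (LaurentPolynomial R)ˣ) : LaurentPolynomial R) =
    C (algebraMap k R ((t ^ m : kˣ) : k)) * T m := by
  rw [unitT, mul_zpow, ← map_zpow, Units.val_mul]
  congr 1
  induction m with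
  | zero => simp
  | succ m ih => rw [zpow_add_one, Units.val_mul, ih, ← T_add]
  | pred m ih => rw [zpow_sub_one, Units.val_mul, ih, Units.inv_mk, ← T_add]; rfl

open LaurentPolynomial in
lemma laurent_act (t : kˣ) (x : TorsorRing R L) : F.laurent ((act k t).symm x) =
    eval₂ C (unitT R t⁻¹) (F.laurent x) := by
  have h : ∀ m : ℤ, eval₂ C (unitT R t⁻¹) (T m) = C (algebraMap k R (((t⁻¹) ^ m : kˣ) : k)) * T m :=
    fun m => (eval₂_T _ _ m).trans (unitT_zpow _ _)
  induction x using TorsorRing.induction with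
  | base r =>
    rw [TorsorRing.act_symm_algebraMap, commutes, ← C_eq_algebraMap, eval₂_C]
  | sec' l =>
    rw [TorsorRing.act_symm_sec, ← algebraMap_smul R, map_smul, laurent_sec, smul_eq_C_mul, smul_eq_C_mul,
      RingHom.map_mul (eval₂ C (unitT R t⁻¹)), eval₂_C, h, zpow_neg_one, inv_inv, mul_left_comm]
  | cosec' ν =>
    rw [TorsorRing.act_symm_cosec, ← algebraMap_smul R, map_smul, laurent_cosec, smul_eq_C_mul,
      smul_eq_C_mul, RingHom.map_mul (eval₂ C (unitT R t⁻¹)), eval₂_C, h, zpow_one, mul_left_comm]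
  | mul a b ha hb => simp only [map_mul, ha, hb]
  | add a b ha hb => simp only [map_add, ha, hb]

open LaurentPolynomial in
lemma coef_act (t : kˣ) (n : ℤ) (x : TorsorRing R L) :
    F.coef n ((act k t).symm x) = algebraMap k R (((t⁻¹) ^ n : kˣ) : k) * F.coef n x := by
  change (F.laurent _).coeff n = _ * (F.laurent x).coeff n
  rw [laurent_act]
  generalize F.laurent x = q
  induction q using LaurentPolynomial.induction_on' with
  | add a b ha hb => simp only [map_add, AddMonoidAlgebra.coeff_add, Finsupp.add_apply, ha, hb, mul_add]
  | C_mul_T m r =>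
    rw [eval₂_C_mul_T, unitT_zpow, ← mul_assoc, ← C.map_mul, ← single_eq_C_mul_T, ← single_eq_C_mul_T,
      AddMonoidAlgebra.coeff_single, AddMonoidAlgebra.coeff_single, Finsupp.single_apply, Finsupp.single_apply]
    split_ifs with hmn
    · rw [hmn, mul_comm]
    · rw [mul_zero]

/-- Invariant functions on the principal bundle are functions on the base. -/
lemma exists_of_invariant (F : LFrame R L) [Infinite k] {x : TorsorRing R L}
    (hx : ∀ t : kˣ, act k t x = x) : ∃ r, algebraMap R _ r = x := by
  refine ⟨F.coef 0 x, F.coef_ext fun n => ?_⟩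
  rw [coef_algebraMap]
  split_ifs with hn
  · rw [hn]
  obtain ⟨t, ht⟩ : ∃ t : kˣ, t ^ (-n) ≠ 1 := by
    by_contra! h
    have h1 : ∀ t : kˣ, t ^ n.natAbs = 1 := fun t => by
      rcases Int.natAbs_eq n with h' | h'
      · have := h t
        rw [zpow_neg, inv_eq_one, h', zpow_natCast] at this
        exact this
      · have := h t
        rw [h', neg_neg, zpow_natCast] at this
        exact this
    have hpos : 0 < n.natAbs := Int.natAbs_pos.mpr hn
    let P : Polynomial k := Polynomial.X ^ (n.natAbs + 1) - Polynomial.X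
    have hP : P ≠ 0 := by
      intro h0
      have := congrArg (fun q => Polynomial.coeff q 1) h0
      simp only [P, Polynomial.coeff_sub, Polynomial.coeff_X_pow, Polynomial.coeff_X, Polynomial.coeff_zero] at this
      rw [if_neg (by omega)] at this
      simp at this
    refine hP (Polynomial.eq_zero_of_infinite_isRoot P (Set.infinite_of_injective_forall_mem
      (f := (id : k → k)) Function.injective_id fun a => ?_))
    by_cases ha : a = 0
    · simp [P, ha]
    · have := congrArg Units.val (h1 (Units.mk0 a ha))
      simp only [Units.val_pow_eq_pow_val, Units.val_mk0, Units.val_one] at this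
      simp [P, pow_succ, this]
  have h1 := F.coef_act t n x
  have h2 : (act k t).symm x = x := by rw [AlgEquiv.symm_apply_eq, hx]
  rw [h2] at h1
  have h3 : (((t⁻¹ ^ n : kˣ) : k) - 1) • F.coef n x = 0 := by
    rw [smul_def, map_sub, sub_mul, ← h1, map_one, one_mul, sub_self]
  refine ((smul_eq_zero_iff_right ?_).mp h3).symm
  rw [sub_ne_zero]
  exact fun h => ht (Units.ext (by rw [zpow_neg, ← inv_zpow]; exact h))

variable {I : Type} (X : Coords k R I)

lemma liftDer_y (ξ : Der k R) : liftDer F.invSys ξ F.y = 0 := by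
  rw [y, TorsorRing.liftDer_cosec]
  refine Finset.sum_eq_zero fun j _ => ?_
  have : ξ (F.dual (F.invSys.l j)) = 0 := by
    change ξ (F.dual F.s) = 0
    rw [dual_s, Derivation.map_one_eq_zero]
  rw [this, map_zero, zero_mul]

lemma euler_y : euler R L k F.y = F.y := TorsorRing.euler_cosec _ _ _ _

/-- The coordinate system on the trivial principal bundle. -/
def coords : Coords k (TorsorRing R L) (Option I) where
  x i := i.elim F.y fun i => algebraMap R _ (X.x i)
  der i := i.elim (F.yinv • euler R L k) fun i => liftDer F.invSys (X.der i)
  der_self i := by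
    cases i with
    | none => 
      change F.yinv • euler R L k F.y = 1
      rw [euler_y, smul_eq_mul, yinv_mul_y]
    | some i =>
      change liftDer _ _ (algebraMap R _ (X.x i)) = 1
      rw [liftDer_algebraMap, X.der_self, map_one]
  der_ne i j hij := by
    rcases i with _ | i <;> rcases j with _ | j
    · exact absurd rfl hij
    · change F.yinv • euler R L k _ = 0
      rw [Option.elim_some, TorsorRing.euler_algebraMap, smul_zero]
    · exact F.liftDer_y _
    · change liftDer _ _ (algebraMap R _ (X.x j)) = 0
      rw [liftDer_algebraMap, X.der_ne i j fun h => hij (by rw [h]), map_zero]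
  ext_zero ξ hξ := by
    have h0 : ∀ r, ξ (algebraMap R _ r) = 0 := by
      intro r
      refine F.coef_ext fun n => ?_
      let D : Der k R := Derivation.mk'
        { toFun := fun r => F.coef n (ξ (algebraMap R _ r))
          map_add' := by simp
          map_smul' := fun a r => by
            rw [smul_def, map_mul, ← IsScalarTower.algebraMap_apply, ← smul_def,
              Derivation.map_smul, ← algebraMap_smul R, map_smul, algebraMap_smul]
            rfl } (fun a b => by
            change F.coef n (ξ (algebraMap R _ (a * b))) = _
            rw [map_mul, leibniz, map_add, smul_eq_mul, smul_eq_mul, coef_algebraMap_mul,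
              coef_algebraMap_mul]
            rfl)
      have hD : D = 0 := X.ext_zero D fun i => by
        change F.coef n (ξ (algebraMap R _ (X.x i))) = 0
        rw [show ξ (algebraMap R _ (X.x i)) = 0 from hξ (some i), map_zero]
      rw [map_zero]
      exact congrArg (fun D : Der k R => D r) hD
    have h1 := TorsorRing.eq_eulerCoef_smul F.invSys h0
    have h2 : ξ F.y = 0 := hξ none
    rw [h1, Derivation.smul_apply, euler_y, smul_eq_mul] at h2
    have h3 := congrArg (· * F.yinv) h2
    simp only [mul_assoc, y_mul_yinv, mul_one, zero_mul] at h3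
    rw [h1, h3, zero_smul]

/-- The frame of invariant vector fields on the trivial principal bundle. -/
def frame : CommFrame k (TorsorRing R L) (Option I) where
  der i := i.elim (euler R L k) fun i => liftDer F.invSys (X.der i)
  coef :=
    { toFun := fun ξ i => i.elim (F.yinv * ξ F.y) fun i => ξ (algebraMap R _ (X.x i))
      map_add' := fun ξ η => by
        funext i
        rcases i with _ | i
        · exact mul_add _ _ _
        · rfl
      map_smul' := fun f ξ => by
        funext i
        rcases i with _ | i
        · exact mul_left_comm _ _ _
        · rfl }
  der_comm i j := by
    refine (F.coords X).ext fun l => ?_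
    rw [commutator_apply]
    rcases i with _ | i <;> rcases j with _ | j <;> rcases l with _ | l <;>
      simp [coords, euler_y, liftDer_y]
    rw [← map_sub, ← commutator_apply, X.der_comm]; simp
  coef_self i := by
    rcases i with _ | i
    · change F.yinv * euler R L k F.y = 1
      rw [euler_y, yinv_mul_y]
    · exact (F.coords X).der_self (some i)
  coef_ne i j hij := by
    rcases i with _ | i <;> rcases j with _ | j
    · exact absurd rfl hij
    · exact TorsorRing.euler_algebraMap R L k _
    · change F.yinv * liftDer F.invSys (X.der i) F.y = 0
      rw [liftDer_y, mul_zero]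
    · exact (F.coords X).der_ne (some i) (some j) hij
  coef_inj ξ h := by
    refine (F.coords X).ext_zero ξ fun i => ?_
    rcases i with _ | i
    · have : F.yinv * ξ F.y = 0 := congrFun h none
      have h3 := congrArg (F.y * ·) this
      simp only [← mul_assoc, y_mul_yinv, one_mul, mul_zero] at h3
      exact h3
    · exact congrFun h (some i)

end LFrame

end LFrame

/-! ## Homogenization of polynomials -/

section Homogenize

open MvPolynomial

variable (R : Type*) [CommRing R] (J : Type*)

/-- The substitution `ℏ ↦ ℏ`, `t_j ↦ t_j ℏ`. -/
def homog : MvPolynomial (Option J) R →ₐ[R] Polynomial (MvPolynomial J R) :=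
  aeval fun j => j.elim Polynomial.X fun j => Polynomial.C (X j) * Polynomial.X

variable {R J}

lemma homog_monomial (α : Option J →₀ ℕ) (r : R) : homog R J (monomial α r) =
    Polynomial.monomial α.degree (monomial α.some r) := by
  have h1 : α.degree = α none + α.some.degree := by
    have := Finsupp.sum_option_index α (fun _ n => n) (fun _ => rfl) (fun _ _ _ => rfl)
    exact this
  rw [homog, aeval_monomial, Finsupp.prod_option_index _ _ (by simp) (by intros; simp [pow_add])]
  simp only [Option.elim_none, Option.elim_some, mul_pow, Finsupp.prod_mul]
  have h2 : (α.some.prod fun _ b => (Polynomial.X : Polynomial (MvPolynomial J R)) ^ b) =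
      Polynomial.X ^ α.some.degree := Finset.prod_pow_eq_pow_sum _ _ _
  have h3 : (α.some.prod fun j b => (Polynomial.C (X j : MvPolynomial J R)) ^ b) =
      Polynomial.C (monomial α.some 1) := by
    rw [monomial_eq, C_1, one_mul, Finsupp.prod, Finsupp.prod, map_prod]
    simp only [map_pow]
  rw [h2, h3, ← Polynomial.C_mul_X_pow_eq_monomial, h1, pow_add,
    show algebraMap R (Polynomial (MvPolynomial J R)) r = Polynomial.C (C r) from rfl,
    ← mul_one r, ← C_mul_monomial, mul_one, map_mul]
  ring

lemma coeff_homog (q : MvPolynomial (Option J) R) (α : Option J →₀ ℕ) :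
    coeff α.some ((homog R J q).coeff α.degree) = coeff α q := by
  classical
  induction q using MvPolynomial.induction_on' with
  | add a b ha hb => rw [map_add, Polynomial.coeff_add, coeff_add, coeff_add, ha, hb]
  | monomial β r =>
    rw [homog_monomial, Polynomial.coeff_monomial, coeff_monomial]
    by_cases h : β = α
    · simp [h]
    · rw [if_neg h]
      split_ifs with h1
      · rw [coeff_monomial, if_neg]
        intro h2
        refine h ?_
        have hd : ∀ γ : Option J →₀ ℕ, γ.degree = γ none + γ.some.degree := fun γ =>
          Finsupp.sum_option_index γ (fun _ n => n) (fun _ => rfl) (fun _ _ _ => rfl)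
        ext j
        cases j with
        | none => rw [hd, hd, h2] at h1; omega
        | some j => exact DFunLike.congr_fun h2 j
      · simp

lemma homog_injective : Function.Injective (homog R J) := fun a b h => by
  ext α
  rw [← coeff_homog a α, h, coeff_homog]

lemma exists_homog (P : Polynomial (MvPolynomial J R)) (hP : ∀ n, (P.coeff n).totalDegree ≤ n) :
    ∃ q, homog R J q = P := by
  have h1 : ∀ (N : ℕ) (Q : MvPolynomial J R), Q.totalDegree ≤ N →
      Polynomial.monomial N Q ∈ (homog R J).range := by
    intro N Q hQ
    rw [Q.as_sum, map_sum]
    refine sum_mem fun β hβ => ?_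
    have hle : β.degree ≤ N := (le_totalDegree hβ).trans hQ
    refine ⟨monomial (β.embDomain Function.Embedding.some + Finsupp.single none (N - β.degree))
      (coeff β Q), ?_⟩
    rw [AlgHom.toRingHom_eq_coe, RingHom.coe_coe, homog_monomial]
    have e1 : (β.embDomain Function.Embedding.some +
        Finsupp.single none (N - β.degree)).degree = N := by
      rw [map_add, Finsupp.degree_single]
      have : (β.embDomain (Function.Embedding.some : J ↪ Option J)).degree = β.degree := by
        rw [Finsupp.embDomain_eq_mapDomain, Finsupp.degree_mapDomain]
      rw [this]; omega
    have e2 : (β.embDomain Function.Embedding.some +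
        Finsupp.single none (N - β.degree)).some = β := by
      ext j
      simp only [Finsupp.some_apply, Finsupp.add_apply]
      rw [Finsupp.single_eq_of_ne (by simp), add_zero]
      exact Finsupp.embDomain_apply_self _ _ _
    rw [e1, e2]
  rw [P.as_sum_support]
  exact sum_mem fun n _ => h1 n _ (hP n)

end Homogenize

/-! ## The algebra `D_{c,ℏ,L}` over a chart -/

section ChartTDO

variable {R : Type u} [CommRing R] [Algebra k R]
  {L : Type u} [AddCommGroup L] [Module R L]

variable (k L) in
/-- Functions on the base in `D_{c,ℏ,L}`. -/
def TDOAlg.fn : R →ₐ[k] TDOAlg k R L :=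
  ((Polynomial.CAlgHom (R := k)).comp ((CrysDiff.fn k (TorsorRing R L)).comp
    (IsScalarTower.toAlgHom k R (TorsorRing R L)))).codRestrict _ fun r => by
      refine ⟨fun n => ?_, fun t => ?_⟩
      · change (Polynomial.C _).coeff n ∈ _
        rw [Polynomial.coeff_C]
        split_ifs with h
        · subst h; exact CrysDiff.fn_mem_order _ _ _
        · exact zero_mem _
      · change Polynomial.map _ (Polynomial.C _) = Polynomial.C _
        rw [Polynomial.map_C]
        refine congrArg Polynomial.C ((CrysDiff.map_fn _ _).trans ?_)
        exact congrArg _ ((AlgEquiv.eq_symm_apply _).mp (TorsorRing.act_symm_algebraMap t r).symm)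

lemma TDOAlg.coe_fn (r : R) : (TDOAlg.fn k L r : TorsorOps k R L) =
    fnT (algebraMap R _ r) := rfl

/-- The element `ξ̂` of `D_{c,ℏ,L}` given by an invariant vector field. -/
def TDOAlg.ofInv {ξ : TorsorDer k R L} (hξ : TorsorRing.IsInvariant ξ) :
    TDOAlg k R L := ⟨hat ξ, hat_mem hξ⟩

section
open Polynomial (C X)

lemma hat_mul_fnT (ξ : TorsorDer k R L) (f : TorsorRing R L) :
    hat ξ * fnT f = fnT f * hat ξ + fnT (ξ f) * X := by
  simp only [hat, fnT]
  rw [mul_assoc, Polynomial.X_mul, ← mul_assoc, ← mul_assoc, ← Polynomial.C_mul, ← Polynomial.C_mul,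
    CrysDiff.vf_mul_fn, Polynomial.C_add, add_mul]

lemma hat_mul_hat (ξ η : TorsorDer k R L) :
    hat ξ * hat η = hat η * hat ξ + hat ⁅ξ, η⁆ * X := by
  have h : ∀ a b : CrysDiff k (TorsorRing R L), C a * X * (C b * X) =
      C (a * b) * X * X := by
    intro a b
    rw [mul_assoc, ← mul_assoc X, Polynomial.X_mul, ← mul_assoc, ← mul_assoc, ← Polynomial.C_mul]
  simp only [hat]
  rw [h, h, CrysDiff.vf_mul_vf, Polynomial.C_add, add_mul, add_mul]

end

lemma TDOAlg.hbar_central (d : TDOAlg k R L) : TDOAlg.hbar k R L * d = d * TDOAlg.hbar k R L :=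
  Subtype.ext (Polynomial.X_mul (p := (d : TorsorOps k R L)))

variable {I : Type} (X : Coords k R I) (F : LFrame R L)

lemma LFrame.frame_isInvariant (i : Option I) : TorsorRing.IsInvariant ((F.frame X).der i) := by
  cases i with
  | none => exact TorsorRing.euler_isInvariant R L k
  | some i => exact liftDer_isInvariant _ _

/-- The generators of `D_{c,ℏ,L}` over a chart. -/
def LFrame.gen (j : Option (Option I)) : TDOAlg k R L :=
  j.elim (TDOAlg.hbar k R L) fun i => TDOAlg.ofInv (F.frame_isInvariant X i)

lemma LFrame.gen_comm (i j : Option (Option I)) : F.gen X i * F.gen X j = F.gen X j * F.gen X i := by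
  rcases i with _ | i
  · exact TDOAlg.hbar_central _
  rcases j with _ | j
  · exact (TDOAlg.hbar_central _).symm
  refine Subtype.ext ((hat_mul_hat _ _).trans ?_)
  rw [(F.frame X).der_comm, show hat (0 : TorsorDer k R L) = 0 by simp [hat],
    zero_mul, add_zero]
  rfl

/-- `D_{c,ℏ,L}` over a chart as a ring of operators. -/
def LFrame.ore : OreData k R (TDOAlg k R L) (Option (Option I)) where
  ι := TDOAlg.fn k L
  m := commAeval (F.gen X) (F.gen_comm X)
  der j := j.elim 0 fun i => i.elim 0 X.der
  h := MvPolynomial.X none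
  rel j r := by
    rw [commAeval_X, commAeval_X]
    rcases j with _ | i
    · simp [LFrame.gen, TDOAlg.hbar_central]
    · refine Subtype.ext ((hat_mul_fnT _ (algebraMap R _ r)).trans ?_)
      rcases i with _ | i
      · rw [show (F.frame X).der none = euler R L k from rfl, TorsorRing.euler_algebraMap]
        simp [fnT, LFrame.gen]; rfl
      · rw [show (F.frame X).der (some i) = liftDer _ _ from rfl, liftDer_algebraMap]
        rfl

lemma LFrame.ore_m_X (j : Option (Option I)) : (F.ore X).m (MvPolynomial.X j) = F.gen X j :=
  commAeval_X (F.gen X) (F.gen_comm X) j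

open MvPolynomial in
lemma LFrame.coeff_op (q : MvPolynomial (Option (Option I)) R) (n : ℕ) :
    ((F.ore X).op q : TorsorOps k R L).coeff n =
      (F.frame X).ore.op (MvPolynomial.map (algebraMap R (TorsorRing R L)) ((homog R _ q).coeff n)) := by
  have hk : (TDOAlg k R L).val.comp (F.ore X).m =
      (mapAlgHom (F.frame X).ore.m).comp ((homog k (Option I))) := by
    refine MvPolynomial.algHom_ext fun j => ?_
    rw [AlgHom.comp_apply, AlgHom.comp_apply, ore_m_X, homog, aeval_X]
    rcases j with _ | i
    · simp only [Option.elim_none, Polynomial.coe_mapAlgHom, Polynomial.map_X]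
      rfl
    · simp only [Option.elim_some, Polynomial.coe_mapAlgHom, Polynomial.map_mul, Polynomial.map_X,
        Polynomial.map_C, RingHom.coe_coe, CommFrame.ore_m_X]
      rfl
  induction q using mv_induction k R with
  | add a b ha hb =>
    rw [map_add, map_add, Polynomial.coeff_add, map_add, map_add, ← ha, ← hb]; rfl
  | mul r g =>
    have h1 : homog R (Option I) (C r * MvPolynomial.map (algebraMap k R) g) =
        Polynomial.C (C r) * (homog k (Option I) g).map (MvPolynomial.map (algebraMap k R)) := by
      rw [map_mul, homog, ← algebraMap_eq, commutes]
      congr 1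
      induction g using MvPolynomial.induction_on with
      | C a => 
        rw [map_C, ← algebraMap_eq, commutes, homog, ← algebraMap_eq, commutes]
        simp [Polynomial.algebraMap_apply]
      | add a b ha hb => simp only [map_add, ha, hb, Polynomial.map_add]
      | mul_X a j ha =>
        rw [map_mul, map_mul, map_mul, Polynomial.map_mul, ha]
        congr 1
        rcases j with _ | j <;> simp [homog]
    rw [OreData.op_C_mul_map, h1, Polynomial.coeff_C_mul, Polynomial.coeff_map, map_mul, map_C,
      MvPolynomial.map_map, ← IsScalarTower.algebraMap_eq, OreData.op_C_mul_map]
    have h2 := congrArg (fun P : TorsorOps k R L => P.coeff n)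
      (AlgHom.congr_fun hk g)
    simp only [AlgHom.comp_apply, Polynomial.coe_mapAlgHom, Polynomial.coeff_map] at h2
    change (Polynomial.C _ * _).coeff n = _
    rw [Polynomial.coeff_C_mul]
    exact congrArg _ h2

lemma LFrame.op_injective [Finite I] : Function.Injective (F.ore X).op := by
  rw [← LinearMap.ker_eq_bot, LinearMap.ker_eq_bot']
  intro q hq
  refine homog_injective (Polynomial.ext fun n => ?_)
  have h := F.coeff_op X q n
  rw [hq] at h
  have h1 : MvPolynomial.map (algebraMap R (TorsorRing R L)) ((homog R _ q).coeff n) = 0 :=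
    (F.frame X).op_injective (h.symm.trans (map_zero _).symm)
  rw [map_zero, Polynomial.coeff_zero]
  exact MvPolynomial.map_injective _ (F.algebraMap_injective) (h1.trans (map_zero _).symm)

lemma LFrame.map_act_op (t : kˣ) (P : MvPolynomial (Option I) (TorsorRing R L)) :
    CrysDiff.map (act k t) ((F.frame X).ore.op P) =
      (F.frame X).ore.op (MvPolynomial.map ((act k t : TorsorRing R L ≃ₐ[k] TorsorRing R L) : TorsorRing R L →+* TorsorRing R L) P) := by
  have hm : (CrysDiff.map (act k t)).comp (F.frame X).ore.m = (F.frame X).ore.m := by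
    refine MvPolynomial.algHom_ext fun i => ?_
    rw [AlgHom.comp_apply, CommFrame.ore_m_X, CrysDiff.map_vf, F.frame_isInvariant X i t]
  induction P using mv_induction k (TorsorRing R L) with
  | add a b ha hb => simp only [map_add, ha, hb]
  | mul r g =>
    have : MvPolynomial.map ((act k t : TorsorRing R L ≃ₐ[k] TorsorRing R L) : TorsorRing R L →+* TorsorRing R L)
        (MvPolynomial.map (algebraMap k (TorsorRing R L)) g) =
        MvPolynomial.map (algebraMap k (TorsorRing R L)) g := by
      rw [MvPolynomial.map_map]
      refine congrArg (fun φ => MvPolynomial.map φ g) ?_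
      exact RingHom.ext fun a => (act (R := R) (L := L) k t).commutes a
    rw [RingHom.map_mul, this, MvPolynomial.map_C, OreData.op_C_mul_map, OreData.op_C_mul_map, map_mul]
    congr 1
    · exact CrysDiff.map_fn _ r
    · exact AlgHom.congr_fun hm g

lemma LFrame.op_surjective [Finite I] [Infinite k] : Function.Surjective (F.ore X).op := by
  rintro ⟨d, hd, hd'⟩
  have h1 : ∀ n, ∃ Q : MvPolynomial (Option I) R, Q.totalDegree ≤ n ∧
      (F.frame X).ore.op (MvPolynomial.map (algebraMap R (TorsorRing R L)) Q) = d.coeff n := by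
    intro n
    obtain ⟨P, hP, hPd⟩ := (F.frame X).exists_op_of_order (hd n)
    have hinv : ∀ t : kˣ, MvPolynomial.map ((act k t : TorsorRing R L ≃ₐ[k] TorsorRing R L) : TorsorRing R L →+* TorsorRing R L) P = P := by
      intro t
      refine (F.frame X).op_injective ?_
      rw [← LFrame.map_act_op, hPd]
      have := congrArg (fun q => Polynomial.coeff q n) (hd' t)
      simpa [Polynomial.coeff_map] using this
    have hc : ∀ β, ∃ r, algebraMap R (TorsorRing R L) r = P.coeff β := fun β =>
      F.exists_of_invariant (k := k) fun t => by
        conv_rhs => rw [← hinv t]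
        rw [MvPolynomial.coeff_map]; rfl
    obtain ⟨Q, rfl⟩ : ∃ Q, MvPolynomial.map (algebraMap R (TorsorRing R L)) Q = P := by
      choose c hc using hc
      refine ⟨∑ β ∈ P.support, MvPolynomial.monomial β (c β), ?_⟩
      conv_rhs => rw [P.as_sum]
      simp only [map_sum, MvPolynomial.map_monomial, hc]
    refine ⟨Q, ?_, hPd⟩
    refine le_trans (Finset.sup_mono ?_) hP
    rw [MvPolynomial.support_map_of_injective _ F.algebraMap_injective]
  choose Q hQ hQ' using h1
  obtain ⟨q, hq⟩ := exists_homog (∑ n ∈ d.support, Polynomial.monomial n (Q n)) (fun n => by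
    simp only [Polynomial.finsetSum_coeff, Polynomial.coeff_monomial]
    rw [Finset.sum_ite_eq']
    split_ifs
    · exact hQ n
    · simp)
  refine ⟨q, Subtype.ext (Polynomial.ext fun n => ?_)⟩
  rw [F.coeff_op X, hq]
  simp only [Polynomial.finsetSum_coeff, Polynomial.coeff_monomial]
  rw [Finset.sum_ite_eq']
  split_ifs with h
  · exact hQ' n
  · rw [map_zero, map_zero]
    exact (Polynomial.notMem_support_iff.mp h).symm

end ChartTDO

/-! ## Central localizations -/

section RingAway

/-- `θ` is the localization away from the central element `t`. -/
structure RingAway {D D' : Type*} [Ring D] [Ring D'] (θ : D →+* D') (t : D) : Prop where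
  central : ∀ d, t * d = d * t
  isUnit : IsUnit (θ t)
  surj : ∀ d', ∃ (n : ℕ) (d : D), θ t ^ n * d' = θ d
  ker : ∀ d, θ d = 0 → ∃ n : ℕ, t ^ n * d = 0

variable {D D' : Type*} [Ring D] [Ring D'] {θ : D →+* D'} {t : D}

lemma RingAway.exists_of_eq (h : RingAway θ t) {a b : D} (hab : θ a = θ b) :
    ∃ n : ℕ, t ^ n * a = t ^ n * b := by
  obtain ⟨n, hn⟩ := h.ker (a - b) (by rw [map_sub, hab, sub_self])
  exact ⟨n, by rwa [mul_sub, sub_eq_zero] at hn⟩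

lemma RingAway.pow_central (h : RingAway θ t) (n : ℕ) (d : D) : t ^ n * d = d * t ^ n :=
  (Commute.pow_left (h.central d) n).eq

lemma RingAway.central' (h : RingAway θ t) (d' : D') : θ t * d' = d' * θ t := by
  obtain ⟨n, d, hd⟩ := h.surj d'
  have hc : ∀ m, θ t ^ m * θ d = θ d * θ t ^ m := fun m => by
    rw [← map_pow, ← map_mul, ← map_mul, h.pow_central]
  have := hc 1
  rw [pow_one, ← hd, ← mul_assoc, ← pow_succ', pow_succ, mul_assoc, mul_assoc] at this
  exact (h.isUnit.pow n).mul_left_cancel this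

/-- The elements which come from `D` up to a power of `t`. -/
def RingAway.clearable {k D D' : Type*} [CommSemiring k] [Ring D] [Ring D'] [Algebra k D] [Algebra k D']
    (θ : D →ₐ[k] D') (t : D) (ht : ∀ d, θ t * d = d * θ t) : Subalgebra k D' where
  carrier := {d' | ∃ (n : ℕ) (d : D), θ t ^ n * d' = θ d}
  mul_mem' := by
    rintro a b ⟨n, x, hx⟩ ⟨m, y, hy⟩
    have hc : θ t ^ m * a = a * θ t ^ m := (Commute.pow_left (ht a) m).eq
    exact ⟨n + m, x * y, by rw [pow_add, map_mul, ← hx, ← hy, mul_assoc, ← mul_assoc (θ t ^ m) a, hc]; simp only [mul_assoc]⟩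
  add_mem' := by
    rintro a b ⟨n, x, hx⟩ ⟨m, y, hy⟩
    refine ⟨n + m, t ^ m * x + t ^ n * y, ?_⟩
    rw [map_add, map_mul, map_mul, ← hx, ← hy, map_pow, map_pow, mul_add, ← mul_assoc, ← mul_assoc,
      ← pow_add, ← pow_add, add_comm m n]
  algebraMap_mem' r := ⟨0, algebraMap k D r, by simp⟩

lemma RingAway.mem_clearable_of_eq {k D D' : Type*} [CommSemiring k] [Ring D] [Ring D'] [Algebra k D]
    [Algebra k D'] {θ : D →ₐ[k] D'} {t : D} {ht : ∀ d, θ t * d = d * θ t} {d' : D'} {d : D} (n : ℕ)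
    (h : θ t ^ n * d' = θ d) : d' ∈ RingAway.clearable θ t ht := ⟨n, d, h⟩

/-- A finite family of elements can be cleared simultaneously. -/
lemma RingAway.surj_fintype (h : RingAway θ t) {α : Type*} [Finite α] (d' : α → D') :
    ∃ (n : ℕ) (d : α → D), ∀ i, θ t ^ n * d' i = θ (d i) := by
  have := Fintype.ofFinite α
  choose n d hd using fun i => h.surj (d' i)
  refine ⟨Finset.univ.sup n, fun i => t ^ (Finset.univ.sup n - n i) * d i, fun i => ?_⟩
  rw [map_mul, map_pow, ← hd, ← mul_assoc, ← pow_add, Nat.sub_add_cancel (Finset.le_sup (Finset.mem_univ i))]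

end RingAway

lemma OreData.eq_top_of_generators {k R A : Type u} [Field k] [CommRing R] [Algebra k R] [Ring A] [Algebra k A]
    {J : Type*} (O : OreData k R A J) (hO : Function.Surjective O.op) (T : Subalgebra k A)
    (h1 : ∀ r, O.ι r ∈ T) (h2 : ∀ j, O.m (MvPolynomial.X j) ∈ T) : T = ⊤ := by
  rw [eq_top_iff]
  rintro a -
  obtain ⟨q, rfl⟩ := hO a
  induction q using mv_induction k R with
  | add a b ha hb => rw [map_add]; exact add_mem ha hb
  | mul r g =>
    rw [OreData.op_C_mul_map]
    refine mul_mem (h1 r) ?_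
    induction g using MvPolynomial.induction_on with
    | C a => rw [← MvPolynomial.algebraMap_eq, commutes]; exact T.algebraMap_mem a
    | add a b ha hb => rw [map_add]; exact add_mem ha hb
    | mul_X a j ha => rw [map_mul]; exact mul_mem ha (h2 j)

section Restriction

open Polynomial (C X)


/-- The Rees algebra is generated by functions, vector fields and the parameter. -/
lemma CrysDiff.rees_le {A : Type u} [CommRing A] [Algebra k A] (S : Subalgebra k (Polynomial (CrysDiff k A)))
    (h1 : ∀ f, C (CrysDiff.fn k A f) ∈ S)
    (h2 : ∀ ξ, C (vf k A ξ) * X ∈ S) (h3 : X ∈ S) :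
    CrysDiff.rees k A ≤ S := by
  let T : ℕ → Submodule k (CrysDiff k A) := fun n =>
    { carrier := {a | C a * X ^ n ∈ S}
      add_mem' := fun {a b} ha hb => by
        change C (a + b) * _ ∈ S
        rw [Polynomial.C_add, add_mul]; exact add_mem ha hb
      zero_mem' := by change C 0 * _ ∈ S; simp
      smul_mem' := fun c a ha => by
        change C (c • a) * _ ∈ S
        rw [← Polynomial.smul_C, smul_mul_assoc]; exact S.smul_mem ha c }
  have hmem : ∀ n a, a ∈ T n ↔ C a * X ^ n ∈ S := fun _ _ => Iff.rfl
  clear_value T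
  have hT : ∀ n m, T n * T m ≤ T (n + m) := by
    intro n m
    rw [Submodule.mul_le]
    intro a ha b hb
    rw [hmem] at ha hb ⊢
    have := mul_mem ha hb
    rwa [mul_assoc, ← mul_assoc (X ^ n), Polynomial.X_pow_mul_C, mul_assoc, ← pow_add, ← mul_assoc,
      ← Polynomial.C_mul] at this
  have hF : ∀ n, LinearMap.range (CrysDiff.fn k A).toLinearMap ≤ T n := by
    rintro n _ ⟨f, rfl⟩
    exact (hmem _ _).mpr (mul_mem (h1 f) (pow_mem h3 n))
  have hV : LinearMap.range (vf k A) ≤ T 1 := by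
    rintro _ ⟨ξ, rfl⟩
    rw [hmem, pow_one]; exact h2 ξ
  have hM : ∀ n, (LinearMap.range (CrysDiff.fn k A).toLinearMap ⊔ LinearMap.range (vf k A)) ^ n ≤ T n := by
    intro n
    induction n with
    | zero =>
      rw [pow_zero, Submodule.one_le, hmem, pow_zero, mul_one, Polynomial.C_1]
      exact one_mem S
    | succ n ih =>
      rw [pow_succ]
      exact (mul_le_mul' ih (sup_le (hF 1) hV)).trans (hT n 1)
  intro q hq
  rw [q.as_sum_support_C_mul_X_pow]
  refine sum_mem fun n _ => (hmem _ _).mp ?_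
  have := (mul_le_mul' (hF 0) (hM n)).trans (hT 0 n) (hq n)
  rwa [zero_add] at this

variable {R R' : Type u} [CommRing R] [Algebra k R] [CommRing R']
  [Algebra k R'] {L L' : Type u} [AddCommGroup L] [Module R L] [AddCommGroup L'] [Module R' L']
  {ρ : R →ₐ[k] R'} {σ : L →+ L'} (H : IsRestr ρ σ) (S : InvSys R L)

lemma map_crys_act (t : kˣ) (d : CrysDiff k (TorsorRing R L)) :
    (TorsorRing.map_derExt H S).map (CrysDiff.map (act k t) d) =
      CrysDiff.map (act k t) ((TorsorRing.map_derExt H S).map d) := by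
  have hact : ∀ x, TorsorRing.map H (act k t x) = act k t (TorsorRing.map H x) := by
    intro x
    have := TorsorRing.map_act H t (act k t x)
    rw [AlgEquiv.symm_apply_apply, AlgEquiv.eq_symm_apply] at this
    exact this.symm
  refine AlgHom.congr_fun (φ₁ := (TorsorRing.map_derExt H S).map.comp (CrysDiff.map (act k t)))
    (φ₂ := (CrysDiff.map (act k t)).comp (TorsorRing.map_derExt H S).map)
    (CrysDiff.algHom_ext (fun f => ?_) fun ξ => ?_) d
  · simp only [AlgHom.comp_apply, CrysDiff.map_fn, DerExt.map_fn, hact]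
  · simp only [AlgHom.comp_apply, CrysDiff.map_vf, DerExt.map_vf]
    congr 1
    refine ((TorsorRing.map_derExt H S).eq_ext fun x => ?_).symm
    rw [conjDer_apply, conjDer_apply, ← TorsorRing.map_act H t x, DerExt.ext_apply, hact]

/-- Restriction for `D_{c,ℏ,L}`. -/
def TDOAlg.map : TDOAlg k R L →ₐ[k] TDOAlg k R' L' :=
  ((mapAlgHom (TorsorRing.map_derExt H S).map).comp (TDOAlg k R L).val).codRestrict _ (by
    rintro ⟨q, hq₁, hq₂⟩
    refine ⟨fun n => ?_, fun t => ?_⟩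
    · change (Polynomial.map _ q).coeff n ∈ _
      rw [Polynomial.coeff_map]
      exact DerExt.map_order _ (hq₁ n)
    · change Polynomial.map _ (Polynomial.map _ q) = Polynomial.map _ q
      conv_rhs => rw [← hq₂ t]
      ext n
      rw [Polynomial.coeff_map, Polynomial.coeff_map, Polynomial.coeff_map]
      change _ = (TorsorRing.map_derExt H S).map ((Polynomial.map _ q).coeff n)
      rw [Polynomial.coeff_map]
      exact (map_crys_act H S t _).symm)

lemma TDOAlg.coeff_map (d : TDOAlg k R L) (n : ℕ) :
    (TDOAlg.map H S d : TorsorOps k R' L').coeff n =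
      (TorsorRing.map_derExt H S).map ((d : TorsorOps k R L).coeff n) :=
  Polynomial.coeff_map _ n

lemma TDOAlg.coe_map (d : TDOAlg k R L) :
    (TDOAlg.map H S d : TorsorOps k R' L') =
      mapAlgHom (TorsorRing.map_derExt H S).map (d : TorsorOps k R L) := rfl

lemma mapAlgHom_hat (ξ : TorsorDer k R L) :
    mapAlgHom (TorsorRing.map_derExt H S).map (hat ξ) = hat ((TorsorRing.map_derExt H S).ext ξ) := by
  simp only [hat, Polynomial.coe_mapAlgHom, Polynomial.map_mul, Polynomial.map_C, Polynomial.map_X,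
    RingHom.coe_coe, DerExt.map_vf]

lemma mapAlgHom_fnT (f : TorsorRing R L) :
    mapAlgHom (TorsorRing.map_derExt H S).map (fnT f) = fnT (TorsorRing.map H f) := by
  simp only [fnT, Polynomial.coe_mapAlgHom, Polynomial.map_C, RingHom.coe_coe, DerExt.map_fn]

lemma TDOAlg.map_ofInv {ξ : TorsorDer k R L} (hξ : TorsorRing.IsInvariant ξ) :
    TDOAlg.map H S (TDOAlg.ofInv hξ) = TDOAlg.ofInv (TorsorRing.ext_isInvariant H S hξ) :=
  Subtype.ext (mapAlgHom_hat H S ξ)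

lemma TDOAlg.map_fn (r : R) : TDOAlg.map H S (TDOAlg.fn k L r) = TDOAlg.fn k L' (ρ r) :=
  Subtype.ext ((mapAlgHom_fnT H S _).trans (congrArg fnT (TorsorRing.map_algebraMap H r)))

lemma TDOAlg.map_c : TDOAlg.map H S (TDOAlg.c k R L) = TDOAlg.c k R' L' :=
  Subtype.ext ((mapAlgHom_hat H S _).trans (congrArg hat (TorsorRing.ext_euler H S)))

lemma TDOAlg.map_hbar : TDOAlg.map H S (TDOAlg.hbar k R L) = TDOAlg.hbar k R' L' :=
  Subtype.ext (Polynomial.map_X _)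

lemma TDOAlg.mem_resGraph_iff (d : TDOAlg k R L) (d' : TDOAlg k R' L') :
    (d, d') ∈ TDOAlg.resGraph (k := k) ρ σ ↔ d' = TDOAlg.map H S d := by
  let Q := mapAlgHom (R := k) (TorsorRing.map_derExt H S).map
  have hgen : ∀ ξ ξ', (∀ y ∈ TorsorRing.resGraph ρ σ, (ξ y.1, ξ' y.2) ∈ TorsorRing.resGraph ρ σ) ↔
      ξ' = (TorsorRing.map_derExt (k := k) H S).ext ξ := by
    intro ξ ξ'
    constructor
    · intro h
      refine DerExt.eq_ext _ fun a => ?_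
      have := h (a, TorsorRing.map H a) ((TorsorRing.mem_resGraph_iff H _ _).mpr rfl)
      exact (TorsorRing.mem_resGraph_iff H _ _).mp this
    · rintro rfl ⟨a, b⟩ h
      rw [TorsorRing.mem_resGraph_iff H] at h ⊢
      subst h
      exact DerExt.ext_apply _ _ _
  constructor
  · intro h
    refine Subtype.ext ?_
    have hle : adjoin k (
      {x | ∃ y ∈ TorsorRing.resGraph (k := k) ρ σ, x = (fnT y.1, fnT y.2)} ∪
      {x | ∃ (ξ : TorsorDer k R L)
          (ξ' : TorsorDer k R' L'),
          (∀ y ∈ TorsorRing.resGraph ρ σ, (ξ y.1, ξ' y.2) ∈ TorsorRing.resGraph ρ σ) ∧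
          x = (hat ξ, hat ξ')} ∪
      {(X, X)}) ≤ AlgHom.equalizer (AlgHom.snd k _ _) (Q.comp (AlgHom.fst k _ _)) := by
      refine Algebra.adjoin_le ?_
      rintro _ ((⟨⟨a, b⟩, h, rfl⟩ | ⟨ξ, ξ', h, rfl⟩) | rfl)
      · rw [TorsorRing.mem_resGraph_iff H] at h
        subst h
        exact (mapAlgHom_fnT H S a).symm
      · rw [hgen] at h
        subst h
        exact (mapAlgHom_hat H S ξ).symm
      · exact (Polynomial.map_X _).symm
    exact hle h
  · rintro rfl
    let G := adjoin k (
      {x | ∃ y ∈ TorsorRing.resGraph (k := k) ρ σ, x = (fnT (k := k) y.1, fnT (k := k) y.2)} ∪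
      {x | ∃ (ξ : TorsorDer k R L)
          (ξ' : TorsorDer k R' L'),
          (∀ y ∈ TorsorRing.resGraph ρ σ, (ξ y.1, ξ' y.2) ∈ TorsorRing.resGraph ρ σ) ∧
          x = (hat ξ, hat ξ')} ∪
      {(X, X)})
    let T := G.comap ((AlgHom.id k _).prod Q)
    have hT := CrysDiff.rees_le T
      (fun f => subset_adjoin (Or.inl (Or.inl ⟨(f, TorsorRing.map H f),
        (TorsorRing.mem_resGraph_iff H _ _).mpr rfl, Prod.ext rfl (mapAlgHom_fnT H S f)⟩)))
      (fun ξ => subset_adjoin (Or.inl (Or.inr ⟨ξ, _, (hgen ξ _).mpr rfl,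
        Prod.ext rfl (mapAlgHom_hat H S ξ)⟩)))
      (subset_adjoin (Or.inr (Prod.ext rfl (Polynomial.map_X _))))
    exact hT d.2.1

lemma TDOAlg.fn_pow_central (p : ℕ) [Fact p.Prime] [CharP k p] (f : R) (d : TDOAlg k R L) :
    TDOAlg.fn k L (f ^ p) * d = d * TDOAlg.fn k L (f ^ p) := by
  refine Subtype.ext (Polynomial.ext fun n => ?_)
  change (C (CrysDiff.fn k _ (algebraMap R (TorsorRing R L) (f ^ p))) *
    (d : TorsorOps k R L)).coeff n =
    ((d : TorsorOps k R L) *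
      C (CrysDiff.fn k _ (algebraMap R (TorsorRing R L) (f ^ p)))).coeff n
  rw [Polynomial.coeff_C_mul, Polynomial.coeff_mul_C, map_pow (algebraMap R (TorsorRing R L)),
    CrysDiff.fn_pow_central]

lemma TorsorRing.liftDer_smul (f : R) (ξ : Der k R) :
    liftDer S (f • ξ) = algebraMap R (TorsorRing R L) f • liftDer S ξ := by
  apply derivation_ext <;> intro x <;> simp [smul_def, mul_sum, mul_assoc]

lemma TorsorRing.eulerCoef_invariant {a : TorsorDer k R L}
    (ha : IsInvariant a) (t : kˣ) : act k t (eulerCoef S a) = eulerCoef S a := by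
  rw [← AlgEquiv.eq_symm_apply, eulerCoef, map_neg, map_sum]
  congr 1
  refine sum_congr rfl fun j _ => ?_
  rw [map_mul, act_symm_cosec, ← isInvariant_iff.mp ha, act_symm_sec, Derivation.map_smul,
    smul_mul_smul_comm]
  simp

lemma hat_smul_add (f : TorsorRing R L) (ξ η : TorsorDer k R L) :
    hat (f • ξ + η) = fnT f * hat ξ + hat η := by
  simp only [hat, fnT, map_add, vf_smul, Polynomial.C_mul, add_mul, mul_assoc]

variable [Infinite k] [FiniteType k R] {I : Type} [Finite I] (X : Coords k R' I) (F : LFrame R' L')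

/-- Two invariant lifts of a vector field differ by a multiple of the Euler field. -/
lemma LFrame.exists_hat_eq (F : LFrame R' L') {a b : TorsorDer k R' L'}
    (ha : TorsorRing.IsInvariant a) (hb : TorsorRing.IsInvariant b)
    (h : ∀ r, a (algebraMap R' _ r) = b (algebraMap R' _ r)) :
    ∃ r, TDOAlg.ofInv ha = TDOAlg.fn k L' r * TDOAlg.c k R' L' + TDOAlg.ofInv hb := by
  have hab : TorsorRing.IsInvariant (a - b) := by
    rw [TorsorRing.isInvariant_iff] at ha hb ⊢
    intro t f
    rw [Derivation.sub_apply, Derivation.sub_apply, ha, hb, map_sub]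
  obtain ⟨r, hr⟩ := F.exists_of_invariant (TorsorRing.eulerCoef_invariant F.invSys hab)
  refine ⟨r, Subtype.ext ?_⟩
  change hat a = fnT (algebraMap R' _ r) * hat (euler R' L' k) + hat b
  rw [← hat_smul_add, hr, ← TorsorRing.eq_eulerCoef_smul F.invSys (fun r => by
    rw [Derivation.sub_apply, h, sub_self]), sub_add_cancel]

theorem TDOAlg.ringAway (X : Coords k R' I) (F : LFrame R' L') (p : ℕ) [Fact p.Prime] [CharP k p] {f : R} (hf : IsAway ρ f) :
    RingAway (TDOAlg.map H S : TDOAlg k R L →+* TDOAlg k R' L') (TDOAlg.fn k L (f ^ p)) where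
  central := TDOAlg.fn_pow_central p f
  isUnit := by
    rw [RingHom.coe_coe, TDOAlg.map_fn, map_pow]
    exact (hf.isUnit.pow p).map _
  ker d hd := by
    have := TorsorRing.finiteType k S
    have h1 : ∀ n, ∃ N, CrysDiff.fn k _ (algebraMap R (TorsorRing R L) f ^ p) ^ N *
        (d : TorsorOps k R L).coeff n = 0 := by
      intro n
      refine (TorsorRing.map_isAway H S hf).map_eq_zero p _ ?_
      have := TDOAlg.coeff_map H S d n
      rw [show TDOAlg.map H S d = 0 from hd] at this
      exact this.symm
    choose N hN using h1
    refine ⟨(d : TorsorOps k R L).support.sup N, Subtype.ext (Polynomial.ext fun n => ?_)⟩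
    set M := (d : TorsorOps k R L).support.sup N
    have hM : ((TDOAlg.fn k L (f ^ p) ^ M * d : TDOAlg k R L) : TorsorOps k R L) =
        C (CrysDiff.fn k _ (algebraMap R (TorsorRing R L) f ^ p) ^ M) *
          (d : TorsorOps k R L) := by
      rw [MulMemClass.coe_mul, SubmonoidClass.coe_pow, TDOAlg.coe_fn, fnT, map_pow (algebraMap R _), Polynomial.C_pow]
    rw [hM, Polynomial.coeff_C_mul]
    by_cases hn : n ∈ (d : TorsorOps k R L).support
    · have hle : N n ≤ M := Finset.le_sup hn
      rw [← Nat.sub_add_cancel hle, pow_add, mul_assoc, hN, mul_zero]; rfl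
    · rw [Polynomial.notMem_support_iff.mp hn, mul_zero]; rfl
  surj d' := by
    have hp : 1 ≤ p := (Fact.out : p.Prime).one_le
    have hc : ∀ d, TDOAlg.map H S (TDOAlg.fn k L (f ^ p)) * d = d * TDOAlg.map H S (TDOAlg.fn k L (f ^ p)) := by
      intro d
      rw [TDOAlg.map_fn, map_pow, TDOAlg.fn_pow_central]
    have hpow : ∀ n, TDOAlg.map H S (TDOAlg.fn k L (f ^ p)) ^ n = TDOAlg.fn k L' (ρ f ^ (p * n)) := by
      intro n
      rw [TDOAlg.map_fn, map_pow ρ, pow_mul, map_pow (TDOAlg.fn k L') (ρ f ^ p)]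
    have hmul : ∀ (n : ℕ) (x : TDOAlg k R' L') (y : TDOAlg k R L),
        TDOAlg.fn k L' (ρ f ^ n) * x = TDOAlg.map H S y →
        x ∈ RingAway.clearable (TDOAlg.map H S) (TDOAlg.fn k L (f ^ p)) hc := by
      intro n x y hxy
      refine RingAway.mem_clearable_of_eq (d := TDOAlg.fn k L (f ^ (p * n - n)) * y) n ?_
      have hn : n ≤ p * n := Nat.le_mul_of_pos_left n hp
      rw [hpow, map_mul (TDOAlg.map H S), ← hxy, TDOAlg.map_fn, map_pow ρ, ← mul_assoc, ← map_mul, ← pow_add,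
        Nat.sub_add_cancel hn]
    have hfn : ∀ r, TDOAlg.fn k L' r ∈ RingAway.clearable (TDOAlg.map H S) (TDOAlg.fn k L (f ^ p)) hc := by
      intro r
      obtain ⟨n, a, ha⟩ := hf.surj r
      refine hmul n _ (TDOAlg.fn k L a) ?_
      rw [TDOAlg.map_fn, ← ha, map_mul]
    have hcc : TDOAlg.c k R' L' ∈ RingAway.clearable (TDOAlg.map H S) (TDOAlg.fn k L (f ^ p)) hc :=
      RingAway.mem_clearable_of_eq (d := TDOAlg.c k R L) 0 (by rw [pow_zero, one_mul, TDOAlg.map_c])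
    have htop : RingAway.clearable (TDOAlg.map H S) (TDOAlg.fn k L (f ^ p)) hc = ⊤ := by
      refine (F.ore X).eq_top_of_generators (F.op_surjective X) _ hfn fun j => ?_
      rw [F.ore_m_X]
      rcases j with _ | _ | i
      · exact RingAway.mem_clearable_of_eq (d := TDOAlg.hbar k R L) 0
          (by rw [pow_zero, one_mul, TDOAlg.map_hbar]; rfl)
      · exact hcc
      · obtain ⟨n, ξ, hξ⟩ := hf.exists_der (X.der i)
        have he : H.derExt.ext ξ = ρ f ^ n • X.der i := by
          refine (H.derExt.eq_ext fun a => ?_).symm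
          rw [hξ]; rfl
        have hi := liftDer_isInvariant F.invSys (X.der i)
        obtain ⟨r, hr⟩ := F.exists_hat_eq (a := algebraMap R' (TorsorRing R' L') (ρ f ^ n) •
            liftDer F.invSys (X.der i)) (k := k)
          (by rw [← TorsorRing.liftDer_smul]; exact liftDer_isInvariant _ _)
          (TorsorRing.ext_isInvariant H S (liftDer_isInvariant S ξ)) (fun r => by
            rw [← TorsorRing.liftDer_smul, TorsorRing.ext_liftDer, he, liftDer_algebraMap,
              liftDer_algebraMap])
        have h1 : TDOAlg.fn k L' (ρ f ^ n) * F.gen X (some (some i)) ∈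
            RingAway.clearable (TDOAlg.map H S) (TDOAlg.fn k L (f ^ p)) hc := by
          have : TDOAlg.fn k L' (ρ f ^ n) * F.gen X (some (some i)) = TDOAlg.fn k L' r * TDOAlg.c k R' L' +
              TDOAlg.map H S (TDOAlg.ofInv (liftDer_isInvariant S ξ)) := by
            rw [TDOAlg.map_ofInv, ← hr]
            refine Subtype.ext ?_
            have := hat_smul_add (algebraMap R' (TorsorRing R' L') (ρ f ^ n))
              (liftDer F.invSys (X.der i)) 0
            rw [add_zero, show hat (0 : TorsorDer k R' L') = 0 by simp [hat], add_zero] at this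
            exact this.symm
          rw [this]
          exact add_mem (mul_mem (hfn r) hcc) (RingAway.mem_clearable_of_eq 0 (by rw [pow_zero, one_mul]))
        obtain ⟨m, y, hy⟩ := h1
        rw [hpow, ← mul_assoc, ← map_mul, ← pow_add] at hy
        exact hmul _ _ _ hy
    have : d' ∈ RingAway.clearable (TDOAlg.map H S) (TDOAlg.fn k L (f ^ p)) hc := htop ▸ trivial
    exact this

end Restriction

section Charts

variable (k : Type u) [Field k] (p : ℕ)

/-- Coordinates and a frame of a line bundle. -/
structure Chart (R L : Type u) [CommRing R] [Algebra k R] [AddCommGroup L] [Module R L] where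
  /-- the dimension -/
  n : ℕ
  /-- the coordinates -/
  X : Coords k R (Fin n)
  /-- the frame -/
  F : LFrame R L
  red : ∀ r : R, r ^ p = 0 → r = 0
  const : ∀ r, (∀ i, X.der i r = 0) → ∃ g, g ^ p = r

/-- There are charts locally. -/
def HasCharts (R L : Type u) [CommRing R] [Algebra k R] [AddCommGroup L] [Module R L] : Prop :=
  ∃ s : Set R, Ideal.span s = ⊤ ∧ ∀ f ∈ s, ∃ (R' : Type u) (_ : CommRing R') (_ : Algebra k R')
    (L' : Type u) (_ : AddCommGroup L') (_ : Module R' L') (ρ : R →ₐ[k] R') (σ : L →+ L'),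
    IsRestr ρ σ ∧ IsAway ρ f ∧ Nonempty (Chart k p R' L')

end Charts

lemma LFrame.c_central {k : Type u} [Field k] [Infinite k] {R : Type u} [CommRing R] [Algebra k R]
    {L : Type u} [AddCommGroup L] [Module R L] {I : Type} [Finite I] (X : Coords k R I)
    (F : LFrame R L) (d : TDOAlg k R L) : TDOAlg.c k R L * d = d * TDOAlg.c k R L := by
  obtain ⟨q, rfl⟩ := F.op_surjective X d
  have hc : TDOAlg.c k R L = (F.ore X).m (MvPolynomial.X (some none)) :=
    (F.ore_m_X X (some none)).symm
  rw [hc, OreData.X_mul_op, ← OreData.op_mul_map, MvPolynomial.map_X]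
  have : coefDer ((F.ore X).der (some none)) q = 0 := by
    ext α
    rw [coeff_coefDer]; rfl
  rw [this, zero_mul, add_zero]

section Central

variable [Infinite k] {p : ℕ} [Fact p.Prime] [CharP k p] {R : Type u} [CommRing R]
  [Algebra k R] {L : Type u} [AddCommGroup L] [Module R L] [FiniteType k R]

variable (p) in
lemma TDOAlg.eq_zero_of_local {s : Set R} (hs : Ideal.span s = ⊤) (d : TDOAlg k R L)
    (h : ∀ f ∈ s, ∃ n : ℕ, TDOAlg.fn k L (f ^ p) ^ n * d = 0) : d = 0 :=
  TDO.eq_zero_of_local ((TDOAlg.fn k L).toRingHom.comp (frobHom k p R)) s hs d fun f hf => by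
    obtain ⟨n, hn⟩ := h f hf
    refine ⟨n, ?_⟩
    rw [map_pow]
    exact hn

lemma TDOAlg.c_central (S : InvSys R L) (hC : HasCharts k p R L) (d : TDOAlg k R L) :
    TDOAlg.c k R L * d = d * TDOAlg.c k R L := by
  obtain ⟨s, hs, h⟩ := hC
  rw [← sub_eq_zero]
  refine TDOAlg.eq_zero_of_local p hs _ fun f hf => ?_
  obtain ⟨R', _, _, L', _, _, ρ, σ, H, hρ, ⟨C⟩⟩ := h f hf
  refine (TDOAlg.ringAway H S C.X C.F p hρ).ker _ ?_
  rw [RingHom.coe_coe, map_sub, map_mul, map_mul, TDOAlg.map_c, C.F.c_central C.X, sub_self]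

end Central

section Spec

variable {R : Type u} [CommRing R] [Algebra k R] {L : Type u} [AddCommGroup L]
  [Module R L] (c₀ h₀ : k)

lemma TDOSpec.mk_surjective : Function.Surjective (TDOSpec.mk k R L c₀ h₀) :=
  RingQuot.mkAlgHom_surjective k _

@[simp] lemma TDOSpec.mk_c : TDOSpec.mk k R L c₀ h₀ (TDOAlg.c k R L) = algebraMap k _ c₀ :=
  (RingQuot.mkAlgHom_rel k (SpecRel.c)).trans (commutes _ _)

@[simp] lemma TDOSpec.mk_hbar : TDOSpec.mk k R L c₀ h₀ (TDOAlg.hbar k R L) = algebraMap k _ h₀ :=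
  (RingQuot.mkAlgHom_rel k (SpecRel.hbar)).trans (commutes _ _)

variable {c₀ h₀} in
/-- The universal property of the specialization. -/
def TDOSpec.lift {B : Type*} [Ring B] [Algebra k B] (φ : TDOAlg k R L →ₐ[k] B)
    (h1 : φ (TDOAlg.c k R L) = algebraMap k B c₀) (h2 : φ (TDOAlg.hbar k R L) = algebraMap k B h₀) :
    TDOSpec k R L c₀ h₀ →ₐ[k] B :=
  RingQuot.liftAlgHom k ⟨φ, by
    intro x y h
    cases h with
    | c => rw [h1, commutes]
    | hbar => rw [h2, commutes]⟩

variable {c₀ h₀} in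
@[simp] lemma TDOSpec.lift_mk {B : Type*} [Ring B] [Algebra k B] (φ : TDOAlg k R L →ₐ[k] B)
    (h1 : φ (TDOAlg.c k R L) = algebraMap k B c₀) (h2 : φ (TDOAlg.hbar k R L) = algebraMap k B h₀)
    (d : TDOAlg k R L) : TDOSpec.lift φ h1 h2 (TDOSpec.mk k R L c₀ h₀ d) = φ d :=
  RingQuot.liftAlgHom_mkAlgHom_apply k _ _ _

lemma TDOSpec.mk_eq_zero_iff (hcc : ∀ d : TDOAlg k R L, TDOAlg.c k R L * d = d * TDOAlg.c k R L)
    {d : TDOAlg k R L} : TDOSpec.mk k R L c₀ h₀ d = 0 ↔ ∃ u v,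
      d = (TDOAlg.c k R L - algebraMap k _ c₀) * u + (TDOAlg.hbar k R L - algebraMap k _ h₀) * v := by
  constructor
  · intro hd
    have hcen : ∀ x : TDOAlg k R L, (∀ d, x * d = d * x) → ∀ (a : k) d, (x - algebraMap k _ a) * d =
        d * (x - algebraMap k _ a) := by
      intro x hx a d
      rw [sub_mul, mul_sub, hx, Algebra.commutes]
    have hC := hcen _ hcc c₀
    have hH := hcen _ TDOAlg.hbar_central h₀
    let I : Submodule k (TDOAlg k R L) :=
      LinearMap.range (mulLeft k (TDOAlg.c k R L - algebraMap k _ c₀)) ⊔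
        LinearMap.range (mulLeft k (TDOAlg.hbar k R L - algebraMap k _ h₀))
    have hI : ∀ d, I ≤ I.comap (mulLeft k d) := by
      intro d
      refine sup_le ?_ ?_
      · rintro _ ⟨u, rfl⟩
        refine Submodule.mem_sup_left ⟨d * u, ?_⟩
        simp only [mulLeft_apply]
        rw [← mul_assoc, hC, mul_assoc]
      · rintro _ ⟨u, rfl⟩
        refine Submodule.mem_sup_right ⟨d * u, ?_⟩
        simp only [mulLeft_apply]
        rw [← mul_assoc, hH, mul_assoc]
    let φ : TDOAlg k R L →ₐ[k] Module.End k (TDOAlg k R L ⧸ I) := AlgHom.ofLinearMap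
      { toFun := fun d => I.mapQ I (mulLeft k d) (hI d)
        map_add' := fun a b => by ext x; simp [add_mul]
        map_smul' := fun a b => by ext x; simp }
      (by ext x; simp) (fun a b => by ext x; simp)
    have hφ : ∀ d x, φ d (I.mkQ x) = I.mkQ (d * x) := fun _ _ => rfl
    have hφ1 : φ (TDOAlg.c k R L) = algebraMap k _ c₀ := by
      ext x
      change I.mkQ (_ * x) = c₀ • I.mkQ x
      rw [← map_smul, ← sub_eq_zero, ← map_sub, ← LinearMap.mem_ker, Submodule.ker_mkQ]
      refine Submodule.mem_sup_left ⟨x, ?_⟩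
      simp [sub_mul, smul_def]
    have hφ2 : φ (TDOAlg.hbar k R L) = algebraMap k _ h₀ := by
      ext x
      change I.mkQ (_ * x) = h₀ • I.mkQ x
      rw [← map_smul, ← sub_eq_zero, ← map_sub, ← LinearMap.mem_ker, Submodule.ker_mkQ]
      refine Submodule.mem_sup_right ⟨x, ?_⟩
      simp [sub_mul, smul_def]
    have h1 : φ d = 0 := by
      rw [← TDOSpec.lift_mk φ hφ1 hφ2 d, hd, map_zero]
    have h2 : I.mkQ d = 0 := by
      have := hφ d 1
      rw [h1, mul_one] at this
      exact this.symm
    rw [← LinearMap.mem_ker, Submodule.ker_mkQ, Submodule.mem_sup] at h2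
    obtain ⟨_, ⟨u, rfl⟩, _, ⟨v, rfl⟩, h⟩ := h2
    exact ⟨u, v, h.symm⟩
  · rintro ⟨u, v, rfl⟩
    simp

/-! ### Charts -/

variable {I : Type} (X : Coords k R I) (F : LFrame R L)

/-- The specialization over a chart as a ring of operators. -/
def LFrame.specOre : OreData k R (TDOSpec k R L c₀ h₀) I where
  ι := (TDOSpec.mk k R L c₀ h₀).comp (TDOAlg.fn k L)
  m := (TDOSpec.mk k R L c₀ h₀).comp ((F.ore X).m.comp (MvPolynomial.rename fun i => some (some i)))
  der := X.der
  h := MvPolynomial.C h₀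
  rel j r := by
    have h := congrArg (TDOSpec.mk k R L c₀ h₀) ((F.ore X).rel (some (some j)) r)
    simp only [AlgHom.comp_apply, MvPolynomial.rename_X]
    have h2 : TDOSpec.mk k R L c₀ h₀ ((F.ore X).m (F.ore X).h) = algebraMap k _ h₀ :=
      (congrArg _ (F.ore_m_X X none)).trans (TDOSpec.mk_hbar _ _)
    rw [map_mul, map_add, map_mul, map_mul, h2] at h
    rw [MvPolynomial.rename_C, ← MvPolynomial.algebraMap_eq, commutes, commutes]
    exact h

/-- The substitution `c ↦ c₀`, `ℏ ↦ ℏ₀`. -/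
def specSubst : MvPolynomial (Option (Option I)) R →ₐ[R] MvPolynomial I R :=
  MvPolynomial.aeval fun j => j.elim (MvPolynomial.C (algebraMap k R h₀)) fun i =>
    i.elim (MvPolynomial.C (algebraMap k R c₀)) MvPolynomial.X

lemma specSubst_rename (q : MvPolynomial I R) : specSubst c₀ h₀ (MvPolynomial.rename (fun i => some (some i)) q) = q := by
  rw [specSubst, MvPolynomial.aeval_rename]
  exact MvPolynomial.aeval_X_left_apply q

open MvPolynomial in
lemma LFrame.mk_op (q : MvPolynomial (Option (Option I)) R) :
    TDOSpec.mk k R L c₀ h₀ ((F.ore X).op q) = (F.specOre c₀ h₀ X).op (specSubst c₀ h₀ q) := by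
  induction q using mv_induction k R with
  | add a b ha hb => simp only [map_add, ha, hb]
  | mul r g =>
    have h1 : specSubst (I := I) c₀ h₀ (C r * MvPolynomial.map (algebraMap k R) g) =
        C r * MvPolynomial.map (algebraMap k R)
          (aeval (fun j => j.elim (C h₀) fun i => i.elim (C c₀) MvPolynomial.X) g) := by
      rw [map_mul, specSubst, aeval_C, algebraMap_eq]
      congr 1
      induction g using MvPolynomial.induction_on with
      | C a => rw [map_C, aeval_C, aeval_C]; simp [algebraMap_eq]
      | add a b ha hb => simp only [map_add, ha, hb]
      | mul_X a j ha =>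
        rw [map_mul, map_mul, map_mul, map_mul, ha]
        congr 1
        rcases j with _ | _ | j <;> simp
    rw [h1, OreData.op_C_mul_map, OreData.op_C_mul_map, map_mul]
    refine congrArg₂ (· * ·) rfl ?_
    refine AlgHom.congr_fun (φ₁ := (TDOSpec.mk k R L c₀ h₀).comp (F.ore X).m)
      (φ₂ := (F.specOre c₀ h₀ X).m.comp (aeval fun j => j.elim (C h₀) fun i => i.elim (C c₀) MvPolynomial.X))
      (MvPolynomial.algHom_ext fun j => ?_) g
    simp only [AlgHom.comp_apply, aeval_X, F.ore_m_X]
    rcases j with _ | _ | j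
    · rw [Option.elim_none, ← algebraMap_eq, commutes]
      exact TDOSpec.mk_hbar _ _
    · rw [Option.elim_some, Option.elim_none, ← algebraMap_eq, commutes]
      exact TDOSpec.mk_c _ _
    · change _ = TDOSpec.mk k R L c₀ h₀ ((F.ore X).m (rename _ (MvPolynomial.X j)))
      rw [rename_X, F.ore_m_X]

lemma LFrame.specOp_eq (q : MvPolynomial I R) : (F.specOre c₀ h₀ X).op q =
    TDOSpec.mk k R L c₀ h₀ ((F.ore X).op (MvPolynomial.rename (fun i => some (some i)) q)) := by
  rw [F.mk_op, specSubst_rename]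

lemma LFrame.specOre_m_X (i : I) : (F.specOre c₀ h₀ X).m (MvPolynomial.X i) =
    TDOSpec.mk k R L c₀ h₀ (F.gen X (some (some i))) := by
  change TDOSpec.mk k R L c₀ h₀ ((F.ore X).m (MvPolynomial.rename _ (MvPolynomial.X i))) = _
  rw [MvPolynomial.rename_X, F.ore_m_X]

variable [Finite I] [Infinite k]

open MvPolynomial in
lemma LFrame.specOp_bijective   :
    Bijective (F.specOre c₀ h₀ X).op := by
  constructor
  · rw [← LinearMap.ker_eq_bot, LinearMap.ker_eq_bot']
    intro q hq
    rw [F.specOp_eq, TDOSpec.mk_eq_zero_iff _ _ (F.c_central X)] at hq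
    obtain ⟨u, v, h⟩ := hq
    obtain ⟨u, rfl⟩ := F.op_surjective X u
    obtain ⟨v, rfl⟩ := F.op_surjective X v
    have key : ∀ (j : Option (Option I)) (hj : (F.ore X).der j = 0) (a : k) (w : MvPolynomial (Option (Option I)) R),
        (F.gen X j - algebraMap k _ a) * (F.ore X).op w =
          (F.ore X).op (w * (MvPolynomial.X j - C (algebraMap k R a))) := by
      intro j hj a w
      have h0 : coefDer ((F.ore X).der j) w = 0 := by
        ext α
        rw [coeff_coefDer, hj]; rfl
      rw [sub_mul, ← F.ore_m_X X, OreData.X_mul_op, h0, zero_mul, add_zero, mul_sub, map_sub,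
        mul_comm w (C _), ← algebraMap_eq, ← IsScalarTower.algebraMap_apply, ← smul_def,
        ← smul_def, map_smul]
    have h1 : TDOAlg.c k R L = F.gen X (some none) := rfl
    have h2 : TDOAlg.hbar k R L = F.gen X none := rfl
    rw [h1, h2, key _ rfl, key _ rfl, ← map_add] at h
    have h3 := congrArg (specSubst c₀ h₀) (F.op_injective X h)
    rw [specSubst_rename] at h3
    rw [h3]
    simp [specSubst, algebraMap_eq]
  · intro d
    obtain ⟨d, rfl⟩ := TDOSpec.mk_surjective c₀ h₀ d
    obtain ⟨q, rfl⟩ := F.op_surjective X d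
    exact ⟨_, (F.mk_op c₀ h₀ X q).symm⟩

end Spec

section SpecRestriction

variable {R R' : Type u} [CommRing R] [Algebra k R] [CommRing R']
  [Algebra k R'] {L L' : Type u} [AddCommGroup L] [Module R L] [AddCommGroup L'] [Module R' L']
  {ρ : R →ₐ[k] R'} {σ : L →+ L'} (H : IsRestr ρ σ) (S : InvSys R L) (c₀ h₀ : k)

/-- Restriction for the specialization. -/
def TDOSpec.map : TDOSpec k R L c₀ h₀ →ₐ[k] TDOSpec k R' L' c₀ h₀ :=
  TDOSpec.lift ((TDOSpec.mk k R' L' c₀ h₀).comp (TDOAlg.map H S))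
    (by rw [AlgHom.comp_apply, TDOAlg.map_c, TDOSpec.mk_c])
    (by rw [AlgHom.comp_apply, TDOAlg.map_hbar, TDOSpec.mk_hbar])

@[simp] lemma TDOSpec.map_mk (d : TDOAlg k R L) : TDOSpec.map H S c₀ h₀ (TDOSpec.mk k R L c₀ h₀ d) =
    TDOSpec.mk k R' L' c₀ h₀ (TDOAlg.map H S d) := TDOSpec.lift_mk _ _ _ d

variable (k L) in
/-- Functions on the base in the specialization. -/
def TDOSpec.fn : R →ₐ[k] TDOSpec k R L c₀ h₀ := (TDOSpec.mk k R L c₀ h₀).comp (TDOAlg.fn k L)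

theorem TDOSpec.ringAway (p : ℕ) [Fact p.Prime] [CharP k p] [Infinite k] [FiniteType k R] (C : Chart k p R' L')
    {f : R} (hf : IsAway ρ f) :
    RingAway (TDOSpec.map H S c₀ h₀ : TDOSpec k R L c₀ h₀ →+* TDOSpec k R' L' c₀ h₀)
      (TDOSpec.fn k L c₀ h₀ (f ^ p)) := by
  have hA := TDOAlg.ringAway H S C.X C.F p hf
  exact
  { central := fun d => by
      obtain ⟨d, rfl⟩ := TDOSpec.mk_surjective c₀ h₀ d
      rw [TDOSpec.fn, AlgHom.comp_apply, ← map_mul, hA.central, map_mul]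
    isUnit := by
      rw [RingHom.coe_coe, TDOSpec.fn, AlgHom.comp_apply, TDOSpec.map_mk]
      exact hA.isUnit.map _
    surj := fun d' => by
      obtain ⟨d', rfl⟩ := TDOSpec.mk_surjective c₀ h₀ d'
      obtain ⟨n, d, h⟩ := hA.surj d'
      refine ⟨n, TDOSpec.mk k R L c₀ h₀ d, ?_⟩
      rw [RingHom.coe_coe] at h ⊢
      rw [TDOSpec.map_mk, ← h, TDOSpec.fn, AlgHom.comp_apply, TDOSpec.map_mk, _root_.map_mul,
        map_pow (TDOSpec.mk k R' L' c₀ h₀)]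
    ker := fun d hd => by
      obtain ⟨d, rfl⟩ := TDOSpec.mk_surjective c₀ h₀ d
      rw [RingHom.coe_coe, TDOSpec.map_mk, TDOSpec.mk_eq_zero_iff _ _ (C.F.c_central C.X)] at hd
      obtain ⟨u', v', hd⟩ := hd
      obtain ⟨n, u, hu⟩ := hA.surj u'
      obtain ⟨m, v, hv⟩ := hA.surj v'
      let t := TDOAlg.fn k L (f ^ p)
      have h1 : TDOAlg.map H S (t ^ (n + m) * d) = TDOAlg.map H S
          ((TDOAlg.c k R L - algebraMap k _ c₀) * (t ^ m * u) +
            (TDOAlg.hbar k R L - algebraMap k _ h₀) * (t ^ n * v)) := by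
        change TDOAlg.map H S t ^ n * u' = TDOAlg.map H S u at hu
        change TDOAlg.map H S t ^ m * v' = TDOAlg.map H S v at hv
        have hcen : ∀ (x : TDOAlg k R' L') y, TDOAlg.map H S t ^ (n + m) * (x * y) =
            x * (TDOAlg.map H S t ^ (n + m) * y) := fun x y => by
          have : Commute (TDOAlg.map H S t) x := hA.central' x
          rw [← mul_assoc, (this.pow_left (n + m)).eq, mul_assoc]
        simp only [map_add, _root_.map_mul, map_sub, TDOAlg.map_c, TDOAlg.map_hbar,
          commutes, map_pow (TDOAlg.map H S), ← hu, ← hv, hd]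
        rw [mul_add, hcen, hcen, ← mul_assoc (_ ^ m), ← mul_assoc (_ ^ n), ← pow_add, ← pow_add,
          add_comm m n]
      obtain ⟨N, hN⟩ := hA.exists_of_eq h1
      refine ⟨N + (n + m), ?_⟩
      have h2 := congrArg (TDOSpec.mk k R L c₀ h₀) hN
      rw [← mul_assoc, ← pow_add, map_mul, map_pow, map_mul] at h2
      refine h2.trans ?_
      simp }

lemma TDOSpec.eq_zero_of_local (p : ℕ) [Fact p.Prime] [CharP k p] {s : Set R} (hs : Ideal.span s = ⊤)
    (d : TDOSpec k R L c₀ h₀)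
    (h : ∀ f ∈ s, ∃ n : ℕ, TDOSpec.fn k L c₀ h₀ (f ^ p) ^ n * d = 0) : d = 0 :=
  TDO.eq_zero_of_local ((TDOSpec.fn k L c₀ h₀).toRingHom.comp (frobHom k p R)) s hs d fun f hf => by
    obtain ⟨n, hn⟩ := h f hf
    refine ⟨n, ?_⟩
    rw [map_pow]
    exact hn

end SpecRestriction

section Untwist

variable {p : ℕ} [Fact p.Prime] [CharP k p] [PerfectRing k p]
  {R : Type u} [CommRing R] [Algebra k R] {L : Type u} [AddCommGroup L] [Module R L]

lemma FrobTwist.of_algebraMap (a : k) : FrobTwist.of p R (algebraMap k R a) =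
    algebraMap k (FrobTwist p R) (a ^ p) := by
  rw [FrobTwist.algebraMap_eq]
  congr 2
  rw [RingEquiv.eq_symm_apply]; rfl

/-- A functional on `Ω¹ ⊗ L⁽¹⁾` and a section of `L` define a vector field. -/
def untwist (μ : Dual (FrobTwist p R) (Ω[FrobTwist p R⁄k] ⊗[FrobTwist p R] FrobTwistMod p L))
    (l : L) : Der k R :=
  Derivation.mk'
    { toFun := fun r => (FrobTwist.of p R).symm
        (μ (D k _ (FrobTwist.of p R r) ⊗ₜ FrobTwistMod.of p L l))
      map_add' := fun a b => by rw [map_add, map_add, TensorProduct.add_tmul, map_add, map_add]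
      map_smul' := fun a r => by
        rw [smul_def, map_mul, FrobTwist.of_algebraMap, ← smul_def, Derivation.map_smul,
          ← algebraMap_smul (FrobTwist p R), ← TensorProduct.smul_tmul', map_smul, smul_eq_mul, map_mul,
          ← FrobTwist.of_algebraMap, RingEquiv.symm_apply_apply, RingHom.id_apply, smul_def] }
    (fun a b => by
      simp only [LinearMap.coe_mk, AddHom.coe_mk]
      rw [map_mul, leibniz, TensorProduct.add_tmul, map_add, ← TensorProduct.smul_tmul',
        ← TensorProduct.smul_tmul', map_smul, map_smul, smul_eq_mul, smul_eq_mul, map_add, map_mul, map_mul,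
        RingEquiv.symm_apply_apply, RingEquiv.symm_apply_apply]
      rfl)

variable (μ μ' : Dual (FrobTwist p R) (Ω[FrobTwist p R⁄k] ⊗[FrobTwist p R] FrobTwistMod p L))
  (l l' : L)

lemma untwist_apply (r : R) : untwist μ l r = (FrobTwist.of p R).symm
    (μ (D k _ (FrobTwist.of p R r) ⊗ₜ FrobTwistMod.of p L l)) := rfl

lemma untwist_add_left : untwist (μ + μ') l = untwist μ l + untwist μ' l := by
  ext r
  simp [untwist_apply]

lemma untwist_smul_left (f : FrobTwist p R) :
    untwist (f • μ) l = (FrobTwist.of p R).symm f • untwist μ l := by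
  ext r
  simp [untwist_apply]

lemma untwist_add_right : untwist μ (l + l') = untwist μ l + untwist μ l' := by
  ext r
  simp [untwist_apply, TensorProduct.tmul_add]

lemma untwist_smul_right (f : R) : untwist μ (f • l) = f • untwist μ l := by
  ext r
  rw [Derivation.smul_apply, untwist_apply, untwist_apply]
  have : FrobTwistMod.of p L (f • l) = FrobTwist.of p R f • FrobTwistMod.of p L l := rfl
  rw [this, TensorProduct.tmul_smul, map_smul, smul_eq_mul, map_mul]
  rfl

lemma untwist_contract (ξ : Der k R) (ν : Dual R L) :
    untwist (contract (twistDer p ξ) (twistDual p ν)) l = ν l • ξ := by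
  ext r
  rw [untwist_apply, contract, LinearMap.comp_apply, TensorProduct.map_tmul, LinearMap.mul'_apply,
    Derivation.liftKaehlerDifferential_comp_D, map_mul, Derivation.smul_apply, smul_eq_mul, mul_comm]
  rfl

variable {μ μ'} in
lemma untwist_ext (h : ∀ l, untwist μ l = untwist μ' l) : μ = μ' := by
  refine LinearMap.ext fun m => ?_
  induction m using TensorProduct.induction_on with
  | zero => simp
  | add x y hx hy => rw [map_add, map_add, hx, hy]
  | tmul ω l =>
    have : ω ∈ Submodule.span (FrobTwist p R) (range (D k (FrobTwist p R))) := by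
      rw [KaehlerDifferential.span_range_derivation]; trivial
    induction this using Submodule.span_induction with
    | mem x hx =>
      obtain ⟨r, rfl⟩ := hx
      exact Derivation.congr_fun (h l) r
    | zero => simp
    | add x y _ _ hx hy => rw [TensorProduct.add_tmul, map_add, map_add, hx, hy]
    | smul a x _ hx => rw [← TensorProduct.smul_tmul', map_smul, map_smul, hx]

lemma untwist_sum_left {ι : Type*} (s : Finset ι)
    (μ : ι → Dual (FrobTwist p R) (Ω[FrobTwist p R⁄k] ⊗[FrobTwist p R] FrobTwistMod p L)) :
    untwist (∑ i ∈ s, μ i) l = ∑ i ∈ s, untwist (μ i) l :=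
  map_sum (AddMonoidHom.mk' (fun μ => untwist μ l) fun μ μ' => untwist_add_left μ μ' l) μ s

lemma untwist_sum_right {ι : Type*} (s : Finset ι) (l : ι → L) :
    untwist μ (∑ i ∈ s, l i) = ∑ i ∈ s, untwist μ (l i) :=
  map_sum (AddMonoidHom.mk' (fun l => untwist μ l) fun l l' => untwist_add_right μ l l') l s

lemma eq_sum_contract (S : InvSys R L) :
    μ = ∑ j, contract (twistDer p (untwist μ (S.l j))) (twistDual p (S.ν j)) := by
  refine untwist_ext fun l => ?_
  rw [untwist_sum_left]
  simp only [untwist_contract]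
  conv_lhs => rw [← S.sum_smul l, untwist_sum_right]
  simp only [untwist_smul_right]

/-- Coordinates of connections in terms of those given by vector fields on the base. -/
lemma coord_eq_sum (S : InvSys R L) (B : Type u) [CommRing B] [Algebra (FrobTwist p R) B] (lam : B)
    (l : FrobTwistMod p L) :
    ConnAlg.coord k (FrobTwist p R) (FrobTwistMod p L) B lam μ l =
      ∑ j, ConnAlg.coord k (FrobTwist p R) (FrobTwistMod p L) B lam
        (contract (twistDer p (untwist μ (S.l j))) (twistDual p (S.ν j))) l := by
  conv_lhs => rw [eq_sum_contract μ S]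
  exact map_sum (AddMonoidHom.mk' (fun μ => ConnAlg.coord k (FrobTwist p R) (FrobTwistMod p L) B lam μ l)
    fun μ μ' => ConnAlg.coord_add_left _ _ _ _ _ μ μ' l) _ _

variable (p) in
lemma contract_add_left (ξ ξ' : Der k R) (ν : Dual R L) :
    contract (twistDer p (ξ + ξ')) (twistDual p ν) =
      contract (twistDer p ξ) (twistDual p ν) + contract (twistDer p ξ') (twistDual p ν) :=
  untwist_ext fun l => by
    rw [untwist_add_left, untwist_contract, untwist_contract, untwist_contract, smul_add]

variable (p) in
lemma contract_smul_left (f : R) (ξ : Der k R) (ν : Dual R L) :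
    contract (twistDer p (f • ξ)) (twistDual p ν) =
      FrobTwist.of p R f • contract (twistDer p ξ) (twistDual p ν) :=
  untwist_ext fun l => by
    rw [untwist_smul_left, untwist_contract, untwist_contract, smul_comm]; rfl

variable (p) in
lemma contract_smul_right (f : R) (ξ : Der k R) (ν : Dual R L) :
    contract (twistDer p ξ) (twistDual p (f • ν)) =
      FrobTwist.of p R f • contract (twistDer p ξ) (twistDual p ν) :=
  untwist_ext fun l => by
    rw [untwist_smul_left, untwist_contract, untwist_contract, LinearMap.smul_apply, smul_eq_mul, mul_smul]
    rfl

/-- Functions on `Z` are generated by functions on the base, `c`, `ℏ` and the coordinates given by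
vector fields. -/
lemma ZAlg.mem_of_generators (S : InvSys R L) (T : Subring (ZAlg k p R L)) (h1 : ∀ r, ZAlg.fn k p L r ∈ T)
    (h2 : ZAlg.c k p R L ∈ T) (h3 : ZAlg.hbar k p R L ∈ T)
    (h4 : ∀ ξ ν l, ZAlg.coord p ξ ν l ∈ T) (z : ZAlg k p R L) : z ∈ T := by
  obtain ⟨z, rfl⟩ := Ideal.Quotient.mk_surjective z
  induction z using MvPolynomial.induction_on with
  | C b =>
    induction b using MvPolynomial.induction_on with
    | C r => exact h1 ((FrobTwist.of p R).symm r)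
    | add a b ha hb => rw [map_add, map_add]; exact add_mem ha hb
    | mul_X a i ha =>
      rw [map_mul, map_mul]
      refine mul_mem ha ?_
      fin_cases i
      · exact h2
      · exact h3
  | add a b ha hb => rw [map_add]; exact add_mem ha hb
  | mul_X a x ha =>
    rw [map_mul]
    refine mul_mem ha ?_
    change ConnAlg.coord _ _ _ _ _ x.1 x.2 ∈ T
    rw [coord_eq_sum _ S]
    exact sum_mem fun j _ => h4 _ _ _

variable (k p L) in
/-- The functions on the base as a homomorphism. -/
def ZAlg.fnHom : R →+* ZAlg k p R L :=
  (ConnAlg.ofBase _ _ _ _ _).comp (MvPolynomial.C.comp (FrobTwist.of p R).toRingHom)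

lemma ZAlg.coord_add_left (ξ ξ' : Der k R) (ν : Dual R L) : ZAlg.coord p (ξ + ξ') ν l =
    ZAlg.coord p ξ ν l + ZAlg.coord p ξ' ν l := by
  rw [ZAlg.coord, contract_add_left, ConnAlg.coord_add_left]; rfl

lemma ZAlg.coord_smul_left (f : R) (ξ : Der k R) (ν : Dual R L) :
    ZAlg.coord p (f • ξ) ν l = ZAlg.fn k p L f * ZAlg.coord p ξ ν l := by
  rw [ZAlg.coord, contract_smul_left, ConnAlg.coord_smul_left]; rfl

lemma ZAlg.coord_smul_mid (f : R) (ξ : Der k R) (ν : Dual R L) :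
    ZAlg.coord p ξ (f • ν) l = ZAlg.fn k p L f * ZAlg.coord p ξ ν l := by
  rw [ZAlg.coord, contract_smul_right, ConnAlg.coord_smul_left]; rfl

lemma ZAlg.coord_smul_right (f : R) (ξ : Der k R) (ν : Dual R L) :
    ZAlg.coord p ξ ν (f • l) = ZAlg.fn k p L f * ZAlg.coord p ξ ν l +
      (ZAlg.c k p R L ^ p - ZAlg.c k p R L * ZAlg.hbar k p R L ^ (p - 1)) * ZAlg.fn k p L (ν l * ξ f) := by
  have : FrobTwistMod.of p L (f • l) = FrobTwist.of p R f • FrobTwistMod.of p L l := rfl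
  rw [ZAlg.coord, this, ConnAlg.coord_smul_right]
  congr 1
  rw [map_mul, map_sub, map_mul, map_pow, map_pow]
  refine congrArg₂ _ rfl ?_
  refine congrArg (fun x => ConnAlg.ofBase _ _ _ _ _ (MvPolynomial.C x)) ?_
  exact congrArg (FrobTwist.of p R) (Derivation.congr_fun (untwist_contract (p := p) l ξ ν) f)

lemma ZAlg.coord_sum_left {ι : Type*} (s : Finset ι) (ξ : ι → Der k R) (ν : Dual R L) :
    ZAlg.coord p (∑ i ∈ s, ξ i) ν l = ∑ i ∈ s, ZAlg.coord p (ξ i) ν l :=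
  map_sum (AddMonoidHom.mk' (fun ξ => ZAlg.coord p ξ ν l) fun ξ ξ' => ZAlg.coord_add_left l ξ ξ' ν) ξ s

end Untwist

section Values

open Polynomial (C X)

variable {p : ℕ} [Fact p.Prime] [CharP k p]
  {R : Type u} [CommRing R] [Algebra k R] {L : Type u} [AddCommGroup L] [Module R L]

lemma TorsorRing.pPow_isInvariant {a : TorsorDer k R L}
    (ha : TorsorRing.IsInvariant a) : TorsorRing.IsInvariant (pPow p a) := by
  rw [TorsorRing.isInvariant_iff] at ha ⊢
  intro t f
  rw [pPow_apply, pPow_apply]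
  exact Function.Commute.iterate_left (f := a) (g := (act k t).symm) (ha t) p f

lemma hat_pow_sub (a : TorsorDer k R L) :
    hat a ^ p - X ^ (p - 1) * hat (pPow p a) = C (pcurv p a) * X ^ p := by
  have hp : p - 1 + 1 = p := Nat.sub_add_cancel (Fact.out : p.Prime).one_le
  rw [hat, hat, (Polynomial.commute_X (C _)).symm.mul_pow, pcurv, map_sub, sub_mul, map_pow]
  congr 1
  rw [← mul_assoc, Polynomial.X_pow_mul_C, mul_assoc, ← pow_succ, hp]

variable (p) in
/-- The element `â^p - ℏ^{p-1} (a^{[p]})^`. -/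
def TDOAlg.pcurv {a : TorsorDer k R L} (ha : TorsorRing.IsInvariant a) :
    TDOAlg k R L :=
  TDOAlg.ofInv ha ^ p - TDOAlg.hbar k R L ^ (p - 1) * TDOAlg.ofInv (TorsorRing.pPow_isInvariant (p := p) ha)

lemma TDOAlg.coe_pcurv {a : TorsorDer k R L} (ha : TorsorRing.IsInvariant a) :
    (TDOAlg.pcurv p ha : TorsorOps k R L) =
      C (TDO.pcurv p a) * X ^ p := hat_pow_sub a

variable (k p R L) in
/-- The element `c^p - c ℏ^{p-1}`. -/
def TDOAlg.lam : TDOAlg k R L := TDOAlg.c k R L ^ p - TDOAlg.c k R L * TDOAlg.hbar k R L ^ (p - 1)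

lemma TDOAlg.coe_lam : (TDOAlg.lam k p R L : TorsorOps k R L) =
    hat (euler R L k) ^ p - hat (euler R L k) * X ^ (p - 1) := rfl

lemma TDOAlg.coe_lam' : (TDOAlg.lam k p R L : TorsorOps k R L) =
    C (TDO.pcurv p (euler R L k)) * X ^ p := by
  rw [TDOAlg.coe_lam, ← hat_pow_sub, TorsorRing.pPow_euler, Polynomial.X_pow_mul]

section
variable [FiniteType k R] (S : InvSys R L) (hC : HasCharts k p R L)
include S hC

lemma TorsorRing.hasLocCoords : HasLocCoords k (TorsorRing R L) := by
  obtain ⟨s, hs, h⟩ := hC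
  refine ⟨algebraMap R (TorsorRing R L) '' s, ?_, ?_⟩
  · rw [← Ideal.map_span, hs, Ideal.map_top]
  · rintro _ ⟨f, hf, rfl⟩
    obtain ⟨R', _, _, L', _, _, ρ, σ, H, hρ, ⟨C⟩⟩ := h f hf
    exact ⟨TorsorRing R' L', _, _, TorsorRing.map H, Option (Fin C.n), inferInstance, C.F.coords C.X,
      TorsorRing.map_isAway H S hρ⟩

lemma TDOAlg.pcurv_central {a : TorsorDer k R L}
    (ha : TorsorRing.IsInvariant a) (d : TDOAlg k R L) : TDOAlg.pcurv p ha * d = d * TDOAlg.pcurv p ha := by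
  have := TorsorRing.finiteType k S
  refine Subtype.ext ?_
  rw [Subalgebra.coe_mul, Subalgebra.coe_mul, TDOAlg.coe_pcurv]
  refine Commute.mul_left ?_ Polynomial.X_pow_mul
  ext n
  rw [Polynomial.coeff_C_mul, Polynomial.coeff_mul_C, TDO.pcurv_central p (TorsorRing.hasLocCoords S hC)]

end

variable (S : InvSys R L)

/-- The pairing of a functional with the derivative of a section along the standard lift of a vector
field. -/
def conB (ξ : Der k R) (ν : Dual R L) (l : L) : R := ∑ i, ξ (S.ν i l) * ν (S.l i)

lemma cosec_mul_liftDer_sec (ξ : Der k R) (ν : Dual R L) (l : L) :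
    TorsorRing.cosec R L ν * liftDer S ξ (TorsorRing.sec R L l) =
      algebraMap R _ (conB S ξ ν l) := by
  rw [TorsorRing.liftDer_sec, mul_sum, conB, map_sum]
  refine sum_congr rfl fun i _ => ?_
  rw [mul_left_comm, mul_comm (TorsorRing.cosec R L ν), TorsorRing.sec_mul_cosec, map_mul]

variable (p) in
/-- The value of the canonical map on a coordinate. -/
def conV (ξ : Der k R) (ν : Dual R L) (l : L) : TDOAlg k R L :=
  TDOAlg.fn k L (ν l ^ p) * TDOAlg.pcurv p (liftDer_isInvariant S ξ) +
    TDOAlg.lam k p R L * TDOAlg.fn k L (conB S ξ ν l ^ p)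

section
variable [FiniteType k R] (hC : HasCharts k p R L)
include hC

theorem coe_conV (ξ : Der k R) (ν : Dual R L) (l : L)
    (a : TorsorDer k R L)
    (h : ∀ f : R, a (algebraMap R _ f) = algebraMap R _ (ξ f)) :
    (conV p S ξ ν l : TorsorOps k R L) =
        fnT (algebraMap R _ (ν l)) ^ p * (hat a ^ p - X ^ (p - 1) * hat (pPow p a))
        + (hat (euler R L k) ^ p
            - hat (euler R L k) * X ^ (p - 1))
          * fnT (TorsorRing.cosec R L ν * a (TorsorRing.sec R L l)) ^ p := by
  have := TorsorRing.finiteType k S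
  have hloc := TorsorRing.hasLocCoords S hC
  let b := liftDer S ξ
  let g := TorsorRing.eulerCoef S (a - b)
  have hab : a = b + g • euler R L k := by
    rw [← TorsorRing.eq_eulerCoef_smul S (a := a - b)
      (fun r => by rw [Derivation.sub_apply, h, liftDer_algebraMap, sub_self]), add_sub_cancel]
  have hpc : TDO.pcurv p a = TDO.pcurv p b + CrysDiff.fn k _ (g ^ p) * TDO.pcurv p (euler R L k) := by
    rw [hab, pcurv_add p hloc, pcurv_smul p hloc]
  have hsec : TorsorRing.cosec R L ν * a (TorsorRing.sec R L l) =
      algebraMap R _ (conB S ξ ν l) - g * algebraMap R _ (ν l) := by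
    rw [← cosec_mul_liftDer_sec, hab, Derivation.add_apply, Derivation.smul_apply, TorsorRing.euler_sec,
      ← TorsorRing.sec_mul_cosec, smul_eq_mul]
    ring
  have hcen := fun (x : TorsorRing R L) => CrysDiff.fn_pow_central (k := k) p x
    (TDO.pcurv p (euler R L k))
  have e1 : (conV p S ξ ν l : TorsorOps k R L) =
      fnT (algebraMap R _ (ν l ^ p)) * (C (TDO.pcurv p b) * X ^ p) +
        (C (TDO.pcurv p (euler R L k)) * X ^ p) *
          fnT (algebraMap R _ (conB S ξ ν l ^ p)) := by
    rw [← TDOAlg.coe_lam', ← TDOAlg.coe_pcurv (liftDer_isInvariant S ξ)]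
    rfl
  rw [e1, hat_pow_sub, ← TDOAlg.coe_lam, TDOAlg.coe_lam', hpc, hsec]
  simp only [fnT, ← map_pow C, mul_assoc, Polynomial.X_pow_mul_C]
  simp only [← mul_assoc, ← map_mul C, ← add_mul, ← map_add C]
  congr 2
  rw [map_pow (algebraMap R (TorsorRing R L)), map_pow (algebraMap R (TorsorRing R L)),
    ← map_pow (CrysDiff.fn k _), ← map_pow (CrysDiff.fn k _), sub_pow_p k p, map_sub, mul_add, mul_sub, ← hcen (g * _), ← mul_assoc, ← map_mul,
    ← mul_pow, mul_comm g]
  abel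

end

section Naturality

variable [FiniteType k R] {R' : Type u} [CommRing R'] [Algebra k R'] [FiniteType k R']
  {L' : Type u} [AddCommGroup L'] [Module R' L'] {ρ : R →ₐ[k] R'} {σ : L →+ L'} (H : IsRestr ρ σ)
  (S' : InvSys R' L')

lemma map_conV (hC : HasCharts k p R L) (hC' : HasCharts k p R' L')
    (ξ : Der k R) (ν : Dual R L) (l : L) :
    TDOAlg.map H S (conV p S ξ ν l) = conV p S' (H.derExt.ext ξ) (H.dualExt ν) (σ l) := by
  refine Subtype.ext ?_
  rw [TDOAlg.coe_map, coe_conV S hC ξ ν l (liftDer S ξ) (liftDer_algebraMap S ξ),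
    coe_conV S' hC' _ _ _ ((TorsorRing.map_derExt H S).ext (liftDer S ξ)) (by
      rw [TorsorRing.ext_liftDer]; exact liftDer_algebraMap _ _)]
  have hX : mapAlgHom (TorsorRing.map_derExt H S).map X = X := by simp
  rw [map_add, map_mul, map_mul, map_sub, map_sub, map_mul, map_mul]
  repeat rw [map_pow (mapAlgHom (TorsorRing.map_derExt H S).map)]
  rw [hX, mapAlgHom_fnT H S, mapAlgHom_fnT H S, mapAlgHom_hat H S, mapAlgHom_hat H S, mapAlgHom_hat H S, TorsorRing.ext_euler H S,
    DerExt.ext_pPow, map_mul, TorsorRing.map_cosec, ← DerExt.ext_apply (TorsorRing.map_derExt H S),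
    TorsorRing.map_sec, TorsorRing.map_algebraMap, IsRestr.dualExt_apply]

end Naturality

end Values

section Phi

variable [Infinite k] {p : ℕ} [Fact p.Prime] [CharP k p] [PerfectRing k p]
  {R : Type u} [CommRing R] [Algebra k R] {L : Type u} [AddCommGroup L] [Module R L]
  [FiniteType k R] (S : InvSys R L) (hC : HasCharts k p R L)

lemma conB_add_left (ξ ξ' : Der k R) (ν : Dual R L) (l : L) :
    conB S (ξ + ξ') ν l = conB S ξ ν l + conB S ξ' ν l := by
  simp [conB, add_mul, sum_add_distrib]

lemma conB_smul_left (f : R) (ξ : Der k R) (ν : Dual R L) (l : L) :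
    conB S (f • ξ) ν l = f * conB S ξ ν l := by
  simp [conB, mul_assoc, mul_sum]

lemma conB_add_right (ξ : Der k R) (ν : Dual R L) (l l' : L) :
    conB S ξ ν (l + l') = conB S ξ ν l + conB S ξ ν l' := by
  simp [conB, add_mul, sum_add_distrib]

lemma conB_smul_right (f : R) (ξ : Der k R) (ν : Dual R L) (l : L) :
    conB S ξ ν (f • l) = f * conB S ξ ν l + ν l * ξ f := by
  rw [S.dual_apply ν l, conB, conB, mul_sum, sum_mul, ← sum_add_distrib]
  refine sum_congr rfl fun i _ => ?_
  rw [map_smul, smul_eq_mul, leibniz, smul_eq_mul, smul_eq_mul]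
  ring

section LiftS

variable {T : Type u} [CommRing T] (g : R →+* T) (c h : T) (w : Der k R → T)
  (w_add : ∀ ξ ξ', w (ξ + ξ') = w ξ + w ξ') (w_smul : ∀ f ξ, w (f • ξ) = g f * w ξ)

variable (p) in
/-- A function of a vector field, a functional and a section. -/
def conT (ξ : Der k R) (ν : Dual R L) (l : L) : T :=
  g (ν l) * w ξ + (c ^ p - c * h ^ (p - 1)) * g (conB S ξ ν l)

include w_smul in
lemma conT_contract (ξ : Der k R) (ν : Dual R L) (l : L) :
    ∑ j, conT p S g c h w (ν (S.l j) • ξ) (S.ν j) l = conT p S g c h w ξ ν l := by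
  have h1 : ν l = ∑ j, S.ν j l * ν (S.l j) := S.dual_apply ν l
  have h2 : conB S ξ ν l = ∑ j, ν (S.l j) * conB S ξ (S.ν j) l := by
    simp only [conB, mul_sum]
    rw [Finset.sum_comm]
    refine sum_congr rfl fun i _ => ?_
    rw [S.dual_apply ν (S.l i), mul_sum]
    exact sum_congr rfl fun j _ => by ring
  rw [conT, h1, h2, map_sum, map_sum, sum_mul, mul_sum, ← sum_add_distrib]
  refine sum_congr rfl fun j _ => ?_
  rw [conT, w_smul, conB_smul_left, map_mul, map_mul]
  ring

/-- Ring homomorphisms out of the ring of functions on `Z`. -/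
def ZAlg.liftS : ZAlg k p R L →+* T :=
  ConnAlg.lift
    (MvPolynomial.eval₂Hom (g.comp (FrobTwist.of p R).symm.toRingHom) ![c, h])
    (fun μ l => ∑ j, conT p S g c h w (untwist μ (S.l j)) (S.ν j) ((FrobTwistMod.of p L).symm l))
    (fun μ μ' l => by
      rw [← sum_add_distrib]
      refine sum_congr rfl fun j _ => ?_
      rw [untwist_add_left, conT, w_add, conB_add_left, map_add]
      simp only [conT]
      ring)
    (fun f μ l => by
      rw [mul_sum]
      refine sum_congr rfl fun j _ => ?_
      rw [untwist_smul_left, conT, w_smul, conB_smul_left, map_mul, MvPolynomial.algebraMap_eq,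
        MvPolynomial.eval₂Hom_C]
      simp only [conT]
      change _ = g ((FrobTwist.of p R).symm f) * _
      ring)
    (fun μ l l' => by
      rw [← sum_add_distrib]
      refine sum_congr rfl fun j _ => ?_
      rw [map_add, conT, conB_add_right, map_add, map_add, map_add]
      simp only [conT]
      ring)
    (fun f μ l => by
      have h1 : (FrobTwistMod.of p L).symm (f • l) = (FrobTwist.of p R).symm f • (FrobTwistMod.of p L).symm l := rfl
      have h2 : μ (D k (FrobTwist p R) f ⊗ₜ l) =
          FrobTwist.of p R (∑ j, S.ν j ((FrobTwistMod.of p L).symm l) *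
            untwist μ (S.l j) ((FrobTwist.of p R).symm f)) := by
        have h3 : untwist μ ((FrobTwistMod.of p L).symm l) = ∑ j, S.ν j ((FrobTwistMod.of p L).symm l) •
            untwist μ (S.l j) := by
          simp only [← untwist_smul_right]
          rw [← untwist_sum_right, S.sum_smul]
        have h4 := Derivation.congr_fun h3 ((FrobTwist.of p R).symm f)
        rw [derivation_sum_apply] at h4
        exact h4
      rw [h1, h2, MvPolynomial.algebraMap_eq, map_mul, MvPolynomial.eval₂Hom_C, MvPolynomial.eval₂Hom_C]
      simp only [map_sub, map_mul, map_pow, MvPolynomial.eval₂Hom_X', Matrix.cons_val_zero, Matrix.cons_val_one]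
      change _ = g ((FrobTwist.of p R).symm f) * _ + _ * g (∑ j : Fin S.n, _)
      rw [map_sum, mul_sum, mul_sum, ← sum_add_distrib]
      refine sum_congr rfl fun j _ => ?_
      rw [conT, conB_smul_right, map_smul, smul_eq_mul]
      simp only [conT, map_add, map_mul]
      ring)

@[simp] lemma ZAlg.liftS_fn (r : R) : ZAlg.liftS (p := p) S g c h w w_add w_smul (ZAlg.fn k p L r) = g r := by
  rw [ZAlg.liftS, ZAlg.fn, ConnAlg.lift_ofBase, MvPolynomial.eval₂Hom_C]
  rfl

@[simp] lemma ZAlg.liftS_c : ZAlg.liftS (p := p) S g c h w w_add w_smul (ZAlg.c k p R L) = c := by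
  rw [ZAlg.liftS, ZAlg.c, ConnAlg.lift_ofBase, MvPolynomial.eval₂Hom_X']
  rfl

@[simp] lemma ZAlg.liftS_hbar : ZAlg.liftS (p := p) S g c h w w_add w_smul (ZAlg.hbar k p R L) = h := by
  rw [ZAlg.liftS, ZAlg.hbar, ConnAlg.lift_ofBase, MvPolynomial.eval₂Hom_X']
  rfl

@[simp] lemma ZAlg.liftS_coord (ξ : Der k R) (ν : Dual R L) (l : L) :
    ZAlg.liftS (p := p) S g c h w w_add w_smul (ZAlg.coord p ξ ν l) = conT p S g c h w ξ ν l := by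
  rw [ZAlg.liftS, ZAlg.coord, ConnAlg.lift_coord, ← conT_contract S g c h w w_smul ξ ν l]
  simp only [untwist_contract]
  rfl

lemma ZAlg.algebraMap_eq_fn (a : k) : algebraMap k (ZAlg k p R L) a =
    ZAlg.fn k p L (algebraMap k R ((frobeniusEquiv k p).symm a)) := by
  have h2 : algebraMap k (FrobTwist p R) a =
      FrobTwist.of p R (algebraMap k R ((frobeniusEquiv k p).symm a)) := FrobTwist.algebraMap_eq _ _ a
  rw [ZAlg.fn, ← h2]
  rfl

end LiftS

variable (k R L) in
/-- The center of `D_{c,ℏ,L}`. -/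
def TDOAlg.Center : Type u := Subalgebra.center k (TDOAlg k R L)

instance : CommRing (TDOAlg.Center k R L) := inferInstanceAs (CommRing (Subalgebra.center k (TDOAlg k R L)))

/-- The inclusion of the center. -/
def TDOAlg.Center.val : TDOAlg.Center k R L →+* TDOAlg k R L :=
  (Subalgebra.center k (TDOAlg k R L)).val.toRingHom

lemma TDOAlg.Center.val_injective : Function.Injective (TDOAlg.Center.val (k := k) (R := R) (L := L)) :=
  Subtype.val_injective

/-- An element of the center. -/
def TDOAlg.Center.mk (z : TDOAlg k R L) (h : ∀ d, z * d = d * z) : TDOAlg.Center k R L :=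
  ⟨z, mem_center_iff.mpr fun d => (h d).symm⟩

@[simp] lemma TDOAlg.Center.val_mk (z : TDOAlg k R L) (h : ∀ d, z * d = d * z) :
    TDOAlg.Center.val (TDOAlg.Center.mk z h) = z := rfl

lemma TDOAlg.Center.val_comm (z : TDOAlg.Center k R L) (d : TDOAlg k R L) :
    TDOAlg.Center.val z * d = d * TDOAlg.Center.val z := (mem_center_iff.mp z.2 d).symm

variable (k p L) in
/-- The Frobenius on functions, with values in the center. -/
def TDOAlg.fnC : R →+* TDOAlg.Center k R L :=
  ((TDOAlg.fn k L).toRingHom.comp (frobHom k p R)).codRestrict (Subalgebra.center k (TDOAlg k R L))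
    fun r => mem_center_iff.mpr fun d => (TDOAlg.fn_pow_central p r d).symm

lemma TDOAlg.val_fnC (r : R) : TDOAlg.Center.val (TDOAlg.fnC k p L r) = TDOAlg.fn k L (r ^ p) := rfl

variable (p) in
/-- The element `â^p - ℏ^{p-1} (a^{[p]})^` of the center for the standard lift of a vector field. -/
def pcurvC (ξ : Der k R) : TDOAlg.Center k R L :=
  TDOAlg.Center.mk (TDOAlg.pcurv p (liftDer_isInvariant S ξ)) (TDOAlg.pcurv_central S hC _)

lemma pcurvC_add (ξ ξ' : Der k R) : pcurvC p S hC (ξ + ξ') = pcurvC p S hC ξ + pcurvC p S hC ξ' := by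
  have := TorsorRing.finiteType k S
  refine TDOAlg.Center.val_injective (Subtype.ext ?_)
  rw [map_add, AddMemClass.coe_add, pcurvC, pcurvC, pcurvC, TDOAlg.Center.val_mk, TDOAlg.Center.val_mk,
    TDOAlg.Center.val_mk, TDOAlg.coe_pcurv, TDOAlg.coe_pcurv,
    TDOAlg.coe_pcurv, TorsorRing.liftDer_add, pcurv_add p (TorsorRing.hasLocCoords S hC), map_add, add_mul]

lemma pcurvC_smul (f : R) (ξ : Der k R) :
    pcurvC p S hC (f • ξ) = TDOAlg.fnC k p L f * pcurvC p S hC ξ := by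
  have := TorsorRing.finiteType k S
  refine TDOAlg.Center.val_injective (Subtype.ext ?_)
  rw [map_mul, Subalgebra.coe_mul, pcurvC, pcurvC, TDOAlg.Center.val_mk, TDOAlg.Center.val_mk,
    TDOAlg.coe_pcurv, TDOAlg.coe_pcurv, TDOAlg.val_fnC, TDOAlg.coe_fn,
    TorsorRing.liftDer_smul, pcurv_smul p (TorsorRing.hasLocCoords S hC), map_mul, mul_assoc,
    ← map_pow]
  rfl

variable (p) in
/-- The canonical map with values in the center. -/
def phiHom : ZAlg k p R L →+* TDOAlg.Center k R L :=
  ZAlg.liftS S (TDOAlg.fnC k p L) (TDOAlg.Center.mk (TDOAlg.c k R L) (TDOAlg.c_central S hC))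
    (TDOAlg.Center.mk (TDOAlg.hbar k R L) TDOAlg.hbar_central) (pcurvC p S hC)
    (pcurvC_add S hC) (pcurvC_smul S hC)

/-- The canonical map from functions on `Z` to `D_{c,ℏ,L}`. -/
def phi : ZAlg k p R L →ₐ[k] TDOAlg k R L :=
  { TDOAlg.Center.val.comp (phiHom p S hC) with
    commutes' := fun a => by
      change TDOAlg.Center.val (phiHom p S hC _) = _
      have h3 : (frobeniusEquiv k p).symm a ^ p = a := (frobeniusEquiv k p).apply_symm_apply a
      rw [ZAlg.algebraMap_eq_fn, phiHom, ZAlg.liftS_fn, TDOAlg.val_fnC, ← map_pow, h3, commutes] }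

lemma phi_apply (z : ZAlg k p R L) : phi S hC z = TDOAlg.Center.val (phiHom p S hC z) := rfl

@[simp] lemma phi_fn (r : R) : phi S hC (ZAlg.fn k p L r) = TDOAlg.fn k L (r ^ p) := by
  rw [phi_apply, phiHom, ZAlg.liftS_fn, TDOAlg.val_fnC]

@[simp] lemma phi_c : phi S hC (ZAlg.c k p R L) = TDOAlg.c k R L := by
  rw [phi_apply, phiHom, ZAlg.liftS_c, TDOAlg.Center.val_mk]

@[simp] lemma phi_hbar : phi S hC (ZAlg.hbar k p R L) = TDOAlg.hbar k R L := by
  rw [phi_apply, phiHom, ZAlg.liftS_hbar, TDOAlg.Center.val_mk]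

@[simp] lemma phi_coord (ξ : Der k R) (ν : Dual R L) (l : L) :
    phi S hC (ZAlg.coord p ξ ν l) = conV p S ξ ν l := by
  rw [phi_apply, phiHom, ZAlg.liftS_coord]
  rfl

lemma phi_central (z : ZAlg k p R L) (d : TDOAlg k R L) : phi S hC z * d = d * phi S hC z :=
  TDOAlg.Center.val_comm _ d

theorem phi_isCanonicalMap : IsCanonicalMap p (phi S hC) := by
  refine ⟨phi_c S hC, phi_hbar S hC, fun f => ?_, fun ξ a _ h ν l => ?_⟩
  · rw [phi_fn, TDOAlg.coe_fn, fnT, fnT, ← map_pow, map_pow, map_pow]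
  · rw [phi_coord, coe_conV S hC ξ ν l a h]

end Phi

section LocalCenter

open MvPolynomial

lemma RingAway.central_of_pow_mul {D D' : Type*} [Ring D] [Ring D'] {θ : D →+* D'} {t : D}
    (hθ : RingAway θ t) {x : D'} (n : ℕ) (h : ∀ d, (θ t ^ n * x) * d = d * (θ t ^ n * x)) (d : D') :
    x * d = d * x := by
  have hc : Commute (θ t ^ n) d := Commute.pow_left (hθ.central' d) n
  refine (hθ.isUnit.pow n).mul_left_cancel ?_
  rw [← mul_assoc, h, ← mul_assoc, ← mul_assoc, hc.eq]

variable {p : ℕ} [Fact p.Prime] [CharP k p] {R R' Q D D' : Type u} [CommRing R]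
  [Algebra k R] [CommRing R'] [Algebra k R'] [CommRing Q] [Algebra k Q] [Ring D] [Algebra k D] [Ring D']
  [Algebra k D'] {ρ : R →ₐ[k] R'} {f : R} (hf : IsAway ρ f) (φ : Q →ₐ[k] D) (θ : D →ₐ[k] D')
  (fq : R →+* Q) {I J : Type} (O : OreData k R' D' J) (e : I → J) (z : J → Q) (M : ℕ)
  (hφ : ∀ q d, φ q * d = d * φ q) (hθ : RingAway (θ : D →+* D') (φ (fq f)))
  (h1 : ∀ r, θ (φ (fq r)) = O.ι (ρ r ^ p))
  (h2 : ∀ i, θ (φ (z (e i))) = θ (φ (fq f)) ^ M * O.m (X (e i)) ^ p)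
  (h3 : ∀ j, j ∉ range e → θ (φ (z j)) = O.m (X j))
  (gen : ∀ T : Subring Q, (∀ r, fq r ∈ T) → (∀ j, z j ∈ T) → ∀ q, ∃ N, fq (f ^ N) * q ∈ T)
  (hinj : Function.Injective O.op)

include hφ hθ in
lemma map_center_central (q : Q) (d' : D') : θ (φ q) * d' = d' * θ (φ q) := by
  obtain ⟨n, d, hd⟩ := hθ.surj d'
  have hc : ∀ x, Commute (θ (φ (fq f)) ^ n) x := fun x => Commute.pow_left (hθ.central' x) n
  refine (hθ.isUnit.pow n).mul_left_cancel ?_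
  change θ (φ (fq f)) ^ n * d' = θ d at hd
  change θ (φ (fq f)) ^ n * _ = θ (φ (fq f)) ^ n * _
  rw [← mul_assoc, (hc _).eq, mul_assoc, hd, ← mul_assoc, hd, ← map_mul, ← map_mul, hφ]

include hf hφ hθ h1 in
lemma ι_pow_central (r : R') (d' : D') : O.ι (r ^ p) * d' = d' * O.ι (r ^ p) := by
  obtain ⟨n, r0, hr⟩ := hf.surj r
  refine hθ.central_of_pow_mul n (fun d => ?_) d'
  have : ((θ : D →+* D') (φ (fq f))) ^ n * O.ι (r ^ p) = θ (φ (fq r0)) := by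
    change (θ (φ (fq f))) ^ n * _ = _
    rw [h1, h1, ← map_pow, ← map_mul, ← hr]
    congr 1
    ring
  rw [this, map_center_central φ θ fq hφ hθ]

include hf hφ hθ h1 h2 h3 gen hinj in
theorem eq_zero_of_localCenter (hred : ∀ r : R', r ^ p = 0 → r = 0) (q : Q) (hq : φ q = 0) :
    ∃ N : ℕ, fq (f ^ N) * q = 0 := by
  have hG : ∀ j, ∃ (c : Subring.center D') (w : ℕ), (∀ i, e i = j → (c : D') = O.m (X j) ^ p) ∧
      (j ∉ range e → (c : D') = O.m (X j)) ∧ θ (φ (z j)) = O.ι (ρ f ^ w) ^ p * c := by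
    intro j
    by_cases hj : j ∈ range e
    · obtain ⟨i, rfl⟩ := hj
      refine ⟨⟨O.m (X (e i)) ^ p, Subring.mem_center_iff.mpr fun d => ?_⟩, M, fun _ _ => rfl,
        fun h => absurd ⟨i, rfl⟩ h, ?_⟩
      · refine (hθ.central_of_pow_mul M (fun d => ?_) d).symm
        change θ (φ (fq f)) ^ M * _ * d = _ * (θ (φ (fq f)) ^ M * _)
        rw [← h2, map_center_central φ θ fq hφ hθ]
      · change θ (φ (z (e i))) = O.ι (ρ f ^ M) ^ p * O.m (X (e i)) ^ p
        rw [h2, h1, ← map_pow O.ι, ← map_pow O.ι, ← pow_mul, ← pow_mul, mul_comm]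
    · refine ⟨⟨O.m (X j), Subring.mem_center_iff.mpr fun d => ?_⟩, 0, fun i hi => absurd ⟨i, hi⟩ hj,
        fun _ => rfl, ?_⟩
      · rw [← h3 j hj, map_center_central φ θ fq hφ hθ]
      · change θ (φ (z j)) = O.ι (ρ f ^ 0) ^ p * O.m (X j)
        rw [h3 j hj, pow_zero, map_one, one_pow, one_mul]
  choose G w hG1 hG2 hG3 using hG
  let ιc : R' →+* Subring.center D' := ((O.ι.toRingHom.comp (frobHom k p R'))).codRestrict _ fun r =>
    Subring.mem_center_iff.mpr fun d => (ι_pow_central hf φ θ fq O hφ hθ h1 r d).symm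
  let F : MvPolynomial J R' →+* D' := (Subring.center D').subtype.comp (eval₂Hom ιc G)
  have hFC : ∀ r, F (C r) = O.ι r ^ p := fun r => by
    change ((eval₂Hom ιc G (C r) : Subring.center D') : D') = _
    rw [eval₂Hom_C, ← map_pow]
    rfl
  have hFX : ∀ j, F (X j) = G j := fun j => by
    change ((eval₂Hom ιc G (X j) : Subring.center D') : D') = _
    rw [eval₂Hom_X']
  let ev : MvPolynomial J R →+* Q := eval₂Hom fq z
  let Ψ : MvPolynomial J R →+* MvPolynomial J R' :=
    eval₂Hom (C.comp ρ.toRingHom) fun j => C (ρ f ^ w j) * X j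
  have hΨ : ((θ.toRingHom.comp φ.toRingHom).comp ev) = F.comp Ψ := by
    refine ringHom_ext (fun r => ?_) fun j => ?_
    · change θ (φ (eval₂Hom fq z (C r))) = F (eval₂Hom _ _ (C r))
      rw [eval₂Hom_C, eval₂Hom_C, h1, map_pow]
      exact (hFC _).symm
    · change θ (φ (eval₂Hom fq z (X j))) = F (eval₂Hom _ _ (X j))
      rw [eval₂Hom_X', eval₂Hom_X', map_mul, hFC, hFX, hG3]
  obtain ⟨v, hv⟩ := hf.isUnit.exists_left_inv
  have hΨ0 : ∀ P, Ψ P = 0 → MvPolynomial.map ρ.toRingHom P = 0 := by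
    intro P hP
    let Υ : MvPolynomial J R' →ₐ[R'] MvPolynomial J R' := aeval fun j => C (v ^ w j) * X j
    have : (Υ.toRingHom.comp Ψ) = MvPolynomial.map ρ.toRingHom := by
      refine ringHom_ext (fun r => ?_) fun j => ?_
      · change Υ (eval₂Hom _ _ (C r)) = _
        rw [eval₂Hom_C, MvPolynomial.map_C]
        exact commutes Υ _
      · change Υ (eval₂Hom _ _ (X j)) = _
        rw [eval₂Hom_X', MvPolynomial.map_X, map_mul, ← algebraMap_eq, commutes, aeval_X,
          algebraMap_eq, ← mul_assoc, ← map_mul, ← mul_pow, mul_comm (ρ f), hv, one_pow, map_one, one_mul]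
    rw [← this, RingHom.comp_apply, hP, map_zero]
  obtain ⟨N, P, hP⟩ := gen ev.range (fun r => ⟨C r, eval₂Hom_C _ _ _⟩) (fun j => ⟨X j, eval₂Hom_X' _ _ _⟩) q
  have hP0 : MvPolynomial.map ρ.toRingHom P = 0 := by
    refine hΨ0 P (O.eq_zero_of_frobenius p e hred hinj F hFC (fun i => ?_) (fun j hj => ?_) _ ?_)
    · rw [hFX, hG1 _ i rfl]
    · rw [hFX, hG2 j hj]
    · rw [← RingHom.comp_apply, ← hΨ]
      change θ (φ (ev P)) = 0
      rw [hP, map_mul, hq, mul_zero, map_zero]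
  have hc : ∀ α, ∃ n : ℕ, f ^ n * coeff α P = 0 := fun α => hf.ker _ (by
    have := congrArg (coeff α) hP0
    rwa [coeff_map, coeff_zero] at this)
  choose n hn using hc
  have hN : C (f ^ P.support.sup n) * P = 0 := by
    ext α
    rw [coeff_C_mul, coeff_zero]
    by_cases hα : α ∈ P.support
    · rw [← Nat.sub_add_cancel (Finset.le_sup (f := n) hα), pow_add, mul_assoc, hn, mul_zero]
    · rw [notMem_support_iff.mp hα, mul_zero]
  refine ⟨P.support.sup n + N, ?_⟩
  have := congrArg ev hN
  rw [map_mul, map_zero, hP] at this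
  rw [pow_add, map_mul, mul_assoc, ← this]
  congr 1
  exact (eval₂Hom_C _ _ _).symm

include hf hφ hθ h1 h2 h3 hinj in
theorem exists_of_localCenter [DecidableEq J] (x : I → R')
    (hx : ∀ i j, O.der j (x i) = if j = e i then 1 else 0)
    (hconst : ∀ r, (∀ j, O.der j r = 0) → ∃ s, s ^ p = r)
    (hh : ∀ q : MvPolynomial J R', q * MvPolynomial.map (algebraMap k R') O.h = 0 → q = 0)
    (hsurj : Function.Surjective O.op) (d : D) (hd : ∀ d', d * d' = d' * d) :
    ∃ (n : ℕ) (q : Q), φ (fq (f ^ n)) * d = φ q := by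
  have hd' : ∀ d', θ d * d' = d' * θ d := by
    intro d'
    obtain ⟨n, d0, hd0⟩ := hθ.surj d'
    have hc : ∀ x, Commute (θ (φ (fq f)) ^ n) x := fun x => Commute.pow_left (hθ.central' x) n
    refine (hθ.isUnit.pow n).mul_left_cancel ?_
    change θ (φ (fq f)) ^ n * d' = θ d0 at hd0
    change θ (φ (fq f)) ^ n * _ = θ (φ (fq f)) ^ n * _
    rw [← mul_assoc, (hc _).eq, mul_assoc, hd0, ← mul_assoc, hd0, ← map_mul, ← map_mul, hd]
  obtain ⟨q, hq⟩ := hsurj (θ d)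
  have hmem := O.mem_of_commute p e x hx hconst hh hinj
    (RingAway.clearable (θ.comp φ) (fq f) (map_center_central φ θ fq hφ hθ _))
    (fun r => by
      obtain ⟨n, r0, hr⟩ := hf.surj r
      refine RingAway.mem_clearable_of_eq n (d := fq r0) ?_
      change θ (φ (fq f)) ^ n * _ = θ (φ (fq r0))
      rw [h1, h1, ← map_pow O.ι, ← map_pow O.ι, ← map_mul, ← hr]
      congr 1
      ring)
    (fun i => RingAway.mem_clearable_of_eq M (d := z (e i)) (h2 i).symm)
    (fun j hj => RingAway.mem_clearable_of_eq 0 (d := z j) (by rw [pow_zero, one_mul]; exact (h3 j hj).symm))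
    q (fun j => by rw [hq, hd']) (fun i => by rw [hq, hd'])
  rw [hq] at hmem
  obtain ⟨n, q', hn⟩ := hmem
  have hn' : (θ : D →+* D') (φ (fq f) ^ n * d) = (θ : D →+* D') (φ q') := by
    rw [map_mul, map_pow]
    exact hn
  obtain ⟨N, hN⟩ := hθ.exists_of_eq hn'
  refine ⟨N + n, fq f ^ N * q', ?_⟩
  rw [map_pow fq, map_mul, map_pow φ, map_pow φ, pow_add, mul_assoc, hN]

end LocalCenter

section Lifts

variable {R R' : Type u} [CommRing R] [Algebra k R] [CommRing R']
  [Algebra k R'] {L L' : Type u} [AddCommGroup L] [Module R L] [AddCommGroup L'] [Module R' L']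
  {ρ : R →ₐ[k] R'} {σ : L →+ L'} (H : IsRestr ρ σ) (S : InvSys R L) {f : R} (hf : IsAway ρ f)

include hf in
lemma IsAway.ringAway : RingAway (ρ : R →+* R') f where
  central := mul_comm f
  isUnit := hf.isUnit
  surj := hf.surj
  ker := hf.ker

include H hf in
lemma IsRestr.exists_sec (l' : L') : ∃ (n : ℕ) (l : L), σ l = ρ f ^ n • l' := by
  have : l' ∈ Submodule.span R' (range σ) := H.span ▸ Submodule.mem_top
  induction this using Submodule.span_induction with
  | mem x hx =>
    obtain ⟨l, rfl⟩ := hx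
    exact ⟨0, l, by rw [pow_zero, one_smul]⟩
  | zero => exact ⟨0, 0, by rw [map_zero, smul_zero]⟩
  | add x y _ _ hx hy =>
    obtain ⟨n, a, ha⟩ := hx
    obtain ⟨m, b, hb⟩ := hy
    refine ⟨n + m, f ^ m • a + f ^ n • b, ?_⟩
    rw [map_add, H.smul, H.smul, ha, hb, map_pow, map_pow, smul_smul, smul_smul, ← pow_add, ← pow_add,
      add_comm m n, smul_add]
  | smul r x _ hx =>
    obtain ⟨n, a, ha⟩ := hx
    obtain ⟨m, r0, hr⟩ := hf.surj r
    refine ⟨m + n, r0 • a, ?_⟩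
    rw [H.smul, ← hr, ha, smul_smul, smul_smul, pow_add]
    congr 1
    ring

include hf in
lemma IsAway.exists_pow_mul_eq_zero {ι : Type*} [Finite ι] (r : ι → R) (hr : ∀ i, ρ (r i) = 0) :
    ∃ n : ℕ, ∀ i, f ^ n * r i = 0 := by
  have := Fintype.ofFinite ι
  choose n hn using fun i => hf.ker _ (hr i)
  refine ⟨Finset.univ.sup n, fun i => ?_⟩
  rw [← Nat.sub_add_cancel (Finset.le_sup (f := n) (Finset.mem_univ i)), pow_add, mul_assoc, hn, mul_zero]

include H S hf in
lemma IsRestr.sec_ker {l : L} (hl : σ l = 0) : ∃ n : ℕ, f ^ n • l = 0 := by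
  obtain ⟨n, hn⟩ := hf.exists_pow_mul_eq_zero (fun j => S.ν j l) fun j => by
    rw [← H.dualExt_apply, hl, map_zero]
  refine ⟨n, ?_⟩
  rw [← S.sum_smul (f ^ n • l)]
  refine Finset.sum_eq_zero fun j _ => ?_
  rw [map_smul, smul_eq_mul, hn, zero_smul]

include S hf in
lemma IsRestr.dual_ker {ν : Dual R L} (hν : H.dualExt ν = 0) : ∃ n : ℕ, f ^ n • ν = 0 := by
  obtain ⟨n, hn⟩ := hf.exists_pow_mul_eq_zero (fun j => ν (S.l j)) fun j => by
    rw [← H.dualExt_apply, hν, LinearMap.zero_apply]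
  refine ⟨n, ?_⟩
  rw [S.dual_eq ν, Finset.smul_sum]
  refine Finset.sum_eq_zero fun j _ => ?_
  rw [smul_smul, hn, zero_smul]

include S hf in
lemma IsRestr.exists_dual (ν' : Dual R' L') :
    ∃ (n : ℕ) (ν : Dual R L), H.dualExt ν = ρ f ^ n • ν' := by
  obtain ⟨n, r, hr⟩ := hf.ringAway.surj_fintype fun j => ν' (σ (S.l j))
  refine ⟨n, ∑ j, r j • S.ν j, (H.eq_dualExt fun l => ?_).symm⟩
  rw [LinearMap.smul_apply, LinearMap.sum_apply, map_sum]
  conv_lhs => rw [← S.sum_smul l, map_sum, map_sum, Finset.smul_sum]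
  refine sum_congr rfl fun j _ => ?_
  rw [LinearMap.smul_apply, H.smul, map_smul, smul_eq_mul, smul_eq_mul, smul_eq_mul, mul_left_comm, map_mul]
  have : ρ f ^ n * ν' (σ (S.l j)) = ρ (r j) := hr j
  rw [this, mul_comm]

include H S hf in
theorem exists_chart_lift [FiniteType k R] {n : ℕ} (X : Coords k R' (Fin n)) (F : LFrame R' L') (p : ℕ)
    [Fact p.Prime] :
    ∃ (D : Fin n → Der k R) (ν₀ : Dual R L) (s₀ : L) (M : ℕ),
      (∀ i, H.derExt.ext (D i) = ρ f ^ M • X.der i) ∧ H.dualExt ν₀ = ρ f ^ M • F.dual ∧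
        σ s₀ = ρ f ^ (p * M) • F.s := by
  choose m D hD using fun i => hf.exists_der (X.der i)
  obtain ⟨a, ν, hν⟩ := H.exists_dual S hf F.dual
  obtain ⟨b, s, hs⟩ := H.exists_sec hf F.s
  let N := Finset.univ.sup m + a + b
  have hp : 0 < p := (Fact.out : p.Prime).pos
  refine ⟨fun i => f ^ (N - m i) • D i, f ^ (N - a) • ν, f ^ (p * N - b) • s, N, fun i => ?_, ?_, ?_⟩
  · have hm : m i ≤ N := (Finset.le_sup (f := m) (Finset.mem_univ i)).trans (by omega)
    refine (H.derExt.eq_ext fun r => ?_).symm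
    rw [Derivation.smul_apply, Derivation.smul_apply, smul_eq_mul, smul_eq_mul, map_mul, hD, map_pow,
      ← mul_assoc, ← pow_add, Nat.sub_add_cancel hm]
  · rw [H.dualExt_smul, hν, smul_smul, map_pow, ← pow_add, Nat.sub_add_cancel (by omega)]
  · rw [H.smul, hs, smul_smul, map_pow, ← pow_add, Nat.sub_add_cancel]
    calc b ≤ N := by omega
      _ ≤ p * N := Nat.le_mul_of_pos_left _ hp

variable {p : ℕ} [Fact p.Prime] [CharP k p] [PerfectRing k p]

include S hf in
/-- Up to powers of `f`, functions on `Z` are generated by the coordinates of a chart. -/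
theorem ZAlg.exists_pow_mul_mem [FiniteType k R] {n : ℕ} (X : Coords k R' (Fin n)) (F : LFrame R' L')
    {D : Fin n → Der k R} {ν₀ : Dual R L} {s₀ : L} {M : ℕ}
    (hD : ∀ i, H.derExt.ext (D i) = ρ f ^ M • X.der i) (hν : H.dualExt ν₀ = ρ f ^ M • F.dual)
    (hs : σ s₀ = ρ f ^ (p * M) • F.s) (T : Subring (ZAlg k p R L)) (h1 : ∀ r, ZAlg.fn k p L r ∈ T)
    (h2 : ZAlg.c k p R L ∈ T) (h3 : ZAlg.hbar k p R L ∈ T) (h4 : ∀ i, ZAlg.coord p (D i) ν₀ s₀ ∈ T)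
    (z : ZAlg k p R L) : ∃ N : ℕ, ZAlg.fn k p L (f ^ N) * z ∈ T := by
  have fn_mul : ∀ a b : R, ZAlg.fn k p L (a * b) = ZAlg.fn k p L a * ZAlg.fn k p L b :=
    fun a b => map_mul (ZAlg.fnHom k p L) a b
  let U : Subring (ZAlg k p R L) :=
    { carrier := {z | ∃ N : ℕ, ZAlg.fn k p L (f ^ N) * z ∈ T}
      mul_mem' := by
        rintro a b ⟨N, hN⟩ ⟨M, hM⟩
        refine ⟨N + M, ?_⟩
        rw [pow_add, fn_mul, mul_mul_mul_comm]
        exact mul_mem hN hM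
      one_mem' := ⟨0, mul_mem (h1 _) (one_mem _)⟩
      add_mem' := by
        rintro a b ⟨N, hN⟩ ⟨M, hM⟩
        refine ⟨N + M, ?_⟩
        rw [pow_add, fn_mul, mul_add]
        refine add_mem ?_ ?_
        · rw [mul_right_comm]
          exact mul_mem hN (h1 _)
        · rw [mul_assoc]
          exact mul_mem (h1 _) hM
      zero_mem' := ⟨0, by rw [mul_zero]; exact zero_mem _⟩
      neg_mem' := by
        rintro a ⟨N, hN⟩
        exact ⟨N, by rw [mul_neg]; exact neg_mem hN⟩ }
  have hTU : ∀ z ∈ T, z ∈ U := fun z hz => ⟨0, mul_mem (h1 _) hz⟩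
  refine ZAlg.mem_of_generators S U (fun r => hTU _ (h1 r)) (hTU _ h2) (hTU _ h3) (fun ξ ν l => ?_) z
  obtain ⟨a, r, ha⟩ : ∃ (a : ℕ) (r : Fin n → R), f ^ a • ξ = ∑ i, r i • D i := by
    obtain ⟨m, r, hr⟩ := hf.ringAway.surj_fintype fun i => H.derExt.ext ξ (X.x i)
    have hr' : ∀ i, ρ f ^ m * H.derExt.ext ξ (X.x i) = ρ (r i) := hr
    have key : H.derExt.ext (f ^ (m + M) • ξ) = H.derExt.ext (∑ i, r i • D i) := by
      have : H.derExt.ext (∑ i, r i • D i) = ∑ i, ρ (r i) • ρ f ^ M • X.der i := by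
        refine (map_sum (AddMonoidHom.mk' H.derExt.ext H.derExt.ext_add) _ _).trans ?_
        exact sum_congr rfl fun i _ => by
          rw [AddMonoidHom.mk'_apply, H.derExt.ext_smul, hD]
      rw [this, H.derExt.ext_smul, X.eq_sum (H.derExt.ext ξ), Finset.smul_sum]
      refine sum_congr rfl fun i _ => ?_
      rw [← hr', smul_smul, smul_smul, map_pow]
      congr 1
      ring
    obtain ⟨N, hN⟩ := hf.der_eq_zero (f ^ (m + M) • ξ - ∑ i, r i • D i) fun a => by
      rw [← H.derExt.ext_apply, sub_eq_add_neg, ← neg_one_smul R, H.derExt.ext_add, key, H.derExt.ext_smul, map_neg, map_one,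
        neg_one_smul, add_neg_cancel, Derivation.zero_apply]
    rw [smul_sub, sub_eq_zero, smul_smul, ← pow_add, Finset.smul_sum] at hN
    exact ⟨_, fun i => f ^ N * r i, hN.trans (sum_congr rfl fun i _ => smul_smul _ _ _)⟩
  obtain ⟨b, r', hb⟩ : ∃ (b : ℕ) (r : R), f ^ b • ν = r • ν₀ := by
    obtain ⟨m, r, hr⟩ := hf.surj (H.dualExt ν F.s)
    have h0 : H.dualExt ν = H.dualExt ν F.s • F.dual := by
      refine LinearMap.ext fun l => ?_
      conv_lhs => rw [← F.dual_smul l, map_smul, smul_eq_mul, mul_comm]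
      rfl
    obtain ⟨N, hN⟩ := H.dual_ker S hf (ν := f ^ (m + M) • ν - r • ν₀) (by
      rw [map_sub, H.dualExt_smul, H.dualExt_smul, hν, h0, smul_smul, smul_smul, ← hr, ← sub_smul, map_pow]
      rw [show ρ f ^ (m + M) * H.dualExt ν F.s - ρ f ^ m * H.dualExt ν F.s * ρ f ^ M = 0 by ring, zero_smul])
    rw [smul_sub, sub_eq_zero, smul_smul, smul_smul, ← pow_add] at hN
    exact ⟨_, _, hN⟩
  obtain ⟨c, r'', hc⟩ : ∃ (c : ℕ) (r : R), f ^ c • l = r • s₀ := by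
    obtain ⟨m, r, hr⟩ := hf.surj (F.dual (σ l))
    obtain ⟨N, hN⟩ := H.sec_ker S hf (l := f ^ (m + p * M) • l - r • s₀) (by
      rw [map_sub, H.smul, H.smul, hs, ← hr, smul_smul, map_pow]
      conv_lhs => rw [← F.dual_smul (σ l), smul_smul]
      rw [F.dual_smul, ← sub_smul]
      rw [show ρ f ^ (m + p * M) * F.dual (σ l) - ρ f ^ m * F.dual (σ l) * ρ f ^ (p * M) = 0 by ring, zero_smul])
    rw [smul_sub, sub_eq_zero, smul_smul, smul_smul, ← pow_add] at hN
    exact ⟨_, _, hN⟩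
  have hlam : ZAlg.c k p R L ^ p - ZAlg.c k p R L * ZAlg.hbar k p R L ^ (p - 1) ∈ T :=
    sub_mem (pow_mem h2 _) (mul_mem h2 (pow_mem h3 _))
  have key : ZAlg.coord p (f ^ a • ξ) (f ^ b • ν) (f ^ c • l) ∈ T := by
    rw [ha, hb, hc, ZAlg.coord_sum_left]
    refine sum_mem fun i _ => ?_
    rw [ZAlg.coord_smul_left, ZAlg.coord_smul_mid, ZAlg.coord_smul_right]
    exact mul_mem (h1 _) (mul_mem (h1 _) (add_mem (mul_mem (h1 _) (h4 i)) (mul_mem hlam (h1 _))))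
  refine ⟨a + b + c, ?_⟩
  rw [ZAlg.coord_smul_left, ZAlg.coord_smul_mid, ZAlg.coord_smul_right, mul_add, mul_add] at key
  have h5 := sub_mem key (mul_mem (h1 (f ^ a)) (mul_mem (h1 (f ^ b)) (mul_mem hlam (h1 (ν l * ξ (f ^ c))))))
  rw [add_sub_cancel_right] at h5
  rw [pow_add, pow_add, fn_mul, fn_mul, mul_assoc, mul_assoc]
  exact h5

end Lifts

section ChartValues

variable [Infinite k] {p : ℕ} [Fact p.Prime] [CharP k p] {R : Type u} [CommRing R]
  [Algebra k R] {L : Type u} [AddCommGroup L] [Module R L]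

lemma isAway_id : IsAway (AlgHom.id k R) 1 where
  isUnit := by rw [map_one]; exact isUnit_one
  surj a := ⟨0, a, by simp⟩
  ker a ha := ⟨0, by simpa using ha⟩

lemma isRestr_id : IsRestr (AlgHom.id k R) (AddMonoidHom.id L) where
  smul _ _ := rfl
  etale := isAway_id.formallyEtale
  span := by
    rw [eq_top_iff]
    intro x _
    exact Submodule.subset_span ⟨x, rfl⟩
  dual ν := ⟨ν, fun _ => rfl⟩

lemma Chart.hasCharts (C : Chart k p R L) : HasCharts k p R L :=
  ⟨{1}, by rw [Ideal.span_singleton_one], fun f hf => by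
    rw [Set.mem_singleton_iff] at hf
    subst hf
    exact ⟨R, _, _, L, _, _, AlgHom.id k R, AddMonoidHom.id L, isRestr_id, isAway_id, ⟨C⟩⟩⟩

variable [PerfectRing k p]

lemma Chart.conV_smul [FiniteType k R] (C : Chart k p R L) (i : Fin C.n) (u : R) (M : ℕ) :
    conV p C.F.invSys (u ^ M • C.X.der i) (u ^ M • C.F.dual) (u ^ (p * M) • C.F.s) =
      TDOAlg.fn k L (u ^ p) ^ (M + M + p * M) * C.F.gen C.X (some (some i)) ^ p := by
  have hpc : TDOAlg.pcurv p (liftDer_isInvariant C.F.invSys (C.X.der i)) =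
      C.F.gen C.X (some (some i)) ^ p := by
    have h0 : pPow p (liftDer C.F.invSys (C.X.der i)) = 0 :=
      (C.F.coords C.X).pPow_der p (some i)
    refine Subtype.ext ?_
    rw [TDOAlg.coe_pcurv, ← hat_pow_sub, h0, hat, hat, map_zero, map_zero, zero_mul, mul_zero, sub_zero]
    rfl
  have hsm := congrArg TDOAlg.Center.val (pcurvC_smul (p := p) C.F.invSys C.hasCharts (u ^ M) (C.X.der i))
  rw [map_mul, TDOAlg.val_fnC, pcurvC, pcurvC, TDOAlg.Center.val_mk, TDOAlg.Center.val_mk, hpc] at hsm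
  have hB : conB C.F.invSys (u ^ M • C.X.der i) (u ^ M • C.F.dual) (u ^ (p * M) • C.F.s) = 0 := by
    refine Finset.sum_eq_zero fun j _ => ?_
    change (u ^ M • C.X.der i) (C.F.dual (u ^ (p * M) • C.F.s)) * _ = 0
    rw [map_smul, C.F.dual_s, smul_eq_mul, mul_one, Derivation.smul_apply, mul_comm p, pow_mul,
      derivation_pow_p p, smul_zero, zero_mul]
  rw [conV, hB, hsm, zero_pow (Fact.out : p.Prime).ne_zero, map_zero, mul_zero, add_zero, ← mul_assoc, ← map_mul]
  congr 1
  rw [LinearMap.smul_apply, map_smul, C.F.dual_s, smul_eq_mul, smul_eq_mul, mul_one, ← map_pow]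
  congr 1
  ring

end ChartValues

lemma IsAway.finiteType {k R R' : Type u} [Field k] [CommRing R] [Algebra k R] [CommRing R'] [Algebra k R']
    {ρ : R →ₐ[k] R'} {f : R} (hf : IsAway ρ f) [FiniteType k R] : FiniteType k R' := by
  algebraize [ρ.toRingHom]
  have : IsScalarTower k R R' := IsScalarTower.of_algebraMap_eq fun a => (ρ.commutes a).symm
  have h := hf.isLocalization
  have : FiniteType R R' := IsLocalization.finiteType_of_monoid_fg (powers f) R'
  exact FiniteType.trans (S := R) inferInstance inferInstance

lemma isIsoOntoCenter_of_local {R Z A : Type u} [CommRing R] [CommRing Z] [Algebra k Z] [Ring A] [Algebra k A]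
    (φ : Z →ₐ[k] A) (ι : R →+* Z) (hφ : ∀ z d, φ z * d = d * φ z) (s : Set R) (hs : Ideal.span s = ⊤)
    (hinj : ∀ f ∈ s, ∀ z, φ z = 0 → ∃ n : ℕ, ι (f ^ n) * z = 0)
    (hsurj : ∀ f ∈ s, ∀ d, (∀ d', d * d' = d' * d) → ∃ (n : ℕ) (z : Z), φ (ι (f ^ n)) * d = φ z) :
    IsIsoOntoCenter φ := by
  refine ⟨(injective_iff_map_eq_zero _).mpr fun z hz => eq_zero_of_local ι s hs z fun f hf => hinj f hf z hz,
    le_antisymm ?_ fun d hd => ?_⟩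
  · rintro _ ⟨z, rfl⟩
    exact mem_center_iff.mpr fun d => (hφ z d).symm
  · refine mem_of_local (φ.toRingHom.comp ι) φ.range.toSubring.toAddSubgroup
      (fun a x hx => mul_mem (S := Subalgebra k A) ⟨ι a, rfl⟩ hx) s hs d fun f hf => ?_
    obtain ⟨n, z, hz⟩ := hsurj f hf d fun d' => (mem_center_iff.mp hd d').symm
    exact ⟨n, z, hz.symm⟩

section

variable [Infinite k] {p : ℕ} [Fact p.Prime] [CharP k p] [PerfectRing k p]
  {R : Type u} [CommRing R] [Algebra k R] {L : Type u} [AddCommGroup L] [Module R L]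
  [FiniteType k R] (S : InvSys R L) (hC : HasCharts k p R L)

/-! ### Specializations -/

variable (c₀ h₀ : k)

/-- The specialization of the canonical map. -/
def phiSpec : ZSpec k p R L c₀ h₀ →ₐ[k] TDOSpec k R L c₀ h₀ :=
  Ideal.Quotient.liftₐ _ ((TDOSpec.mk k R L c₀ h₀).comp (phi S hC)) fun z hz => by
    have : ZAlg.fibreIdeal p R L c₀ h₀ ≤ RingHom.ker ((TDOSpec.mk k R L c₀ h₀).comp (phi S hC)) := by
      refine Ideal.span_le.mpr ?_
      rintro _ (rfl | rfl)
      · simp [RingHom.mem_ker]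
      · simp [RingHom.mem_ker]
    exact this hz

@[simp] lemma phiSpec_mk (z : ZAlg k p R L) : phiSpec S hC c₀ h₀ (Ideal.Quotient.mk _ z) =
    TDOSpec.mk k R L c₀ h₀ (phi S hC z) := rfl

lemma phiSpec_central (z : ZSpec k p R L c₀ h₀) (d : TDOSpec k R L c₀ h₀) :
    phiSpec S hC c₀ h₀ z * d = d * phiSpec S hC c₀ h₀ z := by
  obtain ⟨z, rfl⟩ := Ideal.Quotient.mk_surjective z
  obtain ⟨d, rfl⟩ := TDOSpec.mk_surjective c₀ h₀ d
  rw [phiSpec_mk, ← map_mul, phi_central, map_mul]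

variable (k p L) in
/-- Functions on the base as functions on a fibre of `Z`. -/
def ZSpec.fnHom : R →+* ZSpec k p R L c₀ h₀ :=
  (Ideal.Quotient.mk (ZAlg.fibreIdeal p R L c₀ h₀)).comp (ZAlg.fnHom k p L)

lemma phiSpec_fnHom (r : R) : phiSpec S hC c₀ h₀ (ZSpec.fnHom k p L c₀ h₀ r) = TDOSpec.fn k L c₀ h₀ (r ^ p) :=
  congrArg (TDOSpec.mk k R L c₀ h₀) (phi_fn S hC r)

section Chart

variable {R' L' : Type u} [CommRing R'] [Algebra k R'] [AddCommGroup L'] [Module R' L']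
  {ρ : R →ₐ[k] R'} {σ : L →+ L'} (H : IsRestr ρ σ) {f : R} (hf : IsAway ρ f) (C : Chart k p R' L')
  {D : Fin C.n → Der k R} {ν₀ : Dual R L} {s₀ : L} {M : ℕ}
  (hD : ∀ i, H.derExt.ext (D i) = ρ f ^ M • C.X.der i) (hν : H.dualExt ν₀ = ρ f ^ M • C.F.dual)
  (hs : σ s₀ = ρ f ^ (p * M) • C.F.s)

lemma map_phi_fn (r : R) : TDOAlg.map H S (phi S hC (ZAlg.fn k p L r)) = TDOAlg.fn k L' (ρ r ^ p) := by
  rw [phi_fn, TDOAlg.map_fn, map_pow]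

include hf hD hν hs in
lemma map_phi_coord (i : Fin C.n) : TDOAlg.map H S (phi S hC (ZAlg.coord p (D i) ν₀ s₀)) =
    TDOAlg.map H S (phi S hC (ZAlg.fn k p L f)) ^ (M + M + p * M) * C.F.gen C.X (some (some i)) ^ p := by
  have := hf.finiteType
  rw [phi_coord, map_conV S H C.F.invSys hC C.hasCharts, hD, hν, hs, C.conV_smul, map_phi_fn]

include hf C in
lemma ringAway_phi : RingAway (TDOAlg.map H S : TDOAlg k R L →+* TDOAlg k R' L')
    (phi S hC (ZAlg.fn k p L f)) := by
  rw [phi_fn]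
  exact TDOAlg.ringAway H S C.X C.F p hf

/-- The generators of functions on `Z` over a chart. -/
def ZAlg.gens (D : Fin C.n → Der k R) (ν₀ : Dual R L) (s₀ : L)
    (j : Option (Option (Fin C.n))) : ZAlg k p R L :=
  j.elim (ZAlg.hbar k p R L) fun i => i.elim (ZAlg.c k p R L) fun i => ZAlg.coord p (D i) ν₀ s₀

lemma map_phi_gens (j : Option (Option (Fin C.n))) (hj : j ∉ range fun i => some (some i)) :
    TDOAlg.map H S (phi S hC (ZAlg.gens C D ν₀ s₀ j)) = (C.F.ore C.X).m (MvPolynomial.X j) := by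
  rw [C.F.ore_m_X]
  rcases j with _ | _ | i
  · exact (congrArg _ (phi_hbar S hC)).trans (TDOAlg.map_hbar H S)
  · exact (congrArg _ (phi_c S hC)).trans (TDOAlg.map_c H S)
  · exact absurd ⟨i, rfl⟩ hj

include S H hf C in
theorem phi_local_injective (z : ZAlg k p R L) (hz : phi S hC z = 0) :
    ∃ N : ℕ, ZAlg.fn k p L (f ^ N) * z = 0 := by
  obtain ⟨D, ν₀, s₀, M, hD, hν, hs⟩ := exists_chart_lift H S hf C.X C.F p
  refine eq_zero_of_localCenter hf (phi S hC) (TDOAlg.map H S) (ZAlg.fnHom k p L) (C.F.ore C.X)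
    (fun i => some (some i)) (ZAlg.gens C D ν₀ s₀) (M + M + p * M) (phi_central S hC)
    (ringAway_phi S hC H hf C) (map_phi_fn S hC H) (fun i => ?_)
    (map_phi_gens S hC H C) (fun T h1 h2 => ZAlg.exists_pow_mul_mem H S hf C.X C.F hD hν hs T h1 (h2 (some none)) (h2 none)
      fun i => h2 (some (some i))) (C.F.op_injective C.X) C.red z hz
  · rw [C.F.ore_m_X]
    exact map_phi_coord S hC H hf C hD hν hs i

include H hf C in
theorem phi_local_surjective (d : TDOAlg k R L) (hd : ∀ d', d * d' = d' * d) :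
    ∃ (n : ℕ) (z : ZAlg k p R L), phi S hC (ZAlg.fn k p L (f ^ n)) * d = phi S hC z := by
  obtain ⟨D, ν₀, s₀, M, hD, hν, hs⟩ := exists_chart_lift H S hf C.X C.F p
  refine exists_of_localCenter hf (phi S hC) (TDOAlg.map H S) (ZAlg.fnHom k p L) (C.F.ore C.X)
    (fun i => some (some i)) (ZAlg.gens C D ν₀ s₀) (M + M + p * M) (phi_central S hC)
    (ringAway_phi S hC H hf C) (map_phi_fn S hC H) (fun i => ?_)
    (map_phi_gens S hC H C) (C.F.op_injective C.X) C.X.x (fun i j => ?_) (fun r hr => C.const r fun i => hr (some (some i)))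
    (fun q hq => ?_) (C.F.op_surjective C.X) d hd
  · rw [C.F.ore_m_X]
    exact map_phi_coord S hC H hf C hD hν hs i
  · rcases j with _ | _ | j
    · rfl
    · rfl
    · refine (C.X.der_x j i).trans ?_
      simp only [Option.some.injEq]
  · rw [show (C.F.ore C.X).h = MvPolynomial.X none from rfl, MvPolynomial.map_X] at hq
    exact MvPolynomial.isRegular_X.right.eq_iff.mp (hq.trans (zero_mul _).symm)

lemma map_phiSpec_fn (r : R) : TDOSpec.map H S c₀ h₀ (phiSpec S hC c₀ h₀ (ZSpec.fnHom k p L c₀ h₀ r)) =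
    TDOSpec.fn k L' c₀ h₀ (ρ r ^ p) := by
  rw [phiSpec_fnHom, TDOSpec.fn, AlgHom.comp_apply, TDOSpec.map_mk, TDOAlg.map_fn, map_pow ρ]
  rfl

include hf hD hν hs in
lemma map_phiSpec_coord (i : Fin C.n) :
    TDOSpec.map H S c₀ h₀ (phiSpec S hC c₀ h₀ (Ideal.Quotient.mk _ (ZAlg.coord p (D i) ν₀ s₀))) =
    TDOSpec.map H S c₀ h₀ (phiSpec S hC c₀ h₀ (ZSpec.fnHom k p L c₀ h₀ f)) ^ (M + M + p * M) *
      (C.F.specOre c₀ h₀ C.X).m (MvPolynomial.X i) ^ p := by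
  have h1 := congrArg (TDOSpec.mk k R' L' c₀ h₀) (map_phi_coord S hC H hf C hD hν hs i)
  rw [map_mul, map_pow, map_pow] at h1
  rw [phiSpec_mk, TDOSpec.map_mk, h1, ← TDOSpec.map_mk, LFrame.specOre_m_X]
  rfl

include hf C in
lemma ringAway_phiSpec : RingAway (TDOSpec.map H S c₀ h₀ : TDOSpec k R L c₀ h₀ →+* TDOSpec k R' L' c₀ h₀)
    (phiSpec S hC c₀ h₀ (ZSpec.fnHom k p L c₀ h₀ f)) := by
  rw [phiSpec_fnHom]
  exact TDOSpec.ringAway H S c₀ h₀ p C hf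

include S H hf C in
theorem phiSpec_local_injective (z : ZSpec k p R L c₀ h₀) (hz : phiSpec S hC c₀ h₀ z = 0) :
    ∃ N : ℕ, ZSpec.fnHom k p L c₀ h₀ (f ^ N) * z = 0 := by
  obtain ⟨D, ν₀, s₀, M, hD, hν, hs⟩ := exists_chart_lift H S hf C.X C.F p
  refine eq_zero_of_localCenter hf (phiSpec S hC c₀ h₀) (TDOSpec.map H S c₀ h₀) (ZSpec.fnHom k p L c₀ h₀)
    (C.F.specOre c₀ h₀ C.X) id (fun i => Ideal.Quotient.mk _ (ZAlg.coord p (D i) ν₀ s₀)) (M + M + p * M)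
    (phiSpec_central S hC c₀ h₀)
    (ringAway_phiSpec S hC c₀ h₀ H hf C) (map_phiSpec_fn S hC c₀ h₀ H)
    (map_phiSpec_coord S hC c₀ h₀ H hf C hD hν hs) (fun j hj => absurd ⟨j, rfl⟩ hj)
    (fun T h1 h2 z => ?_) (C.F.specOp_bijective c₀ h₀ C.X).1 C.red z hz
  obtain ⟨z, rfl⟩ := Ideal.Quotient.mk_surjective z
  have hk : ∀ a : k, algebraMap k (ZSpec k p R L c₀ h₀) a ∈ T := fun a => by
    have : algebraMap k (ZSpec k p R L c₀ h₀) a = Ideal.Quotient.mk _ (algebraMap k (ZAlg k p R L) a) := rfl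
    rw [this, ZAlg.algebraMap_eq_fn]
    exact h1 _
  have hc : Ideal.Quotient.mk (ZAlg.fibreIdeal p R L c₀ h₀) (ZAlg.c k p R L) = algebraMap k _ c₀ :=
    Ideal.Quotient.eq.mpr (Ideal.subset_span (Or.inl rfl))
  have hh : Ideal.Quotient.mk (ZAlg.fibreIdeal p R L c₀ h₀) (ZAlg.hbar k p R L) = algebraMap k _ h₀ :=
    Ideal.Quotient.eq.mpr (Ideal.subset_span (Or.inr rfl))
  obtain ⟨N, hN⟩ := ZAlg.exists_pow_mul_mem H S hf C.X C.F hD hν hs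
    (T.comap (Ideal.Quotient.mk (ZAlg.fibreIdeal p R L c₀ h₀))) h1
    (by rw [Subring.mem_comap, hc]; exact hk _) (by rw [Subring.mem_comap, hh]; exact hk _) h2 z
  exact ⟨N, hN⟩

include H hf C in
theorem phiSpec_local_surjective (hh₀ : h₀ ≠ 0) (d : TDOSpec k R L c₀ h₀) (hd : ∀ d', d * d' = d' * d) :
    ∃ (n : ℕ) (z : ZSpec k p R L c₀ h₀), phiSpec S hC c₀ h₀ (ZSpec.fnHom k p L c₀ h₀ (f ^ n)) * d =
      phiSpec S hC c₀ h₀ z := by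
  obtain ⟨D, ν₀, s₀, M, hD, hν, hs⟩ := exists_chart_lift H S hf C.X C.F p
  refine exists_of_localCenter hf (phiSpec S hC c₀ h₀) (TDOSpec.map H S c₀ h₀) (ZSpec.fnHom k p L c₀ h₀)
    (C.F.specOre c₀ h₀ C.X) id (fun i => Ideal.Quotient.mk _ (ZAlg.coord p (D i) ν₀ s₀)) (M + M + p * M)
    (phiSpec_central S hC c₀ h₀)
    (ringAway_phiSpec S hC c₀ h₀ H hf C) (map_phiSpec_fn S hC c₀ h₀ H)
    (map_phiSpec_coord S hC c₀ h₀ H hf C hD hν hs) (fun j hj => absurd ⟨j, rfl⟩ hj)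
    (C.F.specOp_bijective c₀ h₀ C.X).1 C.X.x (fun i j => C.X.der_x j i) C.const (fun q hq => ?_)
    (C.F.specOp_bijective c₀ h₀ C.X).2 d hd
  rw [show (C.F.specOre c₀ h₀ C.X).h = MvPolynomial.C h₀ from rfl, MvPolynomial.map_C] at hq
  have hu : (MvPolynomial.C (algebraMap k R' h₀) : MvPolynomial (Fin C.n) R') *
      MvPolynomial.C (algebraMap k R' h₀⁻¹) = 1 := by
    rw [← map_mul, ← map_mul, mul_inv_cancel₀ hh₀, map_one, map_one]
  rw [← mul_one q, ← hu, ← mul_assoc, hq, zero_mul]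

end Chart

theorem phi_isIsoOntoCenter : IsIsoOntoCenter (phi S hC) := by
  obtain ⟨s, hs, h⟩ := id hC
  refine isIsoOntoCenter_of_local _ (ZAlg.fnHom k p L) (phi_central S hC) s hs (fun f hf => ?_) fun f hf => ?_
  · obtain ⟨R', _, _, L', _, _, ρ, σ, H, hρ, ⟨C⟩⟩ := h f hf
    exact phi_local_injective S hC H hρ C
  · obtain ⟨R', _, _, L', _, _, ρ, σ, H, hρ, ⟨C⟩⟩ := h f hf
    exact phi_local_surjective S hC H hρ C

theorem phiSpec_isIsoOntoCenter (hh₀ : h₀ ≠ 0) : IsIsoOntoCenter (phiSpec S hC c₀ h₀) := by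
  obtain ⟨s, hs, h⟩ := id hC
  refine isIsoOntoCenter_of_local _ (ZSpec.fnHom k p L c₀ h₀) (phiSpec_central S hC c₀ h₀) s hs
    (fun f hf => ?_) fun f hf => ?_
  · obtain ⟨R', _, _, L', _, _, ρ, σ, H, hρ, ⟨C⟩⟩ := h f hf
    exact phiSpec_local_injective S hC c₀ h₀ H hρ C
  · obtain ⟨R', _, _, L', _, _, ρ, σ, H, hρ, ⟨C⟩⟩ := h f hf
    exact phiSpec_local_surjective S hC c₀ h₀ H hρ C hh₀

end

section Clearing

variable {D D' : Type u} [Ring D] [Ring D'] {θ : D →+* D'} {t : D}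

lemma RingAway.exists_multSubring (h : RingAway θ t) (l : List (D' × D')) :
    ∃ (n : ℕ) (τ : Module.End ℤ D), τ ∈ multSubring D ∧ ∀ a, θ (τ a) = θ t ^ n * listOp l (θ a) := by
  induction l with
  | nil => exact ⟨0, 0, zero_mem _, fun a => by simp [listOp]⟩
  | cons u l ih =>
    obtain ⟨n, τ, hτ, hn⟩ := ih
    obtain ⟨i, x, hx⟩ := h.surj u.1
    obtain ⟨j, y, hy⟩ := h.surj u.2
    have hc : ∀ (m : ℕ) (d' : D'), θ t ^ m * d' = d' * θ t ^ m := fun m d' =>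
      Commute.pow_left (h.central' d') m
    refine ⟨n + i + j, mulLeft ℤ (t ^ n * x) * mulRight ℤ y + mulLeft ℤ (t ^ (i + j)) * τ,
      add_mem (mul_mem (mulLeft_mem _) (mulRight_mem _)) (mul_mem (mulLeft_mem _) hτ), fun a => ?_⟩
    change θ (t ^ n * x * (a * y) + t ^ (i + j) * τ a) = _ * (List.map _ (u :: l)).sum
    rw [map_add, map_mul, map_mul, map_mul, map_mul, map_pow, map_pow, hn, ← hx, ← hy, List.map_cons,
      List.sum_cons, mul_add]
    change _ = _ + _ * listOp l (θ a)
    congr 1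
    · rw [← mul_assoc (θ a), ← hc j (θ a), mul_assoc _ (θ a), ← mul_assoc (_ * (_ * u.1)), ← mul_assoc (θ t ^ n),
        ← pow_add, mul_assoc _ u.1, ← hc j u.1, ← mul_assoc (θ t ^ (n + i)), ← pow_add]
      simp only [mul_assoc]
    · rw [← mul_assoc, ← pow_add]; congr 2; omega

theorem RingAway.exists_pow_mem_centralOps (h : RingAway θ t) (ht : ∀ (d : D) (n : ℕ), t ^ n * d = 0 → t * d = 0)
    (hD : HasAzumayaCert D') : ∃ n : ℕ, (mulLeft ℤ (t ^ n) : Module.End ℤ D) ∈ centralOps D := by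
  have hz : ∀ d : D, θ d = 0 → t * d = 0 := fun d hd => by
    obtain ⟨n, hn⟩ := h.ker d hd
    exact ht d n hn
  have hc : ∀ (m : ℕ) (d' : D'), θ t ^ m * d' = d' * θ t ^ m := fun m d' =>
    Commute.pow_left (h.central' d') m
  have key : ∀ l : List (D' × List (D' × D')), (∀ u ∈ l, ∀ a, listOp u.2 a ∈ Subring.center D') →
      ∃ (n : ℕ) (T : Module.End ℤ D), T ∈ centralOps D ∧
        ∀ a, θ (T a) = θ t ^ n * (l.map fun u => u.1 * listOp u.2 (θ a)).sum := by
    intro l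
    induction l with
    | nil => exact fun _ => ⟨0, 0, zero_mem _, fun a => by simp⟩
    | cons u l ih =>
      intro hl
      obtain ⟨n, T, hT, hn⟩ := ih fun v hv => hl v (List.mem_cons_of_mem _ hv)
      obtain ⟨i, b, hb⟩ := h.surj u.1
      obtain ⟨j, τ, hτ, hj⟩ := h.exists_multSubring u.2
      have hcen : ∀ a, (mulLeft ℤ t * τ : Module.End ℤ D) a ∈ Subring.center D := by
        intro a
        refine Subring.mem_center_iff.mpr fun d => sub_eq_zero.mp ?_
        change d * (t * τ a) - t * τ a * d = 0
        rw [← mul_assoc, ← h.central d, mul_assoc, mul_assoc, ← mul_sub]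
        refine hz _ ?_
        rw [map_sub, map_mul, map_mul, hj, sub_eq_zero, ← mul_assoc, ← hc, mul_assoc, mul_assoc,
          Subring.mem_center_iff.mp (hl u List.mem_cons_self (θ a))]
      refine ⟨n + i + j + 1, mulLeft ℤ (t ^ n * b) * (mulLeft ℤ t * τ) +
          mulLeft ℤ (t ^ (i + j + 1)) * T,
        add_mem (mulLeft_mul_mem_centralOps _ (mul_mem (mulLeft_mem _) hτ) hcen)
          (centralOps_mul_left hT (mulLeft_mem _)), fun a => ?_⟩
      change θ (t ^ n * b * (t * τ a) + t ^ (i + j + 1) * T a) = _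
      rw [map_add, map_mul, map_mul, map_mul, map_mul, map_pow, map_pow, hn, hj, ← hb, List.map_cons, List.sum_cons,
        mul_add]
      congr 1
      · rw [← mul_assoc (θ t), ← pow_succ', ← mul_assoc (_ * (_ * u.1)), ← mul_assoc (θ t ^ n), ← pow_add, mul_assoc _ u.1,
          ← hc (j + 1) u.1, ← mul_assoc (θ t ^ (n + i)), ← pow_add]
        simp only [mul_assoc, add_assoc]
      · rw [← mul_assoc, ← pow_add]; congr 2; omega
  obtain ⟨l, hl, h1⟩ := hasAzumayaCert_iff.mp hD
  obtain ⟨n, T, hT, hn⟩ := key l hl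
  refine ⟨n + 1, ?_⟩
  have : (mulLeft ℤ (t ^ (n + 1)) : Module.End ℤ D) = mulLeft ℤ t * T := by
    ext a
    refine sub_eq_zero.mp ?_
    change t ^ (n + 1) * a - t * T a = 0
    rw [pow_succ', mul_assoc, ← mul_sub]
    refine hz _ ?_
    rw [map_sub, hn, ← h1, map_mul, map_pow, sub_self]
  rw [this]
  exact centralOps_mul_left hT (mulLeft_mem _)

end Clearing

section Commutative

variable {k R A : Type u} [Field k] [CommRing R] [Algebra k R] [Ring A] [Algebra k A]
  {J : Type*} (O : OreData k R A J) (hO : O.m O.h = 0)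

include hO

lemma OreData.ι_commute_m (r : R) (g : MvPolynomial J k) : O.m g * O.ι r = O.ι r * O.m g := by
  induction g using MvPolynomial.induction_on with
  | C a => rw [← MvPolynomial.algebraMap_eq, commutes, Algebra.commutes]
  | add a b ha hb => rw [map_add, add_mul, ha, hb, mul_add]
  | mul_X a j ha => rw [map_mul, mul_assoc, O.rel, hO, mul_zero, add_zero, ← mul_assoc, ha, mul_assoc]

lemma OreData.ι_commute (r : R) (q : MvPolynomial J R) : O.op q * O.ι r = O.ι r * O.op q := by
  induction q using mv_induction k R with
  | mul s g => rw [O.op_C_mul_map, mul_assoc, O.ι_commute_m hO, ← mul_assoc, ← map_mul, mul_comm, map_mul, mul_assoc]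
  | add a b ha hb => rw [map_add, add_mul, ha, hb, mul_add]

lemma OreData.op_mul (q q' : MvPolynomial J R) : O.op (q * q') = O.op q * O.op q' := by
  induction q' using mv_induction k R with
  | mul s g =>
    rw [O.op_C_mul_map, mul_left_comm, O.op_C_mul, O.op_mul_map, ← mul_assoc, ← O.ι_commute hO, mul_assoc]
  | add a b ha hb => rw [mul_add, map_add, ha, hb, map_add, mul_add]

/-- The operators whose symbol has coefficients killed by a derivation. -/
def OreData.constants (d : Der k R) : Subring A where
  carrier := {a | ∃ q, O.op q = a ∧ coefDer d q = 0}
  mul_mem' := by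
    rintro _ _ ⟨q, rfl, h⟩ ⟨q', rfl, h'⟩
    exact ⟨q * q', O.op_mul hO q q', by rw [leibniz, h, h', smul_zero, smul_zero, add_zero]⟩
  one_mem' := ⟨1, by simpa using O.op_C 1, Derivation.map_one_eq_zero _⟩
  add_mem' := by
    rintro _ _ ⟨q, rfl, h⟩ ⟨q', rfl, h'⟩
    exact ⟨q + q', map_add _ _ _, by rw [map_add, h, h', add_zero]⟩
  zero_mem' := ⟨0, map_zero _, map_zero _⟩
  neg_mem' := by
    rintro _ ⟨q, rfl, h⟩
    exact ⟨-q, map_neg _ _, by rw [map_neg, h, neg_zero]⟩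

end Commutative

section

variable [Infinite k] {p : ℕ} [Fact p.Prime] [CharP k p] [PerfectRing k p]
  {R : Type u} [CommRing R] [Algebra k R] {L : Type u} [AddCommGroup L] [Module R L]
  [FiniteType k R] (S : InvSys R L) (hC : HasCharts k p R L) (c₀ h₀ : k)

include S hC in
lemma TDOSpec.eq_zero_of_charts (d : TDOSpec k R L c₀ h₀)
    (h : ∀ (f : R) (R' L' : Type u) [CommRing R'] [Algebra k R'] [AddCommGroup L'] [Module R' L']
      (ρ : R →ₐ[k] R') (σ : L →+ L') (H : IsRestr ρ σ), IsAway ρ f → Chart k p R' L' →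
        TDOSpec.map H S c₀ h₀ d = 0) : d = 0 := by
  obtain ⟨s, hs, hs'⟩ := hC
  refine TDOSpec.eq_zero_of_local c₀ h₀ p hs d fun f hf => ?_
  obtain ⟨R', _, _, L', _, _, ρ, σ, H, hρ, ⟨C⟩⟩ := hs' f hf
  exact (TDOSpec.ringAway H S c₀ h₀ p C hρ).ker d (h f R' L' ρ σ H hρ C)

omit [Infinite k] [FiniteType k R] in
lemma TDOSpec.map_fn {R' L' : Type u} [CommRing R'] [Algebra k R'] [AddCommGroup L'] [Module R' L']
    {ρ : R →ₐ[k] R'} {σ : L →+ L'} (H : IsRestr ρ σ) (r : R) :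
    TDOSpec.map H S c₀ h₀ (TDOSpec.fn k L c₀ h₀ r) = TDOSpec.fn k L' c₀ h₀ (ρ r) := by
  rw [TDOSpec.fn, AlgHom.comp_apply, TDOSpec.map_mk, TDOAlg.map_fn]
  rfl

lemma Chart.smul_eq_zero {R' L' A : Type u} [CommRing R'] [Algebra k R'] [AddCommGroup L'] [Module R' L']
    (C : Chart k p R' L') [Ring A] [Algebra k A] {J : Type} (O : OreData k R' A J) (hO : Bijective O.op)
    (g : R') (n : ℕ) (a : A) (h : O.ι (g ^ p) ^ n * a = 0) : O.ι (g ^ p) * a = 0 := by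
  obtain ⟨q, rfl⟩ := hO.2 a
  rw [← map_pow O.ι, ← O.op_C_mul] at h
  have h' := hO.1 (h.trans (map_zero _).symm)
  rw [← O.op_C_mul, ← map_zero O.op]
  congr 1
  have : IsReduced R' := ⟨fun x ⟨m, hm⟩ => by
    have hp := (Fact.out : p.Prime).one_lt
    have : ∀ j, x ^ p ^ j = 0 → x = 0 := fun j => by
      induction j with
      | zero => simp
      | succ j ih => exact fun hj => ih (C.red _ (by rwa [pow_succ, pow_mul] at hj))
    exact this m (pow_eq_zero_of_le (Nat.lt_pow_self hp).le hm)⟩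
  ext α
  have h2 := congrArg (MvPolynomial.coeff α) h'
  rw [MvPolynomial.coeff_C_mul, MvPolynomial.coeff_zero] at h2 ⊢
  refine pow_eq_zero_iff (n := n + 1) n.succ_ne_zero |>.mp ?_
  rw [mul_pow, pow_succ, pow_succ, mul_mul_mul_comm, ← pow_mul, mul_comm p]
  rw [← pow_mul, mul_comm p] at h2
  linear_combination (MvPolynomial.coeff α q ^ n * g ^ p) * h2

include S hC in
lemma TDOSpec.torsion (f : R) (n : ℕ) (d : TDOSpec k R L c₀ h₀)
    (h : TDOSpec.fn k L c₀ h₀ (f ^ p) ^ n * d = 0) : TDOSpec.fn k L c₀ h₀ (f ^ p) * d = 0 := by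
  refine TDOSpec.eq_zero_of_charts (p := p) S hC c₀ h₀ _ fun g R' L' _ _ _ _ ρ σ H hρ C => ?_
  have h1 := congrArg (TDOSpec.map H S c₀ h₀) h
  rw [map_mul, map_pow, TDOSpec.map_fn, map_zero, map_pow] at h1
  rw [map_mul, TDOSpec.map_fn, map_pow]
  exact C.smul_eq_zero (C.F.specOre c₀ h₀ C.X) (C.F.specOp_bijective c₀ h₀ C.X) (ρ f) n _ h1

include S hC in
theorem TDOSpec.hasAzumayaCert (hh₀ : h₀ ≠ 0) : HasAzumayaCert (TDOSpec k R L c₀ h₀) := by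
  obtain ⟨s, hs, h⟩ := id hC
  have := mem_of_local ((phiSpec S hC c₀ h₀).toRingHom.comp (ZSpec.fnHom k p L c₀ h₀))
    ((centralOps (TDOSpec k R L c₀ h₀)).comap (LinearMap.mul ℤ (TDOSpec k R L c₀ h₀)).toAddMonoidHom)
    (fun a x hx => ?_) s hs 1 fun f hf => ?_
  · change mulLeft ℤ (1 : TDOSpec k R L c₀ h₀) ∈ centralOps (TDOSpec k R L c₀ h₀) at this
    rwa [LinearMap.mulLeft_one] at this
  · change mulLeft ℤ (phiSpec S hC c₀ h₀ (ZSpec.fnHom k p L c₀ h₀ a) * x) ∈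
      centralOps (TDOSpec k R L c₀ h₀)
    rw [LinearMap.mulLeft_mul]
    exact centralOps_mul_left hx (mulLeft_mem _)
  · obtain ⟨R', _, _, L', _, _, ρ, σ, H, hρ, ⟨C⟩⟩ := h f hf
    have hp2 := (Fact.out : p.Prime).two_le
    obtain ⟨n, hn⟩ := (ringAway_phiSpec S hC c₀ h₀ H hρ C).exists_pow_mem_centralOps (fun d n => by
      rw [phiSpec_fnHom]; exact TDOSpec.torsion S hC c₀ h₀ f n d)
      (OreData.hasAzumayaCert (C.F.specOre c₀ h₀ C.X) p C.X.x (fun i j => C.X.der_x j i) C.const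
        (fun j r => C.X.der_iterate p hp2 j r) h₀ hh₀ rfl (C.F.specOp_bijective c₀ h₀ C.X))
    refine ⟨n, ?_⟩
    change mulLeft ℤ ((phiSpec S hC c₀ h₀ (ZSpec.fnHom k p L c₀ h₀ (f ^ n))) * 1) ∈
      centralOps (TDOSpec k R L c₀ h₀)
    rwa [mul_one, map_pow, map_pow]

theorem phiSpec_isAzumayaVia (hh₀ : h₀ ≠ 0) : IsAzumayaVia (phiSpec S hC c₀ h₀) :=
  isAzumayaVia_of_cert _ (phiSpec_isIsoOntoCenter S hC c₀ h₀ hh₀) (TDOSpec.hasAzumayaCert S hC c₀ h₀ hh₀)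

lemma Chart.specOre_zero {R' L' : Type u} [CommRing R'] [Algebra k R'] [AddCommGroup L'] [Module R' L']
    (C : Chart k p R' L') : (C.F.specOre c₀ 0 C.X).m (C.F.specOre c₀ 0 C.X).h = 0 := by
  rw [show (C.F.specOre c₀ 0 C.X).h = 0 from MvPolynomial.C_0, map_zero]

include S hC in
lemma TDOSpec.fn_central_of_hbar_zero (r : R) (d : TDOSpec k R L c₀ 0) :
    d * TDOSpec.fn k L c₀ 0 r = TDOSpec.fn k L c₀ 0 r * d := by
  refine sub_eq_zero.mp (TDOSpec.eq_zero_of_charts (p := p) S hC c₀ 0 _ fun g R' L' _ _ _ _ ρ σ H hρ C => ?_)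
  rw [map_sub, map_mul, map_mul, TDOSpec.map_fn, sub_eq_zero]
  obtain ⟨q, hq⟩ := (C.F.specOp_bijective c₀ 0 C.X).2 (TDOSpec.map H S c₀ 0 d)
  rw [← hq]
  exact (C.F.specOre c₀ 0 C.X).ι_commute (C.specOre_zero c₀) (ρ r) q

theorem phiSpec_not_isIsoOntoCenter {R' L' : Type u} [CommRing R'] [Algebra k R'] [AddCommGroup L'] [Module R' L']
    {ρ : R →ₐ[k] R'} {σ : L →+ L'} (H : IsRestr ρ σ) {f : R} (hf : IsAway ρ f) (C : Chart k p R' L')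
    [Nontrivial R'] (hn : C.n ≠ 0) : ¬ IsIsoOntoCenter (phiSpec S hC c₀ 0) := by
  intro hiso
  let i : Fin C.n := ⟨0, Nat.pos_of_ne_zero hn⟩
  let O := C.F.specOre c₀ 0 C.X
  have hO : O.m O.h = 0 := C.specOre_zero c₀
  have hbij := C.F.specOp_bijective c₀ 0 C.X
  obtain ⟨N, r, hr⟩ := hf.surj (C.X.x i)
  obtain ⟨z, hz⟩ : TDOSpec.fn k L c₀ 0 (f ^ (N * (p - 1)) * r) ∈ (phiSpec S hC c₀ 0).range := by
    rw [hiso.2]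
    exact mem_center_iff.mpr fun d => TDOSpec.fn_central_of_hbar_zero S hC c₀ _ d
  obtain ⟨z, rfl⟩ := Ideal.Quotient.mk_surjective z
  obtain ⟨D, ν₀, s₀, M, hD, hν, hs⟩ := exists_chart_lift H S hf C.X C.F p
  have hpw : ∀ g, O.ι (g ^ p) ∈ O.constants hO (C.X.der i) := fun g =>
    ⟨MvPolynomial.C (g ^ p), O.op_C _, by rw [coefDer_C, derivation_pow_p, map_zero]⟩
  let θ : ZAlg k p R L →+* TDOSpec k R' L' c₀ 0 :=
    (TDOSpec.map H S c₀ 0).toRingHom.comp ((phiSpec S hC c₀ 0).toRingHom.comp (Ideal.Quotient.mk _))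
  have hθ' : ∀ z, θ z = TDOSpec.map H S c₀ 0 (phiSpec S hC c₀ 0 (Ideal.Quotient.mk _ z)) := fun _ => rfl
  have hθ : ∀ r, θ (ZAlg.fn k p L r) = O.ι (ρ r ^ p) := map_phiSpec_fn S hC c₀ 0 H
  have hX : ∀ j, O.m (MvPolynomial.X j) ∈ O.constants hO (C.X.der i) := fun j =>
    ⟨MvPolynomial.X j, O.op_X j, coefDer_X _ j⟩
  have hk : ∀ a : k, algebraMap k (TDOSpec k R' L' c₀ 0) a ∈ O.constants hO (C.X.der i) := fun a =>
    ⟨MvPolynomial.C (algebraMap k R' a), by rw [O.op_C, commutes],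
      by rw [coefDer_C, Derivation.map_algebraMap, map_zero]⟩
  obtain ⟨N', hN'⟩ := ZAlg.exists_pow_mul_mem H S hf C.X C.F hD hν hs ((O.constants hO (C.X.der i)).comap θ)
    (fun r => by rw [Subring.mem_comap, hθ]; exact hpw _)
    (by
      rw [Subring.mem_comap, hθ', phiSpec_mk, phi_c, TDOSpec.mk_c, commutes]; exact hk _)
    (by
      rw [Subring.mem_comap, hθ', phiSpec_mk, phi_hbar, TDOSpec.mk_hbar, commutes]; exact hk _)
    (fun j => by
      rw [Subring.mem_comap, hθ', map_phiSpec_coord S hC c₀ 0 H hf C hD hν hs]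
      refine mul_mem (pow_mem ?_ _) (pow_mem (hX j) _)
      rw [map_phiSpec_fn]; exact hpw _) z
  obtain ⟨q, hq, hq'⟩ := hN'
  have hθz : θ z = O.ι (ρ f ^ (N * p) * C.X.x i) := by
    refine (hθ' z).trans ((congrArg _ hz).trans ((TDOSpec.map_fn S c₀ 0 H _).trans (congrArg O.ι ?_)))
    rw [map_mul, ← hr, ← mul_assoc, map_pow, ← pow_add]
    congr 2
    have := (Fact.out : p.Prime).one_le
    rw [← Nat.mul_succ]; congr 1; omega
  rw [map_mul, hθ, hθz, ← map_mul, ← O.op_C] at hq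
  rw [hbij.1 hq, coefDer_C, map_pow ρ, pow_mul (ρ f) N p, ← mul_assoc, ← mul_pow, leibniz, derivation_pow_p,
    C.X.der_self, smul_zero, add_zero, smul_eq_mul, mul_one] at hq'
  have h0 := MvPolynomial.C_injective _ _ (hq'.trans MvPolynomial.C_0.symm)
  exact ((((hf.isUnit.pow N').mul (hf.isUnit.pow N)).pow p).ne_zero h0)

end

section Naturality

variable {p : ℕ} [Fact p.Prime] [CharP k p] [PerfectRing k p]
  {R R' : Type u} [CommRing R] [Algebra k R] [CommRing R'] [Algebra k R']
  {L L' : Type u} [AddCommGroup L] [Module R L] [AddCommGroup L'] [Module R' L']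
  {ρ : R →ₐ[k] R'} {σ : L →+ L'} (H : IsRestr ρ σ)

lemma untwist_restr
    {μ : Dual (FrobTwist p R) (Ω[FrobTwist p R⁄k] ⊗[FrobTwist p R] FrobTwistMod p L)}
    {μ' : Dual (FrobTwist p R') (Ω[FrobTwist p R'⁄k] ⊗[FrobTwist p R'] FrobTwistMod p L')}
    (h : ∀ f s, μ' (D k _ (FrobTwist.map ρ p f) ⊗ₜ FrobTwistMod.map σ p s)
        = FrobTwist.map ρ p (μ (D k _ f ⊗ₜ s))) (l : L) :
    untwist μ' (σ l) = H.derExt.ext (untwist μ l) := by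
  refine DerExt.eq_ext _ fun a => ?_
  rw [untwist_apply, untwist_apply]
  exact congrArg (FrobTwist.of p R').symm (h (FrobTwist.of p R a) (FrobTwistMod.of p L l))

lemma contract_restr (ξ : Der k R) (ν : Dual R L) (f : FrobTwist p R) (s : FrobTwistMod p L) :
    contract (twistDer p (H.derExt.ext ξ)) (twistDual p (H.dualExt ν))
        (D k _ (FrobTwist.map ρ p f) ⊗ₜ FrobTwistMod.map σ p s) =
      FrobTwist.map ρ p (contract (twistDer p ξ) (twistDual p ν) (D k _ f ⊗ₜ s)) := by
  have h1 : ∀ {R L : Type u} [CommRing R] [Algebra k R] [AddCommGroup L] [Module R L] (ξ : Der k R)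
      (ν : Dual R L) f s, contract ξ ν (D k _ f ⊗ₜ s) = ξ f * ν s := by
    intro R L _ _ _ _ ξ ν f s
    simp [contract]
  rw [h1, h1, map_mul]
  exact congrArg₂ (· * ·) (DerExt.ext_apply H.derExt ξ _) (H.dualExt_apply ν _)

variable [Infinite k] [FiniteType k R] [FiniteType k R'] (S : InvSys R L) (S' : InvSys R' L')
  (hC : HasCharts k p R L) (hC' : HasCharts k p R' L')

include H in
theorem map_phi (z : ZAlg k p R L) (z' : ZAlg k p R' L') (h : (z, z') ∈ ZAlg.resGraph (k := k) ρ σ p) :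
    TDOAlg.map H S (phi S hC z) = phi S' hC' z' := by
  suffices ZAlg.resGraph (k := k) ρ σ p ≤ AlgHom.equalizer
      ((TDOAlg.map H S).comp ((phi S hC).comp (AlgHom.fst k (ZAlg k p R L) (ZAlg k p R' L'))))
      ((phi S' hC').comp (AlgHom.snd k (ZAlg k p R L) (ZAlg k p R' L'))) from this h
  refine Algebra.adjoin_le ?_
  rintro _ (⟨b, rfl⟩ | ⟨μ, μ', l, hμ, rfl⟩)
  · change TDOAlg.map H S (phi S hC (ConnAlg.ofBase _ _ _ _ _ b)) = phi S' hC' (ConnAlg.ofBase _ _ _ _ _ _)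
    induction b using MvPolynomial.induction_on with
    | C a =>
      rw [MvPolynomial.map_C]
      change TDOAlg.map H S (phi S hC (ZAlg.fn k p L ((FrobTwist.of p R).symm a))) =
        phi S' hC' (ZAlg.fn k p L' (ρ ((FrobTwist.of p R).symm a)))
      rw [phi_fn, phi_fn, TDOAlg.map_fn, map_pow ρ]
    | add a b ha hb => rw [map_add (ConnAlg.ofBase _ _ _ _ _), map_add (phi S hC), map_add (TDOAlg.map H S), ha, hb,
        map_add, map_add, map_add]
    | mul_X a i ha =>
      rw [map_mul (ConnAlg.ofBase _ _ _ _ _), map_mul (phi S hC), map_mul (TDOAlg.map H S), ha, map_mul (MvPolynomial.map _),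
        map_mul (ConnAlg.ofBase _ _ _ _ _), map_mul (phi S' hC'), MvPolynomial.map_X]
      refine congrArg₂ (· * ·) rfl ?_
      revert i
      refine Fin.forall_fin_two.mpr ⟨?_, ?_⟩
      · rw [← ZAlg.c, phi_c, TDOAlg.map_c, ← ZAlg.c, phi_c]
      · rw [← ZAlg.hbar, phi_hbar, TDOAlg.map_hbar, ← ZAlg.hbar, phi_hbar]
  · change TDOAlg.map H S (phi S hC (ConnAlg.coord _ _ _ _ _ μ l)) = phi S' hC' (ConnAlg.coord _ _ _ _ _ μ' _)
    rw [coord_eq_sum μ S, coord_eq_sum μ' (H.invSys S), map_sum, map_sum, map_sum]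
    refine sum_congr rfl fun j _ => ?_
    refine ((congrArg _ (phi_coord S hC _ _ _)).trans (map_conV S H S' hC hC' _ _ _)).trans ?_
    rw [← untwist_restr H hμ]
    exact (phi_coord S' hC' _ _ _).symm

include H S S' hC hC' in
theorem ZAlg.existsUnique_resGraph (z : ZAlg k p R L) :
    ∃! z' : ZAlg k p R' L', (z, z') ∈ ZAlg.resGraph (k := k) ρ σ p := by
  have hmem : ∀ z, z ∈ (ZAlg.resGraph (k := k) ρ σ p).toSubring.map (RingHom.fst (ZAlg k p R L) (ZAlg k p R' L')) := by
    have hb : ∀ b, ConnAlg.ofBase _ _ _ _ _ b ∈ (ZAlg.resGraph (k := k) ρ σ p).toSubring.map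
        (RingHom.fst (ZAlg k p R L) (ZAlg k p R' L')) :=
      fun b => ⟨_, subset_adjoin (Or.inl ⟨b, rfl⟩), rfl⟩
    refine ZAlg.mem_of_generators S _ (fun r => hb _) (hb _) (hb _) fun ξ ν l => ?_
    exact ⟨_, subset_adjoin (Or.inr ⟨_, _, _, contract_restr H ξ ν, rfl⟩), rfl⟩
  obtain ⟨⟨z₀, z'⟩, h, h₀⟩ := hmem z
  obtain rfl : z₀ = z := h₀
  refine ⟨z', h, fun z'' h'' => (phi_isIsoOntoCenter S' hC').1 ?_⟩
  rw [← map_phi H S S' hC hC' _ _ h, ← map_phi H S S' hC hC' _ _ h'']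

end Naturality

section Scale

variable [Infinite k] {p : ℕ} [Fact p.Prime] [CharP k p] [PerfectRing k p]
  {R : Type u} [CommRing R] [Algebra k R] {L : Type u} [AddCommGroup L] [Module R L]
  [FiniteType k R] (S : InvSys R L) (hC : HasCharts k p R L)

lemma ZAlg.scale_ofBase (lam : k) (b : MvPolynomial (Fin 2) (FrobTwist p R)) :
    ZAlg.scale p R L lam (ConnAlg.ofBase _ _ _ _ _ b) = MvPolynomial.aeval (R := FrobTwist p R)
        ![algebraMap k (ZAlg k p R L) lam * ZAlg.c k p R L,
          algebraMap k (ZAlg k p R L) lam * ZAlg.hbar k p R L] b := by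
  unfold ZAlg.scale
  dsimp only
  rw [AlgHom.coe_mk]
  rw [ConnAlg.lift_ofBase]
  rfl

lemma ZAlg.scale_coord' (lam : k) (μ) (l) :
    ZAlg.scale p R L lam (ConnAlg.coord _ _ _ _ _ μ l) = algebraMap k (ZAlg k p R L) lam ^ p * ConnAlg.coord _ _ _ _ _ μ l := by
  unfold ZAlg.scale
  dsimp only
  rw [AlgHom.coe_mk]
  rw [ConnAlg.lift_coord]

lemma ZAlg.scale_c (lam : k) : ZAlg.scale p R L lam (ZAlg.c k p R L) = lam • ZAlg.c k p R L := by
  rw [smul_def]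
  exact (ZAlg.scale_ofBase lam _).trans (MvPolynomial.aeval_X _ _)
lemma ZAlg.scale_hbar (lam : k) : ZAlg.scale p R L lam (ZAlg.hbar k p R L) = lam • ZAlg.hbar k p R L := by
  rw [smul_def]
  exact (ZAlg.scale_ofBase lam _).trans (MvPolynomial.aeval_X _ _)

lemma ZAlg.scale_fn (lam : k) (r : R) : ZAlg.scale p R L lam (ZAlg.fn k p L r) = ZAlg.fn k p L r :=
  (ZAlg.scale_ofBase lam _).trans (MvPolynomial.aeval_C _ _)

lemma ZAlg.scale_coord (lam : k) (ξ : Der k R) (ν : Dual R L) (l : L) :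
    ZAlg.scale p R L lam (ZAlg.coord p ξ ν l) = lam ^ p • ZAlg.coord p ξ ν l := by
  rw [smul_def, map_pow]
  exact ZAlg.scale_coord' _ _ _

lemma ZAlg.algHom_ext (S : InvSys R L) {B : Type u} [Ring B] [Algebra k B] {φ ψ : ZAlg k p R L →ₐ[k] B}
    (h1 : ∀ r, φ (ZAlg.fn k p L r) = ψ (ZAlg.fn k p L r)) (h2 : φ (ZAlg.c k p R L) = ψ (ZAlg.c k p R L))
    (h3 : φ (ZAlg.hbar k p R L) = ψ (ZAlg.hbar k p R L))
    (h4 : ∀ ξ ν l, φ (ZAlg.coord p ξ ν l) = ψ (ZAlg.coord p ξ ν l)) : φ = ψ :=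
  AlgHom.ext (ZAlg.mem_of_generators S (AlgHom.equalizer φ ψ).toSubring h1 h2 h3 h4)

include S in
lemma ZAlg.scale_scale {lam lam' : k} (h : lam * lam' = 1) (z : ZAlg k p R L) :
    ZAlg.scale p R L lam (ZAlg.scale p R L lam' z) = z := by
  have : (ZAlg.scale p R L lam).comp (ZAlg.scale p R L lam') = AlgHom.id k _ := by
    refine ZAlg.algHom_ext S (fun r => ?_) ?_ ?_ fun ξ ν l => ?_
    · rw [AlgHom.comp_apply, ZAlg.scale_fn, ZAlg.scale_fn, AlgHom.id_apply]
    · rw [AlgHom.comp_apply, ZAlg.scale_c, map_smul, ZAlg.scale_c, smul_smul, mul_comm lam' lam, h, one_smul, AlgHom.id_apply]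
    · rw [AlgHom.comp_apply, ZAlg.scale_hbar, map_smul, ZAlg.scale_hbar, smul_smul, mul_comm lam' lam, h, one_smul, AlgHom.id_apply]
    · rw [AlgHom.comp_apply, ZAlg.scale_coord, map_smul, ZAlg.scale_coord, smul_smul, ← mul_pow, mul_comm lam' lam, h, one_pow,
        one_smul, AlgHom.id_apply]
  exact AlgHom.congr_fun this z

lemma TDOAlg.coe_scale (lam : k) (d : TDOAlg k R L) :
    (TDOAlg.scale k R L lam d : TorsorOps k R L) = scaleHom lam (d : Polynomial _) := rfl

lemma scaleHom_C_mul_X_pow (lam : k) {A : Type u} [Ring A] [Algebra k A] (a : A) (n : ℕ) :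
    scaleHom lam (Polynomial.C a * Polynomial.X ^ n) = lam ^ n • (Polynomial.C a * Polynomial.X ^ n) := by
  ext m
  rw [coeff_scaleHom, Polynomial.coeff_smul, Polynomial.coeff_C_mul_X_pow]
  split_ifs with h
  · rw [h]
  · rw [smul_zero, smul_zero]

lemma TDOAlg.scale_of_eq (lam : k) (d : TDOAlg k R L) (a : CrysDiff k (TorsorRing R L)) (n : ℕ)
    (h : (d : TorsorOps k R L) = Polynomial.C a * Polynomial.X ^ n) :
    TDOAlg.scale k R L lam d = lam ^ n • d := by
  refine Subtype.ext ?_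
  rw [TDOAlg.coe_scale, h, scaleHom_C_mul_X_pow, ← h]
  rfl

lemma TDOAlg.scale_c (lam : k) : TDOAlg.scale k R L lam (TDOAlg.c k R L) = lam • TDOAlg.c k R L := by
  rw [TDOAlg.scale_of_eq lam (TDOAlg.c k R L) (vf k _ (euler R L k)) 1 (by rw [pow_one]; rfl), pow_one]

lemma TDOAlg.scale_hbar (lam : k) : TDOAlg.scale k R L lam (TDOAlg.hbar k R L) = lam • TDOAlg.hbar k R L := by
  rw [TDOAlg.scale_of_eq lam (TDOAlg.hbar k R L) 1 1 (by rw [pow_one, map_one, one_mul]; rfl), pow_one]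

lemma TDOAlg.scale_fn (lam : k) (r : R) : TDOAlg.scale k R L lam (TDOAlg.fn k L r) = TDOAlg.fn k L r := by
  rw [TDOAlg.scale_of_eq lam (TDOAlg.fn k L r) (CrysDiff.fn k _ (algebraMap R _ r)) 0 (by rw [pow_zero, mul_one]; rfl),
    pow_zero, one_smul]

lemma TDOAlg.scale_scale {lam lam' : k} (h : lam * lam' = 1) (d : TDOAlg k R L) :
    TDOAlg.scale k R L lam (TDOAlg.scale k R L lam' d) = d := by
  refine Subtype.ext (Polynomial.ext fun n => ?_)
  rw [TDOAlg.coe_scale, TDOAlg.coe_scale, coeff_scaleHom, coeff_scaleHom, smul_smul, ← mul_pow, h, one_pow, one_smul]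

theorem phi_scale (lam : k) (z : ZAlg k p R L) :
    phi S hC (ZAlg.scale p R L lam z) = TDOAlg.scale k R L lam (phi S hC z) := by
  have : (phi S hC).comp (ZAlg.scale p R L lam) = (TDOAlg.scale k R L lam).comp (phi S hC) := by
    refine ZAlg.algHom_ext S (fun r => ?_) ?_ ?_ fun ξ ν l => ?_
    · rw [AlgHom.comp_apply, AlgHom.comp_apply, ZAlg.scale_fn, phi_fn, TDOAlg.scale_fn]
    · rw [AlgHom.comp_apply, AlgHom.comp_apply, ZAlg.scale_c, map_smul, phi_c, TDOAlg.scale_c]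
    · rw [AlgHom.comp_apply, AlgHom.comp_apply, ZAlg.scale_hbar, map_smul, phi_hbar, TDOAlg.scale_hbar]
    · rw [AlgHom.comp_apply, AlgHom.comp_apply, ZAlg.scale_coord, map_smul, phi_coord, conV, map_add, map_mul, map_mul,
        TDOAlg.scale_fn, TDOAlg.scale_fn, TDOAlg.scale_of_eq lam _ _ p (TDOAlg.coe_pcurv _),
        TDOAlg.scale_of_eq lam _ _ p TDOAlg.coe_lam', smul_add, mul_smul_comm, smul_mul_assoc]
  exact AlgHom.congr_fun this z

omit [Infinite k] [FiniteType k R] in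
lemma ZSpec.mk_c (c₀ h₀ : k) : Ideal.Quotient.mkₐ k (ZAlg.fibreIdeal p R L c₀ h₀) (ZAlg.c k p R L) = algebraMap k _ c₀ :=
  Ideal.Quotient.eq.mpr (Ideal.subset_span (Or.inl rfl))

omit [Infinite k] [FiniteType k R] in
lemma ZSpec.mk_hbar (c₀ h₀ : k) :
    Ideal.Quotient.mkₐ k (ZAlg.fibreIdeal p R L c₀ h₀) (ZAlg.hbar k p R L) = algebraMap k _ h₀ :=
  Ideal.Quotient.eq.mpr (Ideal.subset_span (Or.inr rfl))

/-- The scaling action on the fibres of `Z`. -/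
def ZSpec.scale {lam c₀ h₀ c₁ h₁ : k} (hc : lam * c₁ = c₀) (hh : lam * h₁ = h₀) :
    ZSpec k p R L c₀ h₀ →ₐ[k] ZSpec k p R L c₁ h₁ :=
  Ideal.Quotient.liftₐ _ ((Ideal.Quotient.mkₐ k (ZAlg.fibreIdeal p R L c₁ h₁)).comp (ZAlg.scale p R L lam)) fun z hz => by
    refine (Ideal.span_le (I := RingHom.ker ((Ideal.Quotient.mkₐ k (ZAlg.fibreIdeal p R L c₁ h₁)).comp
      (ZAlg.scale p R L lam)))).mpr ?_ hz
    rintro _ (rfl | rfl) <;> rw [SetLike.mem_coe, RingHom.mem_ker, AlgHom.comp_apply]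
    · rw [map_sub, ZAlg.scale_c, commutes, map_sub, map_smul, ZSpec.mk_c, ← hc, commutes,
        smul_def, ← map_mul, sub_self]
    · rw [map_sub, ZAlg.scale_hbar, commutes, map_sub, map_smul, ZSpec.mk_hbar, ← hh, commutes,
        smul_def, ← map_mul, sub_self]

/-- The scaling action on the specializations. -/
def TDOSpec.scale {lam c₀ h₀ c₁ h₁ : k} (hc : lam * c₁ = c₀) (hh : lam * h₁ = h₀) :
    TDOSpec k R L c₀ h₀ →ₐ[k] TDOSpec k R L c₁ h₁ :=
  TDOSpec.lift ((TDOSpec.mk k R L c₁ h₁).comp (TDOAlg.scale k R L lam))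
    (by rw [AlgHom.comp_apply, TDOAlg.scale_c, map_smul, TDOSpec.mk_c, smul_def, ← map_mul (algebraMap k (TDOSpec k R L c₁ h₁)), hc])
    (by rw [AlgHom.comp_apply, TDOAlg.scale_hbar, map_smul, TDOSpec.mk_hbar, smul_def, ← map_mul (algebraMap k (TDOSpec k R L c₁ h₁)), hh])

theorem phiSpec_scale (c₀ h₀ : k) (lam : kˣ) :
    ∃ (E : TDOSpec k R L c₀ h₀ ≃ₐ[k] TDOSpec k R L (lam * c₀) (lam * h₀))
      (T : ZSpec k p R L c₀ h₀ ≃ₐ[k] ZSpec k p R L (lam * c₀) (lam * h₀)),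
      (∀ d, E (TDOSpec.mk k _ _ c₀ h₀ d) = TDOSpec.mk k _ _ _ _ (TDOAlg.scale k _ _ ((lam⁻¹ : kˣ) : k) d)) ∧
      (∀ z, T (Ideal.Quotient.mk _ z) = Ideal.Quotient.mk _ (ZAlg.scale p _ _ ((lam⁻¹ : kˣ) : k) z)) ∧
      ∀ z, phiSpec S hC _ _ (T z) = E (phiSpec S hC c₀ h₀ z) := by
  have h1 : ∀ c : k, ((lam⁻¹ : kˣ) : k) * (lam * c) = c := fun c => lam.inv_mul_cancel_left c
  have hE : ∀ d, TDOSpec.scale (R := R) (L := L) (h1 c₀) (h1 h₀) (TDOSpec.mk k R L c₀ h₀ d) =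
      TDOSpec.mk k R L _ _ (TDOAlg.scale k _ _ ((lam⁻¹ : kˣ) : k) d) := TDOSpec.lift_mk _ _ _
  have hE' : ∀ d, TDOSpec.scale (R := R) (L := L) (lam := (lam : k)) (c₁ := c₀) (h₁ := h₀) rfl rfl (TDOSpec.mk k R L _ _ d) =
      TDOSpec.mk k R L _ _ (TDOAlg.scale k _ _ (lam : k) d) := TDOSpec.lift_mk _ _ _
  refine ⟨AlgEquiv.ofAlgHom (TDOSpec.scale (h1 c₀) (h1 h₀)) (TDOSpec.scale (lam := (lam : k)) rfl rfl)
    (AlgHom.ext fun d => ?_) (AlgHom.ext fun d => ?_),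
    AlgEquiv.ofAlgHom (ZSpec.scale (h1 c₀) (h1 h₀)) (ZSpec.scale (lam := (lam : k)) rfl rfl)
    (AlgHom.ext fun z => ?_) (AlgHom.ext fun z => ?_), hE, fun z => rfl, fun z => ?_⟩
  · obtain ⟨d, rfl⟩ := TDOSpec.mk_surjective _ _ d
    rw [AlgHom.comp_apply, hE', hE, TDOAlg.scale_scale lam.inv_mul]; rfl
  · obtain ⟨d, rfl⟩ := TDOSpec.mk_surjective _ _ d
    rw [AlgHom.comp_apply, hE, hE', TDOAlg.scale_scale lam.mul_inv]; rfl
  · obtain ⟨z, rfl⟩ := Ideal.Quotient.mk_surjective z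
    exact congrArg (Ideal.Quotient.mk _) (ZAlg.scale_scale S lam.inv_mul z)
  · obtain ⟨z, rfl⟩ := Ideal.Quotient.mk_surjective z
    exact congrArg (Ideal.Quotient.mk _) (ZAlg.scale_scale S lam.mul_inv z)
  · obtain ⟨z, rfl⟩ := Ideal.Quotient.mk_surjective z
    exact (congrArg (TDOSpec.mk k R L _ _) (phi_scale S hC _ z)).trans (hE _).symm

end Scale

section FrameHom

variable {R : Type u} [CommRing R] [Algebra k R] {L : Type u} [AddCommGroup L] [Module R L]
  (F : LFrame R L)

lemma LFrame.eq_add_liftDer {a : TorsorDer k R L} {ξ : Der k R}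
    (h : ∀ r, a (algebraMap R _ r) = algebraMap R _ (ξ r)) (f : TorsorRing R L) (hf : a F.y = f * F.y) :
    a = f • euler R L k + liftDer F.invSys ξ := by
  have h1 := TorsorRing.eq_eulerCoef_smul F.invSys (a := a - liftDer F.invSys ξ) fun r => by
    rw [Derivation.sub_apply, h, liftDer_algebraMap, sub_self]
  have h2 := congrArg (fun d => d F.y * F.yinv) h1
  simp only [Derivation.sub_apply, F.liftDer_y, sub_zero, hf, Derivation.smul_apply, F.euler_y, smul_eq_mul,
    mul_assoc, F.y_mul_yinv, mul_one] at h2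
  rw [h2, ← h1, sub_add_cancel]

lemma LFrame.eq_liftDer {a : TorsorDer k R L} {ξ : Der k R}
    (h : ∀ r, a (algebraMap R _ r) = algebraMap R _ (ξ r)) (hf : a F.y = 0) : a = liftDer F.invSys ξ := by
  rw [F.eq_add_liftDer h 0 (by rw [hf, zero_mul]), zero_smul, zero_add]

lemma LFrame.liftDer_bracket (ξ η : Der k R) : liftDer F.invSys ⁅ξ, η⁆ =
    ⁅liftDer F.invSys ξ, liftDer F.invSys η⁆ :=
  (F.eq_liftDer (fun r => by simp [commutator_apply])
    (by simp [commutator_apply, F.liftDer_y])).symm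

lemma LFrame.liftDer_pPow (p : ℕ) [Fact p.Prime] [CharP k p] (ξ : Der k R) :
    liftDer F.invSys (pPow p ξ) = pPow p (liftDer F.invSys ξ) := by
  refine (F.eq_liftDer (fun r => ?_) ?_).symm
  · rw [pPow_apply, pPow_apply]
    exact ((Function.Semiconj.iterate_right (f := algebraMap R (TorsorRing R L)) (ga := ξ)
      (gb := liftDer F.invSys ξ) (fun r => (liftDer_algebraMap _ _ r).symm) p) r).symm
  · rw [pPow_apply, ← Nat.sub_add_cancel (Fact.out : p.Prime).one_le, Function.iterate_succ_apply, F.liftDer_y]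
    exact iterate_map_zero (liftDer F.invSys ξ) _

/-- The standard lift of a vector field as an element of `D_{c,ℏ,L}`. -/
def LFrame.lift (ξ : Der k R) : TDOAlg k R L := TDOAlg.ofInv (liftDer_isInvariant F.invSys ξ)

variable (c : k)

/-- Differential operators as twisted differential operators, in the trivialization given by a frame. -/
def LFrame.hom : CrysDiff k R →ₐ[k] TDOSpec k R L c 1 :=
  CrysDiff.lift (TDOSpec.fn k L c 1)
    (AddMonoidHom.mk' (fun ξ => TDOSpec.mk k R L c 1 (F.lift ξ)) fun ξ η => by
      rw [← map_add]
      congr 1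
      refine Subtype.ext ?_
      change hat _ = hat _ + hat _
      rw [TorsorRing.liftDer_add, hat, hat, hat, map_add, map_add, add_mul])
    (fun f ξ => by
      refine Eq.trans (congrArg (TDOSpec.mk k R L c 1) (Subtype.ext ?_)) (map_mul _ (TDOAlg.fn k L f) (F.lift ξ))
      change hat _ = fnT _ * hat _
      rw [TorsorRing.liftDer_smul, hat, hat, fnT, vf_smul, map_mul, mul_assoc]
      rfl)
    (fun ξ f => by
      have h : F.lift ξ * TDOAlg.fn k L f = TDOAlg.fn k L f * F.lift ξ + TDOAlg.fn k L (ξ f) * TDOAlg.hbar k R L :=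
        Subtype.ext (by
          refine (hat_mul_fnT (liftDer F.invSys ξ) (algebraMap R _ f)).trans ?_
          rw [liftDer_algebraMap]; rfl)
      have h' := congrArg (TDOSpec.mk k R L c 1) h
      rw [map_add, map_mul, map_mul, map_mul, TDOSpec.mk_hbar, map_one, mul_one] at h'
      exact h')
    (fun ξ η => by
      have h : F.lift ξ * F.lift η = F.lift η * F.lift ξ + F.lift ⁅ξ, η⁆ * TDOAlg.hbar k R L :=
        Subtype.ext (by
          refine (hat_mul_hat (liftDer F.invSys ξ) _).trans ?_
          rw [← LFrame.liftDer_bracket]; rfl)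
      have h' := congrArg (TDOSpec.mk k R L c 1) h
      rw [map_add, map_mul, map_mul, map_mul, TDOSpec.mk_hbar, map_one, mul_one] at h'
      exact h')

@[simp] lemma LFrame.hom_fn (f : R) : F.hom c (CrysDiff.fn k R f) = TDOSpec.fn k L c 1 f := CrysDiff.lift_fn _ _ _ _ _ f

@[simp] lemma LFrame.hom_vf (ξ : Der k R) : F.hom c (vf k R ξ) = TDOSpec.mk k R L c 1 (F.lift ξ) :=
  CrysDiff.lift_vf _ _ _ _ _ ξ

lemma LFrame.hom_bijective_of_coords [Infinite k] {I : Type} [Finite I] (X : Coords k R I) :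
    Bijective (F.hom c) := by
  have h : F.hom c ∘ X.frame.ore.op = (F.specOre c 1 X).op := by
    have hm : (F.hom c).comp X.frame.ore.m = (F.specOre c 1 X).m := MvPolynomial.algHom_ext fun i => by
      rw [AlgHom.comp_apply, CommFrame.ore_m_X, LFrame.specOre_m_X, LFrame.hom_vf]
      rfl
    funext q
    induction q using mv_induction k R with
    | mul r g =>
      rw [Function.comp_apply, OreData.op_C_mul_map, OreData.op_C_mul_map, map_mul]
      exact congrArg₂ (· * ·) (F.hom_fn c r) (AlgHom.congr_fun hm g)
    | add a b ha hb => rw [Function.comp_apply, map_add, map_add, map_add, ← ha, ← hb]; rfl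
  rw [← Bijective.of_comp_iff _ X.frame.op_bijective, h]
  exact F.specOp_bijective c 1 X

section Gluing

variable {R' : Type u} [CommRing R'] [Algebra k R'] {L' : Type u} [AddCommGroup L'] [Module R' L']
  {ρ : R →ₐ[k] R'} {σ : L →+ L'} (H : IsRestr ρ σ) (F' : LFrame R' L')

lemma LFrame.map_lift (h : R'ˣ) (hs : σ F.s = (h : R') • F'.s) (ξ : Der k R) :
    TDOAlg.map H F.invSys (F.lift ξ) = TDOAlg.fn k L' (H.derExt.ext ξ (h : R') * ((h⁻¹ : R'ˣ) : R')) * TDOAlg.c k R' L' +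
      F'.lift (H.derExt.ext ξ) := by
  have h1 : H.dualExt F.dual F'.s = ((h⁻¹ : R'ˣ) : R') := by
    have := H.dualExt_apply F.dual F.s
    rw [hs, map_smul, F.dual_s, map_one, smul_eq_mul] at this
    exact (Units.inv_eq_of_mul_eq_one_right this).symm
  refine Subtype.ext ((mapAlgHom_hat H F.invSys _).trans ?_)
  rw [TorsorRing.ext_liftDer, F'.eq_add_liftDer (ξ := H.derExt.ext ξ) (liftDer_algebraMap _ _)
    (algebraMap R' _ (H.derExt.ext ξ (h : R') * ((h⁻¹ : R'ˣ) : R'))), hat_smul_add]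
  · rfl
  · rw [y, TorsorRing.liftDer_cosec]
    refine (Fin.sum_univ_one _).trans ?_
    change algebraMap R' _ (H.derExt.ext ξ (F'.dual (σ F.s))) * TorsorRing.cosec R' L' (H.dualExt F.dual) = _
    rw [F'.cosec_eq, h1, hs, map_smul, F'.dual_s, smul_eq_mul, mul_one, map_mul, mul_assoc]
    rfl

theorem LFrame.mem_gluingGraph_iff (h : R'ˣ) (hs : σ F.s = (h : R') • F'.s) (hinj : Function.Injective (F'.hom (k := k) c))
    (x : CrysDiff k R) (y : CrysDiff k R') :
    (x, y) ∈ CrysDiff.gluingGraph ρ c h ↔ F'.hom c y = TDOSpec.map H F.invSys c 1 (F.hom c x) := by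
  have hle : CrysDiff.gluingGraph ρ c h ≤ AlgHom.equalizer ((F'.hom c).comp (AlgHom.snd k (CrysDiff k R) (CrysDiff k R')))
      ((TDOSpec.map H F.invSys c 1).comp ((F.hom c).comp (AlgHom.fst k (CrysDiff k R) (CrysDiff k R')))) := by
    refine Algebra.adjoin_le ?_
    rintro _ (⟨f, rfl⟩ | ⟨ξ, ξ', hξ, rfl⟩)
    · change F'.hom c (CrysDiff.fn k R' (ρ f)) = TDOSpec.map H F.invSys c 1 (F.hom c (CrysDiff.fn k R f))
      rw [F.hom_fn, F'.hom_fn, TDOSpec.map_fn]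
    · change F'.hom c (vf k R' ξ' + CrysDiff.fn k R' (c • (ξ' (h : R') * ((h⁻¹ : R'ˣ) : R')))) =
        TDOSpec.map H F.invSys c 1 (F.hom c (vf k R ξ))
      rw [F.hom_vf, TDOSpec.map_mk, map_add, F'.hom_fn, F'.hom_vf, F.map_lift H F' h hs, ← H.derExt.eq_ext hξ, map_add,
        map_mul, TDOSpec.mk_c, add_comm, map_smul, smul_def, Algebra.commutes]
      rfl
  refine ⟨fun hxy => hle hxy, fun hxy => ?_⟩
  obtain ⟨⟨x', y'⟩, h1, rfl⟩ : x ∈ (CrysDiff.gluingGraph ρ c h).map (AlgHom.fst k (CrysDiff k R) (CrysDiff k R')) := by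
    refine CrysDiff.mem_of_generators _ (fun f => ?_) (fun ξ => ?_) x
    · exact ⟨_, subset_adjoin (Or.inl ⟨f, rfl⟩), rfl⟩
    · exact ⟨_, subset_adjoin (Or.inr ⟨ξ, H.derExt.ext ξ, H.derExt.ext_apply ξ, rfl⟩), rfl⟩
  rwa [hinj (hxy.trans (hle h1).symm)]

lemma LFrame.hom_map (hs : σ F.s = F'.s) (x : CrysDiff k R) :
    F'.hom c (H.derExt.map x) = TDOSpec.map H F.invSys c 1 (F.hom c x) := by
  refine AlgHom.congr_fun (CrysDiff.algHom_ext (φ := (F'.hom c).comp H.derExt.map)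
    (ψ := (TDOSpec.map H F.invSys c 1).comp (F.hom c)) (fun f => ?_) fun ξ => ?_) x
  · rw [AlgHom.comp_apply, AlgHom.comp_apply, F.hom_fn, DerExt.map_fn, F'.hom_fn, TDOSpec.map_fn]
  · rw [AlgHom.comp_apply, AlgHom.comp_apply, F.hom_vf, DerExt.map_vf, F'.hom_vf, TDOSpec.map_mk,
      F.map_lift H F' 1 (by rw [Units.val_one, one_smul, hs]), Units.val_one, Derivation.map_one_eq_zero, zero_mul,
      map_zero, zero_mul, zero_add]

/-- The frame over a localization. -/
def LFrame.away (hf : ∃ f, IsAway ρ f) : LFrame R' L' where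
  s := σ F.s
  bij := by
    obtain ⟨f, hf⟩ := hf
    refine ⟨fun a b hab => ?_, fun l => ?_⟩
    · have := congrArg (H.dualExt F.dual) hab
      simpa [H.dualExt_apply, F.dual_s] using this
    · have : l ∈ Submodule.span R' {σ F.s} := by
        have h : Submodule.span R' (range σ) ≤ Submodule.span R' {σ F.s} := Submodule.span_le.mpr (by
          rintro _ ⟨l, rfl⟩
          rw [← F.dual_smul l, H.smul]
          exact Submodule.smul_mem _ _ (Submodule.mem_span_singleton_self _))
        exact h (H.span ▸ Submodule.mem_top)
      exact Submodule.mem_span_singleton.mp this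

end Gluing

variable [Infinite k] (p : ℕ) [Fact p.Prime] [CharP k p] [FiniteType k R]

theorem LFrame.hom_bijective [PerfectRing k p] (hC : HasCharts k p R L) : Bijective (F.hom (k := k) c) := by
  obtain ⟨s, hs, h⟩ := id hC
  constructor
  · rw [injective_iff_map_eq_zero]
    intro x hx
    refine TDO.eq_zero_of_local ((CrysDiff.fn k R).toRingHom.comp (frobHom k p R)) s hs x fun f hf => ?_
    obtain ⟨R', _, _, L', _, _, ρ, σ, H, hρ, ⟨C⟩⟩ := h f hf
    have h1 := F.hom_map c H (F.away H ⟨f, hρ⟩) rfl x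
    rw [hx, map_zero] at h1
    obtain ⟨n, hn⟩ := hρ.map_eq_zero p x (((F.away H ⟨f, hρ⟩).hom_bijective_of_coords c C.X).1 (h1.trans (map_zero _).symm))
    refine ⟨n, ?_⟩
    rw [← hn, map_pow, RingHom.comp_apply, frobHom_apply]
    rfl
  · intro d
    have := TDO.mem_of_local ((TDOSpec.fn k L c 1).toRingHom.comp (frobHom k p R)) (F.hom c).range.toSubring.toAddSubgroup
      (fun a x hx => ?_) s hs d fun f hf => ?_
    · exact this
    · exact mul_mem (S := Subalgebra k (TDOSpec k R L c 1)) ⟨CrysDiff.fn k R (a ^ p), F.hom_fn c _⟩ hx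
    · obtain ⟨R', _, _, L', _, _, ρ, σ, H, hρ, ⟨C⟩⟩ := h f hf
      obtain ⟨y', hy'⟩ := ((F.away H ⟨f, hρ⟩).hom_bijective_of_coords c C.X).2 (TDOSpec.map H F.invSys c 1 d)
      obtain ⟨n, y, hy⟩ := hρ.map_surj p y'
      have h1 := F.hom_map c H (F.away H ⟨f, hρ⟩) rfl y
      rw [← hy, map_mul, hy', map_pow, LFrame.hom_fn, ← map_pow ρ, ← TDOSpec.map_fn F.invSys c 1 H,
        ← map_pow (TDOSpec.map H F.invSys c 1), ← map_mul] at h1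
      obtain ⟨m, hm⟩ := (TDOSpec.ringAway H F.invSys c 1 p C hρ).exists_of_eq h1
      rw [← mul_assoc, ← pow_add] at hm
      refine ⟨m + n, CrysDiff.fn k R (f ^ p) ^ m * y, ?_⟩
      refine ((map_mul _ _ _).trans ?_).trans (hm.symm.trans ?_)
      · rw [map_pow]; exact congrArg (· ^ m * _) (F.hom_fn c _)
      · change _ = TDOSpec.fn k L c 1 (frobHom k p R (f ^ (m + n))) * d
        rw [map_pow (frobHom k p R), frobHom_apply, map_pow (TDOSpec.fn k L c 1) (f ^ p)]

theorem LFrame.eq_zero_of_map [PerfectRing k p] (hC : HasCharts k p R L) {R' L' : Type u} [CommRing R'] [Algebra k R']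
    [AddCommGroup L'] [Module R' L'] {ρ : R →ₐ[k] R'} {σ : L →+ L'} (H : IsRestr ρ σ) {f : R} (hf : IsAway ρ f)
    [FiniteType k R'] (hC' : HasCharts k p R' L') (d : TDOSpec k R L c 1) (hd : TDOSpec.map H F.invSys c 1 d = 0) :
    TDOSpec.fn k L c 1 (f ^ p) * d = 0 := by
  obtain ⟨x, rfl⟩ := (F.hom_bijective c p hC).2 d
  rw [← F.hom_map c H (F.away H ⟨f, hf⟩) rfl] at hd
  obtain ⟨n, hn⟩ := hf.map_eq_zero p x (((F.away H ⟨f, hf⟩).hom_bijective c p hC').1 (hd.trans (map_zero _).symm))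
  refine TDOSpec.torsion F.invSys hC c 1 f n _ ?_
  rw [← F.hom_fn, ← map_pow (F.hom c), ← map_mul, hn, map_zero]

end FrameHom

section Functoriality

variable {R R' R'' : Type u} [CommRing R] [Algebra k R] [CommRing R'] [Algebra k R']
  [CommRing R''] [Algebra k R''] {L L' L'' : Type u} [AddCommGroup L] [Module R L] [AddCommGroup L'] [Module R' L']
  [AddCommGroup L''] [Module R'' L''] {ρ : R →ₐ[k] R'} {σ : L →+ L'} (H : IsRestr ρ σ) {ρ' : R' →ₐ[k] R''}
  {σ' : L' →+ L''} (H' : IsRestr ρ' σ') {ρ'' : R →ₐ[k] R''} {σ'' : L →+ L''} (H'' : IsRestr ρ'' σ'')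
  (hρ : ∀ r, ρ'' r = ρ' (ρ r)) (hσ : ∀ l, σ'' l = σ' (σ l)) (S : InvSys R L) (S' : InvSys R' L')

include hρ hσ

lemma TorsorRing.map_map (x : TorsorRing R L) : map H'' x = map H' (map H x) := by
  refine RingHom.congr_fun (TorsorRing.ringHom_ext (f := (map H'').toRingHom)
    (g := (map H').toRingHom.comp (map H).toRingHom) (fun r => ?_) (fun l => ?_) fun ν => ?_) x
  · change map H'' _ = map H' (map H _)
    rw [map_algebraMap, map_algebraMap, map_algebraMap, hρ]
  · change map H'' _ = map H' (map H _)
    rw [map_sec, map_sec, map_sec, hσ]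
  · change map H'' _ = map H' (map H _)
    rw [map_cosec, map_cosec, map_cosec, H''.eq_dualExt (ν := ν) (ν' := H'.dualExt (H.dualExt ν)) fun l => by
      rw [hσ, IsRestr.dualExt_apply, IsRestr.dualExt_apply, hρ]]

lemma TDOAlg.map_map (d : TDOAlg k R L) : TDOAlg.map H'' S d = TDOAlg.map H' S' (TDOAlg.map H S d) := by
  refine Subtype.ext (Polynomial.ext fun n => ?_)
  rw [TDOAlg.coeff_map, TDOAlg.coeff_map, TDOAlg.coeff_map]
  refine AlgHom.congr_fun (CrysDiff.algHom_ext (φ := (TorsorRing.map_derExt H'' S).map)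
    (ψ := (TorsorRing.map_derExt H' S').map.comp (TorsorRing.map_derExt H S).map) (fun f => ?_) fun ξ => ?_) _
  · rw [AlgHom.comp_apply, DerExt.map_fn, DerExt.map_fn, DerExt.map_fn, TorsorRing.map_map H H' H'' hρ hσ]
  · rw [AlgHom.comp_apply, DerExt.map_vf, DerExt.map_vf, DerExt.map_vf]
    congr 1
    refine (DerExt.eq_ext _ fun a => ?_).symm
    rw [TorsorRing.map_map H H' H'' hρ hσ, DerExt.ext_apply, DerExt.ext_apply, TorsorRing.map_map H H' H'' hρ hσ]

lemma TDOSpec.map_map (c₀ h₀ : k) (d : TDOSpec k R L c₀ h₀) :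
    TDOSpec.map H'' S c₀ h₀ d = TDOSpec.map H' S' c₀ h₀ (TDOSpec.map H S c₀ h₀ d) := by
  obtain ⟨d, rfl⟩ := TDOSpec.mk_surjective _ _ d
  rw [TDOSpec.map_mk, TDOSpec.map_mk, TDOSpec.map_mk, TDOAlg.map_map H H' H'' hρ hσ S S']

end Functoriality

section ConnTwist

variable {p : ℕ} [Fact p.Prime] [CharP k p] [PerfectRing k p]
  {R : Type u} [CommRing R] [Algebra k R] {L : Type u} [AddCommGroup L] [Module R L] (c : k)

lemma ZSpec.mk_lam : Ideal.Quotient.mk (ZAlg.fibreIdeal p R L c 1) (ConnAlg.ofBase _ _ _ _ _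
    (MvPolynomial.X 0 ^ p - MvPolynomial.X 0 * MvPolynomial.X 1 ^ (p - 1))) = algebraMap k _ (c ^ p - c) := by
  have h1 := ZSpec.mk_c (p := p) (R := R) (L := L) c 1
  have h2 := ZSpec.mk_hbar (p := p) (R := R) (L := L) c 1
  rw [ZAlg.c, Ideal.Quotient.mkₐ_eq_mk] at h1
  rw [ZAlg.hbar, Ideal.Quotient.mkₐ_eq_mk] at h2
  rw [map_sub, map_mul, map_pow, map_pow, map_sub, map_mul, map_pow, map_pow, h1, h2, map_one, one_pow, mul_one,
    map_sub, map_pow]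

/-- Functions on `Conn_{c^p - c}(L⁽¹⁾)` as functions on the fibre of `Z` over `(c, 1)`. -/
def connRingHom : ConnTwist k p R L (c ^ p - c) →+* ZSpec k p R L c 1 :=
  ConnAlg.lift ((Ideal.Quotient.mk (ZAlg.fibreIdeal p R L c 1)).comp
      ((ConnAlg.ofBase _ _ _ _ _).comp MvPolynomial.C))
    (fun μ l => Ideal.Quotient.mk _ (ConnAlg.coord _ _ _ _ _ μ l))
    (fun μ μ' l => by rw [ConnAlg.coord_add_left, map_add])
    (fun f μ l => by rw [ConnAlg.coord_smul_left, map_mul]; rfl)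
    (fun μ l l' => by rw [ConnAlg.coord_add_right, map_add])
    (fun f μ l => by
      rw [ConnAlg.coord_smul_right, map_add, map_mul, map_mul (ConnAlg.ofBase _ _ _ _ _),
        map_mul (Ideal.Quotient.mk _), ZSpec.mk_lam, map_mul (RingHom.comp _ _)]
      rfl)

lemma connRingHom_ofBase (b : FrobTwist p R) : connRingHom (L := L) c (ConnAlg.ofBase _ _ _ _ _ b) =
    ZSpec.fnHom k p L c 1 ((FrobTwist.of p R).symm b) := by
  unfold connRingHom; rw [ConnAlg.lift_ofBase]; rfl

/-- `connRingHom` as a homomorphism of `k`-algebras. -/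
def connHom : ConnTwist k p R L (c ^ p - c) →ₐ[k] ZSpec k p R L c 1 :=
  AlgHom.mk (connRingHom c) fun a => connRingHom_ofBase c (algebraMap k (FrobTwist p R) a)

lemma connHom_ofBase (b : FrobTwist p R) : connHom (L := L) c (ConnAlg.ofBase _ _ _ _ _ b) =
    ZSpec.fnHom k p L c 1 ((FrobTwist.of p R).symm b) :=
  connRingHom_ofBase c b

lemma connHom_coord (μ) (l : FrobTwistMod p L) : connHom (R := R) c (ConnAlg.coord _ _ _ _ _ μ l) =
    Ideal.Quotient.mk (ZAlg.fibreIdeal p R L c 1) (ConnAlg.coord _ _ _ _ _ μ l) := by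
  change connRingHom c _ = _
  unfold connRingHom; rw [ConnAlg.lift_coord]

theorem connHom_bijective (S : InvSys R L) : Bijective (connHom (p := p) (R := R) (L := L) c) := by
  constructor
  · let A := ConnTwist k p R L (c ^ p - c)
    let g : MvPolynomial (Fin 2) (FrobTwist p R) →+* A :=
      MvPolynomial.eval₂Hom (ConnAlg.ofBase _ _ _ _ _) ![algebraMap k A c, 1]
    have hg : ∀ b, g (MvPolynomial.C b) = ConnAlg.ofBase _ _ _ _ _ b := fun b => MvPolynomial.eval₂Hom_C _ _ b
    have hg0 : g (MvPolynomial.X 0) = algebraMap k A c := MvPolynomial.eval₂Hom_X' _ _ _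
    have hg1 : g (MvPolynomial.X 1) = 1 := MvPolynomial.eval₂Hom_X' _ _ _
    have hk : ∀ a : k, ConnAlg.ofBase _ _ _ _ _ (algebraMap k (FrobTwist p R) a) = algebraMap k A a := fun a => rfl
    have hlam : g (MvPolynomial.X 0 ^ p - MvPolynomial.X 0 * MvPolynomial.X 1 ^ (p - 1)) =
        algebraMap k A (c ^ p - c) := by
      rw [map_sub g, map_mul g, map_pow g, map_pow g, hg0, hg1, one_pow, mul_one, map_sub (algebraMap k A),
        map_pow (algebraMap k A)]
    let r₀ : ZAlg k p R L →+* A := ConnAlg.lift g (fun μ l => ConnAlg.coord _ _ _ _ _ μ l)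
      (fun μ μ' l => ConnAlg.coord_add_left _ _ _ _ _ μ μ' l)
      (fun f μ l => by rw [ConnAlg.coord_smul_left, MvPolynomial.algebraMap_eq, hg]; rfl)
      (fun μ l l' => ConnAlg.coord_add_right _ _ _ _ _ μ l l')
      (fun f μ l => by
        rw [ConnAlg.coord_smul_right, MvPolynomial.algebraMap_eq, hg, map_mul g, hlam, hg,
          map_mul (ConnAlg.ofBase _ _ _ _ _), hk]; rfl)
    have hb : ∀ b, r₀ (ConnAlg.ofBase _ _ _ _ _ b) = g b := fun b => ConnAlg.lift_ofBase _ _ _ _ _ _ b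
    have hco : ∀ μ l, r₀ (ConnAlg.coord _ _ _ _ _ μ l) = ConnAlg.coord _ _ _ _ _ μ l := fun μ l =>
      ConnAlg.lift_coord _ _ _ _ _ _ μ l
    have hr : ∀ z ∈ ZAlg.fibreIdeal p R L c 1, r₀ z = 0 := fun z hz => by
      have h : ∀ a : k, r₀ (algebraMap k _ a) = algebraMap k A a := fun a =>
        (hb (MvPolynomial.C (algebraMap k (FrobTwist p R) a))).trans (hg _)
      refine (Ideal.span_le (I := RingHom.ker r₀)).mpr ?_ hz
      rintro _ (rfl | rfl) <;> rw [SetLike.mem_coe, RingHom.mem_ker, map_sub, h, sub_eq_zero]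
      · exact (hb _).trans hg0
      · rw [map_one]; exact (hb _).trans hg1
    refine Function.LeftInverse.injective (g := Ideal.Quotient.lift _ r₀ hr) fun z => ?_
    refine RingHom.congr_fun (ConnAlg.ringHom_ext (g := (Ideal.Quotient.lift _ r₀ hr).comp (connHom c).toRingHom)
      (g' := RingHom.id A) (fun b => ?_) fun μ l => ?_) z
    · change Ideal.Quotient.lift _ r₀ hr (connHom c (ConnAlg.ofBase _ _ _ _ _ b)) = _
      rw [connHom_ofBase]
      exact (hb (MvPolynomial.C b)).trans (hg b)
    · change Ideal.Quotient.lift _ r₀ hr (connHom c (ConnAlg.coord _ _ _ _ _ μ l)) = _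
      rw [connHom_coord]
      exact hco μ l
  · intro z
    obtain ⟨z, rfl⟩ := Ideal.Quotient.mk_surjective z
    have hk : ∀ a : k, algebraMap k (ZSpec k p R L c 1) a ∈ (connHom (p := p) (R := R) (L := L) c).range := fun a =>
      Subalgebra.algebraMap_mem _ a
    exact ZAlg.mem_of_generators S ((connHom (p := p) (R := R) (L := L) c).range.toSubring.comap (Ideal.Quotient.mk _))
      (fun r => ⟨_, connHom_ofBase c (FrobTwist.of p R r)⟩)
      (by have := hk c; rw [← ZSpec.mk_c c 1] at this; exact this)
      (by have := hk 1; rw [← ZSpec.mk_hbar c 1] at this; exact this)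
      (fun ξ ν l => ⟨_, connHom_coord c _ _⟩) z

lemma exists_resGraph {R' L' : Type u} [CommRing R'] [Algebra k R'] [AddCommGroup L'] [Module R' L'] {ρ : R →ₐ[k] R'}
    {σ : L →+ L'} (z : ConnTwist k p R L (c ^ p - c)) (z' : ConnTwist k p R' L' (c ^ p - c))
    (h : (z, z') ∈ ConnTwist.resGraph (k := k) ρ σ p (c ^ p - c)) :
    ∃ w w', (w, w') ∈ ZAlg.resGraph (k := k) ρ σ p ∧ Ideal.Quotient.mk _ w = connHom c z ∧
      Ideal.Quotient.mk _ w' = connHom c z' := by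
  let q := (Ideal.Quotient.mkₐ k (ZAlg.fibreIdeal p R L c 1)).prodMap (Ideal.Quotient.mkₐ k (ZAlg.fibreIdeal p R' L' c 1))
  have hle : ConnTwist.resGraph (k := k) ρ σ p (c ^ p - c) ≤
      ((ZAlg.resGraph (k := k) ρ σ p).map q).comap ((connHom c).prodMap (connHom c)) := by
    refine Algebra.adjoin_le ?_
    rintro _ (⟨b, rfl⟩ | ⟨μ, μ', l, hμ, rfl⟩)
    · refine ⟨_, subset_adjoin (Or.inl ⟨MvPolynomial.C b, rfl⟩), Prod.ext (connHom_ofBase c b).symm ?_⟩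
      refine Eq.trans ?_ (connHom_ofBase c _).symm
      change Ideal.Quotient.mk _ (ConnAlg.ofBase _ _ _ _ _ (MvPolynomial.map _ (MvPolynomial.C b))) = _
      rw [MvPolynomial.map_C]
      rfl
    · exact ⟨_, subset_adjoin (Or.inr ⟨μ, μ', l, hμ, rfl⟩),
        Prod.ext (connHom_coord c _ _).symm (connHom_coord c _ _).symm⟩
  obtain ⟨⟨w, w'⟩, hw, he⟩ := hle h
  exact ⟨w, w', hw, congrArg Prod.fst he, congrArg Prod.snd he⟩

variable [Infinite k] [FiniteType k R] (S : InvSys R L) (hC : HasCharts k p R L)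

/-- The canonical map from functions on `Conn_{c^p - c}(L⁽¹⁾)`. -/
def psi : ConnTwist k p R L (c ^ p - c) →ₐ[k] TDOSpec k R L c 1 := (phiSpec S hC c 1).comp (connHom c)

lemma psi_ofBase (f : R) :
    psi c S hC (ConnAlg.ofBase _ _ _ _ _ (FrobTwist.of p R f)) = TDOSpec.fn k L c 1 (f ^ p) := by
  rw [psi, AlgHom.comp_apply, connHom_ofBase, phiSpec_fnHom]
  rfl

lemma psi_frame (F : LFrame R L) (ξ : Der k R) (ν : Dual R L) :
    psi c S hC (ConnAlg.coord _ _ _ _ _ (contract (twistDer p ξ) (twistDual p ν)) (FrobTwistMod.of p L F.s)) =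
      F.hom c (CrysDiff.fn k _ (ν F.s) ^ p * (vf k _ ξ ^ p - vf k _ (pPow p ξ))) := by
  have h : conV p S ξ ν F.s = TDOAlg.fn k L (ν F.s) ^ p *
      (F.lift ξ ^ p - TDOAlg.hbar k R L ^ (p - 1) * F.lift (pPow p ξ)) := by
    refine Subtype.ext ((coe_conV S hC ξ ν F.s _ (liftDer_algebraMap F.invSys ξ)).trans ?_)
    have h0 : liftDer F.invSys ξ (TorsorRing.sec R L F.s) = 0 := by
      rw [TorsorRing.liftDer_sec]
      refine (Fin.sum_univ_one _).trans ?_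
      change algebraMap R _ (ξ (F.dual F.s)) * _ = 0
      rw [F.dual_s, Derivation.map_one_eq_zero, map_zero, zero_mul]
    rw [h0, mul_zero, fnT, fnT, map_zero, map_zero, zero_pow (Fact.out : p.Prime).ne_zero, mul_zero, add_zero,
      ← F.liftDer_pPow]
    rfl
  rw [psi, AlgHom.comp_apply, connHom_coord, phiSpec_mk]
  refine (congrArg _ ((phi_coord S hC ξ ν F.s).trans h)).trans ?_
  simp only [map_mul, map_sub, map_pow, TDOSpec.mk_hbar, map_one, one_pow, one_mul, LFrame.hom_fn, LFrame.hom_vf]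
  rfl

lemma psi_restr {R' L' : Type u} [CommRing R'] [Algebra k R'] [AddCommGroup L'] [Module R' L'] {ρ : R →ₐ[k] R'}
    {σ : L →+ L'} (H : IsRestr ρ σ) [FiniteType k R'] (S' : InvSys R' L') (hC' : HasCharts k p R' L')
    (z : ConnTwist k p R L (c ^ p - c)) (z' : ConnTwist k p R' L' (c ^ p - c))
    (h : (z, z') ∈ ConnTwist.resGraph (k := k) ρ σ p (c ^ p - c)) :
    TDOSpec.map H S c 1 (psi c S hC z) = psi c S' hC' z' := by
  obtain ⟨w, w', hw, h1, h2⟩ := exists_resGraph c z z' h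
  rw [psi, psi, AlgHom.comp_apply, AlgHom.comp_apply, ← h1, ← h2, phiSpec_mk, phiSpec_mk, TDOSpec.map_mk,
    map_phi H S S' hC hC' w w' hw]

theorem psi_isIsoOntoCenter {D : Type u} [Ring D] [Algebra k D] (E : TDOSpec k R L c 1 ≃ₐ[k] D) :
    IsIsoOntoCenter ((E : TDOSpec k R L c 1 →ₐ[k] D).comp (psi c S hC)) := by
  have h1 := connHom_bijective (p := p) c S
  have h2 := phiSpec_isIsoOntoCenter S hC c 1 one_ne_zero
  refine ⟨E.injective.comp (h2.1.comp h1.1), ?_⟩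
  ext d
  constructor
  · rintro ⟨z, rfl⟩
    refine mem_center_iff.mpr fun d => ?_
    obtain ⟨d, rfl⟩ := E.surjective d
    change E d * E (psi c S hC z) = E (psi c S hC z) * E d
    rw [← map_mul, ← map_mul]
    exact congrArg E (phiSpec_central S hC c 1 _ d).symm
  · intro hd
    obtain ⟨d, rfl⟩ := E.surjective d
    have : d ∈ (phiSpec S hC c 1).range := by
      rw [h2.2]
      refine mem_center_iff.mpr fun d' => E.injective ?_
      rw [map_mul, map_mul]
      exact mem_center_iff.mp hd (E d')
    obtain ⟨w, rfl⟩ := this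
    obtain ⟨z, rfl⟩ := h1.2 w
    exact ⟨z, rfl⟩

theorem psi_isAzumayaVia {D : Type u} [Ring D] [Algebra k D] (E : TDOSpec k R L c 1 ≃ₐ[k] D) :
    IsAzumayaVia ((E : TDOSpec k R L c 1 →ₐ[k] D).comp (psi c S hC)) :=
  isAzumayaVia_of_cert _ (psi_isIsoOntoCenter c S hC E)
    ((TDOSpec.hasAzumayaCert S hC c 1 one_ne_zero).ofEquiv (E : TDOSpec k R L c 1 ≃+* D))

end ConnTwist

section StandardSmooth

variable {R : Type u} [CommRing R] [Algebra k R]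

lemma isReduced_of_etale_mvPolynomial {n : ℕ} (g : MvPolynomial (Fin n) k →+* R) (hg : g.Etale) : IsReduced R := by
  algebraize [g]
  let K := FractionRing (MvPolynomial (Fin n) k)
  have : IsReduced (K ⊗[MvPolynomial (Fin n) k] R) := Algebra.FormallyUnramified.isReduced_of_field K _
  have : Module.Flat (MvPolynomial (Fin n) k) R := inferInstance
  have hinj : Function.Injective (Algebra.TensorProduct.includeRight : R →ₐ[MvPolynomial (Fin n) k] K ⊗[_] R) :=
    Algebra.TensorProduct.includeRight_injective (IsFractionRing.injective (MvPolynomial (Fin n) k) K)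
  exact isReduced_of_injective _ hinj

theorem Chart.nonempty_of_isStandardSmooth (p : ℕ) [Fact p.Prime] [CharP k p] [PerfectRing k p] {L : Type u}
    [AddCommGroup L] [Module R L] [h : Algebra.IsStandardSmooth k R] (F : LFrame R L) : Nonempty (Chart k p R L) := by
  classical
  obtain ⟨n, g, -, hg⟩ := (RingHom.isStandardSmooth_algebraMap.mpr h).exists_etale_mvPolynomial
  have := isReduced_of_etale_mvPolynomial g hg
  obtain ⟨ι, σ, _, _, ⟨P⟩⟩ := h.out
  let e := Finite.equivFin ((range P.map)ᶜ : Set ι)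
  obtain ⟨b, hb⟩ : ∃ b : Module.Basis (Fin _) R (Ω[R⁄k]), ∀ i, b i = D k R (P.val (e.symm i)) :=
    ⟨P.basisKaehler.reindex e, fun i => (P.basisKaehler.reindex_apply e i).trans (P.basisKaehler_apply _)⟩
  have hc : ∀ i j, b.coord i (D k R (P.val (e.symm j))) = if j = i then 1 else 0 := fun i j => by
    rw [← hb, b.coord_apply, b.repr_self, Finsupp.single_apply]
  let X : Coords k R (Fin _) :=
    { x := fun i => P.val (e.symm i)
      der := fun i => (b.coord i).compDer (D k R)
      der_self := fun i => (hc i i).trans (if_pos rfl)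
      der_ne := fun i j hij => (hc i j).trans (if_neg hij.symm)
      ext_zero := fun ξ hξ => by
        have : ξ.liftKaehlerDifferential = 0 := b.ext fun i => by
          rw [hb, ξ.liftKaehlerDifferential_comp_D, hξ, LinearMap.zero_apply]
        rw [← ξ.liftKaehlerDifferential_comp, this]
        exact Derivation.ext fun _ => rfl }
  exact ⟨⟨_, X, F, fun r hr => pow_eq_zero_iff (Fact.out : p.Prime).ne_zero |>.mp hr,
    fun r hr => exists_pow_eq_of_constant k p X.x
      (by rw [← b.span_eq]; exact congrArg _ (congrArg _ (funext fun i => (hb i).symm))) X.der X.der_self X.der_ne r hr⟩⟩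

end StandardSmooth

section Functions

variable {X : Scheme.{u}} [X.Over (Spec (.of k))]

lemma res_res {U V W : X.Opens} (h : V ≤ U) (h' : W ≤ V) (f : Γ(X, U)) :
    res (k := k) h' (res (k := k) h f) = res (k := k) (h'.trans h) f := by
  change (X.presheaf.map _).hom ((X.presheaf.map _).hom f) = (X.presheaf.map _).hom f
  rw [← CommRingCat.comp_apply, ← Functor.map_comp]
  rfl

lemma res_self {U : X.Opens} (f : Γ(X, U)) : res (k := k) le_rfl f = f := by
  change (X.presheaf.map (𝟙 _)).hom f = f
  rw [X.presheaf.map_id]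
  rfl

lemma isAway_res {U V : X.Opens} (hU : IsAffineOpen U) (f : Γ(X, U)) (h : V ≤ U) (hV : V = X.basicOpen f) :
    IsAway (res (k := k) h) f := by
  algebraize [(res (k := k) h).toRingHom]
  have : IsScalarTower k Γ(X, U) Γ(X, V) := .of_algebraMap_eq fun a => ((res (k := k) h).commutes a).symm
  have : @IsLocalization.Away _ _ f Γ(X, V) _ (res (k := k) h).toRingHom.toAlgebra :=
    hU.isLocalization_of_eq_basicOpen f (homOfLE h) hV
  exact isAway_of_isLocalization (k := k) (A' := Γ(X, V)) f

lemma formallyEtale_res {U V : X.Opens} (hU : IsAffineOpen U) (hV : IsAffineOpen V) (h : V ≤ U) :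
    (res (k := k) h).toRingHom.FormallyEtale := by
  have := HasRingHomProperty.appLE @Etale (𝟙 X) inferInstance ⟨U, hU⟩ ⟨V, hV⟩ h
  have e : (Scheme.Hom.appLE (𝟙 X) U V h).hom = (res (k := k) h).toRingHom := by
    ext f
    rfl
  rw [e] at this
  exact this.formallyEtale

variable (k) in
lemma smooth_sections [Smooth (X ↘ Spec (.of k))] {U : X.Opens} (hU : IsAffineOpen U) : Algebra.Smooth k Γ(X, U) := by
  have := HasRingHomProperty.appLE @Smooth (X ↘ Spec (.of k)) inferInstance ⟨⊤, isAffineOpen_top _⟩ ⟨U, hU⟩ le_top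
  have e : algebraMap k Γ(X, U) = (Scheme.Hom.appLE (X ↘ Spec (.of k)) ⊤ U le_top).hom.comp
      (Scheme.ΓSpecIso (.of k)).inv.hom := rfl
  have h2 : (algebraMap k Γ(X, U)).Smooth := by
    rw [e]
    exact RingHom.Smooth.propertyIsLocal.respectsIso.2 (Scheme.Hom.appLE (X ↘ Spec (.of k)) ⊤ U le_top).hom (Scheme.ΓSpecIso (.of k)).symm.commRingCatIsoToRingEquiv this
  exact RingHom.smooth_algebraMap.mp h2

end Functions

section Modules

variable {X : Scheme.{u}} [X.Over (Spec (.of k))] (L : X.Modules)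

lemma resMod_resMod {U V W : X.Opens} (h : V ≤ U) (h' : W ≤ V) (m : Γ(L, U)) :
    resMod L h' (resMod L h m) = resMod L (h'.trans h) m := by
  change (L.presheaf.map _).hom ((L.presheaf.map _).hom m) = (L.presheaf.map _).hom m
  rw [← AddCommGrpCat.comp_apply, ← Functor.map_comp]
  rfl

lemma resMod_self {U : X.Opens} (m : Γ(L, U)) : resMod L le_rfl m = m := by
  change (L.presheaf.map (𝟙 _)).hom m = m
  rw [L.presheaf.map_id]
  rfl

variable (k) in
lemma resMod_smul {U V : X.Opens} (h : V ≤ U) (f : Γ(X, U)) (m : Γ(L, U)) :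
    resMod L h (f • m) = res (k := k) h f • resMod L h m :=
  L.map_smul (homOfLE h) f m

lemma eq_of_locally {ι : Type*} {U : X.Opens} (W : ι → X.Opens) (hW : ∀ i, W i ≤ U) (hU : U ≤ iSup W) (m m' : Γ(L, U))
    (h : ∀ i, resMod L (hW i) m = resMod L (hW i) m') : m = m' :=
  TopCat.Sheaf.eq_of_locally_eq' ⟨L.presheaf, L.isSheaf⟩ W U (fun i => homOfLE (hW i)) hU m m' h

lemma exists_glue {ι : Type u} {U : X.Opens} (W : ι → X.Opens) (hW : ∀ i, W i ≤ U) (hU : U ≤ iSup W)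
    (m : ∀ i, Γ(L, W i)) (h : ∀ i j, resMod L (inf_le_left : W i ⊓ W j ≤ W i) (m i) =
      resMod L (inf_le_right : W i ⊓ W j ≤ W j) (m j)) : ∃ s : Γ(L, U), ∀ i, resMod L (hW i) s = m i :=
  (TopCat.Sheaf.existsUnique_gluing' ⟨L.presheaf, L.isSheaf⟩ W U (fun i => homOfLE (hW i)) hU m h).exists

variable {L}

lemma IsFrame.restrict {U V : X.Opens} {s : Γ(L, U)} (hs : IsFrame L s) (h : V ≤ U) : IsFrame L (resMod L h s) :=
  fun W h' => by
    rw [resMod_resMod]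
    exact hs W (h'.trans h)

/-- A frame of `L` over `U` as a frame of the module of sections. -/
def IsFrame.toLFrame {U : X.Opens} {s : Γ(L, U)} (hs : IsFrame L s) : LFrame Γ(X, U) Γ(L, U) where
  s := s
  bij := by
    have := hs U le_rfl
    rwa [resMod_self] at this

end Modules

section LineBundle

lemma exists_uniform {ι : Type*} [Finite ι] {P : ι → ℕ → Prop} (hP : ∀ i m n, P i m → P i (n + m))
    (h : ∀ i, ∃ n, P i n) : ∃ n, ∀ i, P i n := by
  choose n hn using h
  obtain ⟨N, hN⟩ := Finite.exists_le n
  exact ⟨N, fun i => by have := hP i _ (N - n i) (hn i); rwa [Nat.sub_add_cancel (hN i)] at this⟩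

variable {X : Scheme.{u}} [X.Over (Spec (.of k))] {L : X.Modules}

variable (k) in
include k in
lemma resMod_pow_smul {U V : X.Opens} (h : V ≤ U) (f : Γ(X, U)) (n : ℕ) (m : Γ(L, U)) :
    resMod L h (f ^ n • m) = res (k := k) h f ^ n • resMod L h m := by
  rw [resMod_smul k, map_pow]

lemma basicOpen_res' {U V : X.Opens} (h : V ≤ U) (f : Γ(X, U)) :
    X.basicOpen (res (k := k) h f) = V ⊓ X.basicOpen f := X.basicOpen_res f (homOfLE h).op

include k in
lemma IsFrame.exists_pow_smul_eq_zero {U V : X.Opens} (hU : IsAffineOpen U) {s : Γ(L, U)} (hs : IsFrame L s) (f : Γ(X, U))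
    (h : V ≤ U) (hV : V = X.basicOpen f) {m : Γ(L, U)} (hm : resMod L h m = 0) : ∃ n : ℕ, f ^ n • m = 0 := by
  obtain ⟨a, rfl⟩ := hs.toLFrame.bij.2 m
  have ha : res (k := k) h a = 0 := (hs V h).1 (by
    change res (k := k) h a • resMod L h s = (0 : Γ(X, V)) • _
    rw [← resMod_smul k, zero_smul]
    exact hm)
  obtain ⟨n, hn⟩ := (isAway_res hU f h hV).ker a ha
  exact ⟨n, by rw [smul_smul, hn, zero_smul]⟩

lemma IsFrame.exists_resMod_eq {U V : X.Opens} (hU : IsAffineOpen U) {s : Γ(L, U)} (hs : IsFrame L s) (f : Γ(X, U))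
    (h : V ≤ U) (hV : V = X.basicOpen f) (m' : Γ(L, V)) :
    ∃ (n : ℕ) (m : Γ(L, U)), resMod L h m = res (k := k) h f ^ n • m' := by
  obtain ⟨a', rfl⟩ := (hs V h).2 m'
  obtain ⟨n, a, ha⟩ := (isAway_res (k := k) hU f h hV).surj a'
  exact ⟨n, a • s, by rw [resMod_smul k, ← ha, mul_smul]⟩

variable [Smooth (X ↘ Spec (.of k))] (hL : IsLineBundle L)

variable (k) in
include hL in
lemma span_charts {U : X.Opens} (hU : IsAffineOpen U) : Ideal.span {g : Γ(X, U) |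
    (∃ s : Γ(L, X.basicOpen g), IsFrame L s) ∧ Algebra.IsStandardSmooth k Γ(X, X.basicOpen g)} = ⊤ := by
  rw [← hU.self_le_iSup_basicOpen_iff]
  intro x hx
  obtain ⟨O, hxO, s, hs⟩ := hL x
  obtain ⟨f, hfO, hxf⟩ := hU.exists_basicOpen_le ⟨x, hxO⟩ hx
  have := smooth_sections k hU
  obtain ⟨T, hT, hTs⟩ := Algebra.Smooth.exists_span_eq_top_isStandardSmooth k Γ(X, U)
  have hx' := hU.self_le_iSup_basicOpen_iff.mpr hT hx
  obtain ⟨⟨g, hg⟩, hxg⟩ := mem_iSup.mp hx'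
  have hfg : X.basicOpen (g * f) = X.basicOpen g ⊓ X.basicOpen f := X.basicOpen_mul g f
  refine mem_iSup.mpr ⟨⟨g * f, ⟨⟨_, hs.restrict (hfg.le.trans (inf_le_right.trans hfO))⟩, ?_⟩⟩, ?_⟩
  · have h1 : X.basicOpen g ≤ U := X.basicOpen_le g
    have h2 : X.basicOpen (g * f) ≤ X.basicOpen g := hfg.le.trans inf_le_left
    have hA := isAway_res (k := k) hU g h1 rfl
    have hB := isAway_res (k := k) (hU.basicOpen g) (res (k := k) h1 f) h2 (hfg.trans (basicOpen_res' h1 f).symm)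
    have h3 : Algebra.IsStandardSmooth k Γ(X, X.basicOpen g) := by
      have := hTs g hg
      let := (res (k := k) h1).toRingHom.toAlgebra
      have := hA.isLocalization
      have : IsScalarTower k Γ(X, U) Γ(X, X.basicOpen g) :=
        .of_algebraMap_eq fun a => ((res (k := k) h1).commutes a).symm
      exact .of_algEquiv ((IsLocalization.algEquiv (.powers g) (Localization.Away g) Γ(X, X.basicOpen g)).restrictScalars k)
    let := (res (k := k) h2).toRingHom.toAlgebra
    have := hB.isLocalization
    have : IsScalarTower k Γ(X, X.basicOpen g) Γ(X, X.basicOpen (g * f)) :=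
      .of_algebraMap_eq fun a => ((res (k := k) h2).commutes a).symm
    have := Algebra.IsStandardSmooth.localization_away (S := Γ(X, X.basicOpen (g * f))) (res (k := k) h1 f)
    exact .trans k Γ(X, X.basicOpen g) Γ(X, X.basicOpen (g * f))
  · change x ∈ X.basicOpen (g * f)
    rw [hfg]
    exact ⟨hxg, hxf⟩

variable (k) in
include hL k in
lemma exists_framed_cover {U : X.Opens} (hU : IsAffineOpen U) : ∃ t : Finset Γ(X, U), Ideal.span (t : Set Γ(X, U)) = ⊤ ∧
    U ≤ ⨆ g : t, X.basicOpen g.1 ∧ ∀ g : t, ∃ s : Γ(L, X.basicOpen g.1), IsFrame L s := by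
  obtain ⟨t, ht, hs⟩ := (Ideal.span_eq_top_iff_finite _).mp (span_charts k hL hU)
  exact ⟨t, hs, hU.self_le_iSup_basicOpen_iff.mpr hs, fun g => (ht g.2).1⟩

include hL k in
lemma exists_pow_smul_eq_zero {U V : X.Opens} (hU : IsAffineOpen U) (f : Γ(X, U)) (h : V ≤ U) (hV : V = X.basicOpen f)
    {m : Γ(L, U)} (hm : resMod L h m = 0) : ∃ n : ℕ, f ^ n • m = 0 := by
  obtain ⟨t, -, ht, hs⟩ := exists_framed_cover k hL hU
  choose s hs using hs
  have hg : ∀ g : t, X.basicOpen g.1 ≤ U := fun g => X.basicOpen_le g.1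
  obtain ⟨n, hn⟩ := exists_uniform (P := fun (g : t) n => resMod L (hg g) (f ^ n • m) = 0)
    (fun g m n hm => by rw [pow_add, mul_smul, resMod_smul k, hm, smul_zero]) fun g => by
    obtain ⟨n, hn⟩ := (hs g).exists_pow_smul_eq_zero (k := k) (hU.basicOpen g.1) (res (k := k) (hg g) f)
      (V := X.basicOpen g.1 ⊓ V) inf_le_left (by rw [hV, basicOpen_res']) (m := resMod L (hg g) m)
      (by rw [resMod_resMod, ← resMod_resMod L h inf_le_right, hm, map_zero])
    exact ⟨n, by rw [resMod_pow_smul k, hn]⟩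
  exact ⟨n, eq_of_locally L _ hg ht _ _ fun g => by rw [hn, map_zero]⟩

include hL in
lemma exists_resMod_eq {U V : X.Opens} (hU : IsAffineOpen U) (f : Γ(X, U)) (h : V ≤ U) (hV : V = X.basicOpen f)
    (m' : Γ(L, V)) : ∃ (n : ℕ) (m : Γ(L, U)), resMod L h m = res (k := k) h f ^ n • m' := by
  obtain ⟨t, -, ht, hs⟩ := exists_framed_cover k hL hU
  choose s hs using hs
  have hg : ∀ g : t, X.basicOpen g.1 ≤ U := fun g => X.basicOpen_le g.1
  obtain ⟨n, hn⟩ := exists_uniform (P := fun (g : t) n => ∃ m : Γ(L, X.basicOpen g.1),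
      resMod L (inf_le_left : X.basicOpen g.1 ⊓ V ≤ _) m = resMod L inf_le_right (res (k := k) h f ^ n • m'))
    (fun g m n ⟨x, hx⟩ => ⟨res (k := k) (hg g) f ^ n • x, by
      rw [pow_add, mul_smul, resMod_pow_smul k, hx, resMod_pow_smul k _ _ n, res_res, res_res]⟩) fun g => by
    obtain ⟨n, m, hm⟩ := (hs g).exists_resMod_eq (k := k) (hU.basicOpen g.1) (res (k := k) (hg g) f)
      (V := X.basicOpen g.1 ⊓ V) inf_le_left (by rw [hV, basicOpen_res']) (resMod L inf_le_right m')
    exact ⟨n, m, by rw [hm, resMod_pow_smul k, res_res, res_res]⟩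
  choose m hm using hn
  obtain ⟨K, hK⟩ := exists_uniform (P := fun (gg : t × t) K =>
      resMod L (inf_le_left : X.basicOpen gg.1.1 ⊓ X.basicOpen gg.2.1 ≤ _) (res (k := k) (hg gg.1) f ^ K • m gg.1) =
        resMod L inf_le_right (res (k := k) (hg gg.2) f ^ K • m gg.2))
    (fun gg m n hm => by
      rw [pow_add, mul_smul, pow_add, mul_smul, resMod_pow_smul k, hm, resMod_pow_smul k _ _ n,
        res_res, res_res]) fun ⟨g, g'⟩ => by
    have e := basicOpen_res' (k := k) (hg g) g'.1
    have hle : X.basicOpen g.1 ⊓ X.basicOpen g'.1 ≤ U := inf_le_left.trans (hg g)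
    have hW : X.basicOpen g.1 ⊓ X.basicOpen g'.1 ⊓ V ≤ X.basicOpen g.1 ⊓ V := inf_le_inf_right _ inf_le_left
    have hW' : X.basicOpen g.1 ⊓ X.basicOpen g'.1 ⊓ V ≤ X.basicOpen g'.1 ⊓ V := inf_le_inf_right _ inf_le_right
    obtain ⟨K, hK⟩ := ((hs g).restrict (inf_le_left : X.basicOpen g.1 ⊓ X.basicOpen g'.1 ≤ _)).exists_pow_smul_eq_zero (k := k)
      (e ▸ (hU.basicOpen g.1).basicOpen _) (res (k := k) hle f) (V := X.basicOpen g.1 ⊓ X.basicOpen g'.1 ⊓ V)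
      inf_le_left (by rw [hV, basicOpen_res']) (m := resMod L inf_le_left (m g) - resMod L inf_le_right (m g'))
      (by
        rw [map_sub, sub_eq_zero, resMod_resMod, resMod_resMod, ← resMod_resMod L inf_le_left hW,
          ← resMod_resMod L inf_le_left hW', hm, hm, resMod_resMod, resMod_resMod])
    exact ⟨K, by
      rw [smul_sub, sub_eq_zero] at hK
      rw [resMod_pow_smul k, resMod_pow_smul k, res_res, res_res, hK]⟩
  obtain ⟨x, hx⟩ := exists_glue L _ hg ht (fun g => res (k := k) (hg g) f ^ K • m g) fun g g' => hK (g, g')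
  refine ⟨K + n, x, eq_of_locally L (fun g : t => X.basicOpen g.1 ⊓ V) (fun _ => inf_le_right) ?_ _ _ fun g => ?_⟩
  · intro y hy
    obtain ⟨g, hyg⟩ := mem_iSup.mp (ht (h hy))
    exact mem_iSup.mpr ⟨g, hyg, hy⟩
  · rw [resMod_resMod, ← resMod_resMod L (hg g) inf_le_left, hx, resMod_pow_smul k, hm, res_res, pow_add, mul_smul,
      resMod_pow_smul k _ _ K, res_res]

end LineBundle

lemma exists_pow_smul_of_fg {R M : Type*} [CommRing R] [AddCommGroup M] [Module R M] {N : Submodule R M} (hN : N.FG)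
    (f : R) (h : ∀ m ∈ N, ∃ n : ℕ, f ^ n • m = 0) : ∃ n : ℕ, ∀ m ∈ N, f ^ n • m = 0 := by
  obtain ⟨s, rfl⟩ := hN
  obtain ⟨n, hn⟩ := exists_uniform (P := fun (m : s) n => f ^ n • m.1 = 0)
    (fun m a b h => by rw [pow_add, mul_smul, h, smul_zero]) fun m => h m.1 (Submodule.subset_span m.2)
  refine ⟨n, fun m hm => ?_⟩
  induction hm using Submodule.span_induction with
  | mem m hm => exact hn ⟨m, hm⟩
  | zero => exact smul_zero _
  | add x y _ _ hx hy => rw [smul_add, hx, hy, add_zero]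
  | smul a x _ hx => rw [smul_comm, hx, smul_zero]

lemma exists_linearMap_of_ker_le {R M N P : Type*} [CommRing R] [AddCommGroup M] [Module R M] [AddCommGroup N] [Module R N]
    [AddCommGroup P] [Module R P] {f : M →ₗ[R] N} (hf : Function.Surjective f) {g : M →ₗ[R] P}
    (h : ∀ m, f m = 0 → g m = 0) : ∃ e : N →ₗ[R] P, ∀ m, e (f m) = g m := by
  refine ⟨(LinearMap.ker f).liftQ g (fun m hm => h m hm) ∘ₗ (f.quotKerEquivOfSurjective hf).symm.toLinearMap, fun m => ?_⟩
  have : (f.quotKerEquivOfSurjective hf).symm (f m) = Submodule.Quotient.mk m :=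
    (LinearEquiv.symm_apply_eq _).mpr rfl
  rw [LinearMap.comp_apply, LinearEquiv.coe_coe, this]
  exact Submodule.liftQ_apply _ _ _

section LineBundle

variable {X : Scheme.{u}} [X.Over (Spec (.of k))] {L : X.Modules} [Smooth (X ↘ Spec (.of k))]
  (hL : IsLineBundle L)

lemma span_common_basicOpen {U V : X.Opens} (hU : IsAffineOpen U) (hV : IsAffineOpen V) (h : V ≤ U) :
    Ideal.span {g : Γ(X, V) | ∃ f : Γ(X, U), X.basicOpen f = X.basicOpen g} = ⊤ := by
  rw [← hV.self_le_iSup_basicOpen_iff]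
  intro x hx
  obtain ⟨f, g, hfg, hxf⟩ := exists_basicOpen_le_affine_inter hU hV x ⟨h hx, hx⟩
  exact mem_iSup.mpr ⟨⟨g, f, hfg⟩, hfg ▸ hxf⟩

include hL k in
lemma span_range_resMod {U V : X.Opens} (hU : IsAffineOpen U) (hV : IsAffineOpen V) (h : V ≤ U) :
    Submodule.span Γ(X, V) (range (resMod L h)) = ⊤ := by
  refine eq_top_iff.mpr fun m' _ => Submodule.mem_of_span_eq_top_of_smul_pow_mem _ _
    (span_common_basicOpen hU hV h) _ ?_
  rintro ⟨g, f, hfg⟩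
  have hW : X.basicOpen g ≤ V := X.basicOpen_le g
  obtain ⟨n, l, hl⟩ := exists_resMod_eq (k := k) hL hU f (hW.trans h) hfg.symm (resMod L hW m')
  obtain ⟨v, hv⟩ := (isAway_res (k := k) hU f (hW.trans h) hfg.symm).isUnit
  obtain ⟨j, a, ha⟩ := (isAway_res (k := k) hV g hW rfl).surj ((v⁻¹ ^ n : Γ(X, X.basicOpen g)ˣ) : Γ(X, X.basicOpen g))
  obtain ⟨K, hK⟩ := exists_pow_smul_eq_zero (k := k) hL hV g hW rfl (m := a • resMod L h l - g ^ j • m') (by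
    rw [map_sub, resMod_smul k, resMod_pow_smul k, ← ha, resMod_resMod, hl, ← hv, ← mul_smul, mul_assoc,
      ← Units.val_pow_eq_pow_val, ← Units.val_mul, inv_pow, inv_mul_cancel, Units.val_one, mul_one, sub_self])
  refine ⟨K + j, ?_⟩
  rw [smul_sub, sub_eq_zero] at hK
  change g ^ (K + j) • m' ∈ _
  rw [pow_add, mul_smul, ← hK]
  exact Submodule.smul_mem _ _ (Submodule.smul_mem _ _ (Submodule.subset_span ⟨l, rfl⟩))

include hL in
theorem isRestr {U V : X.Opens} (hU : IsAffineOpen U) (hV : IsAffineOpen V) (h : V ≤ U) :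
    IsRestr (res (k := k) h) (resMod L h) where
  smul := resMod_smul k L h
  etale := formallyEtale_res hU hV h
  span := span_range_resMod (k := k) hL hU hV h
  dual ν := by
    have hsurj : Function.Surjective (Finsupp.linearCombination Γ(X, V) (resMod L h)) := by
      rw [← LinearMap.range_eq_top, Finsupp.range_linearCombination, span_range_resMod (k := k) hL hU hV h]
    obtain ⟨e, he⟩ := exists_linearMap_of_ker_le hsurj
      (g := Finsupp.linearCombination Γ(X, V) fun l => res (k := k) h (ν l)) fun x hx => by
      refine (Submodule.mem_bot Γ(X, V)).mp (Submodule.mem_of_span_eq_top_of_smul_pow_mem _ _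
        (span_common_basicOpen hU hV h) _ ?_)
      rintro ⟨g, f, hfg⟩
      have hW : X.basicOpen g ≤ V := X.basicOpen_le g
      have hA := isAway_res (k := k) hU f (hW.trans h) hfg.symm
      refine (isAway_res (k := k) hV g hW rfl).ker _ ?_
      obtain ⟨n, hn⟩ := exists_uniform (P := fun (i : x.support) n => ∃ b : Γ(X, U),
          res (k := k) (hW.trans h) f ^ n * res (k := k) hW (x i) = res (k := k) (hW.trans h) b)
        (fun i m n ⟨b, hb⟩ => ⟨f ^ n * b, by rw [pow_add, mul_assoc, hb, map_mul, map_pow]⟩) fun i => hA.surj _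
      choose b hb using hn
      rw [Finsupp.linearCombination_apply, Finsupp.sum, ← Finset.sum_attach] at hx ⊢
      obtain ⟨K, hK⟩ := exists_pow_smul_eq_zero (k := k) hL hU f (hW.trans h) hfg.symm
        (m := ∑ i : x.support, b i • i.1) (by
          have := congrArg (fun m => res (k := k) (hW.trans h) f ^ n • resMod L hW m) hx
          simp only [map_sum, map_zero, smul_zero, Finset.smul_sum] at this
          rw [map_sum, ← this]
          refine sum_congr rfl fun i _ => ?_
          rw [resMod_smul k, ← hb, resMod_smul k, resMod_resMod, mul_smul])
      have hK' := congrArg (fun m => res (k := k) (hW.trans h) (ν m)) hK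
      simp only [map_smul, map_sum, smul_eq_mul, map_mul, map_pow, map_zero, ← hb] at hK'
      refine ((hA.isUnit.pow (K + n)).mul_right_eq_zero).mp ?_
      rw [← hK', map_sum, pow_add, mul_assoc, mul_sum]
      refine congrArg _ (sum_congr rfl fun i _ => ?_)
      rw [smul_eq_mul, map_mul, res_res, mul_assoc]
    exact ⟨e, fun l => by simpa using he (Finsupp.single l 1)⟩

variable (k) in
theorem finiteType_sections {U : X.Opens} (hU : IsAffineOpen U) : FiniteType k Γ(X, U) := by
  have := smooth_sections k hU
  infer_instance

include hL in
theorem hasCharts (p : ℕ) [Fact p.Prime] [CharP k p] [PerfectRing k p] {U : X.Opens} (hU : IsAffineOpen U) :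
    HasCharts k p Γ(X, U) Γ(L, U) := by
  refine ⟨_, span_charts k hL hU, fun g ⟨⟨s, hs⟩, hg⟩ => ⟨_, _, _, _, _, _, _, _,
    isRestr hL hU (hU.basicOpen g) (X.basicOpen_le g), isAway_res hU g _ rfl, ?_⟩⟩
  exact Chart.nonempty_of_isStandardSmooth p hs.toLFrame

include hL k in
theorem fg_sections {U : X.Opens} (hU : IsAffineOpen U) : Module.Finite Γ(X, U) Γ(L, U) := by
  obtain ⟨t, ht, -, hs⟩ := exists_framed_cover k hL hU
  choose s hs using hs
  have hg : ∀ g : t, X.basicOpen g.1 ≤ U := fun g => X.basicOpen_le g.1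
  choose n l hl using fun g : t => exists_resMod_eq (k := k) hL hU g.1 (hg g) rfl (s g)
  refine Module.finite_def.mpr (Submodule.fg_def.mpr ⟨range l, Set.finite_range l, eq_top_iff.mpr fun m _ =>
    Submodule.mem_of_span_eq_top_of_smul_pow_mem _ _ ht _ fun g => ?_⟩)
  obtain ⟨a', ha'⟩ := (hs g _ le_rfl).2 (resMod L (hg g) m)
  obtain ⟨j, a, ha⟩ := (isAway_res (k := k) hU g.1 (hg g) rfl).surj a'
  obtain ⟨K, hK⟩ := exists_pow_smul_eq_zero (k := k) hL hU g.1 (hg g) rfl (m := a • l g - g.1 ^ (n g + j) • m) (by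
    rw [map_sub, resMod_smul k, hl, resMod_pow_smul k, ← ha, ← ha', sub_eq_zero]
    simp only [resMod_self, smul_smul]
    congr 1
    ring)
  refine ⟨K + (n g + j), ?_⟩
  rw [smul_sub, sub_eq_zero] at hK
  rw [pow_add, mul_smul, ← hK]
  exact Submodule.smul_mem _ _ (Submodule.smul_mem _ _ (Submodule.subset_span ⟨g, rfl⟩))

include hL in
lemma IsFrame.exists_dual {U V : X.Opens} (hU : IsAffineOpen U) (f : Γ(X, U)) (h : V ≤ U) (hV : V = X.basicOpen f)
    {s : Γ(L, V)} (hs : IsFrame L s) : ∃ (n : ℕ) (ν : Dual Γ(X, U) Γ(L, U)),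
      ∀ m, res (k := k) h (ν m) • s = res (k := k) h f ^ n • resMod L h m := by
  have := fg_sections (k := k) hL hU
  have := finiteType_sections k hU
  have : IsNoetherianRing Γ(X, U) := FiniteType.isNoetherianRing k _
  have hA := isAway_res (k := k) hU f h hV
  obtain ⟨K, hK⟩ := exists_pow_smul_of_fg (IsNoetherian.noetherian (RingHom.ker (res (k := k) h))) f fun a ha => hA.ker a ha
  obtain ⟨r, x, hx⟩ := Module.Finite.exists_fin (R := Γ(X, U)) (M := Γ(L, U))
  obtain ⟨n, hn⟩ := exists_uniform (P := fun (i : Fin r) n => ∃ b : Γ(X, U),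
      res (k := k) h f ^ n * hs.toLFrame.dual (resMod L h (x i)) = res (k := k) h b)
    (fun i m n ⟨b, hb⟩ => ⟨f ^ n * b, by rw [pow_add, mul_assoc, hb, map_mul, map_pow]⟩) fun i => hA.surj _
  choose a ha using hn
  have hsurj : Function.Surjective (Fintype.linearCombination Γ(X, U) x) := by
    rw [← LinearMap.range_eq_top, Fintype.range_linearCombination, hx]
  have key : ∀ c, res (k := k) h (Fintype.linearCombination Γ(X, U) a c) • s =
      res (k := k) h f ^ n • resMod L h (Fintype.linearCombination Γ(X, U) x c) := fun c => by
    rw [Fintype.linearCombination_apply, Fintype.linearCombination_apply, map_sum, map_sum, Finset.sum_smul, Finset.smul_sum]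
    refine sum_congr rfl fun i _ => ?_
    rw [smul_eq_mul, map_mul, ← ha, resMod_smul k, mul_smul, mul_smul, show hs.toLFrame.dual (resMod L h (x i)) • s = _ from hs.toLFrame.dual_smul _, smul_comm]
  obtain ⟨ν, hν⟩ := exists_linearMap_of_ker_le hsurj (g := f ^ K • Fintype.linearCombination Γ(X, U) a) fun c hc =>
    hK _ (hs.toLFrame.bij.1 (by
      change res (k := k) h (Fintype.linearCombination Γ(X, U) a c) • s = (0 : Γ(X, V)) • s
      rw [key, hc, map_zero, smul_zero, zero_smul]))
  refine ⟨K + n, ν, fun m => ?_⟩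
  obtain ⟨c, rfl⟩ := hsurj m
  rw [hν, LinearMap.smul_apply, smul_eq_mul, map_mul, map_pow, mul_smul, key, pow_add, mul_smul]

include hL k in
lemma exists_invSys_local {U V : X.Opens} (hU : IsAffineOpen U) (f : Γ(X, U)) (h : V ≤ U) (hV : V = X.basicOpen f)
    {s : Γ(L, V)} (hs : IsFrame L s) : ∃ (N : ℕ) (l : Γ(L, U)) (ν : Dual Γ(X, U) Γ(L, U)),
      (∀ m, ν m • l = f ^ N • m) ∧ ν l = f ^ N := by
  have := fg_sections (k := k) hL hU
  have := finiteType_sections k hU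
  have : IsNoetherianRing Γ(X, U) := FiniteType.isNoetherianRing k _
  obtain ⟨n, ν, hν⟩ := hs.exists_dual (k := k) hL hU f h hV
  obtain ⟨j, l, hl⟩ := exists_resMod_eq (k := k) hL hU f h hV s
  obtain ⟨K, hK⟩ := exists_pow_smul_of_fg (IsNoetherian.noetherian (LinearMap.range
    (ν.smulRight l - f ^ (n + j) • LinearMap.id))) f (by
      rintro _ ⟨m, rfl⟩
      refine exists_pow_smul_eq_zero (k := k) hL hU f h hV ?_
      rw [LinearMap.sub_apply, LinearMap.smulRight_apply, LinearMap.smul_apply, LinearMap.id_apply, map_sub,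
        resMod_smul k, hl, smul_comm, hν, resMod_pow_smul k, smul_smul, pow_add, mul_comm, sub_self])
  obtain ⟨K', hK'⟩ := (isAway_res (k := k) hU f h hV).ker (ν l - f ^ (n + j)) (by
    rw [map_sub, map_pow, sub_eq_zero]
    refine hs.toLFrame.bij.1 ((hν l).trans ?_)
    rw [hl, smul_smul, pow_add]
    rfl)
  refine ⟨K' + K + (n + j), f ^ (K' + K) • l, ν, fun m => ?_, ?_⟩
  · have := hK _ ⟨m, rfl⟩
    rw [LinearMap.sub_apply, LinearMap.smulRight_apply, LinearMap.smul_apply, LinearMap.id_apply, smul_sub,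
      sub_eq_zero] at this
    rw [smul_comm, pow_add f K' K, mul_smul, this, ← mul_smul, ← mul_smul]
    exact congrArg (· • m) (by ring)
  · rw [mul_sub, sub_eq_zero] at hK'
    rw [map_smul, smul_eq_mul, pow_add f K' K, mul_comm (f ^ K'), mul_assoc, hK', pow_add, pow_add]
    ring

include hL k in
theorem nonempty_invSys {U : X.Opens} (hU : IsAffineOpen U) : Nonempty (InvSys Γ(X, U) Γ(L, U)) := by
  obtain ⟨t, ht, -, hs⟩ := exists_framed_cover k hL hU
  choose s hs using hs
  choose N l ν hν hνl using fun g : t => exists_invSys_local (k := k) hL hU g.1 (X.basicOpen_le g.1) rfl (hs g)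
  obtain ⟨M, hM⟩ := Finite.exists_le N
  have h1 : (1 : Γ(X, U)) ∈ Ideal.span (range fun g : t => g.1 ^ M) := by
    have := Ideal.span_pow_eq_top (t : Set Γ(X, U)) ht M
    rw [Set.image_eq_range] at this
    exact this ▸ Submodule.mem_top
  obtain ⟨c, hc⟩ := (Ideal.mem_span_range_iff_exists_fun).mp h1
  have hp : ∀ g : t, g.1 ^ (M - N g) * g.1 ^ N g = g.1 ^ M := fun g => by rw [← pow_add, Nat.sub_add_cancel (hM g)]
  let e := Fintype.equivFin t
  refine ⟨⟨Fintype.card t, fun j => l (e.symm j), fun j => (c (e.symm j) * (e.symm j).1 ^ (M - N (e.symm j))) • ν (e.symm j),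
    fun m => ?_, ?_⟩⟩
  · rw [← e.sum_comp]
    simp only [Equiv.symm_apply_apply, LinearMap.smul_apply, smul_eq_mul, mul_smul, hν]
    simp only [smul_smul, hp]
    rw [← Finset.sum_smul, hc, one_smul]
  · rw [← e.sum_comp, ← hc]
    simp only [Equiv.symm_apply_apply, LinearMap.smul_apply, smul_eq_mul, hνl, mul_assoc, hp]

end LineBundle

section Dimension


lemma isArtinianRing_of_derivation_eq_zero {R : Type u} [CommRing R] [Algebra k R] [Algebra.Smooth k R]
    (h : ∀ ξ : Der k R, ξ = 0) : IsArtinianRing R := by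
  have h0 : ∀ φ : Dual R (Ω[R⁄k]), φ = 0 := fun φ => by
    refine Derivation.liftKaehlerDifferential_unique _ _ ?_
    exact (h (φ.compDer (D k R))).trans (h _).symm
  have : Algebra.FormallyUnramified k R :=
    ⟨⟨fun a b => sub_eq_zero.mp ((Module.forall_dual_apply_eq_zero_iff R (a - b)).mp fun φ => by rw [h0 φ]; rfl)⟩⟩
  have : Module.Finite k R := Algebra.FormallyUnramified.finite_of_free k R
  exact IsArtinianRing.of_finite k R

variable {X : Scheme.{u}} [X.Over (Spec (.of k))] {L : X.Modules} [Smooth (X ↘ Spec (.of k))] (hL : IsLineBundle L)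

include hL in
theorem exists_chart_pos (p : ℕ) [Fact p.Prime] [CharP k p] [PerfectRing k p] (hX : 0 < topologicalKrullDim X) :
    ∃ (U : X.affineOpens) (g : Γ(X, U.1)) (C : Chart k p Γ(X, X.basicOpen g) Γ(L, X.basicOpen g)),
      Nontrivial Γ(X, X.basicOpen g) ∧ C.n ≠ 0 := by
  by_contra! hn
  let S := {q : Σ U : X.affineOpens, Γ(X, U.1) | (∃ s : Γ(L, X.basicOpen q.2), IsFrame L s) ∧
    Algebra.IsStandardSmooth k Γ(X, X.basicOpen q.2)}
  have hcov : TopologicalSpace.IsOpenCover fun q : S => X.basicOpen q.1.2 := by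
    refine eq_top_iff.mpr fun x _ => ?_
    obtain ⟨U, hU, hxU, -⟩ := exists_isAffineOpen_mem_and_subset (TopologicalSpace.Opens.mem_top x)
    obtain ⟨g, hg⟩ := mem_iSup.mp (hU.self_le_iSup_basicOpen_iff.mpr (span_charts k hL hU) hxU)
    exact mem_iSup.mpr ⟨⟨⟨⟨U, hU⟩, g.1⟩, g.2⟩, hg⟩
  have : IsLocallyArtinian X := by
    refine (isLocallyArtinian_iff_of_isOpenCover hcov fun q => q.1.1.2.basicOpen _).mpr ?_
    rintro ⟨⟨U, g⟩, ⟨s, hs⟩, hstd⟩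
    change IsArtinianRing Γ(X, X.basicOpen g)
    rcases subsingleton_or_nontrivial Γ(X, X.basicOpen g) with h | h
    · infer_instance
    · obtain ⟨C⟩ := Chart.nonempty_of_isStandardSmooth (k := k) (h := hstd) p hs.toLFrame
      have := smooth_sections k (U.2.basicOpen g)
      exact isArtinianRing_of_derivation_eq_zero (k := k) fun ξ => C.X.ext_zero ξ fun i =>
        absurd (Nat.zero_lt_of_lt i.2) (by rw [hn U g C h]; exact Nat.not_lt_zero _)
  exact absurd (topologicalKrullDim_zero_of_discreteTopology X) (not_le.mpr hX)

end Dimension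

lemma TDOSpec.map_congr {k : Type u} [Field k] {R R' L L' : Type u} [CommRing R] [Algebra k R] [CommRing R'] [Algebra k R']
    [AddCommGroup L] [Module R L] [AddCommGroup L'] [Module R' L'] {ρ : R →ₐ[k] R'} {σ : L →+ L'} (H : IsRestr ρ σ)
    (S S' : InvSys R L) (c₀ h₀ : k) : TDOSpec.map H S c₀ h₀ = TDOSpec.map H S' c₀ h₀ := by
  refine AlgHom.ext fun d => ?_
  obtain ⟨d, rfl⟩ := TDOSpec.mk_surjective _ _ d
  rw [TDOSpec.map_mk, TDOSpec.map_mk,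
    (TDOAlg.mem_resGraph_iff H S d _).mp ((TDOAlg.mem_resGraph_iff H S' d _).mpr rfl)]

section Glued

variable [Infinite k] (p : ℕ) [Fact p.Prime] [CharP k p] [PerfectRing k p]
  {X : Scheme.{u}} [X.Over (Spec (.of k))] [Smooth (X ↘ Spec (.of k))] {L : X.Modules} (hL : IsLineBundle L) (c : k)

/-- The trivialization of `D_{c,ℏ,L}[c, 1]` given by a framing. -/
def Framing.equiv {U : X.Opens} (i : Framing L U) :
    CrysDiff k Γ(X, i.V.1) ≃ₐ[k] TDOSpec k Γ(X, i.V.1) Γ(L, i.V.1) c 1 :=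
  have := finiteType_sections k i.V.2
  AlgEquiv.ofBijective (i.isFrame.toLFrame.hom c) (i.isFrame.toLFrame.hom_bijective c p (hasCharts hL p i.V.2))

lemma Framing.mem_gluingGraph_iff {U : X.Opens} (i j : Framing L U) (hij : j.V.1 ≤ i.V.1) (h : Γ(X, j.V.1)ˣ)
    (e : resMod L hij i.s = (h : Γ(X, j.V.1)) • j.s) (S : InvSys Γ(X, i.V.1) Γ(L, i.V.1)) (x y) :
    (x, y) ∈ CrysDiff.gluingGraph (res (k := k) hij) c h ↔
      j.equiv p hL c y = TDOSpec.map (isRestr hL i.V.2 j.V.2 hij) S c 1 (i.equiv p hL c x) := by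
  refine (i.isFrame.toLFrame.mem_gluingGraph_iff c (isRestr hL i.V.2 j.V.2 hij) j.isFrame.toLFrame h e
    (j.equiv p hL c).injective x y).trans ?_
  rw [TDOSpec.map_congr (isRestr hL i.V.2 j.V.2 hij) i.isFrame.toLFrame.invSys S]
  rfl

/-- Restriction of `D_{c,ℏ,L}[c, 1]`. -/
abbrev specRes {U V : X.affineOpens} (h : V.1 ≤ U.1) (S : InvSys Γ(X, U.1) Γ(L, U.1)) :
    TDOSpec k Γ(X, U.1) Γ(L, U.1) c 1 →ₐ[k] TDOSpec k Γ(X, V.1) Γ(L, V.1) c 1 :=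
  TDOSpec.map (isRestr hL U.2 V.2 h) S c 1

lemma specRes_specRes {U V W : X.affineOpens} (h : V.1 ≤ U.1) (h' : W.1 ≤ V.1) (S S') (d) :
    specRes (k := k) hL c h' S' (specRes hL c h S d) = specRes hL c (h'.trans h) S d :=
  (TDOSpec.map_map _ _ _ (fun r => (res_res h h' r).symm) (fun l => (resMod_resMod L h h' l).symm) S S' c 1 d).symm

/-- The map from `D_{c,ℏ,L}[c, 1]` to `D_{L^c}`. -/
def toSheaf (U : X.affineOpens) (S : InvSys Γ(X, U.1) Γ(L, U.1)) :
    TDOSpec k Γ(X, U.1) Γ(L, U.1) c 1 →ₐ[k] TDOSheaf k L c U.1 :=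
  AlgHom.codRestrict (AlgHom.pi fun i => ((i.equiv p hL c).symm : _ →ₐ[k] _).comp (specRes hL c i.le S)) _ fun d =>
    fun i j hij h e => (Framing.mem_gluingGraph_iff p hL c i j hij h e (nonempty_invSys (k := k) hL i.V.2).some _ _).mpr (by
      change j.equiv p hL c ((j.equiv p hL c).symm _) = specRes hL c hij _ (i.equiv p hL c ((i.equiv p hL c).symm _))
      rw [AlgEquiv.apply_symm_apply, AlgEquiv.apply_symm_apply]
      exact (specRes_specRes hL c _ _ _ _ d).symm)

lemma equiv_toSheaf (U : X.affineOpens) (S) (d) (i : Framing L U.1) :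
    i.equiv p hL c ((toSheaf p hL c U S d).1 i) = specRes hL c i.le S d :=
  (i.equiv p hL c).apply_symm_apply _

lemma exists_chart_framing {U : X.affineOpens} (S : InvSys Γ(X, U.1) Γ(L, U.1)) (f : Γ(X, U.1))
    (hf : (∃ s : Γ(L, X.basicOpen f), IsFrame L s) ∧ Algebra.IsStandardSmooth k Γ(X, X.basicOpen f)) :
    ∃ i : Framing L U.1, i.V.1 = X.basicOpen f ∧ RingAway (specRes hL c i.le S : TDOSpec k Γ(X, U.1) Γ(L, U.1) c 1 →+*
      TDOSpec k Γ(X, i.V.1) Γ(L, i.V.1) c 1)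
      (TDOSpec.fn k Γ(L, U.1) c 1 (f ^ p)) := by
  obtain ⟨⟨s, hs⟩, hstd⟩ := hf
  have := finiteType_sections k U.2
  obtain ⟨C⟩ := Chart.nonempty_of_isStandardSmooth (k := k) (h := hstd) p hs.toLFrame
  exact ⟨⟨⟨_, U.2.basicOpen f⟩, X.basicOpen_le f, s, hs⟩, rfl, TDOSpec.ringAway _ S c 1 p C (isAway_res U.2 f _ rfl)⟩

theorem toSheaf_injective (U : X.affineOpens) (S) : Function.Injective (toSheaf p hL c U S) := by
  refine (injective_iff_map_eq_zero _).mpr fun d hd => ?_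
  refine eq_zero_of_local (TDOSpec.fn k Γ(L, U.1) c 1).toRingHom _ (span_charts k hL U.2) d fun f hf => ?_
  obtain ⟨i, -, hi⟩ := exists_chart_framing p hL c S f hf
  obtain ⟨n, hn⟩ := hi.ker d ((equiv_toSheaf p hL c U S d i).symm.trans (by rw [hd]; exact map_zero _))
  exact ⟨p * n, (congrArg (· * d) ((congrArg _ (pow_mul f p n)).trans (map_pow (TDOSpec.fn k Γ(L, U.1) c 1) _ _))).trans hn⟩

/-- Change of framing between sections of `D_{L^c}`. -/
lemma TDOSheaf.specRes_eq {U : X.affineOpens} (e : TDOSheaf k L c U.1) (i j : Framing L U.1) (hij : j.V.1 ≤ i.V.1) (S) :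
    specRes hL c hij S (i.equiv p hL c (e.1 i)) = j.equiv p hL c (e.1 j) := by
  obtain ⟨a, ha⟩ := (j.isFrame _ le_rfl).2 (resMod L hij i.s)
  obtain ⟨b, hb⟩ := (i.isFrame _ hij).2 j.s
  simp only [resMod_self] at ha hb
  have h1 : a * b = 1 := j.isFrame.toLFrame.bij.1 (by
    change (a * b) • j.s = (1 : Γ(X, j.V.1)) • j.s
    rw [mul_comm, mul_smul, ha, hb, one_smul])
  exact ((Framing.mem_gluingGraph_iff p hL c i j hij ⟨a, b, h1, by rw [mul_comm, h1]⟩ ha.symm S _ _).mp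
    (e.2 i j hij _ ha.symm)).symm

theorem toSheaf_surjective (U : X.affineOpens) (S) : Function.Surjective (toSheaf (k := k) p hL c U S) := by
  intro e
  let G : TDOSpec k Γ(X, U.1) Γ(L, U.1) c 1 →ₐ[k] ∀ i : Framing L U.1, TDOSpec k Γ(X, i.V.1) Γ(L, i.V.1) c 1 :=
    AlgHom.pi fun i => specRes hL c i.le S
  suffices h : (fun i => i.equiv p hL c (e.1 i)) ∈ G.range.toSubring.toAddSubgroup by
    obtain ⟨d, hd⟩ := h
    refine ⟨d, Subtype.ext (funext fun i => (i.equiv p hL c).injective ?_)⟩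
    exact (equiv_toSheaf p hL c U S d i).trans (congrFun hd i)
  refine mem_of_local (G.comp (TDOSpec.fn k Γ(L, U.1) c 1)).toRingHom _
    (fun a x hx => G.range.mul_mem ⟨_, rfl⟩ hx) _ (span_charts k hL U.2) _ fun f hf => ?_
  obtain ⟨i₀, hi₀, hA⟩ := exists_chart_framing p hL c S f hf
  obtain ⟨n, d, hd⟩ := hA.surj (i₀.equiv p hL c (e.1 i₀))
  replace hd : specRes hL c i₀.le S (TDOSpec.fn k Γ(L, U.1) c 1 (f ^ p)) ^ n * i₀.equiv p hL c (e.1 i₀) =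
    specRes hL c i₀.le S d := hd
  refine ⟨p * n + p, TDOSpec.fn k Γ(L, U.1) c 1 (f ^ p) * d, funext fun i => ?_⟩
  let fi := res (k := k) i.le f
  let W : X.affineOpens := ⟨X.basicOpen fi, i.V.2.basicOpen fi⟩
  have hW : W.1 ≤ i.V.1 := X.basicOpen_le fi
  have hW₀ : W.1 ≤ i₀.V.1 := ((basicOpen_res' i.le f).le.trans inf_le_right).trans hi₀.ge
  let j : Framing L U.1 := ⟨W, hW.trans i.le, resMod L hW i.s, i.isFrame.restrict hW⟩
  have := finiteType_sections k i.V.2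
  have := finiteType_sections k W.2
  have h0 := i.isFrame.toLFrame.eq_zero_of_map c p (hasCharts hL p i.V.2) (isRestr hL i.V.2 W.2 hW)
    (isAway_res i.V.2 fi hW rfl) (hasCharts hL p W.2)
    (specRes hL c i.le S d - TDOSpec.fn k _ c 1 (fi ^ p) ^ n * i.equiv p hL c (e.1 i)) (by
      have h1 := TDOSheaf.specRes_eq p hL c e i j hW i.isFrame.toLFrame.invSys
      have h2 := TDOSheaf.specRes_eq p hL c e i₀ j hW₀ i₀.isFrame.toLFrame.invSys
      have h3 := congrArg (specRes hL c hW₀ i₀.isFrame.toLFrame.invSys) hd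
      rw [map_mul, map_pow, specRes_specRes, TDOSpec.map_fn, h2, specRes_specRes] at h3
      rw [map_sub, map_mul, map_pow, sub_eq_zero, TDOSpec.map_fn, specRes_specRes, h1, ← h3, map_pow, map_pow, map_pow,
        res_res, map_pow (TDOSpec.fn k _ c 1)])
  rw [mul_sub, sub_eq_zero] at h0
  change specRes hL c i.le S _ = specRes hL c i.le S (TDOSpec.fn k Γ(L, U.1) c 1 (f ^ (p * n + p))) * i.equiv p hL c (e.1 i)
  rw [map_mul, TDOSpec.map_fn, TDOSpec.map_fn, map_pow, h0, ← mul_assoc, ← pow_succ', ← map_pow, ← pow_mul, mul_add,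
    mul_one, map_pow (res (k := k) i.le)]

/-- The isomorphism from `D_{c,ℏ,L}[c, 1]` to `D_{L^c}`. -/
def sheafEquiv (U : X.affineOpens) (S : InvSys Γ(X, U.1) Γ(L, U.1)) :
    TDOSpec k Γ(X, U.1) Γ(L, U.1) c 1 ≃ₐ[k] TDOSheaf k L c U.1 :=
  AlgEquiv.ofBijective _ ⟨toSheaf_injective p hL c U S, toSheaf_surjective p hL c U S⟩

end Glued

section Psi

variable [Infinite k] (p : ℕ) [Fact p.Prime] [CharP k p] [PerfectRing k p]
  {X : Scheme.{u}} [X.Over (Spec (.of k))] [Smooth (X ↘ Spec (.of k))] {L : X.Modules} (hL : IsLineBundle L) (c : k)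
  (S : ∀ U : X.affineOpens, InvSys Γ(X, U.1) Γ(L, U.1))

/-- The canonical map from functions on `Conn_{c^p - c}(L⁽¹⁾)` to `D_{L^c}`. -/
def sheafPsi (U : X.affineOpens) : ConnTwist k p Γ(X, U.1) Γ(L, U.1) (c ^ p - c) →ₐ[k] TDOSheaf k L c U.1 :=
  have := finiteType_sections k U.2
  (sheafEquiv p hL c U (S U) : _ →ₐ[k] TDOSheaf k L c U.1).comp (psi c (S U) (hasCharts hL p U.2))

lemma equiv_sheafPsi (U : X.affineOpens) [FiniteType k Γ(X, U.1)] (z) (i : Framing L U.1) :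
    i.equiv p hL c ((sheafPsi p hL c S U z).1 i) = specRes hL c i.le (S U) (psi c (S U) (hasCharts hL p U.2) z) :=
  equiv_toSheaf p hL c U (S U) _ i

lemma sheafPsi_ofBase (U : X.affineOpens) (f : Γ(X, U.1)) (i : Framing L U.1) :
    (sheafPsi p hL c S U (ConnAlg.ofBase _ _ _ _ _ (FrobTwist.of p _ f))).1 i =
      CrysDiff.fn k _ (res (k := k) i.le f) ^ p := by
  have := finiteType_sections k U.2
  refine (i.equiv p hL c).injective ((equiv_sheafPsi p hL c S U _ i).trans ?_)
  rw [psi_ofBase, TDOSpec.map_fn, map_pow, map_pow, map_pow]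
  exact congrArg (· ^ p) (i.isFrame.toLFrame.hom_fn c _).symm

lemma sheafPsi_frame (U : X.affineOpens) (s : Γ(L, U.1)) (hs : IsFrame L s) (ξ : Derivation k Γ(X, U.1) Γ(X, U.1))
    (ν : Dual Γ(X, U.1) Γ(L, U.1)) :
    (sheafPsi p hL c S U (ConnAlg.coord _ _ _ _ _ (contract (twistDer p ξ) (twistDual p ν))
      (FrobTwistMod.of p _ s))).1 ⟨U, le_rfl, s, hs⟩ =
        CrysDiff.fn k _ (ν s) ^ p * (vf k _ ξ ^ p - vf k _ (pPow p ξ)) := by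
  have := finiteType_sections k U.2
  let i : Framing L U.1 := ⟨U, le_rfl, s, hs⟩
  refine (i.equiv p hL c).injective ((equiv_sheafPsi p hL c S U _ i).trans ?_)
  have e₁ : ∀ f, FrobTwist.map (res (k := k) (le_rfl : U.1 ≤ U.1)) p f = f := fun f => res_self (k := k) (U := U.1) f
  have e₂ : ∀ t, FrobTwistMod.map (resMod L (le_rfl : U.1 ≤ U.1)) p t = t := resMod_self L
  have hz : ∀ μ t, (ConnAlg.coord _ _ _ _ _ μ t, ConnAlg.coord _ _ _ _ _ μ (FrobTwistMod.map (resMod L le_rfl) p t)) ∈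
      ConnTwist.resGraph (k := k) (res le_rfl) (resMod L (le_rfl : U.1 ≤ U.1)) p (c ^ p - c) := fun μ t =>
    subset_adjoin (Or.inr ⟨μ, μ, t, fun f t => by rw [e₁, e₁, e₂], rfl⟩)
  replace hz := hz (contract (twistDer p ξ) (twistDual p ν)) (FrobTwistMod.of p _ s)
  rw [e₂] at hz
  exact (psi_restr c (S U) (hasCharts hL p U.2) (isRestr hL U.2 U.2 le_rfl) (S U) (hasCharts hL p U.2) _ _ hz).trans
    (psi_frame c (S U) (hasCharts hL p U.2) hs.toLFrame ξ ν)

lemma sheafPsi_restr (U V : X.affineOpens) (h : V.1 ≤ U.1) (z z')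
    (hz : (z, z') ∈ ConnTwist.resGraph (k := k) (res h) (resMod L h) p (c ^ p - c)) (i : Framing L V.1) :
    (sheafPsi p hL c S U z).1 (i.of h) = (sheafPsi p hL c S V z').1 i := by
  have := finiteType_sections k U.2
  have := finiteType_sections k V.2
  refine (i.equiv p hL c).injective ((equiv_sheafPsi p hL c S U z (i.of h)).trans ?_)
  rw [equiv_sheafPsi, ← psi_restr c (S U) (hasCharts hL p U.2) (isRestr hL U.2 V.2 h) (S V) (hasCharts hL p V.2) z z' hz]
  exact (specRes_specRes hL c h i.le (S U) (S V) _).symm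

end Psi

end TDO

end

theorem mainTheorem2 {k : Type u} [Field k] [IsAlgClosed k] (p : ℕ) [Fact p.Prime] [CharP k p]
    (X : Scheme.{u}) [X.Over (Spec (.of k))] [Smooth (X ↘ Spec (.of k))]
    (L : X.Modules) (hL : IsLineBundle L) :
    (∃ Φ : ∀ U : X.affineOpens,
        ZAlg k p Γ(X, U.1) Γ(L, U.1) →ₐ[k] TDOAlg k Γ(X, U.1) Γ(L, U.1),
      -- the canonical isomorphism of `𝒪_Z` with the center of `D_{c,ℏ,L}`, as sheaves on `X`
      (∀ U, IsCanonicalMap p (Φ U)) ∧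
      (∀ U, IsIsoOntoCenter (Φ U)) ∧
      (∀ (U V : X.affineOpens) (h : V.1 ≤ U.1),
        (∀ z, ∃! z', (z, z') ∈ ZAlg.resGraph (k := k) (res h) (resMod L h) p) ∧
        (∀ d, ∃! d', (d, d') ∈ TDOAlg.resGraph (k := k) (res h) (resMod L h)) ∧
        ∀ z z', (z, z') ∈ ZAlg.resGraph (k := k) (res h) (resMod L h) p →
          (Φ U z, Φ V z') ∈ TDOAlg.resGraph (k := k) (res h) (resMod L h)) ∧
      (∀ (U : X.affineOpens) (lam : kˣ) (z),
        Φ U (ZAlg.scale p _ _ (lam : k) z) = TDOAlg.scale k _ _ (lam : k) (Φ U z)) ∧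
      -- the induced maps on specializations
      ∃ Φ' : ∀ (c₀ h₀ : k) (U : X.affineOpens),
          ZSpec k p Γ(X, U.1) Γ(L, U.1) c₀ h₀ →ₐ[k] TDOSpec k Γ(X, U.1) Γ(L, U.1) c₀ h₀,
        (∀ c₀ h₀ U z, Φ' c₀ h₀ U (Ideal.Quotient.mk _ z) = TDOSpec.mk k _ _ c₀ h₀ (Φ U z)) ∧
        (∀ c₀ h₀ U z, Φ' c₀ h₀ U z ∈ Subalgebra.center k (TDOSpec k Γ(X, U.1) Γ(L, U.1) c₀ h₀)) ∧
        (0 < topologicalKrullDim X →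
          ∀ c₀ h₀, (∀ U, IsIsoOntoCenter (Φ' c₀ h₀ U)) ↔ h₀ ≠ 0) ∧
        (∀ c₀ h₀, h₀ ≠ 0 → ∀ U, IsIsoOntoCenter (Φ' c₀ h₀ U) ∧ IsAzumayaVia (Φ' c₀ h₀ U)) ∧
        -- compatibility with the isomorphisms given by the scaling action
        (∀ (c₀ h₀ : k) (lam : kˣ) (U : X.affineOpens),
          ∃ (S : TDOSpec k Γ(X, U.1) Γ(L, U.1) c₀ h₀ ≃ₐ[k]
                TDOSpec k Γ(X, U.1) Γ(L, U.1) (lam * c₀) (lam * h₀))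
            (T : ZSpec k p Γ(X, U.1) Γ(L, U.1) c₀ h₀ ≃ₐ[k]
                ZSpec k p Γ(X, U.1) Γ(L, U.1) (lam * c₀) (lam * h₀)),
            (∀ d, S (TDOSpec.mk k _ _ c₀ h₀ d) =
              TDOSpec.mk k _ _ _ _ (TDOAlg.scale k _ _ ((lam⁻¹ : kˣ) : k) d)) ∧
            (∀ z, T (Ideal.Quotient.mk _ z) =
              Ideal.Quotient.mk _ (ZAlg.scale p _ _ ((lam⁻¹ : kˣ) : k) z)) ∧
            ∀ z, Φ' _ _ U (T z) = S (Φ' c₀ h₀ U z))) ∧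
    -- the sheaf `D_{L^c}` is the pushforward of an Azumaya algebra on `Conn_{c^p - c}(L⁽¹⁾)`
    ∀ c : k, ∃ Ψ : ∀ U : X.affineOpens,
        ConnTwist k p Γ(X, U.1) Γ(L, U.1) (c ^ p - c) →ₐ[k] TDOSheaf k L c U.1,
      (∀ (U : X.affineOpens) (f : Γ(X, U.1)) (i : Framing L U.1),
        (Ψ U (ConnAlg.ofBase _ _ _ _ _ (FrobTwist.of p _ f))).1 i =
          CrysDiff.fn k _ (res (k := k) i.le f) ^ p) ∧
      (∀ (U : X.affineOpens) (s : Γ(L, U.1)) (hs : IsFrame L s)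
        (ξ : Derivation k Γ(X, U.1) Γ(X, U.1)) (ν : Module.Dual Γ(X, U.1) Γ(L, U.1)),
        (Ψ U (ConnAlg.coord _ _ _ _ _ (contract (twistDer p ξ) (twistDual p ν))
            (FrobTwistMod.of p _ s))).1 ⟨U, le_rfl, s, hs⟩ =
          CrysDiff.fn k _ (ν s) ^ p * (CrysDiff.vf k _ ξ ^ p - CrysDiff.vf k _ (pPow p ξ))) ∧
      (∀ (U V : X.affineOpens) (h : V.1 ≤ U.1) (z z'),
        (z, z') ∈ ConnTwist.resGraph (k := k) (res h) (resMod L h) p (c ^ p - c) →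
        ∀ i : Framing L V.1, (Ψ U z).1 (i.of h) = (Ψ V z').1 i) ∧
      ∀ U, IsIsoOntoCenter (Ψ U) ∧ IsAzumayaVia (Ψ U) := by
  have S : ∀ U : X.affineOpens, InvSys Γ(X, U.1) Γ(L, U.1) := fun U => (nonempty_invSys (k := k) hL U.2).some
  have hC : ∀ U : X.affineOpens, HasCharts k p Γ(X, U.1) Γ(L, U.1) := fun U => hasCharts hL p U.2
  have hft : ∀ U : X.affineOpens, Algebra.FiniteType k Γ(X, U.1) := fun U => finiteType_sections k U.2
  have H : ∀ (U V : X.affineOpens) (h : V.1 ≤ U.1), IsRestr (res (k := k) h) (resMod L h) := fun U V h =>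
    isRestr hL U.2 V.2 h
  refine ⟨⟨fun U => phi (S U) (hC U), fun U => phi_isCanonicalMap (S U) (hC U), fun U => phi_isIsoOntoCenter (S U) (hC U),
    fun U V h => ⟨fun z => ZAlg.existsUnique_resGraph (H U V h) (S U) (S V) (hC U) (hC V) z, fun d =>
      ⟨TDOAlg.map (H U V h) (S U) d, (TDOAlg.mem_resGraph_iff (H U V h) (S U) _ _).mpr rfl,
        fun d' hd' => (TDOAlg.mem_resGraph_iff (H U V h) (S U) _ _).mp hd'⟩,
      fun z z' hz => (TDOAlg.mem_resGraph_iff (H U V h) (S U) _ _).mpr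
        (map_phi (H U V h) (S U) (S V) (hC U) (hC V) z z' hz).symm⟩,
    fun U lam z => phi_scale (S U) (hC U) lam z, fun c₀ h₀ U => phiSpec (S U) (hC U) c₀ h₀,
    fun c₀ h₀ U z => phiSpec_mk (S U) (hC U) c₀ h₀ z,
    fun c₀ h₀ U z => Subalgebra.mem_center_iff.mpr fun d => (phiSpec_central (S U) (hC U) c₀ h₀ z d).symm,
    fun hX c₀ h₀ => ⟨?_, fun hh U => phiSpec_isIsoOntoCenter (S U) (hC U) c₀ h₀ hh⟩,
    fun c₀ h₀ hh U => ⟨phiSpec_isIsoOntoCenter (S U) (hC U) c₀ h₀ hh, phiSpec_isAzumayaVia (S U) (hC U) c₀ h₀ hh⟩,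
    fun c₀ h₀ lam U => phiSpec_scale (S U) (hC U) c₀ h₀ lam⟩,
    fun c => ⟨sheafPsi p hL c S, sheafPsi_ofBase p hL c S, sheafPsi_frame p hL c S, sheafPsi_restr p hL c S,
      fun U => ⟨psi_isIsoOntoCenter c (S U) (hC U) (sheafEquiv p hL c U (S U)),
        psi_isAzumayaVia c (S U) (hC U) (sheafEquiv p hL c U (S U))⟩⟩⟩
  rintro hiso rfl
  obtain ⟨U, g, C, hR, hn⟩ := exists_chart_pos (k := k) hL p hX
  exact phiSpec_not_isIsoOntoCenter (S U) (hC U) c₀ (H U ⟨_, U.2.basicOpen g⟩ (X.basicOpen_le g)) (isAway_res U.2 g _ rfl)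
    C hn (hiso U)
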